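/- **Setting.** Let $I=I_1\sqcup I_2\sqcup I_3$ be a finite index set and $I_4$ a finite set labelling Dirac fields. Every $a\in I$ has a mass $\mu_a\ge 0$, with $\mu_a=0$ for $a\in I_1$ and $\mu_a>0$ for $a\in I_2$; put $m_a=\mu_a$ for $a\in I_1\cup I_2$ and $m_a=0$ for $a\in I_3$. Every $a\in I$ carries a quadruple of free fields $v_a^\mu,\Phi_a$ (Bose) and $u_a,\tilde u_a$ (Fermi) on Minkowski space with metric $\eta=\mathrm{diag}(1,-1,-1,-1)$, satisfying the Klein–Gordon equation of mass $\mu_a$, where $\Phi_a=0$ for $a\in I_1$ and $v_a^\mu=u_a=\tilde u_a=0$ for $a\in I_3$ (Higgs indices). For $A\in I_4$ there is a Dirac field $\Psi_A$ (Fermi) with $i\gamma^\mu\partial_\mu\Psi_A=M_A\Psi_A$ and $i\partial_\mu\bar\Psi_A\gamma^\mu=-M_A\bar\Psi_A$, $M_A\ge 0$; $M=\mathrm{diag}(M_A)$. Wick polynomials form the graded-commutative complex algebra generated by the derivatives of all orders of these fields modulo the field equations. On it $d_Q=[Q,\cdot\,]$ is the odd derivation commuting with $\partial_\mu$ and given by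 $$d_Qv_a^\mu=i\partial^\mu u_a,\quad d_Qu_a=0,\quad d_Q\tilde u_a=-i(\partial_\mu v_a^\mu+m_a\Phi_a),\quad d_Q\Phi_a=i\,m_au_a,\quad d_Q\Psi_A=d_Q\bar\Psi_A=0 .$$ The ghost number is $+1$ for $u_a$, $-1$ for $\tilde u_a$, $0$ otherwise; the canonical dimension is $1$ for $v,u,\tilde u,\Phi$, $3/2$ for $\Psi,\bar\Psi$, and $1$ for each derivative. A Wick polynomial $T$ is a co-cycle if $d_QT=i\partial_\mu T^\mu$ for some Wick polynomials $T^\mu$, and a co-boundary (trivial) if $T=d_QB+i\partial_\mu B^\mu$ for some Wick polynomials $B,B^\mu$; two Wick polynomials are cohomologous if they differ by a co-boundary. Write $F_a^{\mu\nu}=\partial^\mu v_a^\nu-\partial^\nu v_a^\mu$, $\phi_a^\mu=\partial^\mu\Phi_a-m_av_a^\mu$, $\gamma_\epsilon=\frac12(1+\epsilon\gamma_5)$ for $\epsilon=\pm1$, where $\gamma_5=i\gamma^0\gamma^1\gamma^2\gamma^3$. Repeated indices are summed (also $\epsilon$ in the currents). **Theorem.** Let $T$ be a Lorentz invariant co-cycle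 that is a linear combination of Wick monomials which are at least trilinear in the fields, of canonical dimension $\le 4$, of ghost number $0$, and contain as many factors $\Psi$ as factors $\bar\Psi$ (derivatives included). Then there are complex constants $f_{abc},f'_{abc},f''_{abc},g_{abcd}$ and complex matrices $t_a^\epsilon,s_a^\epsilon$ on the labels $I_4$ such that, with $j_a^\mu=\bar\Psi\,t_a^\epsilon\otimes\gamma^\mu\gamma_\epsilon\Psi$ and $j_a=\bar\Psi\,s_a^\epsilon\otimes\gamma_\epsilon\Psi$: (i) $T$ is cohomologous to $$T_{YM}=f_{abc}\Big(\tfrac12v_{a\mu}v_{b\nu}F_c^{\nu\mu}+u_av_b^\mu\partial_\mu\tilde u_c\Big)+f'_{abc}\big[\Phi_a\phi_b^\mu v_{c\mu}+m_b\Phi_a\tilde u_bu_c\big]+\tfrac1{3!}f''_{abc}\Phi_a\Phi_b\Phi_c+\tfrac1{4!}\sum_{a,b,c,d\in I_3}g_{abcd}\Phi_a\Phi_b\Phi_c\Phi_d+j_a^\mu v_{a\mu}+j_a\Phi_a ,$$ and $T_{YM}$ is a non-trivial co-cycle if $T$ is non-trivial; (ii) $d_QT_{YM}=i\partial_\mu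 T^\mu$ with $$T^\mu=f_{abc}\Big(u_av_{b\nu}F_c^{\nu\mu}-\tfrac12u_au_b\partial^\mu\tilde u_c\Big)+f'_{abc}\Phi_a\phi_b^\mu u_c+j_a^\mu u_a ;$$ (iii) $d_QT^\mu=i\partial_\nu T^{\mu\nu}$ with $T^{\mu\nu}=\tfrac12f_{abc}u_au_bF_c^{\mu\nu}$, and $d_QT^{\mu\nu}=0$. Moreover the constants can be chosen with the following properties. $f_{abc}$ is totally antisymmetric and vanishes if an index is in $I_3$; $f'_{abc}=-f'_{bac}$, $f'_{abc}=0$ for $c\in I_3$ and for $a\in I_1$; $f''$ and $g$ are totally symmetric, $f''_{abc}=0$ for $a\in I_1$; $t_a^\epsilon=0$ for $a\in I_3$ and $s_a^\epsilon=0$ for $a\in I_1$; $$f'_{cab}m_a-f'_{cba}m_b=f_{abc}m_c\qquad\forall a,b\in I_1\cup I_2,\ c\in I_2\cup I_3 ;$$ $$m_as_a^\epsilon=i\,(Mt_a^\epsilon-t_a^{-\epsilon}M)\qquad\forall a\in I ;$$ writing $t_a^\epsilon=t_a+\epsilon t'_a$, one has $[M,t_a]=0$ and $\{M,t'_a\}=0$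 whenever $m_a=0$; and $$f''_{abc}=\begin{cases}\frac1{m_c}f'_{abc}(\mu_a^2-\mu_b^2)&a,b\in I_3,\ c\in I_2,\\-\frac1{m_c}f'_{abc}\,\mu_b^2&a,c\in I_2,\ b\in I_3,\\0&a,b,c\in I_2.\end{cases}$$ -/

import Mathlib

open scoped BigOperators

noncomputable section

namespace YangMills

/-! ### Field content -/

/-- The three kinds of indices: massless spin-one particles, massive spin-one particles, and
Higgs fields. -/
inductive Sector
  | massless
  | massive
  | higgs
  deriving DecidableEq

/-- The spectrum of the model: the index set `Ind` is the disjoint union of the three sectors, and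
`Dir` labels the Dirac fields.  `mass a` is the Klein-Gordon mass of all the fields that carry the
index `a`. -/
structure FieldContent (Ind Dir : Type*) where
  sector : Ind → Sector
  mass : Ind → ℝ
  diracMass : Dir → ℝ
  mass_massless : ∀ a, sector a = Sector.massless → mass a = 0
  mass_massive : ∀ a, sector a = Sector.massive → 0 < mass a
  mass_higgs : ∀ a, sector a = Sector.higgs → 0 ≤ mass a
  diracMass_nonneg : ∀ A, 0 ≤ diracMass A

/-- The components of the quadruple `(v_μ, u, ũ, Φ)` attached to one index; `v μ` is the component
with lower index `μ`. -/
inductive QuadComp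
  | v (μ : Fin 4)
  | u
  | ut
  | phi

/-- The components of all the fields: quadruples, Dirac fields, and conjugate Dirac fields. -/
inductive Comp (Ind Dir : Type*)
  | quad (a : Ind) (q : QuadComp)
  | psi (A : Dir) (s : Fin 4)
  | psibar (A : Dir) (s : Fin 4)

/-- A jet variable `(c, {μ₁, …, μₖ})` stands for `∂_{μ₁} ⋯ ∂_{μₖ} c`. -/
abbrev Jet (Ind Dir : Type*) := Comp Ind Dir × Multiset (Fin 4)

section Gradings

variable {Ind Dir : Type*}

/-- Statistics: `true` for Fermi fields. -/
def Comp.odd : Comp Ind Dir → Bool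
  | .quad _ (.v _) => false
  | .quad _ .u => true
  | .quad _ .ut => true
  | .quad _ .phi => false
  | .psi _ _ => true
  | .psibar _ _ => true

/-- Ghost number. -/
def Comp.ghost : Comp Ind Dir → ℤ
  | .quad _ .u => 1
  | .quad _ .ut => -1
  | _ => 0

/-- Charge under the phase transformations `Ψ ↦ exp(iα) Ψ`. -/
def Comp.fermionNumber : Comp Ind Dir → ℤ
  | .psi _ _ => 1
  | .psibar _ _ => -1
  | _ => 0

/-- Canonical dimension: `1` for integer spin and ghosts, `3/2` for Dirac fields. -/
def Comp.dim : Comp Ind Dir → ℚ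
  | .quad _ _ => 1
  | .psi _ _ => 3 / 2
  | .psibar _ _ => 3 / 2

/-- Every derivative raises the canonical dimension by one. -/
def Jet.dim (x : Jet Ind Dir) : ℚ := x.1.dim + (Multiset.card x.2 : ℚ)

/-- The sign in `x y = ± y x`. -/
def koszul (p q : Bool) : ℂ := if p && q then -1 else 1

end Gradings

/-! ### Minkowski metric and Dirac matrices -/

/-- The diagonal entries of the Minkowski metric `diag(1, -1, -1, -1)`. -/
def eta (μ : Fin 4) : ℂ := if μ = 0 then 1 else -1

theorem eta_sq (μ : Fin 4) : eta μ * eta μ = 1 := by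
  simp only [eta]
  split_ifs <;> norm_num

/-- The Dirac matrices `γ^μ` in the chiral representation. -/
def gamma : Fin 4 → Matrix (Fin 4) (Fin 4) ℂ :=
  ![!![0, 0, 1, 0; 0, 0, 0, 1; 1, 0, 0, 0; 0, 1, 0, 0],
    !![0, 0, 0, 1; 0, 0, 1, 0; 0, -1, 0, 0; -1, 0, 0, 0],
    !![0, 0, 0, -Complex.I; 0, 0, Complex.I, 0; 0, Complex.I, 0, 0; -Complex.I, 0, 0, 0],
    !![0, 0, 1, 0; 0, 0, 0, -1; -1, 0, 0, 0; 0, 1, 0, 0]]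

def gamma5 : Matrix (Fin 4) (Fin 4) ℂ :=
  Complex.I • (gamma 0 * gamma 1 * gamma 2 * gamma 3)

/-- The chiral projectors `γ_ε = (1 + ε γ₅) / 2`, `ε = ±1`. -/
def chiral (ε : ℤˣ) : Matrix (Fin 4) (Fin 4) ℂ :=
  (1 / 2 : ℂ) • (1 + ((ε : ℤ) : ℂ) • gamma5)

set_option maxHeartbeats 2000000 in
theorem gamma_clifford (μ ν : Fin 4) :
    gamma μ * gamma ν + gamma ν * gamma μ = if μ = ν then (2 * eta μ) • 1 else 0 := by
  fin_cases μ <;> fin_cases ν <;> ext i j <;> fin_cases i <;> fin_cases j <;>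
    simp [gamma, eta] <;> norm_num

/-- The infinitesimal Lorentz transformation `(ρ, σ)` of a covector:
`δ x_μ = η_{μρ} x_σ - η_{μσ} x_ρ = ∑ ν, rot ρ σ μ ν * x_ν`. -/
def rot (ρ σ μ ν : Fin 4) : ℂ :=
  (if μ = ρ ∧ ν = σ then eta ρ else 0) - (if μ = σ ∧ ν = ρ then eta σ else 0)

/-- The same infinitesimal Lorentz transformation on Dirac spinors: `[γ_ρ, γ_σ] / 4`. -/
def spinRot (ρ σ : Fin 4) : Matrix (Fin 4) (Fin 4) ℂ :=
  (eta ρ * eta σ / 4) • (gamma ρ * gamma σ - gamma σ * gamma ρ)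

theorem gamma_spinRot (ρ σ μ : Fin 4) :
    gamma μ * spinRot ρ σ + ∑ ν, rot ρ σ ν μ • gamma ν = spinRot ρ σ * gamma μ := by
  have hs : ∑ ν, rot ρ σ ν μ • gamma ν
      = (if μ = σ then eta ρ else 0) • gamma ρ - (if μ = ρ then eta σ else 0) • gamma σ := by
    simp only [rot, sub_smul, Finset.sum_sub_distrib]
    congr 1
    · rw [Finset.sum_eq_single ρ] <;> simp +contextual
    · rw [Finset.sum_eq_single σ] <;> simp +contextual
  have comm : ∀ α β : Fin 4, gamma α * gamma β
      = (if α = β then 2 * eta α else 0) • (1 : Matrix (Fin 4) (Fin 4) ℂ) - gamma β * gamma α := by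
    intro α β
    rw [eq_sub_iff_add_eq, gamma_clifford]
    split_ifs <;> simp
  have key : ∀ α β : Fin 4, gamma μ * (gamma α * gamma β)
      = (if μ = α then 2 * eta μ else 0) • gamma β - (if μ = β then 2 * eta μ else 0) • gamma α
        + gamma α * gamma β * gamma μ := by
    intro α β
    rw [← mul_assoc, comm μ α, sub_mul, mul_assoc, comm μ β, mul_sub]
    simp only [smul_mul_assoc, one_mul, mul_smul_comm, mul_one, mul_assoc]
    abel
  rw [hs, spinRot, mul_smul_comm, mul_sub, key, key, smul_mul_assoc, sub_mul]
  by_cases h1 : μ = ρ <;> by_cases h2 : μ = σ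
  · subst h1; subst h2; simp
  · subst h1
    simp only [h2, if_true, if_false]
    have e1 : eta μ * eta σ / 4 * (2 * eta μ) = eta σ / 2 := by linear_combination eta σ / 2 * eta_sq μ
    simp only [zero_smul, sub_zero, zero_sub, smul_sub, smul_add, smul_neg, smul_smul, e1]
    module
  · subst h2
    simp only [h1, if_true, if_false]
    have e1 : eta ρ * eta μ / 4 * (2 * eta μ) = eta ρ / 2 := by linear_combination eta ρ / 2 * eta_sq μ
    simp only [zero_smul, sub_zero, zero_sub, smul_sub, smul_add, smul_neg, smul_smul, e1]
    module
  · simp [h1, h2]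

/-! ### Wick polynomials -/

namespace FieldContent

variable {Ind Dir : Type*} (F : FieldContent Ind Dir)

/-- The masses `m_a` that enter the gauge charge: they are put to zero for the Higgs fields. -/
def gaugeMass (a : Ind) : ℝ :=
  match F.sector a with
  | .higgs => 0
  | _ => F.mass a

/-- The members of the quadruples that are absent: `Φ_a` for massless `a`, and `v_a, u_a, ũ_a` for
Higgs indices. -/
def Absent (a : Ind) : QuadComp → Prop
  | .phi => F.sector a = Sector.massless
  | _ => F.sector a = Sector.higgs

/-- The relations between free fields under the Wick (normally ordered) product: graded
commutativity, the Klein-Gordon and Dirac equations with all their derivatives, and the vanishing of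
the absent fields. -/
inductive Rel : FreeAlgebra ℂ (Jet Ind Dir) → FreeAlgebra ℂ (Jet Ind Dir) → Prop
  | comm (x y : Jet Ind Dir) :
      Rel (FreeAlgebra.ι ℂ x * FreeAlgebra.ι ℂ y)
        (koszul x.1.odd y.1.odd • (FreeAlgebra.ι ℂ y * FreeAlgebra.ι ℂ x))
  | kleinGordon (a : Ind) (q : QuadComp) (α : Multiset (Fin 4)) :
      Rel (∑ μ, eta μ • FreeAlgebra.ι ℂ ((Comp.quad a q, μ ::ₘ μ ::ₘ α) : Jet Ind Dir))
        (-((F.mass a : ℂ) ^ 2) • FreeAlgebra.ι ℂ (Comp.quad a q, α))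
  | absent (a : Ind) (q : QuadComp) (α : Multiset (Fin 4)) (h : F.Absent a q) :
      Rel (FreeAlgebra.ι ℂ (Comp.quad a q, α)) 0
  | dirac (A : Dir) (s : Fin 4) (α : Multiset (Fin 4)) :
      Rel (∑ μ, ∑ r, (Complex.I * gamma μ s r) •
          FreeAlgebra.ι ℂ ((Comp.psi A r, μ ::ₘ α) : Jet Ind Dir))
        ((F.diracMass A : ℂ) • FreeAlgebra.ι ℂ (Comp.psi A s, α))
  | diracBar (A : Dir) (s : Fin 4) (α : Multiset (Fin 4)) :
      Rel (∑ μ, ∑ r, (Complex.I * gamma μ r s) •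
          FreeAlgebra.ι ℂ ((Comp.psibar A r, μ ::ₘ α) : Jet Ind Dir))
        (-(F.diracMass A : ℂ) • FreeAlgebra.ι ℂ (Comp.psibar A s, α))

/-- The algebra of Wick polynomials in the free fields and their derivatives. -/
abbrev Wick : Type _ := RingQuot F.Rel

/-- The Wick polynomial given by one jet variable. -/
def jet (x : Jet Ind Dir) : F.Wick := RingQuot.mkAlgHom ℂ F.Rel (FreeAlgebra.ι ℂ x)

/-! Relations in the algebra. -/

theorem jet_comm (x y : Jet Ind Dir) :
    F.jet x * F.jet y = koszul x.1.odd y.1.odd • (F.jet y * F.jet x) := by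
  have h := RingQuot.mkAlgHom_rel ℂ (Rel.comm (F := F) x y)
  simpa [jet] using h

theorem jet_kleinGordon (a : Ind) (q : QuadComp) (α : Multiset (Fin 4)) :
    ∑ μ, eta μ • F.jet (Comp.quad a q, μ ::ₘ μ ::ₘ α)
      = -((F.mass a : ℂ) ^ 2) • F.jet (Comp.quad a q, α) := by
  have h := RingQuot.mkAlgHom_rel ℂ (Rel.kleinGordon (F := F) a q α)
  simpa only [jet, map_sum, map_smul] using h

theorem jet_absent (a : Ind) (q : QuadComp) (α : Multiset (Fin 4)) (h : F.Absent a q) :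
    F.jet (Comp.quad a q, α) = 0 := by
  have h := RingQuot.mkAlgHom_rel ℂ (Rel.absent (F := F) a q α h)
  simpa [jet] using h

theorem jet_dirac (A : Dir) (s : Fin 4) (α : Multiset (Fin 4)) :
    ∑ μ, ∑ r, (Complex.I * gamma μ s r) • F.jet (Comp.psi A r, μ ::ₘ α)
      = (F.diracMass A : ℂ) • F.jet (Comp.psi A s, α) := by
  have h := RingQuot.mkAlgHom_rel ℂ (Rel.dirac (F := F) A s α)
  simpa only [jet, map_sum, map_smul] using h

theorem jet_diracBar (A : Dir) (s : Fin 4) (α : Multiset (Fin 4)) :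
    ∑ μ, ∑ r, (Complex.I * gamma μ r s) • F.jet (Comp.psibar A r, μ ::ₘ α)
      = -(F.diracMass A : ℂ) • F.jet (Comp.psibar A s, α) := by
  have h := RingQuot.mkAlgHom_rel ℂ (Rel.diracBar (F := F) A s α)
  simpa only [jet, map_sum, map_smul] using h

/-! ### Graded derivations -/

/-- The linear span of the jet variables with given statistics. -/
def linSpan (p : Bool) : Submodule ℂ F.Wick :=
  Submodule.span ℂ {w | ∃ x : Jet Ind Dir, x.1.odd = p ∧ w = F.jet x}

theorem jet_mem_linSpan (x : Jet Ind Dir) : F.jet x ∈ F.linSpan x.1.odd :=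
  Submodule.subset_span ⟨x, rfl, rfl⟩

theorem jet_mem_linSpan' {x : Jet Ind Dir} {p : Bool} (h : x.1.odd = p) :
    F.jet x ∈ F.linSpan p :=
  Submodule.subset_span ⟨x, h, rfl⟩

theorem linSpan_comm {p q : Bool} {w z : F.Wick} (hw : w ∈ F.linSpan p) (hz : z ∈ F.linSpan q) :
    w * z = koszul p q • (z * w) := by
  induction hw using Submodule.span_induction with
  | mem w h =>
    obtain ⟨x, rfl, rfl⟩ := h
    induction hz using Submodule.span_induction with
    | mem z h =>
      obtain ⟨y, rfl, rfl⟩ := h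
      exact F.jet_comm x y
    | zero => simp
    | add a b _ _ ha hb => simp only [mul_add, add_mul, smul_add, ha, hb]
    | smul c a _ ha => rw [mul_smul_comm, ha, smul_mul_assoc, smul_comm]
  | zero => simp
  | add a b _ _ ha hb => simp only [mul_add, add_mul, smul_add, ha, hb]
  | smul c a _ ha => rw [smul_mul_assoc, ha, mul_smul_comm, smul_comm]

/-- The values on jet variables of a graded derivation of the algebra of Wick polynomials, of even
(`b = false`) or odd (`b = true`) degree: they are linear in the fields and respect the field
equations. -/
structure DerData (b : Bool) where
  val : Jet Ind Dir → F.Wick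
  parity : ∀ x, val x ∈ F.linSpan (xor x.1.odd b)
  kleinGordon : ∀ a q α, ∑ μ, eta μ • val (Comp.quad a q, μ ::ₘ μ ::ₘ α)
      = -((F.mass a : ℂ) ^ 2) • val (Comp.quad a q, α)
  absent : ∀ a q α, F.Absent a q → val (Comp.quad a q, α) = 0
  dirac : ∀ A s α, ∑ μ, ∑ r, (Complex.I * gamma μ s r) • val (Comp.psi A r, μ ::ₘ α)
      = (F.diracMass A : ℂ) • val (Comp.psi A s, α)
  diracBar : ∀ A s α, ∑ μ, ∑ r, (Complex.I * gamma μ r s) • val (Comp.psibar A r, μ ::ₘ α)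
      = -(F.diracMass A : ℂ) • val (Comp.psibar A s, α)

namespace DerData

variable {F} {b : Bool} (D : F.DerData b)

/-- A graded derivation `D` is the same as an algebra homomorphism
`w ↦ [[± w, D w], [0, w]]` to upper triangular matrices. -/
def freeHom : FreeAlgebra ℂ (Jet Ind Dir) →ₐ[ℂ] Matrix (Fin 2) (Fin 2) F.Wick :=
  FreeAlgebra.lift ℂ fun x => !![koszul x.1.odd b • F.jet x, D.val x; 0, F.jet x]

theorem freeHom_rel ⦃p q : FreeAlgebra ℂ (Jet Ind Dir)⦄ (h : F.Rel p q) :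
    D.freeHom p = D.freeHom q := by
  have e : ∀ x, D.freeHom (FreeAlgebra.ι ℂ x)
      = !![koszul x.1.odd b • F.jet x, D.val x; 0, F.jet x] := fun x => by simp [freeHom]
  cases h with
  | comm x y =>
    have h1 := F.jet_comm x y
    have h2 := F.linSpan_comm (F.jet_mem_linSpan x) (D.parity y)
    have h3 := F.linSpan_comm (D.parity x) (F.jet_mem_linSpan y)
    ext i j
    fin_cases i <;> fin_cases j
    · simp [map_mul, map_smul, e, Matrix.mul_apply, h1, smul_smul]
      ring_nf
    · simp only [map_mul, map_smul, e, Matrix.mul_apply, Fin.sum_univ_two]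
      simp [h2, h3, smul_smul]
      rw [add_comm]
      cases x.1.odd <;> cases y.1.odd <;> cases b <;> simp [koszul, -neg_smul]
    · simp [map_mul, map_smul, e, Matrix.mul_apply]
    · simp [map_mul, map_smul, e, Matrix.mul_apply, h1]
  | kleinGordon a q α =>
    have h1 := F.jet_kleinGordon a q α
    have h2 := D.kleinGordon a q α
    ext i j
    fin_cases i <;> fin_cases j
    · have h3 := congrArg (fun w => koszul (Comp.quad a q : Comp Ind Dir).odd b • w) h1
      simp only [Finset.smul_sum] at h3
      simp only [map_sum, map_smul, e, Matrix.sum_apply, Matrix.smul_apply]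
      simpa [smul_comm (koszul _ _)] using h3
    · simp only [map_sum, map_smul, e, Matrix.sum_apply, Matrix.smul_apply]
      simpa using h2
    · simp only [map_sum, map_smul, e, Matrix.sum_apply, Matrix.smul_apply]
      simp
    · simp only [map_sum, map_smul, e, Matrix.sum_apply, Matrix.smul_apply]
      simpa using h1
  | absent a q α h =>
    rw [e, F.jet_absent a q α h, D.absent a q α h, map_zero]
    ext i j
    fin_cases i <;> fin_cases j <;> simp
  | dirac A s α =>
    have h1 := F.jet_dirac A s α
    have h2 := D.dirac A s α
    ext i j
    fin_cases i <;> fin_cases j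
    · have h3 := congrArg (fun w => koszul (Comp.psi A s : Comp Ind Dir).odd b • w) h1
      simp only [Finset.smul_sum] at h3
      simp only [map_sum, map_smul, e, Matrix.sum_apply, Matrix.smul_apply]
      simpa [smul_comm (koszul _ _), Comp.odd] using h3
    · simp only [map_sum, map_smul, e, Matrix.sum_apply, Matrix.smul_apply]
      simpa using h2
    · simp only [map_sum, map_smul, e, Matrix.sum_apply, Matrix.smul_apply]
      simp
    · simp only [map_sum, map_smul, e, Matrix.sum_apply, Matrix.smul_apply]
      simpa using h1
  | diracBar A s α =>
    have h1 := F.jet_diracBar A s α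
    have h2 := D.diracBar A s α
    ext i j
    fin_cases i <;> fin_cases j
    · have h3 := congrArg (fun w => koszul (Comp.psibar A s : Comp Ind Dir).odd b • w) h1
      simp only [Finset.smul_sum] at h3
      simp only [map_sum, map_smul, e, Matrix.sum_apply, Matrix.smul_apply]
      simpa [smul_comm (koszul _ _), Comp.odd] using h3
    · simp only [map_sum, map_smul, e, Matrix.sum_apply, Matrix.smul_apply]
      simpa using h2
    · simp only [map_sum, map_smul, e, Matrix.sum_apply, Matrix.smul_apply]
      simp
    · simp only [map_sum, map_smul, e, Matrix.sum_apply, Matrix.smul_apply]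
      simpa using h1

def hom : F.Wick →ₐ[ℂ] Matrix (Fin 2) (Fin 2) F.Wick :=
  RingQuot.liftAlgHom ℂ ⟨D.freeHom, D.freeHom_rel⟩

/-- The graded derivation with the given values on the jet variables. -/
def der : F.Wick →ₗ[ℂ] F.Wick :=
  (Matrix.entryLinearMap ℂ F.Wick (0 : Fin 2) (1 : Fin 2)).comp D.hom.toLinearMap

theorem hom_jet (x : Jet Ind Dir) :
    D.hom (F.jet x) = !![koszul x.1.odd b • F.jet x, D.val x; 0, F.jet x] := by
  simp [hom, jet, freeHom]

theorem der_jet (x : Jet Ind Dir) : D.der (F.jet x) = D.val x := by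
  simp [der, hom_jet]

theorem hom_lower (w : F.Wick) : D.hom w 1 0 = 0 ∧ D.hom w 1 1 = w := by
  obtain ⟨p, rfl⟩ := RingQuot.mkAlgHom_surjective ℂ F.Rel w
  induction p using FreeAlgebra.induction with
  | grade0 c =>
    simp [AlgHom.commutes, Matrix.algebraMap_matrix_apply]
  | grade1 x =>
    have h := D.hom_jet x
    rw [jet] at h
    rw [h]
    simp
  | mul p q hp hq =>
    simp [map_mul, Matrix.mul_apply, hp.1, hp.2, hq.1, hq.2]
  | add p q hp hq => simp [hp.1, hp.2, hq.1, hq.2]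

/-- The graded Leibniz rule. -/
theorem der_jet_mul (x : Jet Ind Dir) (w : F.Wick) :
    D.der (F.jet x * w) = D.val x * w + koszul x.1.odd b • (F.jet x * D.der w) := by
  have h := (D.hom_lower w).2
  simp only [der, LinearMap.comp_apply, AlgHom.toLinearMap_apply, map_mul, hom_jet,
    Matrix.entryLinearMap_apply, Matrix.mul_apply, Fin.sum_univ_two, h]
  simp [add_comm]

theorem der_one : D.der (1 : F.Wick) = 0 := by
  simp [der]

end DerData

/-! ### Partial derivatives, gauge charge, Lorentz generators -/

def pdData (μ : Fin 4) : F.DerData false where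
  val x := F.jet (x.1, μ ::ₘ x.2)
  parity x := F.jet_mem_linSpan' (by simp)
  kleinGordon a q α := by
    have h := F.jet_kleinGordon a q (μ ::ₘ α)
    rw [← h]
    refine Finset.sum_congr rfl fun ν _ => ?_
    rw [Multiset.cons_swap μ ν, Multiset.cons_swap μ ν]
  absent a q α h := F.jet_absent a q _ h
  dirac A s α := by
    rw [← F.jet_dirac A s (μ ::ₘ α)]
    simp only [Multiset.cons_swap μ]
  diracBar A s α := by
    rw [← F.jet_diracBar A s (μ ::ₘ α)]
    simp only [Multiset.cons_swap μ]

/-- The derivative `∂_μ`. -/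
def pd (μ : Fin 4) : F.Wick →ₗ[ℂ] F.Wick := (F.pdData μ).der

/-- The graded commutators of the gauge charge with the fields:
`[Q, v_μ] = i ∂_μ u`, `[Q, u] = 0`, `[Q, ũ] = - i (∂_μ v^μ + m Φ)`, `[Q, Φ] = i m u`,
and zero for the Dirac fields. -/
def dQVal : Jet Ind Dir → F.Wick
  | (.quad a (.v μ), α) => Complex.I • F.jet (.quad a .u, μ ::ₘ α)
  | (.quad _ .u, _) => 0
  | (.quad a .ut, α) => -Complex.I •
      ((∑ μ, eta μ • F.jet (.quad a (.v μ), μ ::ₘ α))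
        + (F.gaugeMass a : ℂ) • F.jet (.quad a .phi, α))
  | (.quad a .phi, α) => (Complex.I * (F.gaugeMass a : ℂ)) • F.jet (.quad a .u, α)
  | (.psi _ _, _) => 0
  | (.psibar _ _, _) => 0

def dQData : F.DerData true where
  val := F.dQVal
  parity x := by
    obtain ⟨c, α⟩ := x
    rcases c with ⟨a, q⟩ | ⟨A, s⟩ | ⟨A, s⟩
    · rcases q with μ | _ | _ | _
      · exact Submodule.smul_mem _ _ (F.jet_mem_linSpan' rfl)
      · exact Submodule.zero_mem _
      · refine Submodule.smul_mem _ _ (Submodule.add_mem _ ?_ ?_)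
        · exact Submodule.sum_mem _ fun μ _ => Submodule.smul_mem _ _ (F.jet_mem_linSpan' rfl)
        · exact Submodule.smul_mem _ _ (F.jet_mem_linSpan' rfl)
      · exact Submodule.smul_mem _ _ (F.jet_mem_linSpan' rfl)
    · exact Submodule.zero_mem _
    · exact Submodule.zero_mem _
  kleinGordon a q α := by
    rcases q with μ | _ | _ | _
    · simp only [dQVal]
      rw [smul_comm _ Complex.I, ← F.jet_kleinGordon a .u (μ ::ₘ α), Finset.smul_sum]
      refine Finset.sum_congr rfl fun ν _ => ?_
      rw [Multiset.cons_swap μ ν, Multiset.cons_swap μ ν, smul_comm]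
    · simp [dQVal]
    · simp only [dQVal]
      rw [smul_comm _ (-Complex.I), smul_add, smul_comm _ (F.gaugeMass a : ℂ),
        ← F.jet_kleinGordon a .phi α, Finset.smul_sum]
      simp_rw [smul_comm _ (-Complex.I) (_ + _)]
      rw [← Finset.smul_sum]
      congr 1
      simp_rw [smul_add]
      rw [Finset.sum_add_distrib]
      congr 1
      · have h : ∀ μ, -((F.mass a : ℂ) ^ 2) • eta μ • F.jet (.quad a (.v μ), μ ::ₘ α)
            = ∑ ν, eta ν • eta μ • F.jet (.quad a (.v μ), μ ::ₘ ν ::ₘ ν ::ₘ α) := by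
          intro μ
          rw [smul_comm, ← F.jet_kleinGordon a (.v μ) (μ ::ₘ α), Finset.smul_sum]
          refine Finset.sum_congr rfl fun ν _ => ?_
          rw [Multiset.cons_swap μ ν, Multiset.cons_swap μ ν, smul_comm]
        simp_rw [h]
        rw [Finset.sum_comm]
        simp_rw [Finset.smul_sum]
      · rw [Finset.smul_sum]
        exact Finset.sum_congr rfl fun ν _ => smul_comm _ _ _
    · simp only [dQVal]
      rw [smul_comm, ← F.jet_kleinGordon a .u α, Finset.smul_sum]
      exact Finset.sum_congr rfl fun ν _ => smul_comm _ _ _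
  absent a q α h := by
    rcases q with μ | _ | _ | _
    · simp [dQVal, F.jet_absent a .u _ h]
    · simp [dQVal]
    · have h' : F.sector a = Sector.higgs := h
      have hv : ∀ μ β, F.jet (.quad a (.v μ), β) = 0 := fun μ β => F.jet_absent a (.v μ) β h
      simp [dQVal, hv, gaugeMass, h']
    · have h' : F.sector a = Sector.massless := h
      simp [dQVal, gaugeMass, h', F.mass_massless a h']
  dirac A s α := by simp [dQVal]
  diracBar A s α := by simp [dQVal]

/-- The graded commutator `d_Q = [Q, ·]` with the gauge charge. -/
def dQ : F.Wick →ₗ[ℂ] F.Wick := F.dQData.der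

/-- Action of the infinitesimal Lorentz transformation `(ρ, σ)` on the tensor or spinor index of a
field. -/
def spinVal (ρ σ : Fin 4) : Jet Ind Dir → F.Wick
  | (.quad a (.v μ), α) => ∑ ν, rot ρ σ μ ν • F.jet (.quad a (.v ν), α)
  | (.quad _ .u, _) => 0
  | (.quad _ .ut, _) => 0
  | (.quad _ .phi, _) => 0
  | (.psi A s, α) => ∑ r, spinRot ρ σ s r • F.jet (.psi A r, α)
  | (.psibar A s, α) => -∑ r, spinRot ρ σ r s • F.jet (.psibar A r, α)

/-- Action of the infinitesimal Lorentz transformation `(ρ, σ)` on the derivatives: each `∂_κ` is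
replaced in turn by `∑ ν, rot ρ σ κ ν ∂_ν`. -/
def orbitVal (ρ σ : Fin 4) (x : Jet Ind Dir) : F.Wick :=
  (x.2.map fun κ => ∑ ν, rot ρ σ κ ν • F.jet (x.1, ν ::ₘ x.2.erase κ)).sum

theorem pd_jet (μ : Fin 4) (x : Jet Ind Dir) : F.pd μ (F.jet x) = F.jet (x.1, μ ::ₘ x.2) :=
  (F.pdData μ).der_jet x

theorem spinVal_cons (ρ σ μ : Fin 4) (c : Comp Ind Dir) (α : Multiset (Fin 4)) :
    F.spinVal ρ σ (c, μ ::ₘ α) = F.pd μ (F.spinVal ρ σ (c, α)) := by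
  rcases c with ⟨a, (_ | _ | _ | _)⟩ | ⟨A, s⟩ | ⟨A, s⟩ <;> simp [spinVal, map_sum, pd_jet]

theorem orbitVal_cons (ρ σ μ : Fin 4) (c : Comp Ind Dir) (α : Multiset (Fin 4)) :
    F.orbitVal ρ σ (c, μ ::ₘ α)
      = F.pd μ (F.orbitVal ρ σ (c, α)) + ∑ ν, rot ρ σ μ ν • F.jet (c, ν ::ₘ α) := by
  simp only [orbitVal, Multiset.map_cons, Multiset.sum_cons, Multiset.erase_cons_head]
  rw [add_comm, map_multiset_sum, Multiset.map_map]
  congr 2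
  refine Multiset.map_congr rfl fun κ hκ => ?_
  simp only [Function.comp_apply, map_sum, map_smul, pd_jet]
  rw [Multiset.erase_cons_tail_of_mem hκ]
  simp only [Multiset.cons_swap μ]

theorem lorentzVal_parity (ρ σ : Fin 4) (x : Jet Ind Dir) :
    F.spinVal ρ σ x + F.orbitVal ρ σ x ∈ F.linSpan x.1.odd := by
  refine Submodule.add_mem _ ?_ ?_
  · obtain ⟨c, α⟩ := x
    rcases c with ⟨a, (μ | _ | _ | _)⟩ | ⟨A, s⟩ | ⟨A, s⟩
    · exact Submodule.sum_mem _ fun ν _ => Submodule.smul_mem _ _ (F.jet_mem_linSpan' rfl)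
    · exact Submodule.zero_mem _
    · exact Submodule.zero_mem _
    · exact Submodule.zero_mem _
    · exact Submodule.sum_mem _ fun ν _ => Submodule.smul_mem _ _ (F.jet_mem_linSpan' rfl)
    · exact Submodule.neg_mem _
        (Submodule.sum_mem _ fun ν _ => Submodule.smul_mem _ _ (F.jet_mem_linSpan' rfl))
  · refine multiset_sum_mem _ fun w hw => ?_
    obtain ⟨κ, _, rfl⟩ := Multiset.mem_map.1 hw
    exact Submodule.sum_mem _ fun ν _ => Submodule.smul_mem _ _ (F.jet_mem_linSpan' rfl)

theorem lorentzVal_cons (ρ σ μ : Fin 4) (c : Comp Ind Dir) (α : Multiset (Fin 4)) :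
    F.spinVal ρ σ (c, μ ::ₘ α) + F.orbitVal ρ σ (c, μ ::ₘ α)
      = F.pd μ (F.spinVal ρ σ (c, α) + F.orbitVal ρ σ (c, α))
        + ∑ ν, rot ρ σ μ ν • F.jet (c, ν ::ₘ α) := by
  rw [spinVal_cons, orbitVal_cons, map_add, add_assoc]

theorem orbitVal_zero (ρ σ : Fin 4) (c : Comp Ind Dir) : F.orbitVal ρ σ (c, 0) = 0 := by
  simp [orbitVal]

theorem lorentzVal_firstOrder (ρ σ : Fin 4) (c : Fin 4 → Comp Ind Dir) (s : Fin 4)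
    (G : Fin 4 → Fin 4 → ℂ) (M : ℂ)
    (hjet : ∀ β, ∑ μ, ∑ r, G μ r • F.jet (c r, μ ::ₘ β) = M • F.jet (c s, β))
    (hspin : ∑ μ, ∑ r, G μ r • F.pd μ (F.spinVal ρ σ (c r, 0))
        + ∑ μ, ∑ r, (∑ ν, rot ρ σ ν μ * G ν r) • F.jet (c r, μ ::ₘ 0)
      = M • F.spinVal ρ σ (c s, 0)) (α : Multiset (Fin 4)) :
    ∑ μ, ∑ r, G μ r • (F.spinVal ρ σ (c r, μ ::ₘ α) + F.orbitVal ρ σ (c r, μ ::ₘ α))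
      = M • (F.spinVal ρ σ (c s, α) + F.orbitVal ρ σ (c s, α)) := by
  induction α using Multiset.induction with
  | empty =>
    rw [orbitVal_zero, add_zero, ← hspin]
    simp only [lorentzVal_cons, orbitVal_zero, add_zero, smul_add, Finset.sum_add_distrib]
    congr 1
    simp only [Finset.smul_sum, Finset.sum_smul, smul_smul]
    have h : ∀ μ, ∑ r, ∑ ν, (G μ r * rot ρ σ μ ν) • F.jet (c r, ν ::ₘ 0)
        = ∑ ν, ∑ r, (G μ r * rot ρ σ μ ν) • F.jet (c r, ν ::ₘ 0) := fun μ => Finset.sum_comm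
    simp_rw [h]
    rw [Finset.sum_comm]
    refine Finset.sum_congr rfl fun ν _ => ?_
    rw [Finset.sum_comm]
    simp_rw [mul_comm (G _ _)]
  | cons κ α ih =>
    have h1 := congrArg (F.pd κ) ih
    simp only [map_sum, map_smul] at h1
    simp_rw [Multiset.cons_swap _ κ, lorentzVal_cons _ _ _ κ, smul_add (G _ _)]
    simp only [Finset.sum_add_distrib]
    rw [h1, smul_add M]
    congr 1
    simp only [Finset.smul_sum]
    have h : ∀ ν, M • rot ρ σ κ ν • F.jet (c s, ν ::ₘ α)
        = ∑ μ, ∑ r, G μ r • rot ρ σ κ ν • F.jet (c r, ν ::ₘ μ ::ₘ α) := by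
      intro ν
      rw [smul_comm, ← hjet]
      simp only [Finset.smul_sum, Multiset.cons_swap ν, smul_comm (rot ρ σ κ ν)]
    simp_rw [h]
    conv_rhs => rw [Finset.sum_comm]
    exact Finset.sum_congr rfl fun μ _ => Finset.sum_comm

def lorentzData (ρ σ : Fin 4) : F.DerData false where
  val x := F.spinVal ρ σ x + F.orbitVal ρ σ x
  parity x := by simpa using F.lorentzVal_parity ρ σ x
  kleinGordon a q α := by
    induction α using Multiset.induction with
    | empty =>
      have h1 : ∑ μ, eta μ • F.pd μ (F.pd μ (F.spinVal ρ σ (Comp.quad a q, 0)))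
          = -((F.mass a : ℂ) ^ 2) • F.spinVal ρ σ (Comp.quad a q, 0) := by
        rcases q with κ | _ | _ | _
        · simp only [spinVal, map_sum, map_smul, pd_jet, Finset.smul_sum]
          rw [Finset.sum_comm]
          refine Finset.sum_congr rfl fun ν _ => ?_
          simp_rw [smul_comm _ (rot ρ σ κ ν)]
          rw [← Finset.smul_sum, F.jet_kleinGordon]
        · simp [spinVal]
        · simp [spinVal]
        · simp [spinVal]
      have h2 : ∑ μ, eta μ • ∑ ν, rot ρ σ μ ν • F.jet (Comp.quad a q, μ ::ₘ ν ::ₘ 0) = 0 := by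
        have h3 : ∀ μ ν, eta μ * rot ρ σ μ ν = -(eta ν * rot ρ σ ν μ) := by
          intro μ ν
          by_cases h1 : μ = ρ <;> by_cases h2 : μ = σ <;> by_cases h3 : ν = ρ <;>
            by_cases h4 : ν = σ <;> simp_all [rot, eta_sq]
        have h4 : ∑ μ, eta μ • ∑ ν, rot ρ σ μ ν • F.jet (Comp.quad a q, μ ::ₘ ν ::ₘ 0)
            = -∑ μ, eta μ • ∑ ν, rot ρ σ μ ν • F.jet (Comp.quad a q, μ ::ₘ ν ::ₘ 0) := by
          simp only [Finset.smul_sum, smul_smul]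
          conv_lhs => rw [Finset.sum_comm]
          rw [← Finset.sum_neg_distrib]
          refine Finset.sum_congr rfl fun ν _ => ?_
          rw [← Finset.sum_neg_distrib]
          refine Finset.sum_congr rfl fun μ _ => ?_
          rw [h3 μ ν, neg_smul, Multiset.cons_swap]
        have h5 := eq_neg_iff_add_eq_zero.1 h4
        rw [← two_smul ℂ] at h5
        exact (smul_eq_zero_iff_right two_ne_zero).1 h5
      simp only [lorentzVal_cons, orbitVal_zero, add_zero, map_add, map_sum, map_smul, pd_jet,
        smul_add, Finset.sum_add_distrib]
      rw [h1, h2]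
      simp only [Multiset.cons_swap _ _ (0 : Multiset (Fin 4))] at h2 ⊢
      rw [add_zero]
      simpa [Multiset.cons_swap] using h2
    | cons κ α ih =>
      have h1 := congrArg (F.pd κ) ih
      have h2 : ∀ μ, F.spinVal ρ σ (Comp.quad a q, μ ::ₘ μ ::ₘ κ ::ₘ α)
            + F.orbitVal ρ σ (Comp.quad a q, μ ::ₘ μ ::ₘ κ ::ₘ α)
          = F.pd κ (F.spinVal ρ σ (Comp.quad a q, μ ::ₘ μ ::ₘ α)
              + F.orbitVal ρ σ (Comp.quad a q, μ ::ₘ μ ::ₘ α))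
            + ∑ ν, rot ρ σ κ ν • F.jet (Comp.quad a q, μ ::ₘ μ ::ₘ ν ::ₘ α) := by
        intro μ
        rw [Multiset.cons_swap μ κ, Multiset.cons_swap μ κ, lorentzVal_cons]
        congr 1
        refine Finset.sum_congr rfl fun ν _ => ?_
        rw [Multiset.cons_swap ν μ, Multiset.cons_swap ν μ]
      simp only [map_sum, map_smul] at h1
      simp_rw [h2, smul_add (eta _)]
      rw [Finset.sum_add_distrib, h1, lorentzVal_cons, smul_add (-((F.mass a : ℂ) ^ 2))]
      congr 1
      simp only [Finset.smul_sum]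
      rw [Finset.sum_comm]
      refine Finset.sum_congr rfl fun ν _ => ?_
      simp_rw [smul_comm _ (rot ρ σ κ ν)]
      rw [← Finset.smul_sum, F.jet_kleinGordon]
  absent a q α h := by
    have hz : ∀ β, F.jet (Comp.quad a q, β) = 0 := fun β => F.jet_absent a q β h
    have hs : F.spinVal ρ σ (Comp.quad a q, α) = 0 := by
      rcases q with κ | _ | _ | _
      · have hv : ∀ ν β, F.jet (.quad a (.v ν), β) = 0 := fun ν β => F.jet_absent a (.v ν) β h
        simp [spinVal, hv]
      · simp [spinVal]
      · simp [spinVal]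
      · simp [spinVal]
    simp [hs, orbitVal, hz]
  dirac A s α := by
    refine F.lorentzVal_firstOrder ρ σ (Comp.psi A) s (fun μ r => Complex.I * gamma μ s r) _
      (fun β => F.jet_dirac A s β) ?_ α
    have h0 : ∀ μ r, (∑ t, gamma μ s t * spinRot ρ σ t r) + ∑ ν, rot ρ σ ν μ * gamma ν s r
        = ∑ t, spinRot ρ σ s t * gamma μ t r := by
      intro μ r
      have h := congrFun (congrFun (gamma_spinRot ρ σ μ) s) r
      simpa [Matrix.mul_apply, Matrix.add_apply, Matrix.sum_apply] using h
    have h1 : (F.diracMass A : ℂ) • F.spinVal ρ σ (Comp.psi A s, 0)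
        = ∑ μ, ∑ r, (∑ t, spinRot ρ σ s t * (Complex.I * gamma μ t r)) •
          F.jet (Comp.psi A r, μ ::ₘ 0) := by
      simp only [spinVal, Finset.smul_sum, Finset.sum_smul]
      simp_rw [smul_comm (F.diracMass A : ℂ), ← F.jet_dirac A _ 0, Finset.smul_sum, smul_smul]
      rw [Finset.sum_comm]
      exact Finset.sum_congr rfl fun μ _ => Finset.sum_comm
    have h2 : ∑ μ, ∑ r, (Complex.I * gamma μ s r) • F.pd μ (F.spinVal ρ σ (Comp.psi A r, 0))
        = ∑ μ, ∑ r, (∑ t, Complex.I * gamma μ s t * spinRot ρ σ t r) •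
          F.jet (Comp.psi A r, μ ::ₘ 0) := by
      simp only [spinVal, map_sum, map_smul, pd_jet, Finset.smul_sum, Finset.sum_smul, smul_smul]
      exact Finset.sum_congr rfl fun μ _ => Finset.sum_comm
    rw [h1, h2, ← Finset.sum_add_distrib]
    refine Finset.sum_congr rfl fun μ _ => ?_
    rw [← Finset.sum_add_distrib]
    refine Finset.sum_congr rfl fun r _ => ?_
    rw [← add_smul]
    congr 1
    have h3 := congrArg (fun z => Complex.I * z) (h0 μ r)
    simp only [mul_add, Finset.mul_sum] at h3
    simp only [mul_assoc, mul_left_comm _ Complex.I] at h3 ⊢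
    exact h3
  diracBar A s α := by
    refine F.lorentzVal_firstOrder ρ σ (Comp.psibar A) s (fun μ r => Complex.I * gamma μ r s) _
      (fun β => F.jet_diracBar A s β) ?_ α
    have h0 : ∀ μ r, (∑ t, gamma μ r t * spinRot ρ σ t s) + ∑ ν, rot ρ σ ν μ * gamma ν r s
        = ∑ t, spinRot ρ σ r t * gamma μ t s := by
      intro μ r
      have h := congrFun (congrFun (gamma_spinRot ρ σ μ) r) s
      simpa [Matrix.mul_apply, Matrix.add_apply, Matrix.sum_apply] using h
    have h1 : -(F.diracMass A : ℂ) • F.spinVal ρ σ (Comp.psibar A s, 0)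
        = ∑ μ, ∑ r, (-∑ t, spinRot ρ σ t s * (Complex.I * gamma μ r t)) •
          F.jet (Comp.psibar A r, μ ::ₘ 0) := by
      simp only [spinVal, Finset.smul_sum, Finset.sum_smul, neg_smul _ (F.jet _),
        Finset.sum_neg_distrib, smul_neg]
      simp_rw [smul_comm (-(F.diracMass A : ℂ)), ← F.jet_diracBar A _ 0, Finset.smul_sum, smul_smul]
      rw [Finset.sum_comm]
      exact congrArg _ (Finset.sum_congr rfl fun μ _ => Finset.sum_comm)
    have h2 : ∑ μ, ∑ r, (Complex.I * gamma μ r s) • F.pd μ (F.spinVal ρ σ (Comp.psibar A r, 0))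
        = ∑ μ, ∑ r, (-∑ t, Complex.I * gamma μ t s * spinRot ρ σ r t) •
          F.jet (Comp.psibar A r, μ ::ₘ 0) := by
      simp only [spinVal, map_neg, map_sum, map_smul, pd_jet, Finset.smul_sum, Finset.sum_smul,
        smul_smul, neg_smul _ (F.jet _), Finset.sum_neg_distrib, smul_neg]
      exact congrArg _ (Finset.sum_congr rfl fun μ _ => Finset.sum_comm)
    rw [h1, h2, ← Finset.sum_add_distrib]
    refine Finset.sum_congr rfl fun μ _ => ?_
    rw [← Finset.sum_add_distrib]
    refine Finset.sum_congr rfl fun r _ => ?_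
    rw [← add_smul]
    congr 1
    have h3 := congrArg (fun z => Complex.I * z) (h0 μ r)
    simp only [mul_add, Finset.mul_sum] at h3
    simp only [mul_assoc, mul_left_comm _ Complex.I] at h3 ⊢
    simp only [mul_comm (gamma _ _ _)] at h3 ⊢
    linear_combination h3

/-- The infinitesimal Lorentz transformation `(ρ, σ)` of Wick polynomials. -/
def lorentz (ρ σ : Fin 4) : F.Wick →ₗ[ℂ] F.Wick := (F.lorentzData ρ σ).der

/-- Lorentz scalars: invariance under the connected Lorentz group (in the form of its covering
group acting on spinors), expressed by the generators. -/
def LorentzInvariant (w : F.Wick) : Prop := ∀ ρ σ, F.lorentz ρ σ w = 0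

/-! ### Wick monomials, divergences, co-boundaries -/

/-- The Wick monomial with the given factors. -/
def monomial (l : List (Jet Ind Dir)) : F.Wick := (l.map F.jet).prod

/-- Wick polynomials that are at least trilinear in the fields, of canonical dimension at most `4`,
of ghost number `0`, and with as many factors `Ψ` as factors `Ψ̄` in every monomial. -/
def interactionSpace : Submodule ℂ F.Wick :=
  Submodule.span ℂ {w | ∃ l : List (Jet Ind Dir), 3 ≤ l.length ∧ (l.map Jet.dim).sum ≤ 4 ∧
    (l.map fun x => x.1.ghost).sum = 0 ∧ (l.map fun x => x.1.fermionNumber).sum = 0 ∧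
    w = F.monomial l}

/-- `∂_μ J^μ` -/
def divergence (J : Fin 4 → F.Wick) : F.Wick := ∑ μ, F.pd μ (J μ)

/-- Relative co-cycles: `d_Q T = i ∂_μ T^μ` for some `T^μ`. -/
def IsCocycle (T : F.Wick) : Prop :=
  ∃ J : Fin 4 → F.Wick, F.dQ T = Complex.I • F.divergence J

/-- Relative co-boundaries: `d_Q B + i ∂_μ B^μ`. -/
def IsCoboundary (T : F.Wick) : Prop :=
  ∃ (B : F.Wick) (J : Fin 4 → F.Wick), T = F.dQ B + Complex.I • F.divergence J

/-- `T` and `T'` are cohomologous if they differ by a co-boundary. -/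
def Cohomologous (T T' : F.Wick) : Prop := F.IsCoboundary (T - T')

/-! ### The fields -/

def v (a : Ind) (μ : Fin 4) : F.Wick := F.jet (.quad a (.v μ), 0)

def u (a : Ind) : F.Wick := F.jet (.quad a .u, 0)

def ut (a : Ind) : F.Wick := F.jet (.quad a .ut, 0)

def phi (a : Ind) : F.Wick := F.jet (.quad a .phi, 0)

def psi (A : Dir) (s : Fin 4) : F.Wick := F.jet (.psi A s, 0)

def psibar (A : Dir) (s : Fin 4) : F.Wick := F.jet (.psibar A s, 0)

/-- `v_a^μ` -/
def vUp (a : Ind) (μ : Fin 4) : F.Wick := eta μ • F.v a μ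

/-- `F_a^{μν} = ∂^μ v_a^ν - ∂^ν v_a^μ` -/
def fieldStrengthUp (a : Ind) (μ ν : Fin 4) : F.Wick :=
  (eta μ * eta ν) • (F.pd μ (F.v a ν) - F.pd ν (F.v a μ))

/-- `φ_a^μ = ∂^μ Φ_a - m_a v_a^μ` -/
def phiUp (a : Ind) (μ : Fin 4) : F.Wick :=
  eta μ • (F.pd μ (F.phi a) - (F.gaugeMass a : ℂ) • F.v a μ)

end FieldContent

/-! ### The Yang-Mills interaction -/

/-- The coupling constants; `t ε a` and `s ε a`, `ε = ±1`, are matrices on the labels of the Dirac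
fields. -/
structure Couplings (Ind Dir : Type*) where
  f : Ind → Ind → Ind → ℂ
  f' : Ind → Ind → Ind → ℂ
  f'' : Ind → Ind → Ind → ℂ
  g : Ind → Ind → Ind → Ind → ℂ
  t : ℤˣ → Ind → Matrix Dir Dir ℂ
  s : ℤˣ → Ind → Matrix Dir Dir ℂ

namespace FieldContent

variable {Ind Dir : Type*} [Fintype Ind] [Fintype Dir] (F : FieldContent Ind Dir)
  (C : Couplings Ind Dir)

/-- `j_a^μ = ∑_ε Ψ̄ (t_a^ε ⊗ γ^μ γ_ε) Ψ` -/
def vectorCurrent (a : Ind) (μ : Fin 4) : F.Wick :=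
  ∑ ε : ℤˣ, ∑ A, ∑ B, ∑ s, ∑ r,
    (C.t ε a A B * (gamma μ * chiral ε) s r) • (F.psibar A s * F.psi B r)

/-- `j_a = ∑_ε Ψ̄ (s_a^ε ⊗ γ_ε) Ψ` -/
def scalarCurrent (a : Ind) : F.Wick :=
  ∑ ε : ℤˣ, ∑ A, ∑ B, ∑ s, ∑ r,
    (C.s ε a A B * chiral ε s r) • (F.psibar A s * F.psi B r)

/-- The set of Higgs indices. -/
def higgs : Finset Ind := Finset.univ.filter fun a => F.sector a = Sector.higgs

/-- The Yang-Mills interaction Lagrangian. -/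
def ymT : F.Wick :=
  (∑ a, ∑ b, ∑ c, C.f a b c •
      ((1 / 2 : ℂ) • (∑ μ, ∑ ν, F.v a μ * F.v b ν * F.fieldStrengthUp c ν μ)
        + ∑ μ, F.u a * F.vUp b μ * F.pd μ (F.ut c)))
    + (∑ a, ∑ b, ∑ c, C.f' a b c •
      ((∑ μ, F.phi a * F.phiUp b μ * F.v c μ)
        + (F.gaugeMass b : ℂ) • (F.phi a * F.ut b * F.u c)))
    + (1 / 6 : ℂ) • (∑ a, ∑ b, ∑ c, C.f'' a b c • (F.phi a * F.phi b * F.phi c))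
    + (1 / 24 : ℂ) • (∑ a ∈ F.higgs, ∑ b ∈ F.higgs, ∑ c ∈ F.higgs, ∑ d ∈ F.higgs,
        C.g a b c d • (F.phi a * F.phi b * F.phi c * F.phi d))
    + (∑ a, ∑ μ, F.vectorCurrent C a μ * F.v a μ)
    + ∑ a, F.scalarCurrent C a * F.phi a

/-- `T^μ` -/
def ymTVec (μ : Fin 4) : F.Wick :=
  (∑ a, ∑ b, ∑ c, C.f a b c •
      ((∑ ν, F.u a * F.v b ν * F.fieldStrengthUp c ν μ)
        - (1 / 2 : ℂ) • (F.u a * F.u b * (eta μ • F.pd μ (F.ut c)))))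
    + (∑ a, ∑ b, ∑ c, C.f' a b c • (F.phi a * F.phiUp b μ * F.u c))
    + ∑ a, F.vectorCurrent C a μ * F.u a

/-- `T^{μν}` -/
def ymTTensor (μ ν : Fin 4) : F.Wick :=
  (1 / 2 : ℂ) • ∑ a, ∑ b, ∑ c, C.f a b c • (F.u a * F.u b * F.fieldStrengthUp c μ ν)

/-- The diagonal mass matrix of the Dirac fields. -/
def diracMassMatrix [DecidableEq Dir] : Matrix Dir Dir ℂ :=
  Matrix.diagonal fun A => (F.diracMass A : ℂ)

end FieldContent

/-- The restrictions on the coupling constants.  The constants `m_a = F.gaugeMass a` are zero for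
Higgs indices, where the Klein-Gordon mass is `F.mass a`. -/
structure Couplings.Restrictions {Ind Dir : Type*} [Fintype Dir] [DecidableEq Dir]
    (C : Couplings Ind Dir) (F : FieldContent Ind Dir) : Prop where
  f_antisymm : ∀ a b c, C.f a b c = -C.f b a c ∧ C.f a b c = -C.f a c b
  f_higgs : ∀ a b c, F.sector c = Sector.higgs → C.f a b c = 0
  f'_antisymm : ∀ a b c, C.f' a b c = -C.f' b a c
  f'_higgs : ∀ a b c, F.sector c = Sector.higgs → C.f' a b c = 0
  f'_massless : ∀ a b c, F.sector a = Sector.massless → C.f' a b c = 0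
  f''_symm : ∀ a b c, C.f'' a b c = C.f'' b a c ∧ C.f'' a b c = C.f'' a c b
  f''_massless : ∀ a b c, F.sector a = Sector.massless → C.f'' a b c = 0
  g_symm : ∀ a b c d, C.g a b c d = C.g b a c d ∧ C.g a b c d = C.g a c b d ∧
    C.g a b c d = C.g a b d c
  t_higgs : ∀ ε a, F.sector a = Sector.higgs → C.t ε a = 0
  s_massless : ∀ ε a, F.sector a = Sector.massless → C.s ε a = 0
  f_mass : ∀ a b c, F.sector a ≠ Sector.higgs → F.sector b ≠ Sector.higgs →
    F.sector c ≠ Sector.massless →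
    C.f' c a b * (F.gaugeMass a : ℂ) - C.f' c b a * (F.gaugeMass b : ℂ)
      = C.f a b c * (F.gaugeMass c : ℂ)
  dirac_mass : ∀ ε a, (F.gaugeMass a : ℂ) • C.s ε a
    = Complex.I • (F.diracMassMatrix * C.t ε a - C.t (-ε) a * F.diracMassMatrix)
  /-- With `t_a^ε = t_a + ε t'_a`: `[M, t_a] = 0`. -/
  dirac_comm : ∀ a, F.gaugeMass a = 0 →
    F.diracMassMatrix * ((1 / 2 : ℂ) • (C.t 1 a + C.t (-1) a))
      - ((1 / 2 : ℂ) • (C.t 1 a + C.t (-1) a)) * F.diracMassMatrix = 0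
  /-- With `t_a^ε = t_a + ε t'_a`: `{M, t'_a} = 0`. -/
  dirac_anticomm : ∀ a, F.gaugeMass a = 0 →
    F.diracMassMatrix * ((1 / 2 : ℂ) • (C.t 1 a - C.t (-1) a))
      + ((1 / 2 : ℂ) • (C.t 1 a - C.t (-1) a)) * F.diracMassMatrix = 0
  f''_two_higgs : ∀ a b c, F.sector a = Sector.higgs → F.sector b = Sector.higgs →
    F.sector c = Sector.massive →
    C.f'' a b c = 1 / (F.mass c : ℂ) * C.f' a b c * ((F.mass a : ℂ) ^ 2 - (F.mass b : ℂ) ^ 2)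
  f''_one_higgs : ∀ a b c, F.sector a = Sector.massive → F.sector b = Sector.higgs →
    F.sector c = Sector.massive →
    C.f'' a b c = -(1 / (F.mass c : ℂ) * C.f' a b c * (F.mass b : ℂ) ^ 2)
  f''_no_higgs : ∀ a b c, F.sector a = Sector.massive → F.sector b = Sector.massive →
    F.sector c = Sector.massive → C.f'' a b c = 0

end YangMills

end

/-!
The interaction `T` is brought to a normal form modulo co-boundaries, the co-cycle condition is turned
into algebraic equations for the finitely many coefficients of the normal form, and these equations
force the normal form to be the Yang-Mills interaction.

*Vertices.* The bounds on the dimension, the ghost number and the Dirac charge leave finitely many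
shapes of Wick monomials, with at most four tensor indices or two spinor indices and one tensor index.
A Lorentz invariant combination has coefficients that may be taken invariant
(`exists_invariant_coeff`): they can be chosen orthogonal to the linear relations between the
monomials, and the generators act by self-adjoint or anti-self-adjoint matrices. Invariant
coefficients are contractions with the metric, the totally antisymmetric tensor (`invariant_tensor₄`),
`γ_ε` and `γ^μ γ_ε` (`invariant_spinor`, `invariant_spinor_vector`). Hence `T` is a combination of the
vertices of `IsVertex` (`mem_invariantSpan`). Divergences of trilinear monomials and gauge variations
of monomials with an antighost express some of the vertices by others (`invariantSpan_le`). The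
coefficients of the remaining vertices are chosen orthogonal to all relations between the vertices
modulo co-boundaries, so that they have the symmetries of the vertices (`exists_interaction`).

*Amplitudes.* Contraction with a plane wave solution of the field equations is a graded derivation of
the Wick algebra (`PlaneWave.op`). It turns derivatives into factors of the momentum, and `d_Q` into
the infinitesimal gauge transformation of the polarization (`PlaneWave.op_dQ`). The amplitudes for
waves whose momenta add up to zero therefore do not see divergences, and for a co-cycle the signed sum
of the amplitudes in which one of the waves is gauge transformed vanishes (`amp₃_cocycle`,
`amp₄_cocycle`). Momenta and polarizations may be complex, so there are
enough of them for any masses: in a null frame the condition becomes polynomial in free parameters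
(`cubic_cocycle_nullFrame`, `quartic_cocycle`), and explicit spinors do the same for the Dirac fields
(`dirac_cocycle`). A reflection separates the parity violating terms. The outcome is that the
coupling of three vector fields is totally antisymmetric and determines the coupling `∂ũ u v`, that
`Φ v v` and `u ũ Φ` are determined by it and by `Φ ∂Φ v`, that the parity violating couplings and all
quadrilinear couplings except that of four Higgs fields vanish, and that the mass relations hold
(`VertexCoeffs.IsNormal.restrictions`). With this the interaction is the Yang-Mills interaction
(`VertexCoeffs.IsNormal.interaction_eq`).

*Descent equations.* `dQ_ymT`, `dQ_ymTVec` and `dQ_ymTTensor` compute gauge variations and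
divergences, and compare them monomial by monomial. Besides the listed properties of the couplings, the
first of them needs that `f'_{bca} (μ_b² - μ_c²) = 0` for a massless index `a` and Higgs indices `b`
and `c`. This is not among the listed properties, but part of what the co-cycle condition says
(`Couplings.ScalarRelation`).
-/


noncomputable section

namespace YangMills
namespace FieldContent
variable {Ind Dir : Type*} (F : FieldContent Ind Dir)

/-! ### Graded derivations of the Wick algebra -/

/-! The general lemmas on negation and subtraction, in the form in which they apply to the ring
structure of `F.Wick`. -/

theorem wick_neg_smul (c : ℂ) (w : F.Wick) : (-c) • w = -(c • w) := neg_smul c w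

theorem wick_neg_mul (w z : F.Wick) : -w * z = -(w * z) := neg_mul w z

theorem wick_mul_neg (w z : F.Wick) : w * -z = -(w * z) := mul_neg w z

theorem wick_sub_mul (w z y : F.Wick) : (w - z) * y = w * y - z * y := sub_mul w z y

theorem wick_mul_sub (y w z : F.Wick) : y * (w - z) = y * w - y * z := mul_sub y w z

theorem wick_eq_zero_of_eq_neg {w : F.Wick} (h : w = -w) : w = 0 := by
  have h1 : (2 : ℂ) • w = 0 := by
    rw [two_smul]
    nth_rewrite 1 [h]
    exact neg_add_cancel w
  exact (smul_eq_zero_iff_right two_ne_zero).1 h1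

/-- Induction over Wick polynomials: products are built up one jet variable at a time. -/
theorem wick_induction {P : F.Wick → Prop} (one : P 1)
    (jet_mul : ∀ x w, P w → P (F.jet x * w)) (add : ∀ w z, P w → P z → P (w + z))
    (smul : ∀ (c : ℂ) w, P w → P (c • w)) (w : F.Wick) : P w := by
  suffices h : ∀ w z : F.Wick, P z → P (w * z) by simpa using h w 1 one
  intro w
  obtain ⟨p, rfl⟩ := RingQuot.mkAlgHom_surjective ℂ F.Rel w
  induction p using FreeAlgebra.induction with
  | grade0 c =>
    intro z hz
    rw [AlgHom.commutes, ← Algebra.smul_def]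
    exact smul c z hz
  | grade1 x => exact fun z hz => jet_mul x z hz
  | mul p q hp hq =>
    intro z hz
    rw [map_mul, mul_assoc]
    exact hp _ (hq z hz)
  | add p q hp hq =>
    intro z hz
    rw [map_add, add_mul]
    exact add _ _ (hp z hz) (hq z hz)

/-- The graded Leibniz rule for a linear map of parity `b`, with a jet variable as first factor. -/
structure IsLeibniz (b : Bool) (D : F.Wick →ₗ[ℂ] F.Wick) : Prop where
  one : D 1 = 0
  jet_mul : ∀ x w, D (F.jet x * w) = D (F.jet x) * w + koszul x.1.odd b • (F.jet x * D w)

/-- `w` is of parity `p`, as seen by graded derivations. -/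
def HasParity (p : Bool) (w : F.Wick) : Prop :=
  ∀ b D, F.IsLeibniz b D → ∀ z, D (w * z) = D w * z + koszul p b • (w * D z)

theorem hasParity_linSpan {p : Bool} {l : F.Wick} (hl : l ∈ F.linSpan p) : F.HasParity p l := by
  intro b D hD z
  induction hl using Submodule.span_induction with
  | mem w h =>
    obtain ⟨x, rfl, rfl⟩ := h
    exact hD.jet_mul x z
  | zero => simp
  | add u v _ _ hu hv => simp only [add_mul, map_add, hu, hv, smul_add]; abel
  | smul c u _ hu => simp only [smul_mul_assoc, map_smul, hu, smul_add, smul_comm c]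

theorem hasParity_smul_one (c : ℂ) : F.HasParity false (c • 1) := by
  intro b D hD z
  simp [hD.one, koszul]

theorem DerData.isLeibniz {b : Bool} (D : F.DerData b) : F.IsLeibniz b D.der where
  one := D.der_one
  jet_mul x w := by rw [D.der_jet_mul, D.der_jet]

theorem koszul_xor_left (p q r : Bool) : koszul (xor p q) r = koszul p r * koszul q r := by
  cases p <;> cases q <;> cases r <;> simp [koszul]

theorem koszul_xor_right (p q r : Bool) : koszul r (xor p q) = koszul r p * koszul r q := by
  cases p <;> cases q <;> cases r <;> simp [koszul]

theorem koszul_comm (p q : Bool) : koszul p q = koszul q p := by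
  cases p <;> cases q <;> simp [koszul]

theorem koszul_sq (p q : Bool) : koszul p q * koszul p q = 1 := by
  cases p <;> cases q <;> simp [koszul]

/-- Two graded derivations whose graded commutator has known values on the jet variables have the
corresponding graded commutator on all Wick polynomials. -/
theorem graded_commutator {b b' : Bool} {D D' E : F.Wick →ₗ[ℂ] F.Wick} (hD : F.IsLeibniz b D)
    (hD' : F.IsLeibniz b' D') (hE : F.IsLeibniz (xor b b') E)
    (hp : ∀ x, F.HasParity (xor x.1.odd b) (D (F.jet x)))
    (hp' : ∀ x, F.HasParity (xor x.1.odd b') (D' (F.jet x)))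
    (h : ∀ x, D (D' (F.jet x)) = koszul b b' • D' (D (F.jet x)) + E (F.jet x)) (w : F.Wick) :
    D (D' w) = koszul b b' • D' (D w) + E w := by
  induction w using F.wick_induction with
  | one => simp [hD.one, hD'.one, hE.one]
  | jet_mul x w hw =>
    rw [hD'.jet_mul, map_add, map_smul, hp' x b D hD, hD.jet_mul, hw, hD.jet_mul, map_add, map_smul,
      hp x b' D' hD', hD'.jet_mul, hE.jet_mul, h]
    simp only [koszul_xor_left, koszul_xor_right, koszul_comm b' b, mul_add, add_mul, smul_add,
      smul_smul, mul_smul_comm, smul_mul_assoc, ← mul_assoc]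
    have e1 : koszul b b' * koszul x.1.odd b' * koszul b b' = koszul x.1.odd b' := by
      rw [mul_comm, ← mul_assoc, koszul_sq, one_mul]
    have e2 : koszul x.1.odd b' * koszul x.1.odd b * koszul b b'
        = koszul b b' * koszul x.1.odd b * koszul x.1.odd b' := by ring
    rw [e1, e2, mul_comm (koszul x.1.odd b') (koszul x.1.odd b)]
    module
  | add w z hw hz => simp only [map_add, hw, hz, smul_add]; abel
  | smul c w hw => simp only [map_smul, hw, smul_add, smul_comm c]

theorem isLeibniz_zero (b : Bool) : F.IsLeibniz b 0 where
  one := rfl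
  jet_mul x w := by simp

theorem pd_isLeibniz (μ : Fin 4) : F.IsLeibniz false (F.pd μ) := (F.pdData μ).isLeibniz

theorem dQ_isLeibniz : F.IsLeibniz true F.dQ := F.dQData.isLeibniz

theorem lorentz_isLeibniz (ρ σ : Fin 4) : F.IsLeibniz false (F.lorentz ρ σ) :=
  (F.lorentzData ρ σ).isLeibniz

theorem dQ_jet (x : Jet Ind Dir) : F.dQ (F.jet x) = F.dQVal x := F.dQData.der_jet x

theorem lorentz_jet (ρ σ : Fin 4) (x : Jet Ind Dir) :
    F.lorentz ρ σ (F.jet x) = F.spinVal ρ σ x + F.orbitVal ρ σ x := (F.lorentzData ρ σ).der_jet x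

variable {F} in
/-- The Leibniz rule for even derivations. -/
theorem IsLeibniz.mul {D : F.Wick →ₗ[ℂ] F.Wick} (hD : F.IsLeibniz false D) (w z : F.Wick) :
    D (w * z) = D w * z + w * D z := by
  induction w using F.wick_induction with
  | one => simp [hD.one]
  | jet_mul x w hw =>
    have hk : koszul x.1.odd false = 1 := by simp [koszul]
    rw [mul_assoc, hD.jet_mul, hw, hD.jet_mul, hk, one_smul, one_smul]
    simp only [mul_add, add_mul, mul_assoc]
    abel
  | add w y hw hy => simp only [add_mul, map_add, hw, hy]; abel
  | smul c w hw => simp only [smul_mul_assoc, map_smul, hw, smul_add]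

theorem pd_mul (μ : Fin 4) (w z : F.Wick) : F.pd μ (w * z) = F.pd μ w * z + w * F.pd μ z :=
  (F.pd_isLeibniz μ).mul w z

theorem lorentz_mul (ρ σ : Fin 4) (w z : F.Wick) :
    F.lorentz ρ σ (w * z) = F.lorentz ρ σ w * z + w * F.lorentz ρ σ z :=
  (F.lorentz_isLeibniz ρ σ).mul w z

theorem dQ_bose_mul {x : Jet Ind Dir} (hx : x.1.odd = false) (w : F.Wick) :
    F.dQ (F.jet x * w) = F.dQ (F.jet x) * w + F.jet x * F.dQ w := by
  rw [F.dQ_isLeibniz.jet_mul, hx]; simp [koszul]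

theorem dQ_fermi_mul {x : Jet Ind Dir} (hx : x.1.odd = true) (w : F.Wick) :
    F.dQ (F.jet x * w) = F.dQ (F.jet x) * w - F.jet x * F.dQ w := by
  rw [F.dQ_isLeibniz.jet_mul, hx]; simp [koszul, sub_eq_add_neg, wick_neg_smul]

theorem dQ_v (a : Ind) (μ : Fin 4) (α : Multiset (Fin 4)) :
    F.dQ (F.jet (.quad a (.v μ), α)) = Complex.I • F.jet (.quad a .u, μ ::ₘ α) := F.dQ_jet _

theorem dQ_u (a : Ind) (α : Multiset (Fin 4)) : F.dQ (F.jet (.quad a .u, α)) = 0 := F.dQ_jet _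

theorem dQ_ut (a : Ind) (α : Multiset (Fin 4)) :
    F.dQ (F.jet (.quad a .ut, α)) = -Complex.I •
      ((∑ μ, eta μ • F.jet (.quad a (.v μ), μ ::ₘ α))
        + (F.gaugeMass a : ℂ) • F.jet (.quad a .phi, α)) := F.dQ_jet _

theorem dQ_phi (a : Ind) (α : Multiset (Fin 4)) :
    F.dQ (F.jet (.quad a .phi, α)) = (Complex.I * (F.gaugeMass a : ℂ)) • F.jet (.quad a .u, α) :=
  F.dQ_jet _

theorem dQ_psi (A : Dir) (s : Fin 4) (α : Multiset (Fin 4)) :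
    F.dQ (F.jet (.psi A s, α)) = 0 := F.dQ_jet _

theorem dQ_psibar (A : Dir) (s : Fin 4) (α : Multiset (Fin 4)) :
    F.dQ (F.jet (.psibar A s, α)) = 0 := F.dQ_jet _

theorem gaugeMass_higgs {a : Ind} (h : F.sector a = Sector.higgs) : F.gaugeMass a = 0 := by
  simp [gaugeMass, h]

theorem gaugeMass_of_ne {a : Ind} (h : F.sector a ≠ Sector.higgs) : F.gaugeMass a = F.mass a := by
  unfold gaugeMass
  split <;> simp_all

theorem gaugeMass_massless {a : Ind} (h : F.sector a = Sector.massless) : F.gaugeMass a = 0 := by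
  rw [F.gaugeMass_of_ne (by simp [h]), F.mass_massless a h]

theorem jet_u_higgs {a : Ind} (h : F.sector a = Sector.higgs) (α : Multiset (Fin 4)) :
    F.jet (.quad a .u, α) = 0 := F.jet_absent a .u α h

theorem jet_ut_higgs {a : Ind} (h : F.sector a = Sector.higgs) (α : Multiset (Fin 4)) :
    F.jet (.quad a .ut, α) = 0 := F.jet_absent a .ut α h

theorem jet_v_higgs {a : Ind} (h : F.sector a = Sector.higgs) (μ : Fin 4) (α : Multiset (Fin 4)) :
    F.jet (.quad a (.v μ), α) = 0 := F.jet_absent a (.v μ) α h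

theorem jet_phi_massless {a : Ind} (h : F.sector a = Sector.massless) (α : Multiset (Fin 4)) :
    F.jet (.quad a .phi, α) = 0 := F.jet_absent a .phi α h

/-- The Klein-Gordon mass of a ghost field agrees with its gauge mass. -/
theorem gaugeMass_sq_smul_u (a : Ind) (α : Multiset (Fin 4)) :
    ((F.mass a : ℂ) ^ 2) • F.jet (.quad a .u, α)
      = ((F.gaugeMass a : ℂ) ^ 2) • F.jet (.quad a .u, α) := by
  by_cases h : F.sector a = Sector.higgs
  · simp [F.jet_u_higgs h]
  · rw [F.gaugeMass_of_ne h]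

/-- Nilpotency needs the fields of a quadruple to have one and the same mass: it turns the
divergence of `∂^μ u_a` in `d_Q d_Q ũ_a` into a multiple of `u_a`, which the gauge variation of
`Φ_a` cancels. -/
theorem dQ_dQ (w : F.Wick) : F.dQ (F.dQ w) = 0 := by
  have hj : ∀ x, F.dQ (F.dQ (F.jet x)) = 0 := by
    rintro ⟨⟨a, (μ | _ | _ | _)⟩ | ⟨A, s⟩ | ⟨A, s⟩, α⟩
    · simp [dQ_v, dQ_u]
    · simp [dQ_u]
    · have h := F.jet_kleinGordon a .u α
      rw [wick_neg_smul, F.gaugeMass_sq_smul_u] at h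
      simp only [dQ_ut, map_smul, map_add, map_sum, dQ_v, dQ_phi]
      simp_rw [smul_comm _ Complex.I (F.jet _)]
      rw [← Finset.smul_sum, h]
      module
    · simp [dQ_phi, dQ_u]
    · simp [dQ_psi]
    · simp [dQ_psibar]
  have hp : ∀ x, F.HasParity (xor x.1.odd true) (F.dQ (F.jet x)) := fun x => by
    rw [dQ_jet]; exact F.hasParity_linSpan (F.dQData.parity x)
  have h := F.graded_commutator F.dQ_isLeibniz F.dQ_isLeibniz (F.isLeibniz_zero _) hp hp
    (by simp [hj]) w
  simp only [koszul, Bool.and_self, if_true, wick_neg_smul, one_smul, LinearMap.zero_apply,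
    add_zero] at h
  exact F.wick_eq_zero_of_eq_neg h

theorem dQ_pd (μ : Fin 4) (w : F.Wick) : F.dQ (F.pd μ w) = F.pd μ (F.dQ w) := by
  have hp : ∀ x, F.HasParity (xor x.1.odd true) (F.dQ (F.jet x)) := fun x => by
    rw [dQ_jet]; exact F.hasParity_linSpan (F.dQData.parity x)
  have hp' : ∀ x, F.HasParity (xor x.1.odd false) (F.pd μ (F.jet x)) := fun x => by
    rw [pd_jet]; exact F.hasParity_linSpan ((F.pdData μ).parity x)
  have h := F.graded_commutator F.dQ_isLeibniz (F.pd_isLeibniz μ) (F.isLeibniz_zero _) hp hp'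
    (by
      rintro ⟨⟨a, (ν | _ | _ | _)⟩ | ⟨A, s⟩ | ⟨A, s⟩, α⟩ <;>
        simp [pd_jet, dQ_v, dQ_u, dQ_ut, dQ_phi, dQ_psi, dQ_psibar, koszul, Multiset.cons_swap μ]) w
  simpa [koszul] using h

theorem dQ_divergence (J : Fin 4 → F.Wick) :
    F.dQ (F.divergence J) = F.divergence fun μ => F.dQ (J μ) := by
  simp [divergence, dQ_pd]

/-! ### Reordering factors -/

theorem bose_comm {x : Jet Ind Dir} (hx : x.1.odd = false) (w : F.Wick) :
    F.jet x * w = w * F.jet x := by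
  induction w using F.wick_induction with
  | one => simp
  | jet_mul y w hw =>
    rw [← mul_assoc, F.jet_comm x y, hx, mul_assoc, ← hw, ← mul_assoc]
    simp [koszul]
  | add w z hw hz => rw [mul_add, add_mul, hw, hz]
  | smul c w hw => rw [mul_smul_comm, smul_mul_assoc, hw]

theorem fermi_comm {x y : Jet Ind Dir} (hx : x.1.odd = true) (hy : y.1.odd = true) :
    F.jet x * F.jet y = -(F.jet y * F.jet x) := by
  rw [F.jet_comm x y, hx, hy]
  simp [koszul, wick_neg_smul]

/-! ### The space of co-boundaries -/

/-- The divergence as a linear map. -/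
def divergenceHom : (Fin 4 → F.Wick) →ₗ[ℂ] F.Wick :=
  ∑ μ, F.pd μ ∘ₗ LinearMap.proj μ

theorem divergenceHom_apply (J : Fin 4 → F.Wick) : F.divergenceHom J = F.divergence J := by
  simp [divergenceHom, divergence]

/-- The co-boundaries form a linear subspace. -/
def coboundaries : Submodule ℂ F.Wick := LinearMap.range F.dQ ⊔ LinearMap.range F.divergenceHom

theorem mem_coboundaries {w : F.Wick} : w ∈ F.coboundaries ↔ F.IsCoboundary w := by
  rw [coboundaries, Submodule.mem_sup]
  constructor
  · rintro ⟨_, ⟨B, rfl⟩, _, ⟨J, rfl⟩, rfl⟩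
    refine ⟨B, -Complex.I • J, ?_⟩
    rw [← divergenceHom_apply, map_smul, smul_smul]
    simp
  · rintro ⟨B, J, rfl⟩
    refine ⟨_, ⟨B, rfl⟩, _, ⟨Complex.I • J, rfl⟩, ?_⟩
    rw [map_smul, divergenceHom_apply]

theorem dQ_mem_coboundaries (w : F.Wick) : F.dQ w ∈ F.coboundaries :=
  Submodule.mem_sup_left ⟨w, rfl⟩

theorem divergence_mem_coboundaries (J : Fin 4 → F.Wick) : F.divergence J ∈ F.coboundaries :=
  Submodule.mem_sup_right ⟨J, F.divergenceHom_apply J⟩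

theorem IsCoboundary.isCocycle {w : F.Wick} (h : F.IsCoboundary w) : F.IsCocycle w := by
  obtain ⟨B, J, rfl⟩ := h
  exact ⟨fun μ => F.dQ (J μ), by simp [dQ_dQ, dQ_divergence]⟩

theorem IsCocycle.sub {w z : F.Wick} (hw : F.IsCocycle w) (hz : F.IsCocycle z) :
    F.IsCocycle (w - z) := by
  obtain ⟨J, hJ⟩ := hw
  obtain ⟨K, hK⟩ := hz
  refine ⟨J - K, ?_⟩
  rw [map_sub, hJ, hK, ← divergenceHom_apply, ← divergenceHom_apply, ← divergenceHom_apply,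
    map_sub, smul_sub]

end FieldContent
namespace FieldContent
variable {Ind Dir : Type*} (F : FieldContent Ind Dir)

/-! ### Contractions with plane waves -/

/-- A plane wave solution `pol c * exp(mom · x)` of the free field equations, of definite
statistics `b`.  The momentum is complex and carries lower indices. -/
structure PlaneWave (b : Bool) where
  pol : Comp Ind Dir → ℂ
  mom : Fin 4 → ℂ
  parity : ∀ c, c.odd ≠ b → pol c = 0
  kleinGordon : ∀ a q, (∑ μ, eta μ * (mom μ * mom μ)) * pol (.quad a q)
    = -(F.mass a : ℂ) ^ 2 * pol (.quad a q)
  absent : ∀ a q, F.Absent a q → pol (.quad a q) = 0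
  dirac : ∀ A s, ∑ μ, ∑ r, Complex.I * gamma μ s r * (mom μ * pol (.psi A r))
    = F.diracMass A * pol (.psi A s)
  diracBar : ∀ A s, ∑ μ, ∑ r, Complex.I * gamma μ r s * (mom μ * pol (.psibar A r))
    = -F.diracMass A * pol (.psibar A s)

namespace PlaneWave

variable {F} {b : Bool} (χ : F.PlaneWave b)

/-- The value of a jet variable on the plane wave, at the origin. -/
def val (x : Jet Ind Dir) : ℂ := χ.pol x.1 * (x.2.map χ.mom).prod

theorem val_cons (c : Comp Ind Dir) (μ : Fin 4) (α : Multiset (Fin 4)) :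
    χ.val (c, μ ::ₘ α) = χ.mom μ * χ.val (c, α) := by
  simp [val]; ring

theorem val_parity {x : Jet Ind Dir} (h : x.1.odd ≠ b) : χ.val x = 0 := by
  simp [val, χ.parity _ h]

/-- The graded derivation `D` with `D x = χ(x)` on jet variables, as an algebra homomorphism to
upper triangular matrices `[[± w, D w], [0, w]]`. -/
def freeHom : FreeAlgebra ℂ (Jet Ind Dir) →ₐ[ℂ] Matrix (Fin 2) (Fin 2) F.Wick :=
  FreeAlgebra.lift ℂ fun x => !![koszul x.1.odd b • F.jet x, χ.val x • 1; 0, F.jet x]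

theorem freeHom_rel ⦃p q : FreeAlgebra ℂ (Jet Ind Dir)⦄ (h : F.Rel p q) :
    χ.freeHom p = χ.freeHom q := by
  have e : ∀ x, χ.freeHom (FreeAlgebra.ι ℂ x)
      = !![koszul x.1.odd b • F.jet x, χ.val x • 1; 0, F.jet x] := fun x => by simp [freeHom]
  -- a linear relation with coefficients `k` that holds between jet variables of one statistics
  -- and between their values on the wave
  have lin : ∀ (n : ℕ) (k : Fin n → ℂ) (x : Fin n → Jet Ind Dir) (c : Bool),
      (∀ i, (x i).1.odd = c) → ∑ i, k i • F.jet (x i) = 0 → ∑ i, k i * χ.val (x i) = 0 →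
      ∑ i, k i • χ.freeHom (FreeAlgebra.ι ℂ (x i)) = 0 := by
    intro n k x c hc h1 h2
    ext i j
    simp only [e, Matrix.sum_apply, Matrix.smul_apply, hc]
    fin_cases i <;> fin_cases j
    · simp [smul_comm _ (koszul c b), ← Finset.smul_sum, h1]
    · simp [smul_smul, ← Finset.sum_smul, h2]
    · simp
    · simp [h1]
  cases h with
  | comm x y =>
    have h1 := F.jet_comm x y
    have h2 : (koszul x.1.odd b * χ.val y) = koszul x.1.odd y.1.odd * χ.val y := by
      by_cases h : y.1.odd = b
      · rw [h]
      · rw [χ.val_parity h, mul_zero, mul_zero]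
    have h3 : (koszul x.1.odd y.1.odd * koszul y.1.odd b) * χ.val x = χ.val x := by
      by_cases h : x.1.odd = b
      · rw [h, koszul_comm, koszul_sq, one_mul]
      · rw [χ.val_parity h, mul_zero]
    ext i j
    fin_cases i <;> fin_cases j
    · simp [map_mul, map_smul, e, Matrix.mul_apply, h1, smul_smul]
      ring_nf
    · simp [map_mul, map_smul, e, Matrix.mul_apply, Fin.sum_univ_two, smul_smul]
      rw [← mul_assoc, h3, mul_comm (χ.val y), h2]
      abel
    · simp [map_mul, map_smul, e, Matrix.mul_apply]
    · simp [map_mul, map_smul, e, Matrix.mul_apply, h1]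
  | kleinGordon a q α =>
    have h := lin 5 (Fin.cons ((F.mass a : ℂ) ^ 2) eta)
      (Fin.cons (.quad a q, α) fun μ => (.quad a q, μ ::ₘ μ ::ₘ α))
      (Comp.quad a q : Comp Ind Dir).odd (by intro i; refine Fin.cases ?_ (fun _ => ?_) i <;> rfl)
      (by rw [Fin.sum_univ_succ]
          simp only [Fin.cons_zero, Fin.cons_succ, F.jet_kleinGordon, wick_neg_smul]; abel)
      (by rw [Fin.sum_univ_succ]
          simp only [Fin.cons_zero, Fin.cons_succ, val_cons]
          have h := χ.kleinGordon a q
          have h' : ∑ μ, eta μ * (χ.mom μ * (χ.mom μ * χ.val (.quad a q, α)))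
              = (∑ μ, eta μ * (χ.mom μ * χ.mom μ)) * χ.val (.quad a q, α) := by
            rw [Finset.sum_mul]; exact Finset.sum_congr rfl fun μ _ => by ring
          rw [h', val, ← mul_assoc, ← mul_assoc, h]; ring)
    rw [Fin.sum_univ_succ] at h
    simp only [Fin.cons_zero, Fin.cons_succ] at h
    simp only [map_sum, map_smul]
    rw [eq_neg_of_add_eq_zero_right h]
    module
  | absent a q α h =>
    rw [e, F.jet_absent a q α h, map_zero]
    have hv : χ.val (.quad a q, α) = 0 := by simp [val, χ.absent a q h]
    rw [hv]
    ext i j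
    fin_cases i <;> fin_cases j <;> simp
  | dirac A s α =>
    have h1 := F.jet_dirac A s α
    have h2 := χ.dirac A s
    have h3 : ∑ μ, ∑ r, (Complex.I * gamma μ s r) * χ.val (.psi A r, μ ::ₘ α)
        = F.diracMass A * χ.val (.psi A s, α) := by
      simp only [val, Multiset.map_cons, Multiset.prod_cons]
      rw [← mul_assoc, ← h2, Finset.sum_mul]
      refine Finset.sum_congr rfl fun μ _ => ?_
      rw [Finset.sum_mul]
      exact Finset.sum_congr rfl fun r _ => by ring
    ext i j
    simp only [map_sum, map_smul, e, Matrix.sum_apply, Matrix.smul_apply]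
    fin_cases i <;> fin_cases j
    · have h4 := congrArg (fun w => koszul true b • w) h1
      simp only [Finset.smul_sum] at h4
      simpa [smul_comm (koszul _ _), Comp.odd] using h4
    · simp [smul_smul, ← Finset.sum_smul, h3]
    · simp
    · simpa using h1
  | diracBar A s α =>
    have h1 := F.jet_diracBar A s α
    have h2 := χ.diracBar A s
    have h3 : ∑ μ, ∑ r, (Complex.I * gamma μ r s) * χ.val (.psibar A r, μ ::ₘ α)
        = -F.diracMass A * χ.val (.psibar A s, α) := by
      simp only [val, Multiset.map_cons, Multiset.prod_cons]
      rw [← mul_assoc, ← h2, Finset.sum_mul]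
      refine Finset.sum_congr rfl fun μ _ => ?_
      rw [Finset.sum_mul]
      exact Finset.sum_congr rfl fun r _ => by ring
    ext i j
    simp only [map_sum, map_smul, e, Matrix.sum_apply, Matrix.smul_apply]
    fin_cases i <;> fin_cases j
    · have h4 := congrArg (fun w => koszul true b • w) h1
      simp only [Finset.smul_sum] at h4
      simpa [smul_comm (koszul _ _), Comp.odd] using h4
    · simp only [Fin.zero_eta, Fin.mk_one, Matrix.of_apply, Matrix.cons_val', Matrix.cons_val_one,
        Matrix.cons_val_zero, Matrix.cons_val_fin_one, smul_smul, ← Finset.sum_smul, h3]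
    · simp
    · simpa using h1

/-- The homomorphism from Wick polynomials to upper triangular matrices whose upper right entry is
the contraction with the plane wave. -/
def hom : F.Wick →ₐ[ℂ] Matrix (Fin 2) (Fin 2) F.Wick :=
  RingQuot.liftAlgHom ℂ ⟨χ.freeHom, χ.freeHom_rel⟩

/-- The contraction of Wick polynomials with a plane wave: the graded derivation that maps every
jet variable to its value on the wave. -/
def op : F.Wick →ₗ[ℂ] F.Wick :=
  (Matrix.entryLinearMap ℂ F.Wick (0 : Fin 2) (1 : Fin 2)).comp χ.hom.toLinearMap

theorem hom_jet (x : Jet Ind Dir) :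
    χ.hom (F.jet x) = !![koszul x.1.odd b • F.jet x, χ.val x • 1; 0, F.jet x] := by
  simp [hom, jet, freeHom]

theorem op_jet (x : Jet Ind Dir) : χ.op (F.jet x) = χ.val x • 1 := by
  simp [op, hom_jet]

theorem hom_lower (w : F.Wick) : χ.hom w 1 1 = w := by
  suffices h : χ.hom w 1 0 = 0 ∧ χ.hom w 1 1 = w from h.2
  induction w using F.wick_induction with
  | one => simp
  | jet_mul x w hw => simp [map_mul, Matrix.mul_apply, hw.1, hw.2, hom_jet]
  | add w z hw hz => simp [hw.1, hw.2, hz.1, hz.2]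
  | smul c w hw => simp [hw.1, hw.2]

theorem op_isLeibniz : F.IsLeibniz b χ.op where
  one := by simp [op]
  jet_mul x w := by
    rw [op_jet]
    have h := χ.hom_lower w
    simp only [op, LinearMap.comp_apply, AlgHom.toLinearMap_apply, map_mul, hom_jet,
      Matrix.entryLinearMap_apply, Matrix.mul_apply, Fin.sum_univ_two, h]
    simp [add_comm]

theorem op_hasParity (x : Jet Ind Dir) : F.HasParity (xor x.1.odd b) (χ.op (F.jet x)) := by
  rw [op_jet]
  by_cases h : x.1.odd = b
  · rw [h, Bool.xor_self]
    exact F.hasParity_smul_one _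
  · rw [χ.val_parity h, zero_smul]
    intro b D _ z
    simp

/-- Contraction with a plane wave turns derivatives into factors of the momentum. -/
theorem op_pd (μ : Fin 4) (w : F.Wick) :
    χ.op (F.pd μ w) = F.pd μ (χ.op w) + χ.mom μ • χ.op w := by
  have hE : F.IsLeibniz (xor b false) (χ.mom μ • χ.op) := by
    rw [Bool.xor_false]
    refine ⟨by simp [χ.op_isLeibniz.one], fun x w => ?_⟩
    simp only [LinearMap.smul_apply, χ.op_isLeibniz.jet_mul, smul_add, smul_mul_assoc,
      mul_smul_comm, smul_comm (χ.mom μ)]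
  have hp' : ∀ x, F.HasParity (xor x.1.odd false) (F.pd μ (F.jet x)) := fun x => by
    rw [pd_jet]; exact F.hasParity_linSpan ((F.pdData μ).parity x)
  have h := F.graded_commutator χ.op_isLeibniz (F.pd_isLeibniz μ) hE χ.op_hasParity hp'
    (by
      rintro ⟨c, α⟩
      simp [pd_jet, op_jet, val_cons, (F.pd_isLeibniz μ).one, smul_smul]) w
  simpa [koszul] using h

/-- The infinitesimal gauge transformation of a plane wave, dual to the action of `d_Q` on the
fields. -/
def gaugePol (pol : Comp Ind Dir → ℂ) (p : Fin 4 → ℂ) : Comp Ind Dir → ℂ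
  | .quad a (.v μ) => Complex.I * p μ * pol (.quad a .u)
  | .quad _ .u => 0
  | .quad a .ut => -Complex.I * ((∑ μ, eta μ * (p μ * pol (.quad a (.v μ))))
      + F.gaugeMass a * pol (.quad a .phi))
  | .quad a .phi => Complex.I * F.gaugeMass a * pol (.quad a .u)
  | .psi _ _ => 0
  | .psibar _ _ => 0

/-- The infinitesimal gauge transformation of a plane wave, which has the opposite statistics. -/
def gauge : F.PlaneWave (!b) where
  pol := gaugePol (F := F) χ.pol χ.mom
  mom := χ.mom
  parity c h := by
    rcases c with ⟨a, (μ | _ | _ | _)⟩ | ⟨A, s⟩ | ⟨A, s⟩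
    · have hu := χ.parity (.quad a .u)
      cases b <;> simp_all [gaugePol, Comp.odd]
    · rfl
    · have hv := fun μ => χ.parity (.quad a (.v μ))
      have hphi := χ.parity (.quad a .phi)
      cases b <;> simp_all [gaugePol, Comp.odd]
    · have hu := χ.parity (.quad a .u)
      cases b <;> simp_all [gaugePol, Comp.odd]
    · rfl
    · rfl
  kleinGordon a q := by
    rcases q with μ | _ | _ | _ <;> simp only [gaugePol, mul_zero]
    · linear_combination (Complex.I * χ.mom μ) * χ.kleinGordon a .u
    · have h := fun μ => χ.kleinGordon a (.v μ)
      have h' := χ.kleinGordon a .phi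
      have h2 : (∑ μ, eta μ * (χ.mom μ * χ.mom μ))
            * ∑ ν, eta ν * (χ.mom ν * χ.pol (.quad a (.v ν)))
          = -(F.mass a : ℂ) ^ 2 * ∑ ν, eta ν * (χ.mom ν * χ.pol (.quad a (.v ν))) := by
        rw [Finset.mul_sum, Finset.mul_sum]
        exact Finset.sum_congr rfl fun ν _ => by
          linear_combination (eta ν * χ.mom ν) * h ν
      linear_combination -Complex.I * h2 - Complex.I * F.gaugeMass a * h'
    · linear_combination (Complex.I * F.gaugeMass a) * χ.kleinGordon a .u
  absent a q h := by
    rcases q with μ | _ | _ | _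
    · simp [gaugePol, χ.absent a .u h]
    · rfl
    · have hv : ∀ μ, χ.pol (.quad a (.v μ)) = 0 := fun μ => χ.absent a (.v μ) h
      simp [gaugePol, hv, F.gaugeMass_higgs h]
    · simp [gaugePol, F.gaugeMass_massless h]
  dirac A s := by simp [gaugePol]
  diracBar A s := by simp [gaugePol]

/-- Contraction with a plane wave commutes with `d_Q` in the graded sense, up to contraction with
the gauge transformed wave. -/
theorem op_dQ (w : F.Wick) :
    χ.op (F.dQ w) = koszul b true • F.dQ (χ.op w) + χ.gauge.op w := by
  have hE : F.IsLeibniz (xor b true) χ.gauge.op := by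
    rw [Bool.xor_true]
    exact χ.gauge.op_isLeibniz
  have hp' : ∀ x, F.HasParity (xor x.1.odd true) (F.dQ (F.jet x)) := fun x => by
    rw [dQ_jet]; exact F.hasParity_linSpan (F.dQData.parity x)
  refine F.graded_commutator χ.op_isLeibniz F.dQ_isLeibniz hE χ.op_hasParity hp' ?_ w
  rintro ⟨⟨a, (ν | _ | _ | _)⟩ | ⟨A, s⟩ | ⟨A, s⟩, α⟩ <;>
    simp only [op_jet, dQ_v, dQ_u, dQ_ut, dQ_phi, dQ_psi, dQ_psibar, map_smul, map_add, map_sum,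
      map_zero, F.dQ_isLeibniz.one, smul_zero, zero_add, val_cons, smul_smul, ← Finset.sum_smul,
      ← add_smul]
  · congr 1; simp [val, gauge, gaugePol]; ring
  · simp [val, gauge, gaugePol]
  · congr 1
    simp only [val, gauge, gaugePol]
    have h : ∀ μ, eta μ * (χ.mom μ * (χ.pol (.quad a (.v μ)) * (α.map χ.mom).prod))
        = eta μ * (χ.mom μ * χ.pol (.quad a (.v μ))) * (α.map χ.mom).prod := fun μ => by ring
    simp only [h, ← Finset.sum_mul]
    ring
  · congr 1; simp [val, gauge, gaugePol]; ring
  · simp [val, gauge, gaugePol]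
  · simp [val, gauge, gaugePol]

end PlaneWave

/-! ### Amplitudes -/

/-- The vacuum expectation value: the constant term of a Wick polynomial. -/
def vev : F.Wick →ₐ[ℂ] ℂ :=
  RingQuot.liftAlgHom ℂ ⟨FreeAlgebra.lift ℂ fun _ => 0, fun p q h => by
    cases h <;> simp [-Complex.coe_smul]⟩

theorem vev_jet (x : Jet Ind Dir) : F.vev (F.jet x) = 0 := by
  simp [vev, jet]

theorem vev_linSpan {p : Bool} {l : F.Wick} (hl : l ∈ F.linSpan p) : F.vev l = 0 := by
  induction hl using Submodule.span_induction with
  | mem w h =>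
    obtain ⟨x, rfl, rfl⟩ := h
    exact F.vev_jet x
  | zero => simp
  | add u v _ _ hu hv => simp [hu, hv]
  | smul c u _ hu => simp [hu]

/-- Derivations that map fields to fields have no constant terms among their values. -/
theorem vev_der {b : Bool} (D : F.DerData b) (w : F.Wick) : F.vev (D.der w) = 0 := by
  induction w using F.wick_induction with
  | one => simp [D.der_one]
  | jet_mul x w hw => simp [D.der_jet_mul, F.vev_linSpan (D.parity x), vev_jet]
  | add w z hw hz => simp [hw, hz]
  | smul c w hw => simp [hw]

variable {F}

/-- The amplitude of a Wick polynomial for two incoming plane waves. -/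
def amp₂ {b₁ b₂ : Bool} (χ₁ : F.PlaneWave b₁) (χ₂ : F.PlaneWave b₂) : F.Wick →ₗ[ℂ] ℂ :=
  F.vev.toLinearMap ∘ₗ χ₁.op ∘ₗ χ₂.op

/-- The amplitude of a Wick polynomial for three incoming plane waves. -/
def amp₃ {b₁ b₂ b₃ : Bool} (χ₁ : F.PlaneWave b₁) (χ₂ : F.PlaneWave b₂) (χ₃ : F.PlaneWave b₃) :
    F.Wick →ₗ[ℂ] ℂ :=
  amp₂ χ₁ χ₂ ∘ₗ χ₃.op

/-- The amplitude of a Wick polynomial for four incoming plane waves. -/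
def amp₄ {b₁ b₂ b₃ b₄ : Bool} (χ₁ : F.PlaneWave b₁) (χ₂ : F.PlaneWave b₂) (χ₃ : F.PlaneWave b₃)
    (χ₄ : F.PlaneWave b₄) : F.Wick →ₗ[ℂ] ℂ :=
  amp₃ χ₁ χ₂ χ₃ ∘ₗ χ₄.op

section

variable {b₁ b₂ b₃ b₄ : Bool} (χ₁ : F.PlaneWave b₁) (χ₂ : F.PlaneWave b₂) (χ₃ : F.PlaneWave b₃)
  (χ₄ : F.PlaneWave b₄)

theorem amp₂_pd (μ : Fin 4) (w : F.Wick) :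
    amp₂ χ₁ χ₂ (F.pd μ w) = (χ₁.mom μ + χ₂.mom μ) * amp₂ χ₁ χ₂ w := by
  have h : ∀ z, F.vev (F.pd μ z) = 0 := F.vev_der (F.pdData μ)
  simp [amp₂, PlaneWave.op_pd, h]; ring

theorem amp₃_pd (μ : Fin 4) (w : F.Wick) :
    amp₃ χ₁ χ₂ χ₃ (F.pd μ w) = (χ₁.mom μ + χ₂.mom μ + χ₃.mom μ) * amp₃ χ₁ χ₂ χ₃ w := by
  simp [amp₃, PlaneWave.op_pd, amp₂_pd]; ring

theorem amp₄_pd (μ : Fin 4) (w : F.Wick) : amp₄ χ₁ χ₂ χ₃ χ₄ (F.pd μ w)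
    = (χ₁.mom μ + χ₂.mom μ + χ₃.mom μ + χ₄.mom μ) * amp₄ χ₁ χ₂ χ₃ χ₄ w := by
  simp [amp₄, PlaneWave.op_pd, amp₃_pd]; ring

theorem amp₂_dQ (w : F.Wick) : amp₂ χ₁ χ₂ (F.dQ w)
    = amp₂ χ₁ χ₂.gauge w + koszul b₂ true * amp₂ χ₁.gauge χ₂ w := by
  have h : ∀ z, F.vev (F.dQ z) = 0 := F.vev_der F.dQData
  simp [amp₂, PlaneWave.op_dQ, h]; ring

theorem amp₃_dQ (w : F.Wick) : amp₃ χ₁ χ₂ χ₃ (F.dQ w)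
    = amp₃ χ₁ χ₂ χ₃.gauge w + koszul b₃ true * amp₃ χ₁ χ₂.gauge χ₃ w
      + koszul b₃ true * koszul b₂ true * amp₃ χ₁.gauge χ₂ χ₃ w := by
  simp [amp₃, PlaneWave.op_dQ, amp₂_dQ]; ring

theorem amp₄_dQ (w : F.Wick) : amp₄ χ₁ χ₂ χ₃ χ₄ (F.dQ w)
    = amp₄ χ₁ χ₂ χ₃ χ₄.gauge w + koszul b₄ true * amp₄ χ₁ χ₂ χ₃.gauge χ₄ w
      + koszul b₄ true * koszul b₃ true * amp₄ χ₁ χ₂.gauge χ₃ χ₄ w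
      + koszul b₄ true * koszul b₃ true * koszul b₂ true * amp₄ χ₁.gauge χ₂ χ₃ χ₄ w := by
  simp [amp₄, PlaneWave.op_dQ, amp₃_dQ]; ring

/-- For momenta that add up to zero, amplitudes do not see divergences; hence those of `d_Q T`
vanish for a co-cycle `T`. -/
theorem amp₃_cocycle {T : F.Wick} (hT : F.IsCocycle T)
    (hp : ∀ μ, χ₁.mom μ + χ₂.mom μ + χ₃.mom μ = 0) :
    amp₃ χ₁ χ₂ χ₃.gauge T + koszul b₃ true * amp₃ χ₁ χ₂.gauge χ₃ T
      + koszul b₃ true * koszul b₂ true * amp₃ χ₁.gauge χ₂ χ₃ T = 0 := by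
  obtain ⟨J, hJ⟩ := hT
  rw [← amp₃_dQ, hJ]
  simp [divergence, amp₃_pd, hp]

theorem amp₄_cocycle {T : F.Wick} (hT : F.IsCocycle T)
    (hp : ∀ μ, χ₁.mom μ + χ₂.mom μ + χ₃.mom μ + χ₄.mom μ = 0) :
    amp₄ χ₁ χ₂ χ₃ χ₄.gauge T + koszul b₄ true * amp₄ χ₁ χ₂ χ₃.gauge χ₄ T
      + koszul b₄ true * koszul b₃ true * amp₄ χ₁ χ₂.gauge χ₃ χ₄ T
      + koszul b₄ true * koszul b₃ true * koszul b₂ true * amp₄ χ₁.gauge χ₂ χ₃ χ₄ T = 0 := by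
  obtain ⟨J, hJ⟩ := hT
  rw [← amp₄_dQ, hJ]
  simp [divergence, amp₄_pd, hp]

theorem amp₂_jets (x y : Jet Ind Dir) : amp₂ χ₁ χ₂ (F.jet x * F.jet y)
    = χ₂.val x * χ₁.val y + koszul x.1.odd b₂ * (χ₂.val y * χ₁.val x) := by
  simp [amp₂, χ₂.op_isLeibniz.jet_mul, PlaneWave.op_jet]

theorem amp₃_jets (x y z : Jet Ind Dir) : amp₃ χ₁ χ₂ χ₃ (F.jet x * (F.jet y * F.jet z))
    = χ₃.val x * amp₂ χ₁ χ₂ (F.jet y * F.jet z)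
      + koszul x.1.odd b₃ * (χ₃.val y * amp₂ χ₁ χ₂ (F.jet x * F.jet z)
        + koszul y.1.odd b₃ * (χ₃.val z * amp₂ χ₁ χ₂ (F.jet x * F.jet y))) := by
  simp [amp₃, χ₃.op_isLeibniz.jet_mul, PlaneWave.op_jet, mul_add, -mul_eq_mul_left_iff]

theorem amp₄_jets (x y z w : Jet Ind Dir) :
    amp₄ χ₁ χ₂ χ₃ χ₄ (F.jet x * (F.jet y * (F.jet z * F.jet w)))
    = χ₄.val x * amp₃ χ₁ χ₂ χ₃ (F.jet y * (F.jet z * F.jet w))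
      + koszul x.1.odd b₄ * (χ₄.val y * amp₃ χ₁ χ₂ χ₃ (F.jet x * (F.jet z * F.jet w))
        + koszul y.1.odd b₄ * (χ₄.val z * amp₃ χ₁ χ₂ χ₃ (F.jet x * (F.jet y * F.jet w))
          + koszul z.1.odd b₄ * (χ₄.val w * amp₃ χ₁ χ₂ χ₃ (F.jet x * (F.jet y * F.jet z))))) := by
  simp [amp₄, χ₄.op_isLeibniz.jet_mul, PlaneWave.op_jet, mul_add, -mul_eq_mul_left_iff]

/-- Three contractions leave a factor of every product of four fields, so there is no constant term.
-/
theorem amp₃_four_jets (x y z w : Jet Ind Dir) :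
    amp₃ χ₁ χ₂ χ₃ (F.jet x * (F.jet y * (F.jet z * F.jet w))) = 0 := by
  simp [amp₃, amp₂, χ₁.op_isLeibniz.jet_mul, χ₂.op_isLeibniz.jet_mul, χ₃.op_isLeibniz.jet_mul,
    PlaneWave.op_jet, vev_jet]

theorem amp₄_three_jets (x y z : Jet Ind Dir) :
    amp₄ χ₁ χ₂ χ₃ χ₄ (F.jet x * (F.jet y * F.jet z)) = 0 := by
  simp [amp₄, amp₃, amp₂, χ₂.op_isLeibniz.jet_mul,
    χ₃.op_isLeibniz.jet_mul, χ₄.op_isLeibniz.jet_mul, PlaneWave.op_jet, χ₁.op_isLeibniz.one,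
    χ₂.op_isLeibniz.one]

end

end FieldContent

/-! ### Invariant tensors of the Lorentz group -/

theorem eta_ne_zero (μ : Fin 4) : eta μ ≠ 0 := by
  unfold eta; split_ifs <;> norm_num

/-- The totally antisymmetric symbol, with `levi 0 1 2 3 = 1`, as a Vandermonde product. -/
def levi (k₁ k₂ k₃ k₄ : Fin 4) : ℂ :=
  (((k₂ : ℕ) : ℂ) - (k₁ : ℕ)) * (((k₃ : ℕ) : ℂ) - (k₁ : ℕ)) * (((k₄ : ℕ) : ℂ) - (k₁ : ℕ)) *
    (((k₃ : ℕ) : ℂ) - (k₂ : ℕ)) * (((k₄ : ℕ) : ℂ) - (k₂ : ℕ)) * (((k₄ : ℕ) : ℂ) - (k₃ : ℕ)) / 12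

theorem sum_rot (ρ σ k : Fin 4) (f : Fin 4 → ℂ) : ∑ k', rot ρ σ k' k * f k'
    = (if k = σ then eta ρ * f ρ else 0) - (if k = ρ then eta σ * f σ else 0) := by
  simp only [rot, sub_mul, Finset.sum_sub_distrib, ite_and, ite_mul, zero_mul]
  simp

/-- The action of infinitesimal Lorentz transformations on one tensor index. -/
def rotIdx (ρ σ k : Fin 4) (f : Fin 4 → ℂ) : ℂ :=
  (if k = σ then eta ρ * f ρ else 0) - (if k = ρ then eta σ * f σ else 0)

theorem exists_ne₂ : ∀ a b : Fin 4, ∃ c, c ≠ a ∧ c ≠ b := by decide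

theorem exists_ne₃ : ∀ a b d : Fin 4, ∃ c, c ≠ a ∧ c ≠ b ∧ c ≠ d := by decide

/-- There are no invariant vectors. -/
theorem invariant_vector {t : Fin 4 → ℂ} (h : ∀ ρ σ k, rotIdx ρ σ k t = 0) (k : Fin 4) :
    t k = 0 := by
  obtain ⟨c, hc, -⟩ := exists_ne₂ k k
  have e := h k c c
  simpa [rotIdx, hc, eta_ne_zero] using e

/-- The invariant tensors of rank two are the multiples of the metric. -/
theorem invariant_tensor₂ {t : Fin 4 → Fin 4 → ℂ}
    (h : ∀ ρ σ k l, rotIdx ρ σ k (fun k' => t k' l) + rotIdx ρ σ l (fun l' => t k l') = 0) :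
    ∃ c : ℂ, ∀ k l, t k l = if k = l then c * eta k else 0 := by
  refine ⟨t 0 0 * eta 0, fun k l => ?_⟩
  split_ifs with hkl
  · subst hkl
    by_cases h0 : k = 0
    · subst h0; rw [mul_assoc, eta_sq, mul_one]
    · have e := h 0 k k 0
      simp only [rotIdx, h0, Ne.symm h0, if_true, if_false] at e
      have : t k k = eta k * (eta k * t k k) := by rw [← mul_assoc, eta_sq, one_mul]
      rw [this]
      linear_combination (-eta k) * e
  · obtain ⟨c, hc, hc'⟩ := exists_ne₂ k l
    have e := h k c c l
    simpa [rotIdx, hc, hc'.symm, eta_ne_zero, Ne.symm hkl] using e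

/-- There are no invariant tensors of rank three. -/
theorem invariant_tensor₃ {t : Fin 4 → Fin 4 → Fin 4 → ℂ}
    (h : ∀ ρ σ k l m, rotIdx ρ σ k (fun k' => t k' l m) + rotIdx ρ σ l (fun l' => t k l' m)
      + rotIdx ρ σ m (fun m' => t k l m') = 0) (k l m : Fin 4) : t k l m = 0 := by
  -- an index value that occurs once can be traded for one that does not occur
  have s1 : ∀ a k l, a ≠ k → a ≠ l → t a k l = 0 := by
    intro a k l hk hl
    obtain ⟨c, hc, hck, hcl⟩ := exists_ne₃ a k l
    simpa [rotIdx, hc, hk.symm, hl.symm, hck.symm, hcl.symm, eta_ne_zero] using h a c c k l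
  have s2 : ∀ a k l, a ≠ k → a ≠ l → t k a l = 0 := by
    intro a k l hk hl
    obtain ⟨c, hc, hck, hcl⟩ := exists_ne₃ a k l
    simpa [rotIdx, hc, hk.symm, hl.symm, hck.symm, hcl.symm, eta_ne_zero] using h a c k c l
  have s3 : ∀ a k l, a ≠ k → a ≠ l → t k l a = 0 := by
    intro a k l hk hl
    obtain ⟨c, hc, hck, hcl⟩ := exists_ne₃ a k l
    simpa [rotIdx, hc, hk.symm, hl.symm, hck.symm, hcl.symm, eta_ne_zero] using h a c k l c
  by_cases h1 : k = l
  · by_cases h2 : l = m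
    · subst h1; subst h2
      obtain ⟨c, hc, -⟩ := exists_ne₂ k k
      simpa [rotIdx, hc, hc.symm, eta_ne_zero, s3 k c c hc.symm hc.symm, s2 k c c hc.symm hc.symm,
        s1 c k k hc hc, s2 c k k hc hc, s3 c k k hc hc] using h k c c k k
    · exact s3 m k l (fun e => h2 (by rw [← h1, e])) (Ne.symm h2)
  · by_cases h2 : l = m
    · subst h2; exact s1 k l l h1 h1
    · exact s2 l k m (Ne.symm h1) h2

set_option maxHeartbeats 1000000 in
/-- The invariant tensors of rank four are spanned by the products of two metrics and the totally
antisymmetric tensor. -/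
theorem invariant_tensor₄ {t : Fin 4 → Fin 4 → Fin 4 → Fin 4 → ℂ}
    (h : ∀ ρ σ k l m n, rotIdx ρ σ k (fun k' => t k' l m n) + rotIdx ρ σ l (fun l' => t k l' m n)
      + rotIdx ρ σ m (fun m' => t k l m' n) + rotIdx ρ σ n (fun n' => t k l m n') = 0) :
    ∃ A B C D : ℂ, ∀ k l m n, t k l m n
      = (if k = l ∧ m = n then A * eta k * eta m else 0)
        + (if k = m ∧ l = n then B * eta k * eta l else 0)
        + (if k = n ∧ l = m then C * eta k * eta l else 0) + D * levi k l m n := by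
  -- tensor components in which an index value occurs once and another one does not occur
  have s1 : ∀ a c k l m, c ≠ a → a ≠ k → a ≠ l → a ≠ m → c ≠ k → c ≠ l → c ≠ m →
      t a k l m = 0 ∧ t k a l m = 0 ∧ t k l a m = 0 ∧ t k l m a = 0 := by
    intro a c k l m hc hk hl hm hck hcl hcm
    refine ⟨?_, ?_, ?_, ?_⟩
    · simpa [rotIdx, hc, hk.symm, hl.symm, hm.symm, hck.symm, hcl.symm, hcm.symm, eta_ne_zero]
        using h a c c k l m
    · simpa [rotIdx, hc, hk.symm, hl.symm, hm.symm, hck.symm, hcl.symm, hcm.symm, eta_ne_zero]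
        using h a c k c l m
    · simpa [rotIdx, hc, hk.symm, hl.symm, hm.symm, hck.symm, hcl.symm, hcm.symm, eta_ne_zero]
        using h a c k l c m
    · simpa [rotIdx, hc, hk.symm, hl.symm, hm.symm, hck.symm, hcl.symm, hcm.symm, eta_ne_zero]
        using h a c k l m c
  -- components with two pairs of equal indices
  have pair : ∀ (u : Fin 4 → Fin 4 → ℂ),
      (∀ a b c, a ≠ b → a ≠ c → b ≠ c → eta b * u a b = eta c * u a c) →
      (∀ a b c, a ≠ b → a ≠ c → b ≠ c → eta b * u b a = eta c * u c a) →
      ∀ a b, a ≠ b → u a b = (eta 0 * eta 1 * u 0 1) * eta a * eta b := by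
    intro u h1 h2
    have hs1 : ∀ a b c, a ≠ b → a ≠ c → eta a * eta b * u a b = eta a * eta c * u a c := by
      intro a b c hb hc
      by_cases hbc : b = c
      · rw [hbc]
      · linear_combination eta a * h1 a b c hb hc hbc
    have hs2 : ∀ a b c, b ≠ a → c ≠ a → eta b * eta a * u b a = eta c * eta a * u c a := by
      intro a b c hb hc
      by_cases hbc : b = c
      · rw [hbc]
      · linear_combination eta a * h2 a b c hb.symm hc.symm hbc
    have key : ∀ a b, a ≠ b → eta a * eta b * u a b = eta 0 * eta 1 * u 0 1 := by
      have h3 : ∀ a b, a ≠ 1 → a ≠ b → eta a * eta b * u a b = eta 0 * eta 1 * u 0 1 :=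
        fun a b ha hab => (hs1 a b 1 hab ha).trans (hs2 1 a 0 ha (by decide))
      intro a b hab
      by_cases ha : a = 1
      · subst ha
        obtain ⟨c, hc, hc'⟩ := exists_ne₂ 1 b
        exact (hs2 b 1 c hab hc').trans (h3 c b hc hc')
      · exact h3 a b ha hab
    intro a b hab
    rw [← key a b hab]
    linear_combination (-u a b) * (eta_sq a) - u a b * eta a * eta a * eta_sq b
  have p12 := pair (fun a b => t a a b b)
    (fun a b c hab hac hbc => by
      have e := h b c a a c b
      simp only [rotIdx, hab, hac, hbc, hbc.symm, if_true, if_false] at e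
      linear_combination e)
    (fun a b c hab hac hbc => by
      have e := h b c c b a a
      simp only [rotIdx, hab, hac, hbc, hbc.symm, if_true, if_false] at e
      linear_combination e)
  have p13 := pair (fun a b => t a b a b)
    (fun a b c hab hac hbc => by
      have e := h b c a c a b
      simp only [rotIdx, hab, hac, hbc, hbc.symm, if_true, if_false] at e
      linear_combination e)
    (fun a b c hab hac hbc => by
      have e := h b c c a b a
      simp only [rotIdx, hab, hac, hbc, hbc.symm, if_true, if_false] at e
      linear_combination e)
  have p14 := pair (fun a b => t a b b a)
    (fun a b c hab hac hbc => by
      have e := h b c a c b a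
      simp only [rotIdx, hab, hac, hbc, hbc.symm, if_true, if_false] at e
      linear_combination e)
    (fun a b c hab hac hbc => by
      have e := h b c c a a b
      simp only [rotIdx, hab, hac, hbc, hbc.symm, if_true, if_false] at e
      linear_combination e)
  have p1234 : ∀ a b, a ≠ b → t a a a a = t a a b b * eta a * eta b + t a b a b * eta a * eta b
      + t a b b a * eta a * eta b := by
    intro a b hab
    have e := h a b a a a b
    simp only [rotIdx, hab, hab.symm, if_true, if_false] at e
    linear_combination eta a * e - t a a a a * eta_sq a
      + eta a * eta b * (p14 b a hab.symm - p14 a b hab)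
  -- components with four different indices
  have alt : ∀ a b c d, a ≠ b → a ≠ c → a ≠ d → b ≠ c → b ≠ d → c ≠ d →
      t a b c d = -t b a c d ∧ t a b c d = -t a c b d ∧ t a b c d = -t a b d c := by
    intro a b c d hab hac had hbc hbd hcd
    have cancel : ∀ x y z : ℂ, z ≠ 0 → z * (x + y) = 0 → x = -y := fun x y z hz hxy =>
      eq_neg_of_add_eq_zero_left ((mul_eq_zero.1 hxy).resolve_left hz)
    refine ⟨cancel _ _ (eta b) (eta_ne_zero b) ?_, cancel _ _ (eta c) (eta_ne_zero c) ?_,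
      cancel _ _ (eta d) (eta_ne_zero d) ?_⟩
    · have e := h b a a a c d
      simp only [rotIdx, hab, hac, had, hac.symm, had.symm, hbc, hbd, hbc.symm, hbd.symm, if_true,
        if_false] at e
      linear_combination e
    · have e := h c b a b b d
      simp only [rotIdx, hab, hac, hbd, hbc, hbd.symm, hcd.symm, if_true, if_false] at e
      linear_combination e
    · have e := h d c a b c c
      simp only [rotIdx, had, hac, hbc, hbd, hcd, if_true, if_false] at e
      linear_combination e
  have r12 : ∀ a b c d, b < a → a ≠ c → a ≠ d → b ≠ c → b ≠ d → c ≠ d →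
      t a b c d = -t b a c d := fun a b c d hab hac had hbc hbd hcd =>
    (alt a b c d hab.ne' hac had hbc hbd hcd).1
  have r23 : ∀ a b c d, c < b → a ≠ b → a ≠ c → a ≠ d → b ≠ d → c ≠ d →
      t a b c d = -t a c b d := fun a b c d hbc hab hac had hbd hcd =>
    (alt a b c d hab hac had hbc.ne' hbd hcd).2.1
  have r34 : ∀ a b c d, d < c → a ≠ b → a ≠ c → a ≠ d → b ≠ d → b ≠ c →
      t a b c d = -t a b d c := fun a b c d hcd hab hac had hbd hbc =>
    (alt a b c d hab hac had hbc hbd hcd.ne').2.2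
  have dist : ∀ a b c d, a ≠ b → a ≠ c → a ≠ d → b ≠ c → b ≠ d → c ≠ d →
      t a b c d = t 0 1 2 3 * levi a b c d := by
    intro a b c d hab hac had hbc hbd hcd
    fin_cases a <;> fin_cases b <;> first | exact absurd rfl hab | skip
    all_goals fin_cases c <;> first | exact absurd rfl hac | exact absurd rfl hbc | skip
    all_goals fin_cases d <;>
      first
      | exact absurd rfl had
      | exact absurd rfl hbd
      | exact absurd rfl hcd
      | (norm_num [levi]; done)
      | (simp only [Fin.zero_eta, Fin.mk_one, Fin.reduceFinMk]
         norm_num [levi]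
         simp [r12, r23, r34])
      | (simp only [Fin.zero_eta, Fin.mk_one, Fin.reduceFinMk]
         norm_num [levi]
         done)
  refine ⟨eta 0 * eta 1 * t 0 0 1 1, eta 0 * eta 1 * t 0 1 0 1, eta 0 * eta 1 * t 0 1 1 0,
    t 0 1 2 3, fun k l m n => ?_⟩
  have lv : ∀ a b c d, (a = b ∨ a = c ∨ a = d ∨ b = c ∨ b = d ∨ c = d) → levi a b c d = 0 := by
    rintro a b c d (rfl | rfl | rfl | rfl | rfl | rfl) <;> simp [levi]
  by_cases hkl : k = l
  · subst hkl
    rw [lv k k m n (by simp)]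
    by_cases hmn : m = n
    · subst hmn
      by_cases hkm : k = m
      · subst hkm
        obtain ⟨b, hb, -⟩ := exists_ne₂ k k
        rw [p1234 k b hb.symm, p12 k b hb.symm, p13 k b hb.symm, p14 k b hb.symm]
        simp only [and_self, if_true]
        have := eta_sq b
        linear_combination ((eta 0 * eta 1 * t 0 0 1 1 + eta 0 * eta 1 * t 0 1 0 1
          + eta 0 * eta 1 * t 0 1 1 0) * eta k * eta k) * eta_sq b
      · rw [p12 k m hkm]
        simp [hkm]
    · by_cases hkm : k = m
      · subst hkm
        obtain ⟨c, hc, hc'⟩ := exists_ne₂ k n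
        rw [(s1 n c k k k hc' (Ne.symm hmn) (Ne.symm hmn) (Ne.symm hmn) hc hc hc).2.2.2]
        simp [hmn]
      · by_cases hkn : k = n
        · subst hkn
          obtain ⟨c, hc, hc'⟩ := exists_ne₂ k m
          rw [(s1 m c k k k hc' hmn hmn hmn hc hc hc).2.2.1]
          simp [hkm, hmn]
        · obtain ⟨c, hc, hc', hc''⟩ := exists_ne₃ k m n
          rw [(s1 m c k k n hc' (Ne.symm hkm) (Ne.symm hkm) hmn hc hc hc'').2.2.1]
          simp [hkm, hmn, hkn]
  · by_cases hmn : m = n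
    · subst hmn
      rw [lv k l m m (by simp)]
      by_cases hkm : k = m
      · subst hkm
        obtain ⟨c, hc, hc'⟩ := exists_ne₂ k l
        rw [(s1 l c k k k hc' (Ne.symm hkl) (Ne.symm hkl) (Ne.symm hkl) hc hc hc).2.1]
        simp [hkl, Ne.symm hkl]
      · by_cases hlm : l = m
        · subst hlm
          obtain ⟨c, hc, hc'⟩ := exists_ne₂ k l
          rw [(s1 k c l l l hc hkl hkl hkl hc' hc' hc').1]
          simp [hkl]
        · obtain ⟨c, hc, hc', hc''⟩ := exists_ne₃ k l m
          rw [(s1 k c l m m hc hkl hkm hkm hc' hc'' hc'').1]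
          simp [hkl, hkm, hlm]
    · by_cases hkm : k = m
      · subst hkm
        rw [lv k l k n (by simp)]
        by_cases hln : l = n
        · subst hln
          rw [p13 k l hkl]
          simp [hkl]
        · obtain ⟨c, hc, hc', hc''⟩ := exists_ne₃ k l n
          rw [(s1 l c k k n hc' (Ne.symm hkl) (Ne.symm hkl) hln hc hc hc'').2.1]
          simp [hkl, hmn, hln]
      · by_cases hkn : k = n
        · subst hkn
          rw [lv k l m k (by simp)]
          by_cases hlm : l = m
          · subst hlm
            rw [p14 k l hkl]
            simp [hkl]
          · obtain ⟨c, hc, hc', hc''⟩ := exists_ne₃ k l m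
            rw [(s1 l c k m k hc' (Ne.symm hkl) hlm (Ne.symm hkl) hc hc'' hc).2.1]
            simp [hkl, hkm, hlm]
        · by_cases hlm : l = m
          · subst hlm
            rw [lv k l l n (by simp)]
            obtain ⟨c, hc, hc', hc''⟩ := exists_ne₃ k l n
            rw [(s1 k c l l n hc hkl hkl hkn hc' hc' hc'').1]
            simp [hkl, hkn]
          · by_cases hln : l = n
            · subst hln
              rw [lv k l m l (by simp)]
              obtain ⟨c, hc, hc', hc''⟩ := exists_ne₃ k l m
              rw [(s1 k c l m l hc hkl hkm hkl hc' hc'' hc').1]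
              simp [hkl, hkm]
            · rw [dist k l m n hkl hkm hkn hlm hln hmn]
              simp [hkl, hkm, hkn]


/-! ### Invariant spinor tensors

The generators and the chiral projections are written out in the chiral representation, in which the
gamma matrices are given. -/

theorem spinRot_12 : spinRot 1 2
    = !![-Complex.I / 2, 0, 0, 0; 0, Complex.I / 2, 0, 0; 0, 0, -Complex.I / 2, 0;
      0, 0, 0, Complex.I / 2] := by
  ext i j
  fin_cases i <;> fin_cases j <;>
    simp [spinRot, gamma, eta, Matrix.mul_apply, Fin.sum_univ_four] <;> ring

theorem spinRot_13 : spinRot 1 3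
    = !![0, 1 / 2, 0, 0; -1 / 2, 0, 0, 0; 0, 0, 0, 1 / 2; 0, 0, -1 / 2, 0] := by
  ext i j
  fin_cases i <;> fin_cases j <;>
    simp [spinRot, gamma, eta, Matrix.mul_apply, Fin.sum_univ_four] <;> norm_num

theorem spinRot_01 : spinRot 0 1
    = !![0, 1 / 2, 0, 0; 1 / 2, 0, 0, 0; 0, 0, 0, -1 / 2; 0, 0, -1 / 2, 0] := by
  ext i j
  fin_cases i <;> fin_cases j <;>
    simp [spinRot, gamma, eta, Matrix.mul_apply, Fin.sum_univ_four] <;> norm_num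

theorem spinRot_02 : spinRot 0 2
    = !![0, -Complex.I / 2, 0, 0; Complex.I / 2, 0, 0, 0; 0, 0, 0, Complex.I / 2;
      0, 0, -Complex.I / 2, 0] := by
  ext i j
  fin_cases i <;> fin_cases j <;>
    simp [spinRot, gamma, eta, Matrix.mul_apply, Fin.sum_univ_four] <;> ring

theorem spinRot_03 : spinRot 0 3
    = !![1 / 2, 0, 0, 0; 0, -1 / 2, 0, 0; 0, 0, -1 / 2, 0; 0, 0, 0, 1 / 2] := by
  ext i j
  fin_cases i <;> fin_cases j <;>
    simp [spinRot, gamma, eta, Matrix.mul_apply, Fin.sum_univ_four] <;> norm_num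

theorem gamma5_eq : gamma5 = !![-1, 0, 0, 0; 0, -1, 0, 0; 0, 0, 1, 0; 0, 0, 0, 1] := by
  have h : gamma 0 * gamma 1 * gamma 2 * gamma 3
      = !![Complex.I, 0, 0, 0; 0, Complex.I, 0, 0; 0, 0, -Complex.I, 0; 0, 0, 0, -Complex.I] := by
    rw [mul_assoc (gamma 0 * gamma 1)]
    ext i j
    fin_cases i <;> fin_cases j <;>
      simp [gamma, Matrix.mul_apply, Fin.sum_univ_four]
  rw [gamma5, h]
  ext i j
  fin_cases i <;> fin_cases j <;> simp

theorem chiral_pos : chiral 1 = !![0, 0, 0, 0; 0, 0, 0, 0; 0, 0, 1, 0; 0, 0, 0, 1] := by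
  rw [chiral, gamma5_eq]
  ext i j
  fin_cases i <;> fin_cases j <;> simp [Matrix.one_apply] <;> norm_num

theorem chiral_neg : chiral (-1) = !![1, 0, 0, 0; 0, 1, 0, 0; 0, 0, 0, 0; 0, 0, 0, 0] := by
  rw [chiral, gamma5_eq]
  ext i j
  fin_cases i <;> fin_cases j <;> simp [Matrix.one_apply] <;> norm_num

/-- The chiral projections span the matrices that commute with the Lorentz transformations of
spinors. -/
theorem invariant_spinor {t : Matrix (Fin 4) (Fin 4) ℂ}
    (h : ∀ ρ σ, t * spinRot ρ σ - spinRot ρ σ * t = 0) :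
    ∃ c : ℤˣ → ℂ, t = ∑ ε, c ε • chiral ε := by
  have e (ρ σ i j) := congrFun (congrFun (h ρ σ) i) j
  have h12 (i j) := e 1 2 i j
  have h03 (i j) := e 0 3 i j
  have h01 (i j) := e 0 1 i j
  rw [spinRot_12] at h12
  rw [spinRot_03] at h03
  rw [spinRot_01] at h01
  simp only [Matrix.sub_apply, Matrix.mul_apply, Fin.sum_univ_four, Matrix.zero_apply] at h12 h03 h01
  have hI := Complex.I_ne_zero
  refine ⟨fun ε => if ε = 1 then t 2 2 else t 0 0, ?_⟩
  have hsum : ∀ f : ℤˣ → Matrix (Fin 4) (Fin 4) ℂ, ∑ ε, f ε = f 1 + f (-1) := by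
    intro f; rw [UnitsInt.univ, Finset.sum_pair (by decide)]
  have a01 : t 0 1 = 0 := by
    have := h03 0 1; simp at this; linear_combination -this
  have a02 : t 0 2 = 0 := by
    have := h03 0 2; simp at this; linear_combination -this
  have a03 : t 0 3 = 0 := by
    have := h12 0 3; simp at this; linear_combination (-Complex.I) * this + t 0 3 * Complex.I_sq
  have a10 : t 1 0 = 0 := by
    have := h03 1 0; simp at this; linear_combination this
  have a12 : t 1 2 = 0 := by
    have := h12 1 2; simp at this; linear_combination (Complex.I) * this + t 1 2 * Complex.I_sq
  have a13 : t 1 3 = 0 := by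
    have := h03 1 3; simp at this; linear_combination this
  have a20 : t 2 0 = 0 := by
    have := h03 2 0; simp at this; linear_combination this
  have a21 : t 2 1 = 0 := by
    have := h12 2 1; simp at this; linear_combination (-Complex.I) * this + t 2 1 * Complex.I_sq
  have a23 : t 2 3 = 0 := by
    have := h03 2 3; simp at this; linear_combination this
  have a30 : t 3 0 = 0 := by
    have := h12 3 0; simp at this; linear_combination (Complex.I) * this + t 3 0 * Complex.I_sq
  have a31 : t 3 1 = 0 := by
    have := h03 3 1; simp at this; linear_combination -this
  have a32 : t 3 2 = 0 := by
    have := h03 3 2; simp at this; linear_combination -this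
  have a11 : t 1 1 = t 0 0 := by
    have := h01 0 1; simp at this; linear_combination -2 * this
  have a33 : t 3 3 = t 2 2 := by
    have := h01 2 3; simp at this; linear_combination 2 * this
  rw [hsum, chiral_pos, chiral_neg]
  ext i j
  fin_cases i <;> fin_cases j <;>
    simp [a01, a02, a03, a10, a11, a12, a13, a20, a21, a23, a30, a31, a32, a33]

set_option maxHeartbeats 1000000 in
/-- The invariant vectors of matrices are spanned by `γ^μ γ_ε`. The boosts express all components by
`t 0`; rotations, which leave `t 0` invariant, and one more boost determine `t 0` up to two
constants. -/
theorem invariant_spinor_vector {t : Fin 4 → Matrix (Fin 4) (Fin 4) ℂ}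
    (h : ∀ ρ σ μ, t μ * spinRot ρ σ - spinRot ρ σ * t μ
      + ((if μ = σ then eta ρ • t ρ else 0) - (if μ = ρ then eta σ • t σ else 0)) = 0) :
    ∃ c : ℤˣ → ℂ, ∀ μ, t μ = ∑ ε, c ε • (gamma μ * chiral ε) := by
  have b1 := h 0 1 0
  have b2 := h 0 2 0
  have b3 := h 0 3 0
  have d1 := h 0 1 1
  have r12 := h 1 2 0
  have r13 := h 1 3 0
  simp [eta] at b1 b2 b3 d1 r12 r13
  have t1 : t 1 = spinRot 0 1 * t 0 - t 0 * spinRot 0 1 := by exact eq_of_sub_eq_zero (by rw [← b1]; abel)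
  have t2 : t 2 = spinRot 0 2 * t 0 - t 0 * spinRot 0 2 := by exact eq_of_sub_eq_zero (by rw [← b2]; abel)
  have t3 : t 3 = spinRot 0 3 * t 0 - t 0 * spinRot 0 3 := by exact eq_of_sub_eq_zero (by rw [← b3]; abel)
  have hc := fun i j => congrFun (congrFun r12 i) j
  have hs := fun i j => congrFun (congrFun r13 i) j
  rw [t1] at d1
  have hd := fun i j => congrFun (congrFun d1 i) j
  rw [spinRot_12] at hc
  rw [spinRot_13] at hs
  rw [spinRot_01] at hd
  simp only [Matrix.add_apply, Matrix.sub_apply, Matrix.mul_apply, Fin.sum_univ_four,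
    Matrix.zero_apply] at hc hs hd
  have hI := Complex.I_ne_zero
  have z (i j : Fin 4) (h : Complex.I * t 0 i j = 0) : t 0 i j = 0 := by simpa using h
  have a01 : t 0 0 1 = 0 := z _ _ (by have := hc 0 1; simp at this; linear_combination this)
  have a03 : t 0 0 3 = 0 := z _ _ (by have := hc 0 3; simp at this; linear_combination this)
  have a21 : t 0 2 1 = 0 := z _ _ (by have := hc 2 1; simp at this; linear_combination this)
  have a23 : t 0 2 3 = 0 := z _ _ (by have := hc 2 3; simp at this; linear_combination this)
  have a10 : t 0 1 0 = 0 := z _ _ (by have := hc 1 0; simp at this; linear_combination -this)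
  have a12 : t 0 1 2 = 0 := z _ _ (by have := hc 1 2; simp at this; linear_combination -this)
  have a30 : t 0 3 0 = 0 := z _ _ (by have := hc 3 0; simp at this; linear_combination -this)
  have a32 : t 0 3 2 = 0 := z _ _ (by have := hc 3 2; simp at this; linear_combination -this)
  have a13 : t 0 1 3 = t 0 0 2 := by
    have := hs 0 3; simp at this; linear_combination -2 * this
  have a31 : t 0 3 1 = t 0 2 0 := by
    have := hs 2 1; simp at this; linear_combination -2 * this
  have a00 : t 0 0 0 = 0 := by
    have := hd 0 0; have h' := hs 0 1; simp at this h'; linear_combination this + h'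
  have a11 : t 0 1 1 = 0 := by
    have := hd 1 1; have h' := hs 0 1; simp at this h'; linear_combination this - h'
  have a22 : t 0 2 2 = 0 := by
    have := hd 2 2; have h' := hs 2 3; simp at this h'; linear_combination this + h'
  have a33 : t 0 3 3 = 0 := by
    have := hd 3 3; have h' := hs 2 3; simp at this h'; linear_combination this - h'
  have t0 : t 0 = !![0, 0, t 0 0 2, 0; 0, 0, 0, t 0 0 2; t 0 2 0, 0, 0, 0; 0, t 0 2 0, 0, 0] := by
    ext i j
    fin_cases i <;> fin_cases j <;>
      simp [a01, a03, a10, a12, a13, a21, a23, a30, a31, a32, a00, a11, a22, a33]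
  have hsum : ∀ f : ℤˣ → Matrix (Fin 4) (Fin 4) ℂ, ∑ ε, f ε = f 1 + f (-1) := by
    intro f; rw [UnitsInt.univ, Finset.sum_pair (by decide)]
  generalize t 0 0 2 = b at t0
  generalize t 0 2 0 = c at t0
  refine ⟨fun ε => if ε = 1 then b else c, fun μ => ?_⟩
  rw [hsum, chiral_pos, chiral_neg]
  simp only [if_true, show (-1 : ℤˣ) ≠ 1 by decide, if_false]
  rw [t0] at t1 t2 t3
  rw [spinRot_01] at t1
  rw [spinRot_02] at t2
  rw [spinRot_03] at t3
  fin_cases μ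
  · simp only [Fin.zero_eta]
    rw [t0]
    ext i j
    fin_cases i <;> fin_cases j <;> simp [gamma, Matrix.mul_apply, Fin.sum_univ_four]
  · simp only [Fin.mk_one]
    rw [t1]
    ext i j
    fin_cases i <;> fin_cases j <;> simp [gamma, Matrix.mul_apply, Fin.sum_univ_four] <;> ring
  · simp only [Fin.reduceFinMk]
    rw [t2]
    ext i j
    fin_cases i <;> fin_cases j <;> simp [gamma, Matrix.mul_apply, Fin.sum_univ_four] <;> ring
  · simp only [Fin.reduceFinMk]
    rw [t3]
    ext i j
    fin_cases i <;> fin_cases j <;> simp [gamma, Matrix.mul_apply, Fin.sum_univ_four] <;> ring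


/-! ### Invariant coefficients -/

open Matrix in
/-- If the span of the vectors `Θ i` is stable under operators that act on the `Θ i` by self-adjoint
or anti-self-adjoint matrices, then an invariant vector is a combination of the `Θ i` with invariant
coefficients, although the `Θ i` may be linearly dependent: the coefficients are taken orthogonal to
the linear relations between the `Θ i`. -/
theorem exists_invariant_coeff {ι G W : Type*} [Fintype ι] [AddCommGroup W] [Module ℂ W]
    (Y : G → W →ₗ[ℂ] W) (X : G → Matrix ι ι ℂ) (s : G → ℂ) (hs : ∀ g, s g ≠ 0)
    (hX : ∀ g, (X g)ᴴ = s g • X g)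
    (Θ : ι → W) (hΘ : ∀ g i, Y g (Θ i) = ∑ j, X g i j • Θ j) {T : W}
    (hT : T ∈ Submodule.span ℂ (Set.range Θ)) (h : ∀ g, Y g T = 0) :
    ∃ t : ι → ℂ, T = ∑ i, t i • Θ i ∧ ∀ g j, ∑ i, t i * X g i j = 0 := by
  let L : EuclideanSpace ℂ ι →ₗ[ℂ] W :=
    Fintype.linearCombination ℂ Θ ∘ₗ (WithLp.linearEquiv 2 ℂ (ι → ℂ)).toLinearMap
  have hL : ∀ x, L x = ∑ i, x i • Θ i := fun x => by
    simp [L, Fintype.linearCombination_apply]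
  obtain ⟨c, hc⟩ := (Submodule.mem_span_range_iff_exists_fun ℂ).1 hT
  obtain ⟨k, hk, t, ht, hkt⟩ := (LinearMap.ker L).exists_add_mem_mem_orthogonal (WithLp.toLp 2 c)
  have hLt : L t = T := by
    have := congrArg L hkt
    rw [map_add, LinearMap.mem_ker.1 hk, zero_add] at this
    rw [← this, hL, ← hc]
  have act : ∀ g x, L (WithLp.toLp 2 (x.ofLp ᵥ* X g)) = Y g (L x) := by
    intro g x
    simp only [hL, map_sum, map_smul, hΘ, vecMul, dotProduct, Finset.sum_smul, Finset.smul_sum,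
      smul_smul]
    exact Finset.sum_comm
  refine ⟨t.ofLp, by rw [← hL, hLt], fun g => ?_⟩
  set y : EuclideanSpace ℂ ι := WithLp.toLp 2 (t.ofLp ᵥ* X g) with hy
  have hyK : y ∈ LinearMap.ker L := by rw [LinearMap.mem_ker, hy, act, hLt, h]
  have hyo : y ∈ (LinearMap.ker L)ᗮ := by
    rw [Submodule.mem_orthogonal]
    intro k hk
    have hk' : (WithLp.toLp 2 (k.ofLp ᵥ* X g) : EuclideanSpace ℂ ι) ∈ LinearMap.ker L := by
      rw [LinearMap.mem_ker, act, LinearMap.mem_ker.1 hk, map_zero]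
    have h0 := (Submodule.mem_orthogonal _ _).1 ht _ hk'
    rw [EuclideanSpace.inner_eq_star_dotProduct] at h0 ⊢
    rw [hy]
    simp only [star_vecMul, hX] at h0 ⊢
    rw [smul_mulVec, dotProduct_smul] at h0
    rw [← Matrix.dotProduct_mulVec]
    exact (smul_eq_zero.1 h0).resolve_left (hs g)
  have : y = 0 := by
    have := Submodule.inner_right_of_mem_orthogonal hyK hyo
    exact inner_self_eq_zero.1 this
  intro j
  have := congrFun (congrArg WithLp.ofLp this) j
  simpa [hy, vecMul, dotProduct] using this

/-- The action of a Lie algebra element on a tensor product, from its actions on the factors. -/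
def kronSum {m n : Type*} [DecidableEq m] [DecidableEq n] (A : Matrix m m ℂ) (B : Matrix n n ℂ) :
    Matrix (m × n) (m × n) ℂ :=
  Matrix.kronecker A 1 + Matrix.kronecker 1 B

section

open Matrix

variable {m n : Type*} [DecidableEq m] [DecidableEq n] {A : Matrix m m ℂ} {B : Matrix n n ℂ}

theorem kronSum_conjTranspose {s : ℂ} (hA : Aᴴ = s • A) (hB : Bᴴ = s • B) :
    (kronSum A B)ᴴ = s • kronSum A B := by
  simp only [kronSum, conjTranspose_add, Matrix.kronecker, conjTranspose_kronecker, hA, hB,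
    conjTranspose_one, smul_add]
  rw [smul_kronecker, kronecker_smul]

theorem kronSum_apply (A : Matrix m m ℂ) (B : Matrix n n ℂ) (p q : m × n) :
    kronSum A B p q = (if p.2 = q.2 then A p.1 q.1 else 0) + (if p.1 = q.1 then B p.2 q.2 else 0) := by
  simp [kronSum, kroneckerMap_apply, one_apply]

variable [Fintype m] [Fintype n]

theorem sum_kronSum_smul {W : Type*} [AddCommGroup W] [Module ℂ W] (i : m) (j : n)
    (θ : m × n → W) : ∑ q, kronSum A B (i, j) q • θ q
      = ∑ i', A i i' • θ (i', j) + ∑ j', B j j' • θ (i, j') := by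
  simp only [kronSum_apply, add_smul, Finset.sum_add_distrib, Fintype.sum_prod_type, ite_smul,
    zero_smul, Finset.sum_ite_eq, Finset.mem_univ, if_true]
  congr 1
  rw [Finset.sum_comm]
  simp

theorem sum_mul_kronSum (i : m) (j : n) (t : m × n → ℂ) : ∑ p, t p * kronSum A B p (i, j)
      = ∑ i', t (i', j) * A i' i + ∑ j', t (i, j') * B j' j := by
  simp only [kronSum_apply, mul_add, Finset.sum_add_distrib, Fintype.sum_prod_type, mul_ite,
    mul_zero, Finset.sum_ite_eq', Finset.mem_univ, if_true]
  congr 1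
  rw [Finset.sum_comm]
  simp

end

/-- The infinitesimal Lorentz transformations of an optional tensor index. -/
def optRot (ρ σ : Fin 4) : Matrix (Option (Fin 4)) (Option (Fin 4)) ℂ
  | some μ, some ν => rot ρ σ μ ν
  | _, _ => 0

/-- Rotations act by anti-self-adjoint and boosts by self-adjoint matrices, as
`exists_invariant_coeff` requires. -/
theorem optRot_conjTranspose (ρ σ : Fin 4) :
    (optRot ρ σ).conjTranspose = (-(eta ρ * eta σ)) • optRot ρ σ := by
  have h : ∀ μ, star (eta μ) = eta μ := fun μ => by unfold eta; split_ifs <;> simp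
  have h1 := eta_sq ρ
  have h2 := eta_sq σ
  ext (_ | μ) (_ | ν) <;> simp only [Matrix.conjTranspose_apply, Matrix.smul_apply, optRot,
    star_zero, smul_zero]
  by_cases a1 : μ = ρ <;> by_cases a2 : μ = σ <;> by_cases a3 : ν = ρ <;>
    by_cases a4 : ν = σ <;> simp [rot, a1, a2, a3, a4] <;> simp_all <;>
    first | linear_combination -eta σ * h1 | linear_combination -eta ρ * h2

theorem spinRot_conjTranspose (ρ σ : Fin 4) :
    (spinRot ρ σ).conjTranspose = (-(eta ρ * eta σ)) • spinRot ρ σ := by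
  have h : ∀ μ, star (eta μ) = eta μ := fun μ => by unfold eta; split_ifs <;> simp
  have hg : ∀ μ, (gamma μ).conjTranspose = eta μ • gamma μ := by
    intro μ
    fin_cases μ <;> ext i j <;> fin_cases i <;> fin_cases j <;> simp [gamma, eta]
  simp only [spinRot, Matrix.conjTranspose_smul, Matrix.conjTranspose_sub,
    Matrix.conjTranspose_mul, hg, star_div₀, star_mul, h]
  simp only [Matrix.smul_mul, Matrix.mul_smul, smul_sub, smul_smul]
  simp
  module


/-! ### Contraction of invariant tensors -/

theorem sum_mul_optRot_none (ρ σ : Fin 4) (t : Option (Fin 4) → ℂ) :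
    ∑ i, t i * optRot ρ σ i none = 0 :=
  Finset.sum_eq_zero fun i _ => by cases i <;> simp [optRot]

theorem sum_mul_optRot_some (ρ σ k : Fin 4) (t : Option (Fin 4) → ℂ) :
    ∑ i, t i * optRot ρ σ i (some k) = rotIdx ρ σ k fun k' => t (some k') := by
  have h := sum_rot ρ σ k fun k' => t (some k')
  rw [Fintype.sum_option]
  simp only [mul_comm (rot ρ σ _ k)] at h
  simp only [optRot, mul_zero, zero_add, rotIdx, h]

/-- The first fundamental theorem of invariant theory for four optional tensor indices: an
invariant combination lies in every subspace that contains all contractions. -/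
theorem invariant_sum_mem {W : Type*} [AddCommGroup W] [Module ℂ W] (S : Submodule ℂ W)
    (θ : Option (Fin 4) → Option (Fin 4) → Option (Fin 4) → Option (Fin 4) → W)
    (t : Option (Fin 4) → Option (Fin 4) → Option (Fin 4) → Option (Fin 4) → ℂ)
    (h : ∀ ρ σ i j k l, ∑ i', t i' j k l * optRot ρ σ i' i + (∑ j', t i j' k l * optRot ρ σ j' j
      + (∑ k', t i j k' l * optRot ρ σ k' k + ∑ l', t i j k l' * optRot ρ σ l' l)) = 0)
    (h0 : θ none none none none ∈ S)
    (h12 : ∑ μ, eta μ • θ (some μ) (some μ) none none ∈ S)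
    (h13 : ∑ μ, eta μ • θ (some μ) none (some μ) none ∈ S)
    (h14 : ∑ μ, eta μ • θ (some μ) none none (some μ) ∈ S)
    (h23 : ∑ μ, eta μ • θ none (some μ) (some μ) none ∈ S)
    (h24 : ∑ μ, eta μ • θ none (some μ) none (some μ) ∈ S)
    (h34 : ∑ μ, eta μ • θ none none (some μ) (some μ) ∈ S)
    (h1234 : ∑ μ, ∑ ν, (eta μ * eta ν) • θ (some μ) (some μ) (some ν) (some ν) ∈ S)
    (h1324 : ∑ μ, ∑ ν, (eta μ * eta ν) • θ (some μ) (some ν) (some μ) (some ν) ∈ S)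
    (h1423 : ∑ μ, ∑ ν, (eta μ * eta ν) • θ (some μ) (some ν) (some ν) (some μ) ∈ S)
    (hlevi : ∑ κ, ∑ l, ∑ μ, ∑ ν, levi κ l μ ν • θ (some κ) (some l) (some μ) (some ν) ∈ S) :
    ∑ i, ∑ j, ∑ k, ∑ l, t i j k l • θ i j k l ∈ S := by
  have z {u : Fin 4 → ℂ} {θ : Fin 4 → W} (hu : ∀ ρ σ k, rotIdx ρ σ k u = 0) :
      ∑ k, u k • θ k = 0 := Finset.sum_eq_zero fun k _ => by rw [invariant_vector hu k, zero_smul]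
  have z3 {u : Fin 4 → Fin 4 → Fin 4 → ℂ} {θ : Fin 4 → Fin 4 → Fin 4 → W}
      (hu : ∀ ρ σ k l m, rotIdx ρ σ k (fun k' => u k' l m) + rotIdx ρ σ l (fun l' => u k l' m)
        + rotIdx ρ σ m (fun m' => u k l m') = 0) : ∑ k, ∑ l, ∑ m, u k l m • θ k l m = 0 :=
    Finset.sum_eq_zero fun k _ => Finset.sum_eq_zero fun l _ => Finset.sum_eq_zero fun m _ => by
      rw [invariant_tensor₃ hu k l m, zero_smul]
  have z2 {u : Fin 4 → Fin 4 → ℂ} {θ : Fin 4 → Fin 4 → W} (hθ : ∑ k, eta k • θ k k ∈ S)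
      (hu : ∀ ρ σ k l, rotIdx ρ σ k (fun k' => u k' l) + rotIdx ρ σ l (fun l' => u k l') = 0) :
      ∑ k, ∑ l, u k l • θ k l ∈ S := by
    obtain ⟨c, hc⟩ := invariant_tensor₂ hu
    have : ∑ k, ∑ l, u k l • θ k l = c • ∑ k, eta k • θ k k := by
      simp [hc, ite_smul, Finset.smul_sum, smul_smul]
    rw [this]
    exact S.smul_mem c hθ
  simp only [Fintype.sum_option (α := Fin 4), Finset.sum_add_distrib]
  have key {a b : W} (ha : a ∈ S) (hb : b ∈ S) : a + b ∈ S := S.add_mem ha hb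
  have i4 : ∑ κ, ∑ l, ∑ μ, ∑ ν, t (some κ) (some l) (some μ) (some ν) •
      θ (some κ) (some l) (some μ) (some ν) ∈ S := by
    obtain ⟨A, B, C, D, hABCD⟩ := invariant_tensor₄
      (t := fun κ l μ ν => t (some κ) (some l) (some μ) (some ν)) (fun ρ σ k l m n => by
        have := h ρ σ (some k) (some l) (some m) (some n)
        simp only [sum_mul_optRot_some] at this
        rw [← this]; ring)
    have : ∑ κ, ∑ l, ∑ μ, ∑ ν, t (some κ) (some l) (some μ) (some ν) •
        θ (some κ) (some l) (some μ) (some ν)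
        = A • (∑ μ, ∑ ν, (eta μ * eta ν) • θ (some μ) (some μ) (some ν) (some ν))
          + B • (∑ μ, ∑ ν, (eta μ * eta ν) • θ (some μ) (some ν) (some μ) (some ν))
          + C • (∑ μ, ∑ ν, (eta μ * eta ν) • θ (some μ) (some ν) (some ν) (some μ))
          + D • ∑ κ, ∑ l, ∑ μ, ∑ ν, levi κ l μ ν • θ (some κ) (some l) (some μ) (some ν) := by
      simp only [hABCD, add_smul, Finset.sum_add_distrib, Finset.smul_sum, smul_smul, ite_and,
        ite_smul, zero_smul, Finset.sum_ite_eq, Finset.sum_ite_irrel, Finset.sum_const_zero,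
        Finset.mem_univ, if_true, mul_assoc]
    rw [this]
    exact S.add_mem (S.add_mem (S.add_mem (S.smul_mem _ h1234) (S.smul_mem _ h1324))
      (S.smul_mem _ h1423)) (S.smul_mem _ hlevi)
  have zero_mem' {w : W} (h : w = 0) : w ∈ S := h ▸ S.zero_mem
  exact (key
    (key
    (key
    (key
    (S.smul_mem _ h0)
    (zero_mem' (z fun ρ σ k => by
      simpa only [sum_mul_optRot_some, sum_mul_optRot_none, zero_add, add_zero] using
        h ρ σ none none none (some k))))
    (key
    (zero_mem' (z fun ρ σ k => by
      simpa only [sum_mul_optRot_some, sum_mul_optRot_none, zero_add, add_zero] using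
        h ρ σ none none (some k) none))
    (z2 h34 fun ρ σ k l => by
      simpa only [sum_mul_optRot_some, sum_mul_optRot_none, zero_add, add_zero] using
        h ρ σ none none (some k) (some l))))
    (key
    (key
    (zero_mem' (z fun ρ σ k => by
      simpa only [sum_mul_optRot_some, sum_mul_optRot_none, zero_add, add_zero] using
        h ρ σ none (some k) none none))
    (z2 h24 fun ρ σ k l => by
      simpa only [sum_mul_optRot_some, sum_mul_optRot_none, zero_add, add_zero] using
        h ρ σ none (some k) none (some l)))
    (key
    (z2 h23 fun ρ σ k l => by
      simpa only [sum_mul_optRot_some, sum_mul_optRot_none, zero_add, add_zero] using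
        h ρ σ none (some k) (some l) none)
    (zero_mem' (z3 fun ρ σ k l m => by
      simpa only [sum_mul_optRot_some, sum_mul_optRot_none, zero_add, add_zero, add_assoc] using
        h ρ σ none (some k) (some l) (some m))))))
    (key
    (key
    (key
    (zero_mem' (z fun ρ σ k => by
      simpa only [sum_mul_optRot_some, sum_mul_optRot_none, zero_add, add_zero] using
        h ρ σ (some k) none none none))
    (z2 h14 fun ρ σ k l => by
      simpa only [sum_mul_optRot_some, sum_mul_optRot_none, zero_add, add_zero] using
        h ρ σ (some k) none none (some l)))
    (key
    (z2 h13 fun ρ σ k l => by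
      simpa only [sum_mul_optRot_some, sum_mul_optRot_none, zero_add, add_zero] using
        h ρ σ (some k) none (some l) none)
    (zero_mem' (z3 fun ρ σ k l m => by
      simpa only [sum_mul_optRot_some, sum_mul_optRot_none, zero_add, add_zero, add_assoc] using
        h ρ σ (some k) none (some l) (some m)))))
    (key
    (key
    (z2 h12 fun ρ σ k l => by
      simpa only [sum_mul_optRot_some, sum_mul_optRot_none, zero_add, add_zero] using
        h ρ σ (some k) (some l) none none)
    (zero_mem' (z3 fun ρ σ k l m => by
      simpa only [sum_mul_optRot_some, sum_mul_optRot_none, zero_add, add_zero, add_assoc] using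
        h ρ σ (some k) (some l) none (some m))))
    (key
    (zero_mem' (z3 fun ρ σ k l m => by
      simpa only [sum_mul_optRot_some, sum_mul_optRot_none, zero_add, add_zero, add_assoc] using
        h ρ σ (some k) (some l) (some m) none))
    i4))))

/-- The infinitesimal Lorentz transformations of conjugate spinors. -/
def cospinRot (ρ σ : Fin 4) : Matrix (Fin 4) (Fin 4) ℂ := -(spinRot ρ σ).transpose

theorem cospinRot_conjTranspose (ρ σ : Fin 4) :
    (cospinRot ρ σ).conjTranspose = (-(eta ρ * eta σ)) • cospinRot ρ σ := by
  have h := congrArg Matrix.transpose (spinRot_conjTranspose ρ σ)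
  rw [cospinRot, Matrix.conjTranspose_neg, smul_neg, ← Matrix.transpose_smul, ← h]
  rfl

/-- The invariants of a conjugate spinor, a spinor, and an optional tensor index. -/
theorem invariant_dirac_sum_mem {W : Type*} [AddCommGroup W] [Module ℂ W] (S : Submodule ℂ W)
    (θ : Fin 4 → Fin 4 → Option (Fin 4) → W) (t : Fin 4 → Fin 4 → Option (Fin 4) → ℂ)
    (h : ∀ ρ σ s r i, ∑ s', t s' r i * cospinRot ρ σ s' s + (∑ r', t s r' i * spinRot ρ σ r' r
      + ∑ i', t s r i' * optRot ρ σ i' i) = 0)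
    (hscalar : ∀ ε, ∑ s, ∑ r, chiral ε s r • θ s r none ∈ S)
    (hvector : ∀ ε, ∑ μ, ∑ s, ∑ r, (gamma μ * chiral ε) s r • θ s r (some μ) ∈ S) :
    ∑ s, ∑ r, ∑ i, t s r i • θ s r i ∈ S := by
  simp only [Fintype.sum_option (α := Fin 4), Finset.sum_add_distrib]
  refine S.add_mem ?_ ?_
  · obtain ⟨c, hc⟩ := invariant_spinor (t := Matrix.of fun s r => t s r none) (by
      intro ρ σ
      ext s r
      have := h ρ σ s r none
      simp only [sum_mul_optRot_none, add_zero, cospinRot, Matrix.neg_apply, Matrix.transpose_apply,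
        mul_neg, Finset.sum_neg_distrib] at this
      simp only [Matrix.sub_apply, Matrix.mul_apply, Matrix.of_apply, Matrix.zero_apply]
      rw [← this]
      simp only [mul_comm]
      ring)
    have hc' : ∀ s r, t s r none = ∑ ε, c ε * chiral ε s r := fun s r => by
      have := congrFun (congrFun hc s) r
      simpa [Matrix.sum_apply] using this
    have : ∑ s, ∑ r, t s r none • θ s r none
        = ∑ ε, c ε • ∑ s, ∑ r, chiral ε s r • θ s r none := by
      simp only [hc', Finset.sum_smul, Finset.smul_sum, smul_smul]
      rw [Finset.sum_comm]
      conv_rhs => rw [Finset.sum_comm]; enter [2, x]; rw [Finset.sum_comm]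
      rw [Finset.sum_comm]
    rw [this]
    exact S.sum_mem fun ε _ => S.smul_mem _ (hscalar ε)
  · obtain ⟨c, hc⟩ := invariant_spinor_vector (t := fun μ => Matrix.of fun s r => t s r (some μ)) (by
      intro ρ σ μ
      ext s r
      have := h ρ σ s r (some μ)
      simp only [sum_mul_optRot_some, cospinRot, Matrix.neg_apply, Matrix.transpose_apply,
        mul_neg, Finset.sum_neg_distrib, rotIdx] at this
      have e1 : ∀ (p : Prop) [Decidable p] (c : ℂ) (M : Matrix (Fin 4) (Fin 4) ℂ),
          (if p then c • M else 0) s r = if p then c * M s r else 0 := by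
        intro p _ c M
        split_ifs <;> simp
      simp only [Matrix.add_apply, Matrix.sub_apply, Matrix.mul_apply, Matrix.of_apply,
        Matrix.zero_apply, e1]
      refine Eq.trans ?_ this
      simp only [mul_comm (spinRot _ _ _ _)]
      ring)
    have hc' : ∀ μ s r, t s r (some μ) = ∑ ε, c ε * (gamma μ * chiral ε) s r := fun μ s r => by
      have := congrFun (congrFun (hc μ) s) r
      simpa [Matrix.sum_apply] using this
    have : ∑ s, ∑ r, ∑ μ, t s r (some μ) • θ s r (some μ)
        = ∑ ε, c ε • ∑ μ, ∑ s, ∑ r, (gamma μ * chiral ε) s r • θ s r (some μ) := by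
      have e2 : ∀ s, ∑ r, ∑ μ, t s r (some μ) • θ s r (some μ)
          = ∑ μ, ∑ r, t s r (some μ) • θ s r (some μ) := fun s => Finset.sum_comm
      simp only [e2]
      rw [Finset.sum_comm]
      simp only [Finset.smul_sum, smul_smul]
      conv_rhs => rw [Finset.sum_comm]
      refine Finset.sum_congr rfl fun μ _ => ?_
      conv_rhs => rw [Finset.sum_comm]
      refine Finset.sum_congr rfl fun s _ => ?_
      conv_rhs => rw [Finset.sum_comm]
      refine Finset.sum_congr rfl fun r _ => ?_
      rw [hc', Finset.sum_smul]
    rw [this]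
    exact S.sum_mem fun ε _ => S.smul_mem _ (hvector ε)


/-! ### Lorentz invariant vertices -/

/-- The kinds of fields in a quadruple: `bose` stands for `v_μ` and `Φ` together. -/
inductive Kind
  | bose
  | ghost
  | antighost

/-- The kind of a component of a quadruple. -/
def QuadComp.kind : QuadComp → Kind
  | .v _ => .bose
  | .u => .ghost
  | .ut => .antighost
  | .phi => .bose

/-- The tensor index of a component of a quadruple. -/
def QuadComp.index : QuadComp → Option (Fin 4)
  | .v μ => some μ
  | _ => none

/-- The derivatives given by an optional index. -/
def optDeriv : Option (Fin 4) → Multiset (Fin 4)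
  | none => 0
  | some μ => {μ}

theorem exists_optDeriv {α : Multiset (Fin 4)} (h : Multiset.card α ≤ 1) : ∃ N, α = optDeriv N := by
  rcases Nat.le_one_iff_eq_zero_or_eq_one.1 h with h | h
  · exact ⟨none, Multiset.card_eq_zero.1 h⟩
  · obtain ⟨μ, rfl⟩ := Multiset.card_eq_one.1 h
    exact ⟨some μ, rfl⟩

namespace FieldContent
variable {Ind Dir : Type*} (F : FieldContent Ind Dir)

/-- The field of given kind and flavour, with optional tensor index `M` and optional derivative `N`;
zero when a ghost field is given a tensor index. -/
def factor : Kind → Ind → Option (Fin 4) → Option (Fin 4) → F.Wick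
  | .bose, a, none, N => F.jet (.quad a .phi, optDeriv N)
  | .bose, a, some μ, N => F.jet (.quad a (.v μ), optDeriv N)
  | .ghost, a, none, N => F.jet (.quad a .u, optDeriv N)
  | .antighost, a, none, N => F.jet (.quad a .ut, optDeriv N)
  | _, _, _, _ => 0

theorem jet_eq_factor (a : Ind) (q : QuadComp) (N : Option (Fin 4)) :
    F.jet (.quad a q, optDeriv N) = F.factor q.kind a q.index N := by
  cases q <;> rfl

theorem lorentz_factor (ρ σ : Fin 4) (k : Kind) (a : Ind) (M N : Option (Fin 4)) :
    F.lorentz ρ σ (F.factor k a M N) = ∑ M', optRot ρ σ M M' • F.factor k a M' N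
      + ∑ N', optRot ρ σ N N' • F.factor k a M N' := by
  have h0 : ∀ (i : Option (Fin 4)), optRot ρ σ none i = 0 := fun i => rfl
  have h1 : ∀ μ, optRot ρ σ (some μ) none = 0 := fun μ => rfl
  have h2 : ∀ μ ν, optRot ρ σ (some μ) (some ν) = rot ρ σ μ ν := fun μ ν => rfl
  rcases k <;> rcases M with _ | μ <;> rcases N with _ | ν <;>
    simp [factor, lorentz_jet, spinVal, orbitVal, optDeriv, h0, h1, h2]

/-- The monomials without Dirac fields from which interactions are built. -/
inductive BoseVertex
  | bbb
  | uab
  | aub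
  | bua
  | bbbb
  | uabb
  | uuaa
  deriving DecidableEq

instance : Fintype BoseVertex where
  elems := {.bbb, .uab, .aub, .bua, .bbbb, .uabb, .uuaa}
  complete x := by cases x <;> simp

/-- The monomial of given shape and flavours; the four optional indices are, for trilinear shapes, a
derivative of the first factor and the tensor indices of the factors, and for quadrilinear shapes the
tensor indices of the factors. -/
def boseMonomial : BoseVertex → Ind → Ind → Ind → Ind →
    Option (Fin 4) → Option (Fin 4) → Option (Fin 4) → Option (Fin 4) → F.Wick
  | .bbb, a, b, c, _, N, i, j, k =>
    F.factor .bose a i N * (F.factor .bose b j none * F.factor .bose c k none)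
  | .uab, a, b, c, _, N, i, j, k =>
    F.factor .ghost a i N * (F.factor .antighost b j none * F.factor .bose c k none)
  | .aub, a, b, c, _, N, i, j, k =>
    F.factor .antighost a i N * (F.factor .ghost b j none * F.factor .bose c k none)
  | .bua, a, b, c, _, N, i, j, k =>
    F.factor .bose a i N * (F.factor .ghost b j none * F.factor .antighost c k none)
  | .bbbb, a, b, c, d, i, j, k, l =>
    F.factor .bose a i none * (F.factor .bose b j none *
      (F.factor .bose c k none * F.factor .bose d l none))
  | .uabb, a, b, c, d, i, j, k, l =>
    F.factor .ghost a i none * (F.factor .antighost b j none *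
      (F.factor .bose c k none * F.factor .bose d l none))
  | .uuaa, a, b, c, d, i, j, k, l =>
    F.factor .ghost a i none * (F.factor .ghost b j none *
      (F.factor .antighost c k none * F.factor .antighost d l none))

/-- The monomials with Dirac fields from which interactions are built. -/
def diracMonomial (A B : Dir) (c : Ind) (s r : Fin 4) (k : Option (Fin 4)) : F.Wick :=
  F.jet (.psibar A s, 0) * (F.jet (.psi B r, 0) * F.factor .bose c k none)

theorem lorentz_boseMonomial (ρ σ : Fin 4) (τ : BoseVertex) (a b c d : Ind)
    (i j k l : Option (Fin 4)) : F.lorentz ρ σ (F.boseMonomial τ a b c d i j k l)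
      = ∑ i', optRot ρ σ i i' • F.boseMonomial τ a b c d i' j k l
        + (∑ j', optRot ρ σ j j' • F.boseMonomial τ a b c d i j' k l
        + (∑ k', optRot ρ σ k k' • F.boseMonomial τ a b c d i j k' l
        + ∑ l', optRot ρ σ l l' • F.boseMonomial τ a b c d i j k l')) := by
  have h0 : ∀ (i : Option (Fin 4)), optRot ρ σ none i = 0 := fun i => rfl
  have h3 (k₁ k₂ k₃ : Kind) : F.lorentz ρ σ (F.factor k₁ a j i * (F.factor k₂ b k none
        * F.factor k₃ c l none))
      = ∑ i', optRot ρ σ i i' • (F.factor k₁ a j i' * (F.factor k₂ b k none * F.factor k₃ c l none))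
        + (∑ j', optRot ρ σ j j' •
            (F.factor k₁ a j' i * (F.factor k₂ b k none * F.factor k₃ c l none))
        + (∑ k', optRot ρ σ k k' •
            (F.factor k₁ a j i * (F.factor k₂ b k' none * F.factor k₃ c l none))
        + ∑ l', optRot ρ σ l l' •
            (F.factor k₁ a j i * (F.factor k₂ b k none * F.factor k₃ c l' none)))) := by
    simp only [lorentz_mul, lorentz_factor, h0, zero_smul, Finset.sum_const_zero, add_zero,
      add_mul, mul_add, Finset.sum_mul, Finset.mul_sum, smul_mul_assoc, mul_smul_comm]
    abel
  have h4 (k₁ k₂ k₃ k₄ : Kind) : F.lorentz ρ σ (F.factor k₁ a i none * (F.factor k₂ b j none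
        * (F.factor k₃ c k none * F.factor k₄ d l none)))
      = ∑ i', optRot ρ σ i i' • (F.factor k₁ a i' none * (F.factor k₂ b j none
          * (F.factor k₃ c k none * F.factor k₄ d l none)))
        + (∑ j', optRot ρ σ j j' • (F.factor k₁ a i none * (F.factor k₂ b j' none
          * (F.factor k₃ c k none * F.factor k₄ d l none)))
        + (∑ k', optRot ρ σ k k' • (F.factor k₁ a i none * (F.factor k₂ b j none
          * (F.factor k₃ c k' none * F.factor k₄ d l none)))
        + ∑ l', optRot ρ σ l l' • (F.factor k₁ a i none * (F.factor k₂ b j none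
          * (F.factor k₃ c k none * F.factor k₄ d l' none))))) := by
    simp only [lorentz_mul, lorentz_factor, h0, zero_smul, Finset.sum_const_zero, add_zero,
      add_mul, mul_add, Finset.sum_mul, Finset.mul_sum, smul_mul_assoc, mul_smul_comm]
  cases τ <;> first | exact h3 _ _ _ | exact h4 _ _ _ _

theorem lorentz_diracMonomial (ρ σ : Fin 4) (A B : Dir) (c : Ind) (s r : Fin 4)
    (k : Option (Fin 4)) : F.lorentz ρ σ (F.diracMonomial A B c s r k)
      = ∑ s', cospinRot ρ σ s s' • F.diracMonomial A B c s' r k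
        + (∑ r', spinRot ρ σ r r' • F.diracMonomial A B c s r' k
        + ∑ k', optRot ρ σ k k' • F.diracMonomial A B c s r k') := by
  have h0 : ∀ (i : Option (Fin 4)), optRot ρ σ none i = 0 := fun i => rfl
  simp only [diracMonomial, lorentz_mul, lorentz_factor, lorentz_jet, spinVal, orbitVal_zero, h0,
    zero_smul, Finset.sum_const_zero, add_zero, cospinRot, Matrix.neg_apply,
    Matrix.transpose_apply, wick_neg_smul, Finset.sum_neg_distrib, wick_neg_mul,
    add_mul, mul_add, Finset.sum_mul, Finset.mul_sum, smul_mul_assoc, mul_smul_comm]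

/-- Reordering the factors changes a Wick monomial by a sign. -/
theorem monomial_perm {l l' : List (Jet Ind Dir)} (h : l.Perm l') :
    ∃ c : ℂ, F.monomial l = c • F.monomial l' := by
  induction h with
  | nil => exact ⟨1, by simp⟩
  | cons x _ ih =>
    obtain ⟨c, hc⟩ := ih
    refine ⟨c, ?_⟩
    simp only [monomial, List.map_cons, List.prod_cons] at hc ⊢
    rw [hc, mul_smul_comm]
  | swap x y l =>
    refine ⟨koszul y.1.odd x.1.odd, ?_⟩
    simp only [monomial, List.map_cons, List.prod_cons]
    rw [← mul_assoc, F.jet_comm, smul_mul_assoc, mul_assoc]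
  | trans _ _ ih ih' =>
    obtain ⟨c, hc⟩ := ih
    obtain ⟨c', hc'⟩ := ih'
    exact ⟨c * c', by rw [hc, hc', smul_smul]⟩

variable {F} in
theorem monomial_mem_of_perm {S : Submodule ℂ F.Wick} {l l' : List (Jet Ind Dir)}
    (h : l.Perm l') (h' : F.monomial l' ∈ S) : F.monomial l ∈ S := by
  obtain ⟨c, hc⟩ := F.monomial_perm h
  rw [hc]
  exact S.smul_mem c h'

end FieldContent
namespace FieldContent
variable {Ind Dir : Type*} (F : FieldContent Ind Dir)

/-- The span of the monomials from which interactions are built. -/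
def vertexSpan : Submodule ℂ F.Wick :=
  Submodule.span ℂ (Set.range fun p : (BoseVertex × Ind × Ind × Ind × Ind) ×
      (Option (Fin 4) × Option (Fin 4) × Option (Fin 4) × Option (Fin 4)) =>
    F.boseMonomial p.1.1 p.1.2.1 p.1.2.2.1 p.1.2.2.2.1 p.1.2.2.2.2 p.2.1 p.2.2.1 p.2.2.2.1 p.2.2.2.2)
  ⊔ Submodule.span ℂ (Set.range fun p : (Dir × Dir × Ind) × (Fin 4 × Fin 4 × Option (Fin 4)) =>
    F.diracMonomial p.1.1 p.1.2.1 p.1.2.2 p.2.1 p.2.2.1 p.2.2.2)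

theorem boseMonomial_mem (τ : BoseVertex) (a b c d : Ind) (i j k l : Option (Fin 4)) :
    F.boseMonomial τ a b c d i j k l ∈ F.vertexSpan :=
  Submodule.mem_sup_left (Submodule.subset_span ⟨((τ, a, b, c, d), (i, j, k, l)), rfl⟩)

theorem diracMonomial_mem (A B : Dir) (c : Ind) (s r : Fin 4) (k : Option (Fin 4)) :
    F.diracMonomial A B c s r k ∈ F.vertexSpan :=
  Submodule.mem_sup_right (Submodule.subset_span ⟨((A, B, c), (s, r, k)), rfl⟩)

theorem Jet.one_le_dim (x : Jet Ind Dir) : 1 ≤ x.dim := by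
  obtain ⟨⟨a, q⟩ | ⟨A, s⟩ | ⟨A, s⟩, α⟩ := x <;> simp only [Jet.dim, Comp.dim] <;>
    have h : (0 : ℚ) ≤ Multiset.card α := Nat.cast_nonneg _ <;> linarith

theorem length_le_sum_dim (l : List (Jet Ind Dir)) : (l.length : ℚ) ≤ (l.map Jet.dim).sum := by
  induction l with
  | nil => simp
  | cons x l ih =>
    have := Jet.one_le_dim x
    simp only [List.length_cons, List.map_cons, List.sum_cons]
    push_cast
    linarith

/-- The ghost number of a kind of fields. -/
def kindGhost : Kind → ℤ
  | .bose => 0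
  | .ghost => 1
  | .antighost => -1

theorem ghost_quad (a : Ind) (q : QuadComp) :
    (Comp.quad a q : Comp Ind Dir).ghost = kindGhost q.kind := by cases q <;> rfl

/-- The factor that may carry a derivative comes first, whatever its kind, and the other two are
brought into the order of one of the shapes. -/
theorem trilinear_mem (a b c : Ind) (p q r : QuadComp) (N : Option (Fin 4))
    (h : kindGhost p.kind + (kindGhost q.kind + kindGhost r.kind) = 0) :
    F.monomial [(.quad a p, optDeriv N), (.quad b q, 0), (.quad c r, 0)] ∈ F.vertexSpan := by
  have e (x y z : Jet Ind Dir) : F.monomial [x, y, z] = F.jet x * (F.jet y * F.jet z) := by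
    simp [monomial]
  have hf : ∀ (a b c : Ind) (p q r : QuadComp), F.monomial [(.quad a p, optDeriv N),
      (.quad b q, 0), (.quad c r, 0)] = F.factor p.kind a p.index N *
        (F.factor q.kind b q.index none * F.factor r.kind c r.index none) := by
    intro a b c p q r
    rw [e, ← jet_eq_factor, ← jet_eq_factor, ← jet_eq_factor]
    rfl
  have hτ := fun τ => F.boseMonomial_mem τ a b c a N p.index q.index r.index
  have hτ' := fun τ => F.boseMonomial_mem τ a c b a N p.index r.index q.index
  have h1 := hf a b c p q r
  have h2 := hf a c b p r q
  have sw := monomial_mem_of_perm (F := F) (S := F.vertexSpan)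
    (List.Perm.cons (.quad a p, optDeriv N) (List.Perm.swap (.quad c r, 0) (.quad b q, 0) []))
  generalize p.kind = P at *
  generalize q.kind = Q at *
  generalize r.kind = R at *
  cases P <;> cases Q <;> cases R <;> first
    | exact absurd h (by decide)
    | (rw [h1]; first | exact hτ .bbb | exact hτ .uab | exact hτ .aub | exact hτ .bua)
    | (apply sw; rw [h2]; first | exact hτ' .uab | exact hτ' .aub | exact hτ' .bua)

theorem quadrilinear_mem (a b c d : Ind) (p q r t : QuadComp)
    (h : kindGhost p.kind + (kindGhost q.kind + (kindGhost r.kind + kindGhost t.kind)) = 0) :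
    F.monomial [(.quad a p, 0), (.quad b q, 0), (.quad c r, 0), (.quad d t, 0)]
      ∈ F.vertexSpan := by
  have e (x y z w : Jet Ind Dir) :
      F.monomial [x, y, z, w] = F.jet x * (F.jet y * (F.jet z * F.jet w)) := by
    simp [monomial]
  -- the three shapes with factors in the standard order
  have std : ∀ (a b c d : Ind) (p q r t : QuadComp),
      ((p.kind = .bose ∧ q.kind = .bose ∧ r.kind = .bose ∧ t.kind = .bose)
      ∨ (p.kind = .ghost ∧ q.kind = .antighost ∧ r.kind = .bose ∧ t.kind = .bose)
      ∨ (p.kind = .ghost ∧ q.kind = .ghost ∧ r.kind = .antighost ∧ t.kind = .antighost)) →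
      F.monomial [(.quad a p, 0), (.quad b q, 0), (.quad c r, 0), (.quad d t, 0)]
        ∈ F.vertexSpan := by
    intro a b c d p q r t hk
    have h1 : F.monomial [(.quad a p, 0), (.quad b q, 0), (.quad c r, 0), (.quad d t, 0)]
        = F.factor p.kind a p.index none * (F.factor q.kind b q.index none
          * (F.factor r.kind c r.index none * F.factor t.kind d t.index none)) := by
      rw [e, ← jet_eq_factor, ← jet_eq_factor, ← jet_eq_factor, ← jet_eq_factor]
      rfl
    rw [h1]
    have hτ := fun τ => F.boseMonomial_mem τ a b c d p.index q.index r.index t.index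
    rcases hk with ⟨h1, h2, h3, h4⟩ | ⟨h1, h2, h3, h4⟩ | ⟨h1, h2, h3, h4⟩ <;> rw [h1, h2, h3, h4]
    · exact hτ .bbbb
    · exact hτ .uabb
    · exact hτ .uuaa
  -- adjacent factors may be exchanged
  have perm {l l' : List (Ind × QuadComp)} (hl : l.Perm l')
      (h : F.monomial (l'.map fun x => (.quad x.1 x.2, 0)) ∈ F.vertexSpan) :
      F.monomial (l.map fun x => (.quad x.1 x.2, 0)) ∈ F.vertexSpan :=
    monomial_mem_of_perm (hl.map _) h
  have coe (x y z w : Ind × QuadComp) : (([x, y, z, w] : List _) : Multiset (Ind × QuadComp))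
      = {x} + ({y} + ({z} + {w})) := rfl
  have std' (x y z w : Ind × QuadComp) (hp : ([(a, p), (b, q), (c, r), (d, t)] : List _).Perm
      [x, y, z, w]) (hk : (x.2.kind = .bose ∧ y.2.kind = .bose ∧ z.2.kind = .bose ∧ w.2.kind = .bose)
      ∨ (x.2.kind = .ghost ∧ y.2.kind = .antighost ∧ z.2.kind = .bose ∧ w.2.kind = .bose)
      ∨ (x.2.kind = .ghost ∧ y.2.kind = .ghost ∧ z.2.kind = .antighost ∧ w.2.kind = .antighost)) :
      F.monomial [(.quad a p, 0), (.quad b q, 0), (.quad c r, 0), (.quad d t, 0)]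
        ∈ F.vertexSpan := perm hp (std _ _ _ _ _ _ _ _ hk)
  rcases hP : p.kind <;> rcases hQ : q.kind <;> rcases hR : r.kind <;> rcases hT : t.kind <;>
    (rw [hP, hQ, hR, hT] at h; first
    | exact absurd h (by decide)
    | (refine std _ _ _ _ _ _ _ _ ?_; simp [hP, hQ, hR, hT]; done)
    | (refine std' (a, p) (b, q) (d, t) (c, r) (Multiset.coe_eq_coe.1 (by simp only [coe]; abel)) ?_
       simp [hP, hQ, hR, hT]; done)
    | (refine std' (a, p) (c, r) (b, q) (d, t) (Multiset.coe_eq_coe.1 (by simp only [coe]; abel)) ?_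
       simp [hP, hQ, hR, hT]; done)
    | (refine std' (a, p) (d, t) (b, q) (c, r) (Multiset.coe_eq_coe.1 (by simp only [coe]; abel)) ?_
       simp [hP, hQ, hR, hT]; done)
    | (refine std' (b, q) (a, p) (c, r) (d, t) (Multiset.coe_eq_coe.1 (by simp only [coe]; abel)) ?_
       simp [hP, hQ, hR, hT]; done)
    | (refine std' (b, q) (c, r) (a, p) (d, t) (Multiset.coe_eq_coe.1 (by simp only [coe]; abel)) ?_
       simp [hP, hQ, hR, hT]; done)
    | (refine std' (b, q) (d, t) (a, p) (c, r) (Multiset.coe_eq_coe.1 (by simp only [coe]; abel)) ?_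
       simp [hP, hQ, hR, hT]; done)
    | (refine std' (c, r) (a, p) (b, q) (d, t) (Multiset.coe_eq_coe.1 (by simp only [coe]; abel)) ?_
       simp [hP, hQ, hR, hT]; done)
    | (refine std' (c, r) (b, q) (a, p) (d, t) (Multiset.coe_eq_coe.1 (by simp only [coe]; abel)) ?_
       simp [hP, hQ, hR, hT]; done)
    | (refine std' (c, r) (d, t) (a, p) (b, q) (Multiset.coe_eq_coe.1 (by simp only [coe]; abel)) ?_
       simp [hP, hQ, hR, hT]; done)
    | (refine std' (d, t) (a, p) (b, q) (c, r) (Multiset.coe_eq_coe.1 (by simp only [coe]; abel)) ?_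
       simp [hP, hQ, hR, hT]; done)
    | (refine std' (d, t) (b, q) (a, p) (c, r) (Multiset.coe_eq_coe.1 (by simp only [coe]; abel)) ?_
       simp [hP, hQ, hR, hT]; done)
    | (refine std' (d, t) (c, r) (a, p) (b, q) (Multiset.coe_eq_coe.1 (by simp only [coe]; abel)) ?_
       simp [hP, hQ, hR, hT]; done))

/-- Monomials without Dirac fields. -/
theorem quad_monomial_mem (l : List (Ind × QuadComp × Multiset (Fin 4))) (h3 : 3 ≤ l.length)
    (hd : l.length + (l.map fun x => Multiset.card x.2.2).sum ≤ 4)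
    (hg : (l.map fun x => kindGhost x.2.1.kind).sum = 0) :
    F.monomial (l.map fun x => (.quad x.1 x.2.1, x.2.2)) ∈ F.vertexSpan := by
  rcases l with _ | ⟨⟨a, p, α⟩, _ | ⟨⟨b, q, β⟩, _ | ⟨⟨c, r, γ⟩, _ | ⟨⟨d, t, δ⟩, _ | ⟨x, l⟩⟩⟩⟩⟩
  · simp at h3
  · simp at h3
  · simp at h3
  · simp only [List.map_cons, List.map_nil, List.sum_cons, List.sum_nil, List.length_cons,
      List.length_nil, add_zero] at hd hg ⊢
    have key : ∀ (a b c : Ind) (p q r : QuadComp) (α β γ : Multiset (Fin 4)),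
        kindGhost p.kind + (kindGhost q.kind + kindGhost r.kind) = 0 →
        Multiset.card α ≤ 1 → Multiset.card β = 0 → Multiset.card γ = 0 →
        F.monomial [(.quad a p, α), (.quad b q, β), (.quad c r, γ)] ∈ F.vertexSpan := by
      intro a b c p q r α β γ hg hα hβ hγ
      obtain ⟨N, rfl⟩ := exists_optDeriv hα
      rw [Multiset.card_eq_zero.1 hβ, Multiset.card_eq_zero.1 hγ]
      exact F.trilinear_mem a b c p q r N hg
    by_cases hβ : Multiset.card β = 0
    · by_cases hγ : Multiset.card γ = 0
      · exact key a b c p q r α β γ hg (by omega) hβ hγ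
      · exact monomial_mem_of_perm ((List.Perm.cons _ (List.Perm.swap _ _ _)).trans
          (List.Perm.swap _ _ _)) (key c a b r p q γ α β (by omega) (by omega) (by omega) (by omega))
    · exact monomial_mem_of_perm (List.Perm.swap _ _ _)
        (key b a c q p r β α γ (by omega) (by omega) (by omega) (by omega))
  · simp only [List.map_cons, List.map_nil, List.sum_cons, List.sum_nil, List.length_cons,
      List.length_nil, add_zero] at hd hg ⊢
    rw [Multiset.card_eq_zero.1 (show Multiset.card α = 0 by omega),
      Multiset.card_eq_zero.1 (show Multiset.card β = 0 by omega),
      Multiset.card_eq_zero.1 (show Multiset.card γ = 0 by omega),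
      Multiset.card_eq_zero.1 (show Multiset.card δ = 0 by omega)]
    exact F.quadrilinear_mem a b c d p q r t hg
  · simp only [List.length_cons] at hd
    omega

theorem exists_quads (l : List (Jet Ind Dir)) (h : ∀ x ∈ l, ∃ a q, x.1 = Comp.quad a q) :
    ∃ l' : List (Ind × QuadComp × Multiset (Fin 4)), l = l'.map fun x => (.quad x.1 x.2.1, x.2.2) := by
  induction l with
  | nil => exact ⟨[], rfl⟩
  | cons x l ih =>
    obtain ⟨l', rfl⟩ := ih fun y hy => h y (List.mem_cons_of_mem _ hy)
    obtain ⟨a, q, hx⟩ := h x List.mem_cons_self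
    exact ⟨(a, q, x.2) :: l', by rw [List.map_cons, ← hx]⟩

/-- The bound on the dimension leaves three factors with at most one derivative or four factors
without derivatives; a factor `Ψ` comes with a factor `Ψ̄`, and the two have dimension three, which
leaves room for one Bose field without derivatives. -/
theorem interactionSpace_le : F.interactionSpace ≤ F.vertexSpan := by
  refine Submodule.span_le.2 ?_
  rintro _ ⟨l, h3, hd, hg, hf, rfl⟩
  by_cases hpsi : ∃ A s α, ((Comp.psi A s, α) : Jet Ind Dir) ∈ l
  · obtain ⟨B, r, β, hB⟩ := hpsi
    obtain ⟨l₁, l₂, rfl⟩ := List.append_of_mem hB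
    have hp := List.perm_middle (a := ((Comp.psi B r, β) : Jet Ind Dir)) (l₁ := l₁) (l₂ := l₂)
    -- the charge of `Ψ` has to be compensated
    have hbar : ∃ A s α, ((Comp.psibar A s, α) : Jet Ind Dir) ∈ l₁ ++ l₂ := by
      by_contra hno
      push Not at hno
      have : 0 ≤ ((l₁ ++ l₂).map fun x : Jet Ind Dir => x.1.fermionNumber).sum := by
        refine List.sum_nonneg fun y hy => ?_
        obtain ⟨⟨c, α⟩, hx, rfl⟩ := List.mem_map.1 hy
        rcases c with ⟨a, q⟩ | ⟨A, s⟩ | ⟨A, s⟩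
        · simp [Comp.fermionNumber]
        · simp [Comp.fermionNumber]
        · exact absurd hx (hno _ _ _)
      have h1 := (hp.map fun x : Jet Ind Dir => x.1.fermionNumber).sum_eq
      rw [hf, List.map_cons, List.sum_cons] at h1
      simp only [Comp.fermionNumber] at h1 this
      omega
    obtain ⟨A, s, α, hA⟩ := hbar
    obtain ⟨m₁, m₂, hm⟩ := List.append_of_mem hA
    rw [hm] at hp
    have hp2 := (hp.trans (List.Perm.cons _ List.perm_middle)).trans (List.Perm.swap _ _ _)
    generalize m₁ ++ m₂ = m at hp2
    have hl := hp2.length_eq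
    rw [hl] at h3
    rw [(hp2.map _).sum_eq] at hd hg
    simp only [List.map_cons, List.sum_cons, List.length_cons] at hd hg h3
    have hα : (0 : ℚ) ≤ Multiset.card α := Nat.cast_nonneg _
    have hβ : (0 : ℚ) ≤ Multiset.card β := Nat.cast_nonneg _
    have hm' := length_le_sum_dim m
    have e1 : Jet.dim ((Comp.psibar A s, α) : Jet Ind Dir) = 3 / 2 + Multiset.card α := rfl
    have e2 : Jet.dim ((Comp.psi B r, β) : Jet Ind Dir) = 3 / 2 + Multiset.card β := rfl
    rw [e1, e2] at hd
    have hm1 : (1 : ℚ) ≤ m.length := by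
      have : 1 ≤ m.length := by omega
      exact_mod_cast this
    have hα0 : α = 0 := Multiset.card_eq_zero.1 (by
      have : (Multiset.card α : ℚ) ≤ ((0 : ℕ) : ℚ) := by push_cast; linarith
      exact Nat.le_zero.1 (Nat.cast_le.1 this))
    have hβ0 : β = 0 := Multiset.card_eq_zero.1 (by
      have : (Multiset.card β : ℚ) ≤ ((0 : ℕ) : ℚ) := by push_cast; linarith
      exact Nat.le_zero.1 (Nat.cast_le.1 this))
    subst hα0 hβ0
    have hm2 : m.length = 1 := by
      have : (m.length : ℚ) ≤ 1 := by linarith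
      have : m.length ≤ 1 := by exact_mod_cast this
      omega
    obtain ⟨⟨c, γ⟩, rfl⟩ := List.length_eq_one_iff.1 hm2
    refine monomial_mem_of_perm hp2 ?_
    simp only [List.map_cons, List.map_nil, List.sum_cons, List.sum_nil, add_zero, Multiset.card_zero,
      Nat.cast_zero] at hd hg
    have hγ : (0 : ℚ) ≤ Multiset.card γ := Nat.cast_nonneg _
    rcases c with ⟨a, q⟩ | ⟨A, s⟩ | ⟨A, s⟩
    · have hγ0 : γ = 0 := Multiset.card_eq_zero.1 (by
        have e3 : Jet.dim ((Comp.quad a q, γ) : Jet Ind Dir) = 1 + Multiset.card γ := rfl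
        rw [e3] at hd
        have : (Multiset.card γ : ℚ) ≤ ((0 : ℕ) : ℚ) := by push_cast; linarith
        exact Nat.le_zero.1 (Nat.cast_le.1 this))
      subst hγ0
      have hq : q.kind = .bose := by
        rw [ghost_quad] at hg
        simp only [Comp.ghost] at hg
        revert hg
        cases q.kind <;> simp [kindGhost]
      have := F.diracMonomial_mem A B a s r q.index
      rw [diracMonomial, ← hq, ← jet_eq_factor] at this
      simpa [monomial, optDeriv] using this
    · have e3 : Jet.dim ((Comp.psi A s, γ) : Jet Ind Dir) = 3 / 2 + Multiset.card γ := rfl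
      rw [e3] at hd
      linarith
    · have e3 : Jet.dim ((Comp.psibar A s, γ) : Jet Ind Dir) = 3 / 2 + Multiset.card γ := rfl
      rw [e3] at hd
      linarith
  · push Not at hpsi
    have hbar : ∀ A s α, ((Comp.psibar A s, α) : Jet Ind Dir) ∉ l := by
      intro A s α hA
      obtain ⟨l₁, l₂, rfl⟩ := List.append_of_mem hA
      have hp := List.perm_middle (a := ((Comp.psibar A s, α) : Jet Ind Dir)) (l₁ := l₁) (l₂ := l₂)
      have : ((l₁ ++ l₂).map fun x : Jet Ind Dir => x.1.fermionNumber).sum ≤ 0 := by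
        refine (List.sum_le_card_nsmul _ 0 fun y hy => ?_).trans (by simp)
        obtain ⟨⟨c, α⟩, hx, rfl⟩ := List.mem_map.1 hy
        rcases c with ⟨a, q⟩ | ⟨A, s⟩ | ⟨A, s⟩
        · simp [Comp.fermionNumber]
        · exact absurd (hp.mem_iff.2 (List.mem_cons_of_mem _ hx)) (hpsi _ _ _)
        · simp [Comp.fermionNumber]
      have h1 := (hp.map fun x : Jet Ind Dir => x.1.fermionNumber).sum_eq
      rw [hf, List.map_cons, List.sum_cons] at h1
      simp only [Comp.fermionNumber] at h1 this
      omega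
    obtain ⟨l', rfl⟩ := exists_quads l (by
      rintro ⟨⟨a, q⟩ | ⟨A, s⟩ | ⟨A, s⟩, α⟩ hx
      · exact ⟨a, q, rfl⟩
      · exact absurd hx (hpsi _ _ _)
      · exact absurd hx (hbar _ _ _))
    refine F.quad_monomial_mem l' (by simpa using h3) ?_ ?_
    · have : ((l'.length + (l'.map fun x => Multiset.card x.2.2).sum : ℕ) : ℚ) ≤ 4 := by
        refine le_trans (le_of_eq ?_) hd
        clear h3 hd hg hf hpsi hbar
        induction l' with
        | nil => simp
        | cons x l ih =>
          simp only [List.map_cons, List.sum_cons, List.length_cons] at ih ⊢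
          rw [← ih]
          simp only [Jet.dim, Comp.dim]
          push_cast
          ring
      exact_mod_cast this
    · simpa [Function.comp_def, ghost_quad] using hg

end FieldContent
namespace FieldContent
variable {Ind Dir : Type*} (F : FieldContent Ind Dir)

/-- The Lorentz invariant vertices. -/
inductive IsVertex : F.Wick → Prop
  | phi_phi_phi (a b c : Ind) : IsVertex (F.phi a * (F.phi b * F.phi c))
  | phi_v_v (a b c : Ind) : IsVertex (∑ μ, eta μ • (F.phi a * (F.v b μ * F.v c μ)))
  | dv_phi_phi (a b c : Ind) : IsVertex (∑ μ, eta μ • (F.pd μ (F.v a μ) * (F.phi b * F.phi c)))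
  | dphi_v_phi (a b c : Ind) : IsVertex (∑ μ, eta μ • (F.pd μ (F.phi a) * (F.v b μ * F.phi c)))
  | dv_v_v (a b c : Ind) : IsVertex
      (∑ μ, ∑ ν, (eta μ * eta ν) • (F.pd μ (F.v a μ) * (F.v b ν * F.v c ν)))
  | dv_v_v' (a b c : Ind) : IsVertex
      (∑ μ, ∑ ν, (eta μ * eta ν) • (F.pd μ (F.v a ν) * (F.v b μ * F.v c ν)))
  | dv_v_v_levi (a b c : Ind) : IsVertex
      (∑ κ, ∑ l, ∑ μ, ∑ ν, levi κ l μ ν • (F.pd κ (F.v a l) * (F.v b μ * F.v c ν)))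
  | u_ut_phi (a b c : Ind) : IsVertex (F.u a * (F.ut b * F.phi c))
  | du_ut_v (a b c : Ind) : IsVertex (∑ μ, eta μ • (F.pd μ (F.u a) * (F.ut b * F.v c μ)))
  | dut_u_v (a b c : Ind) : IsVertex (∑ μ, eta μ • (F.pd μ (F.ut a) * (F.u b * F.v c μ)))
  | dv_u_ut (a b c : Ind) : IsVertex (∑ μ, eta μ • (F.pd μ (F.v a μ) * (F.u b * F.ut c)))
  | dirac_phi (A B : Dir) (c : Ind) (ε : ℤˣ) : IsVertex
      (∑ s, ∑ r, chiral ε s r • (F.psibar A s * (F.psi B r * F.phi c)))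
  | dirac_v (A B : Dir) (c : Ind) (ε : ℤˣ) : IsVertex
      (∑ μ, ∑ s, ∑ r, (gamma μ * chiral ε) s r • (F.psibar A s * (F.psi B r * F.v c μ)))
  | phi_phi_phi_phi (a b c d : Ind) : IsVertex (F.phi a * (F.phi b * (F.phi c * F.phi d)))
  | v_v_phi_phi (a b c d : Ind) : IsVertex
      (∑ μ, eta μ • (F.v a μ * (F.v b μ * (F.phi c * F.phi d))))
  | v_v_v_v (a b c d : Ind) : IsVertex
      (∑ μ, ∑ ν, (eta μ * eta ν) • (F.v a μ * (F.v b μ * (F.v c ν * F.v d ν))))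
  | v_v_v_v_levi (a b c d : Ind) : IsVertex
      (∑ κ, ∑ l, ∑ μ, ∑ ν, levi κ l μ ν • (F.v a κ * (F.v b l * (F.v c μ * F.v d ν))))
  | u_ut_phi_phi (a b c d : Ind) : IsVertex (F.u a * (F.ut b * (F.phi c * F.phi d)))
  | u_ut_v_v (a b c d : Ind) : IsVertex
      (∑ μ, eta μ • (F.u a * (F.ut b * (F.v c μ * F.v d μ))))
  | u_u_ut_ut (a b c d : Ind) : IsVertex (F.u a * (F.u b * (F.ut c * F.ut d)))

/-- The span of the Lorentz invariant vertices. -/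
def invariantSpan : Submodule ℂ F.Wick := Submodule.span ℂ {w | F.IsVertex w}

variable {F} in
theorem IsVertex.mem {w : F.Wick} (h : F.IsVertex w) : w ∈ F.invariantSpan :=
  Submodule.subset_span h

variable {F} in
theorem IsVertex.mem_of_eq {w z : F.Wick} (h : F.IsVertex w) (e : z = w) :
    z ∈ F.invariantSpan := e ▸ h.mem

theorem pd_field (μ : Fin 4) (c : Comp Ind Dir) : F.pd μ (F.jet (c, 0)) = F.jet (c, {μ}) :=
  F.pd_jet μ (c, 0)

theorem phi_comm (a : Ind) (w : F.Wick) : F.phi a * w = w * F.phi a := F.bose_comm rfl w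

theorem v_comm (a : Ind) (μ : Fin 4) (w : F.Wick) : F.v a μ * w = w * F.v a μ :=
  F.bose_comm rfl w

theorem ut_mul_u (a b : Ind) : F.ut a * F.u b = -(F.u b * F.ut a) := F.fermi_comm rfl rfl

/-- Invariant combinations of the monomials of one shape and given flavours: all contractions of the
optional indices are vertices or vanish. -/
theorem invariant_boseMonomial_sum_mem (τ : BoseVertex) (a b c d : Ind)
    (t : Option (Fin 4) → Option (Fin 4) → Option (Fin 4) → Option (Fin 4) → ℂ)
    (h : ∀ ρ σ i j k l, ∑ i', t i' j k l * optRot ρ σ i' i + (∑ j', t i j' k l * optRot ρ σ j' j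
      + (∑ k', t i j k' l * optRot ρ σ k' k + ∑ l', t i j k l' * optRot ρ σ l' l)) = 0) :
    ∑ i, ∑ j, ∑ k, ∑ l, t i j k l • F.boseMonomial τ a b c d i j k l ∈ F.invariantSpan := by
  have z : (0 : F.Wick) ∈ F.invariantSpan := Submodule.zero_mem _
  have e1 : ∀ c : Comp Ind Dir, F.jet (c, optDeriv none) = F.jet (c, 0) := fun _ => rfl
  have e2 : ∀ (c : Comp Ind Dir) μ, F.jet (c, optDeriv (some μ)) = F.pd μ (F.jet (c, 0)) :=
    fun c μ => (F.pd_field μ c).symm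
  refine invariant_sum_mem _ _ t h ?_ ?_ ?_ ?_ ?_ ?_ ?_ ?_ ?_ ?_ ?_ <;> cases τ <;>
    simp only [boseMonomial, factor, e1, e2, zero_mul, mul_zero, smul_zero,
      Finset.sum_const_zero, z] <;>
    simp only [← phi.eq_1, ← v.eq_1, ← u.eq_1, ← ut.eq_1]
  · exact (IsVertex.phi_phi_phi a b c).mem
  · exact (IsVertex.u_ut_phi a b c).mem
  · rw [← mul_assoc, F.ut_mul_u, wick_neg_mul, mul_assoc]
    exact Submodule.neg_mem _ (IsVertex.u_ut_phi b a c).mem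
  · rw [F.phi_comm, mul_assoc]
    exact (IsVertex.u_ut_phi b c a).mem
  · exact (IsVertex.phi_phi_phi_phi a b c d).mem
  · exact (IsVertex.u_ut_phi_phi a b c d).mem
  · exact (IsVertex.u_u_ut_ut a b c d).mem
  · exact (IsVertex.dv_phi_phi a b c).mem
  · exact (IsVertex.dv_u_ut a b c).mem
  · exact (IsVertex.v_v_phi_phi a b c d).mem
  · exact (IsVertex.dphi_v_phi a b c).mem
  · refine (IsVertex.v_v_phi_phi a c b d).mem_of_eq (Finset.sum_congr rfl fun μ _ => ?_)
    rw [← mul_assoc (F.phi b), F.phi_comm b, mul_assoc]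
  · refine (IsVertex.dphi_v_phi a c b).mem_of_eq (Finset.sum_congr rfl fun μ _ => ?_)
    rw [F.phi_comm b]
  · exact (IsVertex.du_ut_v a b c).mem
  · exact (IsVertex.dut_u_v a b c).mem
  · refine (IsVertex.v_v_phi_phi a d b c).mem_of_eq (Finset.sum_congr rfl fun μ _ => ?_)
    rw [F.v_comm d, mul_assoc]
  · refine (IsVertex.phi_v_v c a b).mem_of_eq (Finset.sum_congr rfl fun μ _ => ?_)
    rw [F.phi_comm c, mul_assoc]
  · refine (IsVertex.v_v_phi_phi b c a d).mem_of_eq (Finset.sum_congr rfl fun μ _ => ?_)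
    rw [F.phi_comm a, F.phi_comm a, mul_assoc, mul_assoc]
  · refine (IsVertex.phi_v_v b a c).mem_of_eq (Finset.sum_congr rfl fun μ _ => ?_)
    rw [F.v_comm a, F.v_comm a, mul_assoc]
  · refine (IsVertex.v_v_phi_phi b d c a).mem_of_eq (Finset.sum_congr rfl fun μ _ => ?_)
    rw [F.phi_comm a, F.phi_comm c]
    simp only [mul_assoc]
  · exact (IsVertex.phi_v_v a b c).mem
  · refine (IsVertex.v_v_phi_phi c d a b).mem_of_eq (Finset.sum_congr rfl fun μ _ => ?_)
    rw [F.phi_comm a, F.phi_comm b, F.phi_comm a]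
    simp only [mul_assoc]
  · exact (IsVertex.u_ut_v_v a b c d).mem
  · exact (IsVertex.dv_v_v a b c).mem
  · exact (IsVertex.v_v_v_v a b c d).mem
  · exact (IsVertex.dv_v_v' a b c).mem
  · refine (IsVertex.v_v_v_v a c b d).mem_of_eq
      (Finset.sum_congr rfl fun μ _ => Finset.sum_congr rfl fun ν _ => ?_)
    rw [← mul_assoc (F.v b ν), F.v_comm b, mul_assoc]
  · refine (IsVertex.dv_v_v' a c b).mem_of_eq
      (Finset.sum_congr rfl fun μ _ => Finset.sum_congr rfl fun ν _ => ?_)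
    rw [F.v_comm b]
  · refine (IsVertex.v_v_v_v a d b c).mem_of_eq
      (Finset.sum_congr rfl fun μ _ => Finset.sum_congr rfl fun ν _ => ?_)
    rw [F.v_comm d, mul_assoc]
  · exact (IsVertex.dv_v_v_levi a b c).mem
  · exact (IsVertex.v_v_v_v_levi a b c d).mem

theorem invariant_diracMonomial_sum_mem (A B : Dir) (c : Ind)
    (t : Fin 4 → Fin 4 → Option (Fin 4) → ℂ)
    (h : ∀ ρ σ s r i, ∑ s', t s' r i * cospinRot ρ σ s' s + (∑ r', t s r' i * spinRot ρ σ r' r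
      + ∑ i', t s r i' * optRot ρ σ i' i) = 0) :
    ∑ s, ∑ r, ∑ i, t s r i • F.diracMonomial A B c s r i ∈ F.invariantSpan :=
  invariant_dirac_sum_mem _ _ t h (fun ε => (IsVertex.dirac_phi A B c ε).mem)
    (fun ε => (IsVertex.dirac_v A B c ε).mem)

/-- Lorentz invariant interactions are combinations of Lorentz invariant vertices. -/
theorem mem_invariantSpan [Fintype Ind] [Fintype Dir] {T : F.Wick} (hT : T ∈ F.interactionSpace)
    (hLorentz : F.LorentzInvariant T) : T ∈ F.invariantSpan := by
  classical
  let R := fun g : Fin 4 × Fin 4 => optRot g.1 g.2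
  let X := fun g : Fin 4 × Fin 4 => Matrix.fromBlocks
    (kronSum (0 : Matrix (BoseVertex × Ind × Ind × Ind × Ind) _ ℂ)
      (kronSum (R g) (kronSum (R g) (kronSum (R g) (R g))))) 0 0
    (kronSum (0 : Matrix (Dir × Dir × Ind) _ ℂ)
      (kronSum (cospinRot g.1 g.2) (kronSum (spinRot g.1 g.2) (R g))))
  have hT' := F.interactionSpace_le hT
  rw [vertexSpan, ← Submodule.span_union, ← Set.Sum.elim_range] at hT'
  obtain ⟨t, rfl, ht⟩ := exists_invariant_coeff (fun g : Fin 4 × Fin 4 => F.lorentz g.1 g.2) X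
    (fun g => -(eta g.1 * eta g.2)) (fun g => neg_ne_zero.2 (mul_ne_zero (eta_ne_zero _)
      (eta_ne_zero _))) (fun g => by
      have hR := optRot_conjTranspose g.1 g.2
      simp only [X, R]
      rw [Matrix.fromBlocks_conjTranspose, kronSum_conjTranspose (s := -(eta g.1 * eta g.2))
        (by simp) (kronSum_conjTranspose hR (kronSum_conjTranspose hR (kronSum_conjTranspose hR hR))),
        kronSum_conjTranspose (s := -(eta g.1 * eta g.2)) (by simp)
          (kronSum_conjTranspose (cospinRot_conjTranspose _ _)
            (kronSum_conjTranspose (spinRot_conjTranspose _ _) hR))]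
      rw [Matrix.fromBlocks_smul]
      simp) _ (by
      rintro ⟨ρ, σ⟩ (⟨⟨τ, a, b, c, d⟩, ⟨i, j, k, l⟩⟩ | ⟨⟨A, B, c⟩, ⟨s, r, k⟩⟩)
      · simp only [X, R, Sum.elim_inl, Fintype.sum_sum_type, Matrix.fromBlocks_apply₁₁,
          Matrix.fromBlocks_apply₁₂, Matrix.zero_apply, zero_smul, Finset.sum_const_zero, add_zero]
        rw [sum_kronSum_smul, sum_kronSum_smul, sum_kronSum_smul, sum_kronSum_smul]
        simp only [Matrix.zero_apply, zero_smul, Finset.sum_const_zero, zero_add]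
        exact F.lorentz_boseMonomial ρ σ τ a b c d i j k l
      · simp only [X, R, Sum.elim_inr, Fintype.sum_sum_type, Matrix.fromBlocks_apply₂₁,
          Matrix.fromBlocks_apply₂₂, Matrix.zero_apply, zero_smul, Finset.sum_const_zero, zero_add]
        rw [sum_kronSum_smul, sum_kronSum_smul, sum_kronSum_smul]
        simp only [Matrix.zero_apply, zero_smul, Finset.sum_const_zero, zero_add]
        exact F.lorentz_diracMonomial ρ σ A B c s r k) hT' (fun g => hLorentz g.1 g.2)
  simp only [Fintype.sum_sum_type, Fintype.sum_prod_type, Sum.elim_inl, Sum.elim_inr]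
  refine Submodule.add_mem _ (Submodule.sum_mem _ fun τ _ => Submodule.sum_mem _ fun a _ =>
    Submodule.sum_mem _ fun b _ => Submodule.sum_mem _ fun c _ => Submodule.sum_mem _ fun d _ => ?_)
    (Submodule.sum_mem _ fun A _ => Submodule.sum_mem _ fun B _ => Submodule.sum_mem _ fun c _ => ?_)
  · refine F.invariant_boseMonomial_sum_mem τ a b c d
      (fun i j k l => t (Sum.inl ((τ, a, b, c, d), (i, j, k, l)))) fun ρ σ i j k l => ?_
    have := ht (ρ, σ) (Sum.inl ((τ, a, b, c, d), (i, j, k, l)))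
    simp only [X, R, Fintype.sum_sum_type, Matrix.fromBlocks_apply₁₁,
      Matrix.fromBlocks_apply₂₁, Matrix.zero_apply, mul_zero, Finset.sum_const_zero, add_zero] at this
    rw [sum_mul_kronSum (t := fun p => t (Sum.inl p))] at this
    simp only [Matrix.zero_apply, mul_zero, Finset.sum_const_zero, zero_add] at this
    rw [sum_mul_kronSum (t := fun p => t (Sum.inl (_, p))),
      sum_mul_kronSum (t := fun p => t (Sum.inl (_, (_, p)))),
      sum_mul_kronSum (t := fun p => t (Sum.inl (_, (_, (_, p)))))] at this
    exact this
  · refine F.invariant_diracMonomial_sum_mem A B c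
      (fun s r k => t (Sum.inr ((A, B, c), (s, r, k)))) fun ρ σ s r k => ?_
    have := ht (ρ, σ) (Sum.inr ((A, B, c), (s, r, k)))
    simp only [X, R, Fintype.sum_sum_type, Matrix.fromBlocks_apply₁₂,
      Matrix.fromBlocks_apply₂₂, Matrix.zero_apply, mul_zero, Finset.sum_const_zero, zero_add] at this
    rw [sum_mul_kronSum (t := fun p => t (Sum.inr p))] at this
    simp only [Matrix.zero_apply, mul_zero, Finset.sum_const_zero, zero_add] at this
    rw [sum_mul_kronSum (t := fun p => t (Sum.inr (_, p))),
      sum_mul_kronSum (t := fun p => t (Sum.inr (_, (_, p))))] at this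
    exact this

end FieldContent
namespace FieldContent
variable {Ind Dir : Type*} (F : FieldContent Ind Dir)

/-! ### Reduction modulo co-boundaries -/

/-- Shapes of trilinear vertices without Dirac fields that suffice modulo co-boundaries. -/
inductive CubicShape
  | vvv
  | levi
  | pvp
  | uadv
  | dauv
  | pvv
  | ppp
  | uap

/-- Shapes of quadrilinear vertices. -/
inductive QuarticShape
  | pppp
  | vvpp
  | vvvv
  | levi
  | uapp
  | uavv
  | uuaa

instance : Fintype CubicShape where
  elems := ⟨{.vvv, .levi, .pvp, .uadv, .dauv, .pvv, .ppp, .uap}, by simp⟩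
  complete x := by cases x <;> simp

instance : Fintype QuarticShape where
  elems := ⟨{.pppp, .vvpp, .vvvv, .levi, .uapp, .uavv, .uuaa}, by simp⟩
  complete x := by cases x <;> simp

/-- The trilinear vertices without Dirac fields that suffice modulo co-boundaries. -/
def cubicVertex : CubicShape → Ind → Ind → Ind → F.Wick
  | .vvv, a, b, c =>
    ∑ μ, ∑ ν, (eta μ * eta ν) • (F.pd μ (F.v a ν) * (F.v b μ * F.v c ν))
      - ∑ μ, ∑ ν, (eta μ * eta ν) • (F.pd μ (F.v c ν) * (F.v b μ * F.v a ν))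
  | .levi, a, b, c =>
    ∑ κ, ∑ l, ∑ μ, ∑ ν, YangMills.levi κ l μ ν • (F.pd κ (F.v a l) * (F.v b μ * F.v c ν))
  | .pvp, a, b, c =>
    ∑ μ, eta μ • (F.pd μ (F.phi a) * (F.v b μ * F.phi c))
      - ∑ μ, eta μ • (F.pd μ (F.phi c) * (F.v b μ * F.phi a))
  | .uadv, a, b, c =>
    ∑ μ, eta μ • (F.pd μ (F.v c μ) * (F.u a * F.ut b))
      + ∑ μ, eta μ • (F.pd μ (F.v b μ) * (F.u a * F.ut c))
  | .dauv, a, b, c => ∑ μ, eta μ • (F.pd μ (F.ut a) * (F.u b * F.v c μ))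
  | .pvv, a, b, c => ∑ μ, eta μ • (F.phi a * (F.v b μ * F.v c μ))
  | .ppp, a, b, c => F.phi a * (F.phi b * F.phi c)
  | .uap, a, b, c => F.u a * (F.ut b * F.phi c)

/-- The quadrilinear vertices. -/
def quarticVertex : QuarticShape → Ind → Ind → Ind → Ind → F.Wick
  | .pppp, a, b, c, d => F.phi a * (F.phi b * (F.phi c * F.phi d))
  | .vvpp, a, b, c, d => ∑ μ, eta μ • (F.v a μ * (F.v b μ * (F.phi c * F.phi d)))
  | .vvvv, a, b, c, d =>
    ∑ μ, ∑ ν, (eta μ * eta ν) • (F.v a μ * (F.v b μ * (F.v c ν * F.v d ν)))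
  | .levi, a, b, c, d =>
    ∑ κ, ∑ l, ∑ μ, ∑ ν, YangMills.levi κ l μ ν • (F.v a κ * (F.v b l * (F.v c μ * F.v d ν)))
  | .uapp, a, b, c, d => F.u a * (F.ut b * (F.phi c * F.phi d))
  | .uavv, a, b, c, d => ∑ μ, eta μ • (F.u a * (F.ut b * (F.v c μ * F.v d μ)))
  | .uuaa, a, b, c, d => F.u a * (F.u b * (F.ut c * F.ut d))

/-- The coupling of `Φ_c` to the chiral Dirac fields. -/
def scalarVertex (ε : ℤˣ) (A B : Dir) (c : Ind) : F.Wick :=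
  ∑ s, ∑ r, chiral ε s r • (F.psibar A s * (F.psi B r * F.phi c))

/-- The coupling of `v_c` to the chiral Dirac fields. -/
def vectorVertex (ε : ℤˣ) (A B : Dir) (c : Ind) : F.Wick :=
  ∑ μ, ∑ s, ∑ r, (gamma μ * chiral ε) s r • (F.psibar A s * (F.psi B r * F.v c μ))

/-- The vertices that suffice modulo co-boundaries, as one family. -/
def vertex : (CubicShape × Ind × Ind × Ind) ⊕ (QuarticShape × Ind × Ind × Ind × Ind) ⊕
    (ℤˣ × Dir × Dir × Ind) ⊕ (ℤˣ × Dir × Dir × Ind) → F.Wick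
  | .inl (τ, a, b, c) => F.cubicVertex τ a b c
  | .inr (.inl (τ, a, b, c, d)) => F.quarticVertex τ a b c d
  | .inr (.inr (.inl (ε, A, B, c))) => F.scalarVertex ε A B c
  | .inr (.inr (.inr (ε, A, B, c))) => F.vectorVertex ε A B c

/-- The span of the vertices and the co-boundaries. -/
def reducedSpan : Submodule ℂ F.Wick :=
  F.coboundaries ⊔ Submodule.span ℂ (Set.range F.vertex)

theorem dQ_mem_reducedSpan (w : F.Wick) : F.dQ w ∈ F.reducedSpan :=
  Submodule.mem_sup_left (F.dQ_mem_coboundaries w)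

theorem divergence_mem_reducedSpan (J : Fin 4 → F.Wick) : F.divergence J ∈ F.reducedSpan :=
  Submodule.mem_sup_left (F.divergence_mem_coboundaries J)

theorem cubicVertex_mem (τ : CubicShape) (a b c : Ind) : F.cubicVertex τ a b c ∈ F.reducedSpan :=
  Submodule.mem_sup_right (Submodule.subset_span ⟨.inl (τ, a, b, c), rfl⟩)

theorem quarticVertex_mem (τ : QuarticShape) (a b c d : Ind) :
    F.quarticVertex τ a b c d ∈ F.reducedSpan :=
  Submodule.mem_sup_right (Submodule.subset_span ⟨.inr (.inl (τ, a, b, c, d)), rfl⟩)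

theorem scalarVertex_mem (ε : ℤˣ) (A B : Dir) (c : Ind) : F.scalarVertex ε A B c ∈ F.reducedSpan :=
  Submodule.mem_sup_right (Submodule.subset_span ⟨.inr (.inr (.inl (ε, A, B, c))), rfl⟩)

theorem vectorVertex_mem (ε : ℤˣ) (A B : Dir) (c : Ind) : F.vectorVertex ε A B c ∈ F.reducedSpan :=
  Submodule.mem_sup_right (Submodule.subset_span ⟨.inr (.inr (.inr (ε, A, B, c))), rfl⟩)

/-! Leibniz rules for the fields. -/

theorem dQ_v_mul (a : Ind) (μ : Fin 4) (w : F.Wick) : F.dQ (F.v a μ * w)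
    = Complex.I • (F.pd μ (F.u a) * w) + F.v a μ * F.dQ w := by
  rw [v, F.dQ_bose_mul rfl, dQ_v, smul_mul_assoc, u, pd_jet]

theorem dQ_phi_mul (a : Ind) (w : F.Wick) : F.dQ (F.phi a * w)
    = (Complex.I * F.gaugeMass a) • (F.u a * w) + F.phi a * F.dQ w := by
  rw [phi, F.dQ_bose_mul rfl, dQ_phi, smul_mul_assoc, u]

theorem dQ_u_mul (a : Ind) (w : F.Wick) : F.dQ (F.u a * w) = -(F.u a * F.dQ w) := by
  rw [u, F.dQ_fermi_mul rfl, dQ_u, zero_mul, zero_sub]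

theorem dQ_ut_field (a : Ind) : F.dQ (F.ut a) = -Complex.I •
    ((∑ μ, eta μ • F.pd μ (F.v a μ)) + (F.gaugeMass a : ℂ) • F.phi a) := by
  simp only [ut, dQ_ut, v, pd_jet, phi]

theorem dQ_ut_mul (a : Ind) (w : F.Wick) : F.dQ (F.ut a * w)
    = -Complex.I • (∑ μ, eta μ • (F.pd μ (F.v a μ) * w) + (F.gaugeMass a : ℂ) • (F.phi a * w))
      - F.ut a * F.dQ w := by
  rw [ut, F.dQ_fermi_mul rfl, ← ut.eq_1, dQ_ut_field]
  simp only [smul_mul_assoc, add_mul, Finset.sum_mul]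

theorem dQ_phi_field (a : Ind) : F.dQ (F.phi a) = (Complex.I * F.gaugeMass a) • F.u a := by
  rw [phi, dQ_phi, u]

theorem dQ_v_field (a : Ind) (μ : Fin 4) : F.dQ (F.v a μ) = Complex.I • F.pd μ (F.u a) := by
  rw [v, dQ_v, u, pd_jet]

theorem dQ_u_field (a : Ind) : F.dQ (F.u a) = 0 := F.dQ_u a 0

theorem pd_phi_comm (μ : Fin 4) (a : Ind) (w : F.Wick) :
    F.pd μ (F.phi a) * w = w * F.pd μ (F.phi a) := by
  rw [phi, pd_jet]; exact F.bose_comm rfl w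

theorem pd_v_comm (μ ν : Fin 4) (a : Ind) (w : F.Wick) :
    F.pd μ (F.v a ν) * w = w * F.pd μ (F.v a ν) := by
  rw [v, pd_jet]; exact F.bose_comm rfl w

theorem pd_u_mul_ut (μ : Fin 4) (a b : Ind) :
    F.ut b * F.pd μ (F.u a) = -(F.pd μ (F.u a) * F.ut b) := by
  rw [u, pd_jet]; exact F.fermi_comm rfl rfl

theorem pd_ut_mul_u (μ : Fin 4) (a b : Ind) :
    F.u a * F.pd μ (F.ut b) = -(F.pd μ (F.ut b) * F.u a) := by
  rw [ut, pd_jet]; exact F.fermi_comm rfl rfl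

/-- `∂·v_a Φ_b Φ_c`, from the gauge variation of `ũ_a Φ_b Φ_c`. -/
theorem dv_phi_phi_mem (a b c : Ind) :
    ∑ μ, eta μ • (F.pd μ (F.v a μ) * (F.phi b * F.phi c)) ∈ F.reducedSpan := by
  have h1 : F.ut a * (F.u b * F.phi c) = -(F.u b * (F.ut a * F.phi c)) := by
    rw [← mul_assoc, ut_mul_u, wick_neg_mul, mul_assoc]
  have h2 : F.ut a * (F.phi b * F.u c) = -(F.u c * (F.ut a * F.phi b)) := by
    rw [F.phi_comm, ← mul_assoc, ut_mul_u, wick_neg_mul, mul_assoc]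
  have h := F.dQ_ut_mul a (F.phi b * F.phi c)
  rw [dQ_phi_mul, dQ_phi_field, mul_smul_comm, mul_add, mul_smul_comm, mul_smul_comm, h1, h2] at h
  have e : ∑ μ, eta μ • (F.pd μ (F.v a μ) * (F.phi b * F.phi c))
      = Complex.I • F.dQ (F.ut a * (F.phi b * F.phi c))
        - (F.gaugeMass a : ℂ) • F.cubicVertex .ppp a b c
        + (F.gaugeMass b : ℂ) • F.cubicVertex .uap b a c
        + (F.gaugeMass c : ℂ) • F.cubicVertex .uap c a b := by
    rw [h]
    simp only [cubicVertex]
    have hI := Complex.I_mul_I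
    generalize (∑ μ, eta μ • (F.pd μ (F.v a μ) * (F.phi b * F.phi c))) = S
    match_scalars
    · linear_combination hI
    · linear_combination F.gaugeMass a * hI
    · linear_combination -F.gaugeMass b * hI
    · linear_combination -F.gaugeMass c * hI
  rw [e]
  exact Submodule.add_mem _ (Submodule.add_mem _ (Submodule.sub_mem _
    (Submodule.smul_mem _ _ (F.dQ_mem_reducedSpan _)) (Submodule.smul_mem _ _ (F.cubicVertex_mem _ _ _ _)))
    (Submodule.smul_mem _ _ (F.cubicVertex_mem _ _ _ _)))
    (Submodule.smul_mem _ _ (F.cubicVertex_mem _ _ _ _))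

theorem half_mem {S : Submodule ℂ F.Wick} {w z : F.Wick} (h1 : w - z ∈ S) (h2 : w + z ∈ S) :
    w ∈ S := by
  have e : w = (1 / 2 : ℂ) • (w - z) + (1 / 2 : ℂ) • (w + z) := by module
  rw [e]
  exact S.add_mem (S.smul_mem _ h1) (S.smul_mem _ h2)

/-- Antisymmetric in `a` and `c` this is a vertex; the symmetric part is, up to `∂·v_b Φ_a Φ_c`, the
divergence of `v_b^μ Φ_a Φ_c`. -/
theorem dphi_v_phi_mem (a b c : Ind) :
    ∑ μ, eta μ • (F.pd μ (F.phi a) * (F.v b μ * F.phi c)) ∈ F.reducedSpan := by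
  refine F.half_mem (F.cubicVertex_mem .pvp a b c) ?_
  have e : F.divergence (fun μ => eta μ • (F.v b μ * (F.phi a * F.phi c)))
      = ∑ μ, eta μ • (F.pd μ (F.v b μ) * (F.phi a * F.phi c))
        + (∑ μ, eta μ • (F.pd μ (F.phi a) * (F.v b μ * F.phi c))
          + ∑ μ, eta μ • (F.pd μ (F.phi c) * (F.v b μ * F.phi a))) := by
    rw [divergence, ← Finset.sum_add_distrib, ← Finset.sum_add_distrib]
    refine Finset.sum_congr rfl fun μ _ => ?_
    rw [map_smul, pd_mul, pd_mul, mul_add, F.pd_phi_comm μ a, F.pd_phi_comm μ c, F.phi_comm a,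
      F.pd_phi_comm μ a]
    simp only [mul_assoc, smul_add]
  have h := F.divergence_mem_reducedSpan (fun μ => eta μ • (F.v b μ * (F.phi a * F.phi c)))
  rw [e] at h
  exact (Submodule.add_mem_iff_right _ (F.dv_phi_phi_mem b a c)).1 h

/-- Symmetric in `a` and `c` this is a vertex; the antisymmetric part comes from the gauge variation
of `u_b ũ_c ũ_a`. -/
theorem dv_u_ut_mem (a b c : Ind) :
    ∑ μ, eta μ • (F.pd μ (F.v a μ) * (F.u b * F.ut c)) ∈ F.reducedSpan := by
  refine F.half_mem (z := ∑ μ, eta μ • (F.pd μ (F.v c μ) * (F.u b * F.ut a))) ?_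
    (F.cubicVertex_mem .uadv b c a)
  have e1 : ∀ c, F.u b * (F.ut a * F.phi c) = F.u b * (F.phi c * F.ut a) := fun c => by
    rw [F.phi_comm]
  have h := F.dQ_u_mul b (F.ut c * F.ut a)
  rw [dQ_ut_mul, dQ_ut_field] at h
  have e : ∑ μ, eta μ • (F.pd μ (F.v a μ) * (F.u b * F.ut c))
        - ∑ μ, eta μ • (F.pd μ (F.v c μ) * (F.u b * F.ut a))
      = Complex.I • F.dQ (F.u b * (F.ut c * F.ut a)) + (F.gaugeMass c : ℂ) • F.cubicVertex .uap b a c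
        - (F.gaugeMass a : ℂ) • F.cubicVertex .uap b c a := by
    rw [h]
    have e2 : ∀ a c, ∑ μ, eta μ • (F.pd μ (F.v a μ) * (F.u b * F.ut c))
        = F.u b * ∑ μ, eta μ • (F.pd μ (F.v a μ) * F.ut c) := fun a c => by
      rw [Finset.mul_sum]
      refine Finset.sum_congr rfl fun μ _ => ?_
      rw [mul_smul_comm, F.pd_v_comm, F.pd_v_comm, mul_assoc]
    have e3 : F.ut c * ∑ μ, eta μ • F.pd μ (F.v a μ)
        = ∑ μ, eta μ • (F.pd μ (F.v a μ) * F.ut c) := by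
      rw [Finset.mul_sum]
      refine Finset.sum_congr rfl fun μ _ => ?_
      rw [mul_smul_comm, F.pd_v_comm]
    rw [e2, e2]
    simp only [cubicVertex, mul_smul_comm, mul_add, wick_mul_sub, e3, F.phi_comm c]
    have hI := Complex.I_mul_I
    match_scalars
    · linear_combination hI
    · linear_combination -hI
    · linear_combination -F.gaugeMass c * hI
    · linear_combination F.gaugeMass a * hI
  rw [e]
  exact Submodule.sub_mem _ (Submodule.add_mem _ (Submodule.smul_mem _ _ (F.dQ_mem_reducedSpan _))
    (Submodule.smul_mem _ _ (F.cubicVertex_mem _ _ _ _)))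
    (Submodule.smul_mem _ _ (F.cubicVertex_mem _ _ _ _))

/-- From the divergence of `u_a ũ_b v_c^μ`. -/
theorem du_ut_v_mem (a b c : Ind) :
    ∑ μ, eta μ • (F.pd μ (F.u a) * (F.ut b * F.v c μ)) ∈ F.reducedSpan := by
  have e : ∑ μ, eta μ • (F.pd μ (F.u a) * (F.ut b * F.v c μ))
      = F.divergence (fun μ => eta μ • (F.u a * (F.ut b * F.v c μ))) + F.cubicVertex .dauv b a c
        - ∑ μ, eta μ • (F.pd μ (F.v c μ) * (F.u a * F.ut b)) := by
    rw [divergence, cubicVertex, ← Finset.sum_add_distrib, ← Finset.sum_sub_distrib]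
    refine Finset.sum_congr rfl fun μ _ => ?_
    rw [map_smul, pd_mul, pd_mul, mul_add, ← mul_assoc (F.u a) (F.pd μ (F.ut b)), pd_ut_mul_u,
      wick_neg_mul, F.pd_v_comm, ← mul_assoc (F.u a), mul_assoc (F.pd μ (F.ut b))]
    module
  rw [e]
  exact Submodule.sub_mem _ (Submodule.add_mem _ (F.divergence_mem_reducedSpan _)
    (F.cubicVertex_mem _ _ _ _)) (F.dv_u_ut_mem c a b)

/-- From the gauge variation of `ũ_a v_b·v_c`. -/
theorem dv_v_v_mem (a b c : Ind) :
    ∑ μ, ∑ ν, (eta μ * eta ν) • (F.pd μ (F.v a μ) * (F.v b ν * F.v c ν)) ∈ F.reducedSpan := by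
  have e : ∑ μ, ∑ ν, (eta μ * eta ν) • (F.pd μ (F.v a μ) * (F.v b ν * F.v c ν))
      = Complex.I • F.dQ (∑ ν, eta ν • (F.ut a * (F.v b ν * F.v c ν)))
        - (F.gaugeMass a : ℂ) • F.cubicVertex .pvv a b c
        + (∑ μ, eta μ • (F.pd μ (F.u b) * (F.ut a * F.v c μ))
          + ∑ μ, eta μ • (F.pd μ (F.u c) * (F.ut a * F.v b μ))) := by
    rw [map_sum, Finset.smul_sum, cubicVertex, Finset.smul_sum, Finset.sum_comm,
      ← Finset.sum_sub_distrib, ← Finset.sum_add_distrib, ← Finset.sum_add_distrib]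
    refine Finset.sum_congr rfl fun ν _ => ?_
    have h1 : F.ut a * (F.pd ν (F.u b) * F.v c ν) = -(F.pd ν (F.u b) * (F.ut a * F.v c ν)) := by
      rw [← mul_assoc, pd_u_mul_ut, wick_neg_mul, mul_assoc]
    have h2 : F.ut a * (F.v b ν * F.pd ν (F.u c)) = -(F.pd ν (F.u c) * (F.ut a * F.v b ν)) := by
      rw [F.v_comm, ← mul_assoc, pd_u_mul_ut, wick_neg_mul, mul_assoc]
    have h3 : ∑ μ, (eta μ * eta ν) • (F.pd μ (F.v a μ) * (F.v b ν * F.v c ν))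
        = eta ν • ∑ μ, eta μ • (F.pd μ (F.v a μ) * (F.v b ν * F.v c ν)) := by
      rw [Finset.smul_sum]
      exact Finset.sum_congr rfl fun μ _ => by rw [smul_smul, mul_comm]
    rw [map_smul, dQ_ut_mul, dQ_v_mul, dQ_v_field, mul_add, mul_smul_comm, mul_smul_comm,
      mul_smul_comm, h1, h2, h3]
    generalize (∑ μ, eta μ • (F.pd μ (F.v a μ) * (F.v b ν * F.v c ν))) = S
    have hI := Complex.I_mul_I
    match_scalars
    · linear_combination eta ν * hI
    · linear_combination eta ν * F.gaugeMass a * hI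
    · linear_combination -eta ν * hI
    · linear_combination -eta ν * hI
  rw [e]
  exact Submodule.add_mem _ (Submodule.sub_mem _ (Submodule.smul_mem _ _ (F.dQ_mem_reducedSpan _))
    (Submodule.smul_mem _ _ (F.cubicVertex_mem _ _ _ _)))
    (Submodule.add_mem _ (F.du_ut_v_mem b a c) (F.du_ut_v_mem c a b))

/-- Antisymmetric in `a` and `c` this is a vertex; the symmetric part is, up to `∂·v_b v_a·v_c`, the
divergence of `v_b^μ v_a·v_c`. -/
theorem dv_v_v'_mem (a b c : Ind) :
    ∑ μ, ∑ ν, (eta μ * eta ν) • (F.pd μ (F.v a ν) * (F.v b μ * F.v c ν)) ∈ F.reducedSpan := by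
  refine F.half_mem (F.cubicVertex_mem .vvv a b c) ?_
  have e : F.divergence (fun μ => ∑ ν, (eta μ * eta ν) • (F.v b μ * (F.v a ν * F.v c ν)))
      = ∑ μ, ∑ ν, (eta μ * eta ν) • (F.pd μ (F.v b μ) * (F.v a ν * F.v c ν))
        + (∑ μ, ∑ ν, (eta μ * eta ν) • (F.pd μ (F.v a ν) * (F.v b μ * F.v c ν))
          + ∑ μ, ∑ ν, (eta μ * eta ν) • (F.pd μ (F.v c ν) * (F.v b μ * F.v a ν))) := by
    simp only [divergence, map_sum, ← Finset.sum_add_distrib]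
    refine Finset.sum_congr rfl fun μ _ => Finset.sum_congr rfl fun ν _ => ?_
    rw [map_smul, pd_mul, pd_mul, mul_add, smul_add, smul_add]
    congr 2
    · rw [← mul_assoc, F.v_comm, mul_assoc]
    · rw [← mul_assoc, F.pd_v_comm]
  have h := F.divergence_mem_reducedSpan
    (fun μ => ∑ ν, (eta μ * eta ν) • (F.v b μ * (F.v a ν * F.v c ν)))
  rw [e] at h
  exact (Submodule.add_mem_iff_right _ (F.dv_v_v_mem b a c)).1 h

/-- Modulo co-boundaries, every Lorentz invariant interaction is a combination of the vertices. -/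
theorem invariantSpan_le : F.invariantSpan ≤ F.reducedSpan := by
  refine Submodule.span_le.2 fun w hw => ?_
  cases hw with
  | phi_phi_phi a b c => exact F.cubicVertex_mem .ppp a b c
  | phi_v_v a b c => exact F.cubicVertex_mem .pvv a b c
  | dv_phi_phi a b c => exact F.dv_phi_phi_mem a b c
  | dphi_v_phi a b c => exact F.dphi_v_phi_mem a b c
  | dv_v_v a b c => exact F.dv_v_v_mem a b c
  | dv_v_v' a b c => exact F.dv_v_v'_mem a b c
  | dv_v_v_levi a b c => exact F.cubicVertex_mem .levi a b c
  | u_ut_phi a b c => exact F.cubicVertex_mem .uap a b c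
  | du_ut_v a b c => exact F.du_ut_v_mem a b c
  | dut_u_v a b c => exact F.cubicVertex_mem .dauv a b c
  | dv_u_ut a b c => exact F.dv_u_ut_mem a b c
  | dirac_phi A B c ε => exact F.scalarVertex_mem ε A B c
  | dirac_v A B c ε => exact F.vectorVertex_mem ε A B c
  | phi_phi_phi_phi a b c d => exact F.quarticVertex_mem .pppp a b c d
  | v_v_phi_phi a b c d => exact F.quarticVertex_mem .vvpp a b c d
  | v_v_v_v a b c d => exact F.quarticVertex_mem .vvvv a b c d
  | v_v_v_v_levi a b c d => exact F.quarticVertex_mem .levi a b c d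
  | u_ut_phi_phi a b c d => exact F.quarticVertex_mem .uapp a b c d
  | u_ut_v_v a b c d => exact F.quarticVertex_mem .uavv a b c d
  | u_u_ut_ut a b c d => exact F.quarticVertex_mem .uuaa a b c d

/-- A cyclic sum of the parity violating vertices is a divergence. -/
theorem levi_cyclic_mem (a b c : Ind) : F.cubicVertex .levi a b c + F.cubicVertex .levi b c a
    + F.cubicVertex .levi c a b ∈ F.coboundaries := by
  have hl : ∀ κ l μ ν, YangMills.levi κ l μ ν = YangMills.levi κ μ ν l := fun κ l μ ν => by
    simp only [YangMills.levi]; ring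
  have e : F.divergence (fun κ => ∑ l, ∑ μ, ∑ ν, YangMills.levi κ l μ ν •
      (F.v a l * (F.v b μ * F.v c ν))) = F.cubicVertex .levi a b c + F.cubicVertex .levi b c a
      + F.cubicVertex .levi c a b := by
    simp only [divergence, map_sum, cubicVertex, ← Finset.sum_add_distrib]
    refine Finset.sum_congr rfl fun κ _ => ?_
    have h (g : Fin 4 → Fin 4 → Fin 4 → F.Wick) : ∑ l, ∑ μ, ∑ ν, YangMills.levi κ l μ ν • g l μ ν
        = ∑ l, ∑ μ, ∑ ν, YangMills.levi κ l μ ν • g μ ν l := by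
      conv_rhs => rw [Finset.sum_comm]
      rw [Finset.sum_comm]
      conv_lhs => rw [Finset.sum_comm]
      refine Finset.sum_congr rfl fun l _ => ?_
      conv_rhs => rw [Finset.sum_comm]
      refine Finset.sum_congr rfl fun μ _ => Finset.sum_congr rfl fun ν _ => ?_
      rw [hl κ ν l μ]
    simp only [Finset.sum_add_distrib]
    rw [h fun l μ ν => F.pd κ (F.v b l) * (F.v c μ * F.v a ν),
      h fun l μ ν => F.pd κ (F.v c l) * (F.v a μ * F.v b ν),
      h fun l μ ν => F.pd κ (F.v c μ) * (F.v a ν * F.v b l)]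
    simp only [← Finset.sum_add_distrib]
    refine Finset.sum_congr rfl fun l _ => Finset.sum_congr rfl fun μ _ =>
      Finset.sum_congr rfl fun ν _ => ?_
    rw [map_smul, pd_mul, pd_mul, mul_add, F.v_comm a l (F.pd κ _ * _),
      ← mul_assoc (F.v a l) (F.v b μ), ← F.pd_v_comm κ ν c, mul_assoc (F.pd κ (F.v b μ)),
      smul_add, smul_add, add_assoc]
  rw [← e]
  exact F.divergence_mem_coboundaries _

end FieldContent

/-- A vector in the span of the `X i` modulo a subspace `S` has coefficients that are orthogonal to
all linear relations between the `X i` modulo `S`. -/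
theorem exists_orthogonal_coeff {ι W : Type*} [Fintype ι] [AddCommGroup W] [Module ℂ W]
    (S : Submodule ℂ W) (X : ι → W) {T : W} (hT : T ∈ S ⊔ Submodule.span ℂ (Set.range X)) :
    ∃ k : ι → ℂ, T - ∑ i, k i • X i ∈ S ∧
      ∀ r : ι → ℝ, ∑ i, (r i : ℂ) • X i ∈ S → ∑ i, k i * r i = 0 := by
  obtain ⟨w, hw, z, hz, rfl⟩ := Submodule.mem_sup.1 hT
  obtain ⟨c, rfl⟩ := (Submodule.mem_span_range_iff_exists_fun ℂ).1 hz
  let L : EuclideanSpace ℂ ι →ₗ[ℂ] W ⧸ S :=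
    S.mkQ ∘ₗ Fintype.linearCombination ℂ X ∘ₗ (WithLp.linearEquiv 2 ℂ (ι → ℂ)).toLinearMap
  have hL : ∀ x, L x = S.mkQ (∑ i, x i • X i) := fun x => by
    simp [L, Fintype.linearCombination_apply]
  obtain ⟨y, hy, t, ht, hyt⟩ := (LinearMap.ker L).exists_add_mem_mem_orthogonal (WithLp.toLp 2 c)
  refine ⟨t.ofLp, ?_, fun r hr => ?_⟩
  · have h1 : S.mkQ (∑ i, y i • X i) = 0 := by rw [← hL]; exact hy
    have h2 : c = y.ofLp + t.ofLp := by
      have := congrArg WithLp.ofLp hyt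
      simpa using this
    rw [← LinearMap.mem_ker, Submodule.ker_mkQ] at h1
    have h3 : w + ∑ i, c i • X i - ∑ i, t.ofLp i • X i = w + ∑ i, y i • X i := by
      rw [h2]
      simp only [Pi.add_apply, add_smul, Finset.sum_add_distrib]
      abel
    rw [h3]
    exact S.add_mem hw h1
  · have hr' : (WithLp.toLp 2 fun i => (r i : ℂ)) ∈ LinearMap.ker L := by
      rw [LinearMap.mem_ker, hL, ← LinearMap.mem_ker, Submodule.ker_mkQ]
      exact hr
    have h := (Submodule.mem_orthogonal _ _).1 ht _ hr'
    rw [EuclideanSpace.inner_eq_star_dotProduct] at h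
    simpa [dotProduct] using h

/-- The coefficients of the vertices in an interaction. -/
structure VertexCoeffs (Ind Dir : Type*) where
  cubic : FieldContent.CubicShape → Ind → Ind → Ind → ℂ
  quartic : FieldContent.QuarticShape → Ind → Ind → Ind → Ind → ℂ
  scalar : ℤˣ → Dir → Dir → Ind → ℂ
  vector : ℤˣ → Dir → Dir → Ind → ℂ

namespace FieldContent
variable {Ind Dir : Type*} (F : FieldContent Ind Dir)

section

variable [Fintype Ind] [Fintype Dir]

/-- The interaction with given coefficients of the vertices. -/
def interaction (k : VertexCoeffs Ind Dir) : F.Wick :=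
  (∑ τ, ∑ a, ∑ b, ∑ c, k.cubic τ a b c • F.cubicVertex τ a b c)
    + (∑ τ, ∑ a, ∑ b, ∑ c, ∑ d, k.quartic τ a b c d • F.quarticVertex τ a b c d)
    + (∑ ε, ∑ A, ∑ B, ∑ c, k.scalar ε A B c • F.scalarVertex ε A B c)
    + ∑ ε, ∑ A, ∑ B, ∑ c, k.vector ε A B c • F.vectorVertex ε A B c

end

/-- The symmetries of vertex coefficients: they have the symmetries of the vertices, and vanish where
the vertices vanish; `levi_cyclic` reflects that a cyclic sum of the parity violating vertices is a
divergence. -/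
structure VertexCoeffs.IsNormal (k : VertexCoeffs Ind Dir) : Prop where
  cubic_zero : ∀ τ a b c, F.cubicVertex τ a b c = 0 → k.cubic τ a b c = 0
  quartic_zero : ∀ τ a b c d, F.quarticVertex τ a b c d = 0 → k.quartic τ a b c d = 0
  scalar_zero : ∀ ε A B c, F.scalarVertex ε A B c = 0 → k.scalar ε A B c = 0
  vector_zero : ∀ ε A B c, F.vectorVertex ε A B c = 0 → k.vector ε A B c = 0
  cubic_eq : ∀ τ a b c a' b' c', F.cubicVertex τ a b c = F.cubicVertex τ a' b' c' →
    k.cubic τ a b c = k.cubic τ a' b' c'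
  cubic_neg : ∀ τ a b c a' b' c', F.cubicVertex τ a b c = -F.cubicVertex τ a' b' c' →
    k.cubic τ a b c = -k.cubic τ a' b' c'
  quartic_eq : ∀ τ a b c d a' b' c' d', F.quarticVertex τ a b c d = F.quarticVertex τ a' b' c' d' →
    k.quartic τ a b c d = k.quartic τ a' b' c' d'
  quartic_neg : ∀ τ a b c d a' b' c' d',
    F.quarticVertex τ a b c d = -F.quarticVertex τ a' b' c' d' →
    k.quartic τ a b c d = -k.quartic τ a' b' c' d'
  levi_cyclic : ∀ a b c, k.cubic .levi a b c + k.cubic .levi b c a + k.cubic .levi c a b = 0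

/-- A Lorentz invariant interaction is cohomologous to a combination of vertices with coefficients
that are orthogonal to all relations between the vertices modulo co-boundaries. Each symmetry of the
vertices is such a relation, and so the coefficients inherit it. -/
theorem exists_interaction [Fintype Ind] [Fintype Dir] {T : F.Wick} (hT : T ∈ F.interactionSpace)
    (hLorentz : F.LorentzInvariant T) :
    ∃ k : VertexCoeffs Ind Dir, VertexCoeffs.IsNormal F k ∧ F.Cohomologous T (F.interaction k) := by
  classical
  obtain ⟨k, hk, hr⟩ := exists_orthogonal_coeff F.coboundaries F.vertex
    (F.invariantSpan_le (F.mem_invariantSpan hT hLorentz))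
  have z (i) (h : F.vertex i = 0) : k i = 0 := by
    have := hr (Pi.single i 1) (by simp [Pi.single_apply, apply_ite Complex.ofReal, ite_smul, h])
    simpa [Pi.single_apply, apply_ite Complex.ofReal] using this
  have eq (i j) (h : F.vertex i = F.vertex j) : k i = k j := by
    have := hr (Pi.single i 1 - Pi.single j 1) (by
      simp [Pi.single_apply, apply_ite Complex.ofReal, ite_smul, sub_smul, h])
    simp [Pi.single_apply, apply_ite Complex.ofReal, mul_sub] at this
    exact sub_eq_zero.1 this
  have neg (i j) (h : F.vertex i = -F.vertex j) : k i = -k j := by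
    have := hr (Pi.single i 1 + Pi.single j 1) (by
      simp [Pi.single_apply, apply_ite Complex.ofReal, ite_smul, add_smul, Finset.sum_add_distrib, h])
    simp [Pi.single_apply, apply_ite Complex.ofReal, mul_add, Finset.sum_add_distrib] at this
    exact eq_neg_of_add_eq_zero_left this
  refine ⟨⟨fun τ a b c => k (.inl (τ, a, b, c)), fun τ a b c d => k (.inr (.inl (τ, a, b, c, d))),
    fun ε A B c => k (.inr (.inr (.inl (ε, A, B, c)))),
    fun ε A B c => k (.inr (.inr (.inr (ε, A, B, c))))⟩, ⟨fun τ a b c => z (.inl (τ, a, b, c)),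
      fun τ a b c d => z (.inr (.inl (τ, a, b, c, d))),
      fun ε A B c => z (.inr (.inr (.inl (ε, A, B, c)))),
      fun ε A B c => z (.inr (.inr (.inr (ε, A, B, c)))),
      fun τ a b c a' b' c' => eq (.inl (τ, a, b, c)) (.inl (τ, a', b', c')),
      fun τ a b c a' b' c' => neg (.inl (τ, a, b, c)) (.inl (τ, a', b', c')),
      fun τ a b c d a' b' c' d' =>
        eq (.inr (.inl (τ, a, b, c, d))) (.inr (.inl (τ, a', b', c', d'))),
      fun τ a b c d a' b' c' d' =>
        neg (.inr (.inl (τ, a, b, c, d))) (.inr (.inl (τ, a', b', c', d'))),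
      fun a b c => ?_⟩, ?_⟩
  · have := hr (Pi.single (.inl (.levi, a, b, c)) 1 + Pi.single (.inl (.levi, b, c, a)) 1
      + Pi.single (.inl (.levi, c, a, b)) 1) (by
      simp only [Pi.add_apply, Complex.ofReal_add, add_smul, Finset.sum_add_distrib]
      have h1 : ∀ i, ∑ j, (((Pi.single i 1 : _ → ℝ) j : ℝ) : ℂ) • F.vertex j = F.vertex i := by
        intro i
        simp [Pi.single_apply, apply_ite Complex.ofReal, ite_smul]
      rw [h1, h1, h1]
      exact F.levi_cyclic_mem a b c)
    simpa [Pi.single_apply, apply_ite Complex.ofReal, mul_add, Finset.sum_add_distrib] using this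
  · rw [Cohomologous, ← mem_coboundaries]
    convert hk using 2
    simp only [interaction, Fintype.sum_sum_type, Fintype.sum_prod_type, vertex]
    abel

/-! Symmetries of the vertices. -/

theorem cubicVertex_vvv_neg (a b c : Ind) :
    F.cubicVertex .vvv a b c = -F.cubicVertex .vvv c b a := by
  simp only [cubicVertex]; abel

theorem cubicVertex_levi_neg (a b c : Ind) :
    F.cubicVertex .levi a b c = -F.cubicVertex .levi a c b := by
  have hl : ∀ κ l μ ν, YangMills.levi κ l μ ν = -YangMills.levi κ l ν μ := fun κ l μ ν => by
    simp only [YangMills.levi]; ring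
  simp only [cubicVertex, ← Finset.sum_neg_distrib]
  refine Finset.sum_congr rfl fun κ _ => Finset.sum_congr rfl fun l _ => ?_
  rw [Finset.sum_comm]
  refine Finset.sum_congr rfl fun μ _ => Finset.sum_congr rfl fun ν _ => ?_
  rw [hl, wick_neg_smul, F.v_comm b]

theorem cubicVertex_pvp_neg (a b c : Ind) :
    F.cubicVertex .pvp a b c = -F.cubicVertex .pvp c b a := by
  simp only [cubicVertex]; abel

theorem cubicVertex_uadv_swap (a b c : Ind) :
    F.cubicVertex .uadv a b c = F.cubicVertex .uadv a c b := by
  simp only [cubicVertex]; abel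

theorem cubicVertex_pvv_swap (a b c : Ind) :
    F.cubicVertex .pvv a b c = F.cubicVertex .pvv a c b := by
  simp only [cubicVertex, F.v_comm c]

theorem cubicVertex_ppp_swap (a b c : Ind) :
    F.cubicVertex .ppp a b c = F.cubicVertex .ppp b a c := by
  simp only [cubicVertex]
  rw [← mul_assoc, F.phi_comm, mul_assoc]

theorem cubicVertex_ppp_swap' (a b c : Ind) :
    F.cubicVertex .ppp a b c = F.cubicVertex .ppp a c b := by
  simp only [cubicVertex, F.phi_comm c]

end FieldContent
namespace FieldContent
variable {Ind Dir : Type*} (F : FieldContent Ind Dir)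

/-! ### Amplitudes for waves of one flavour -/

/-- The data of a plane wave whose only non-zero components belong to one quadruple. -/
structure Leg (b : Bool) where
  flavour : Ind
  pol : QuadComp → ℂ
  mom : Fin 4 → ℂ
  parity : ∀ q, (Comp.quad flavour q : Comp Ind Dir).odd ≠ b → pol q = 0
  shell : ∑ μ, eta μ * (mom μ * mom μ) = -(F.mass flavour : ℂ) ^ 2
  absent : ∀ q, F.Absent flavour q → pol q = 0

variable {F} in
theorem PlaneWave.ext_pol {b : Bool} {χ χ' : F.PlaneWave b} (h : χ.pol = χ'.pol)
    (h' : χ.mom = χ'.mom) : χ = χ' := by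
  cases χ; cases χ'
  simp_all

namespace Leg

variable {F} {b : Bool} (L : F.Leg b)

open Classical in
/-- The components of the plane wave. -/
def wavePol : Comp Ind Dir → ℂ
  | .quad a q => if a = L.flavour then L.pol q else 0
  | _ => 0

/-- The plane wave. -/
def wave : F.PlaneWave b where
  pol := L.wavePol
  mom := L.mom
  parity c h := by
    rcases c with ⟨a, q⟩ | ⟨A, s⟩ | ⟨A, s⟩
    · by_cases ha : a = L.flavour
      · subst ha
        simp [wavePol, L.parity q h]
      · simp [wavePol, ha]
    · rfl
    · rfl
  kleinGordon a q := by
    by_cases ha : a = L.flavour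
    · subst ha
      rw [L.shell]
    · simp [wavePol, ha]
  absent a q h := by
    by_cases ha : a = L.flavour
    · subst ha
      simp [wavePol, L.absent q h]
    · simp [wavePol, ha]
  dirac A s := by simp [wavePol]
  diracBar A s := by simp [wavePol]

/-- The value of a derivative of a component of the quadruple, at the origin. -/
def amp (x : QuadComp × Multiset (Fin 4)) : ℂ := L.pol x.1 * (x.2.map L.mom).prod

open Classical in
theorem val_quad (a : Ind) (x : QuadComp × Multiset (Fin 4)) :
    L.wave.val (.quad a x.1, x.2) = if a = L.flavour then L.amp x else 0 := by
  simp [PlaneWave.val, wave, wavePol, amp]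

theorem val_dirac (A : Dir) (s : Fin 4) (α : Multiset (Fin 4)) :
    L.wave.val (.psi A s, α) = 0 ∧ L.wave.val (.psibar A s, α) = 0 := by
  simp [PlaneWave.val, wave, wavePol]

/-- The infinitesimal gauge transformation. -/
def gauge : F.Leg (!b) where
  flavour := L.flavour
  pol
    | .v μ => Complex.I * L.mom μ * L.pol .u
    | .u => 0
    | .ut => -Complex.I * ((∑ μ, eta μ * (L.mom μ * L.pol (.v μ))) + F.gaugeMass L.flavour * L.pol .phi)
    | .phi => Complex.I * F.gaugeMass L.flavour * L.pol .u
  mom := L.mom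
  parity q h := by
    have := L.wave.gauge.parity (.quad L.flavour q) h
    cases q <;> simpa [PlaneWave.gauge, PlaneWave.gaugePol, wave, wavePol] using this
  shell := L.shell
  absent q h := by
    have := L.wave.gauge.absent L.flavour q h
    cases q <;> simpa [PlaneWave.gauge, PlaneWave.gaugePol, wave, wavePol] using this

theorem wave_gauge : L.wave.gauge = L.gauge.wave := by
  have h : L.wave.gauge.pol = L.gauge.wave.pol := by
    funext c
    rcases c with ⟨a, q⟩ | ⟨A, s⟩ | ⟨A, s⟩
    · by_cases ha : a = L.flavour <;> rcases q with μ | _ | _ | _ <;>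
        simp [PlaneWave.gauge, PlaneWave.gaugePol, wave, wavePol, gauge, ha]
    · rfl
    · rfl
  exact PlaneWave.ext_pol h rfl

end Leg

/-- A trilinear expression in the quadruples: a sum over flavours of monomials with coefficients
`k a b c`, with components and derivatives that do not depend on the flavours. -/
def trilinear [Fintype Ind] {I : Type*} [Fintype I] (z : I → ℂ)
    (x : I → Fin 3 → QuadComp × Multiset (Fin 4)) (k : Ind → Ind → Ind → ℂ) : F.Wick :=
  ∑ a, ∑ b, ∑ c, k a b c • ∑ i, z i • (F.jet (.quad a (x i 0).1, (x i 0).2) *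
    (F.jet (.quad b (x i 1).1, (x i 1).2) * F.jet (.quad c (x i 2).1, (x i 2).2)))

/-- A quadrilinear expression in the quadruples without derivatives. -/
def quadrilinear [Fintype Ind] {I : Type*} [Fintype I] (z : I → ℂ)
    (x : I → Fin 4 → QuadComp) (k : Ind → Ind → Ind → Ind → ℂ) : F.Wick :=
  ∑ a, ∑ b, ∑ c, ∑ d, k a b c d • ∑ i, z i • (F.jet (.quad a (x i 0), 0) *
    (F.jet (.quad b (x i 1), 0) * (F.jet (.quad c (x i 2), 0) * F.jet (.quad d (x i 3), 0))))

variable {F} [Fintype Ind] {I : Type*} [Fintype I]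

section

variable {b₁ b₂ b₃ b₄ : Bool} (L₁ : F.Leg b₁) (L₂ : F.Leg b₂) (L₃ : F.Leg b₃) (L₄ : F.Leg b₄)

theorem amp₄_trilinear (z : I → ℂ) (x : I → Fin 3 → QuadComp × Multiset (Fin 4))
    (k : Ind → Ind → Ind → ℂ) (χ₁ : F.PlaneWave b₁) (χ₂ : F.PlaneWave b₂) (χ₃ : F.PlaneWave b₃)
    (χ₄ : F.PlaneWave b₄) : amp₄ χ₁ χ₂ χ₃ χ₄ (F.trilinear z x k) = 0 := by
  simp only [trilinear, map_sum, map_smul, amp₄_three_jets, smul_zero, Finset.sum_const_zero]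

theorem amp₃_quadrilinear (z : I → ℂ) (x : I → Fin 4 → QuadComp)
    (k : Ind → Ind → Ind → Ind → ℂ) (χ₁ : F.PlaneWave b₁) (χ₂ : F.PlaneWave b₂)
    (χ₃ : F.PlaneWave b₃) : amp₃ χ₁ χ₂ χ₃ (F.quadrilinear z x k) = 0 := by
  simp only [quadrilinear, map_sum, map_smul, amp₃_four_jets, smul_zero, Finset.sum_const_zero]

/-- The statistics of a component of a quadruple. -/
def quadOdd (q : QuadComp) : Bool := (Comp.quad () q : Comp Unit Unit).odd

theorem odd_quad (a : Ind) (q : QuadComp) : (Comp.quad a q : Comp Ind Dir).odd = quadOdd q := by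
  cases q <;> rfl

theorem sum_delta₃ (k : Ind → Ind → Ind → ℂ) (a b c : Ind) (w : ℂ) [DecidableEq Ind] :
    ∑ a', ∑ b', ∑ c', k a' b' c' * ((if a' = a then 1 else 0) * (if b' = b then 1 else 0) *
      (if c' = c then 1 else 0) * w) = k a b c * w := by
  simp [mul_ite, ite_mul, Finset.sum_ite_eq']

set_option maxHeartbeats 1000000 in
/-- The amplitude of a trilinear expression is a sum over the assignments of the waves to the
factors. -/
theorem amp₃_trilinear (z : I → ℂ) (x : I → Fin 3 → QuadComp × Multiset (Fin 4))
    (k : Ind → Ind → Ind → ℂ) : amp₃ L₁.wave L₂.wave L₃.wave (F.trilinear z x k)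
    = k L₃.flavour L₂.flavour L₁.flavour *
        (∑ i, z i * (L₃.amp (x i 0) * L₂.amp (x i 1) * L₁.amp (x i 2)))
      + k L₃.flavour L₁.flavour L₂.flavour *
        (∑ i, z i * (koszul (quadOdd (x i 1).1) b₂ *
          (L₃.amp (x i 0) * L₁.amp (x i 1) * L₂.amp (x i 2))))
      + k L₂.flavour L₃.flavour L₁.flavour *
        (∑ i, z i * (koszul (quadOdd (x i 0).1) b₃ *
          (L₂.amp (x i 0) * L₃.amp (x i 1) * L₁.amp (x i 2))))
      + k L₁.flavour L₃.flavour L₂.flavour *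
        (∑ i, z i * (koszul (quadOdd (x i 0).1) b₃ * koszul (quadOdd (x i 0).1) b₂ *
          (L₁.amp (x i 0) * L₃.amp (x i 1) * L₂.amp (x i 2))))
      + k L₂.flavour L₁.flavour L₃.flavour *
        (∑ i, z i * (koszul (quadOdd (x i 0).1) b₃ * koszul (quadOdd (x i 1).1) b₃ *
          (L₂.amp (x i 0) * L₁.amp (x i 1) * L₃.amp (x i 2))))
      + k L₁.flavour L₂.flavour L₃.flavour *
        (∑ i, z i * (koszul (quadOdd (x i 0).1) b₃ * koszul (quadOdd (x i 1).1) b₃ *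
          koszul (quadOdd (x i 0).1) b₂ * (L₁.amp (x i 0) * L₂.amp (x i 1) * L₃.amp (x i 2)))) := by
  classical
  have d : ∀ {b : Bool} (L : F.Leg b) (a : Ind) (y : QuadComp × Multiset (Fin 4)),
      L.wave.val (.quad a y.1, y.2) = (if a = L.flavour then 1 else 0) * L.amp y := by
    intro b L a y
    rw [L.val_quad]
    split_ifs <;> simp
  rw [← sum_delta₃ k L₃.flavour L₂.flavour L₁.flavour, ← sum_delta₃ k L₃.flavour L₁.flavour L₂.flavour,
    ← sum_delta₃ k L₂.flavour L₃.flavour L₁.flavour, ← sum_delta₃ k L₁.flavour L₃.flavour L₂.flavour,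
    ← sum_delta₃ k L₂.flavour L₁.flavour L₃.flavour, ← sum_delta₃ k L₁.flavour L₂.flavour L₃.flavour]
  simp only [← Finset.sum_add_distrib]
  simp only [trilinear, map_sum, map_smul, smul_eq_mul]
  refine Finset.sum_congr rfl fun a _ => Finset.sum_congr rfl fun b _ =>
    Finset.sum_congr rfl fun c _ => ?_
  simp only [← mul_add, Finset.mul_sum, ← Finset.sum_add_distrib]
  refine Finset.sum_congr rfl fun i _ => ?_
  simp only [amp₃_jets, amp₂_jets, d, odd_quad]
  ring

end

end FieldContent
namespace FieldContent
variable {Ind Dir : Type*} {F : FieldContent Ind Dir} [Fintype Ind] {I : Type*} [Fintype I]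
variable {b₁ b₂ b₃ b₄ : Bool} (L₁ : F.Leg b₁) (L₂ : F.Leg b₂) (L₃ : F.Leg b₃) (L₄ : F.Leg b₄)

theorem sum_delta₄ (k : Ind → Ind → Ind → Ind → ℂ) (a b c d : Ind) (w : ℂ) [DecidableEq Ind] :
    ∑ a', ∑ b', ∑ c', ∑ d', k a' b' c' d' * ((if a' = a then 1 else 0) * (if b' = b then 1 else 0) *
      (if c' = c then 1 else 0) * (if d' = d then 1 else 0) * w) = k a b c d * w := by
  simp [mul_ite, ite_mul, Finset.sum_ite_eq']

set_option maxHeartbeats 4000000 in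
/-- The amplitude of a quadrilinear expression is a sum over the assignments of the waves to the
factors. -/
theorem amp₄_quadrilinear (z : I → ℂ) (x : I → Fin 4 → QuadComp)
    (k : Ind → Ind → Ind → Ind → ℂ) :
    amp₄ L₁.wave L₂.wave L₃.wave L₄.wave (F.quadrilinear z x k)
    = k L₁.flavour L₂.flavour L₃.flavour L₄.flavour *
        (∑ i, z i * (koszul (quadOdd (x i 0)) b₄ * koszul (quadOdd (x i 1)) b₄ *
          koszul (quadOdd (x i 2)) b₄ * koszul (quadOdd (x i 0)) b₃ *
          koszul (quadOdd (x i 1)) b₃ * koszul (quadOdd (x i 0)) b₂ *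
          (L₁.pol (x i 0) * L₂.pol (x i 1) * L₃.pol (x i 2) * L₄.pol (x i 3))))
      + k L₁.flavour L₂.flavour L₄.flavour L₃.flavour *
        (∑ i, z i * (koszul (quadOdd (x i 0)) b₄ * koszul (quadOdd (x i 1)) b₄ *
          koszul (quadOdd (x i 0)) b₃ * koszul (quadOdd (x i 1)) b₃ * koszul (quadOdd (x i 0)) b₂ *
          (L₁.pol (x i 0) * L₂.pol (x i 1) * L₄.pol (x i 2) * L₃.pol (x i 3))))
      + k L₁.flavour L₃.flavour L₂.flavour L₄.flavour *
        (∑ i, z i * (koszul (quadOdd (x i 0)) b₄ * koszul (quadOdd (x i 1)) b₄ *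
          koszul (quadOdd (x i 2)) b₄ * koszul (quadOdd (x i 0)) b₃ * koszul (quadOdd (x i 0)) b₂ *
          (L₁.pol (x i 0) * L₃.pol (x i 1) * L₂.pol (x i 2) * L₄.pol (x i 3))))
      + k L₁.flavour L₃.flavour L₄.flavour L₂.flavour *
        (∑ i, z i * (koszul (quadOdd (x i 0)) b₄ * koszul (quadOdd (x i 1)) b₄ *
          koszul (quadOdd (x i 0)) b₃ * koszul (quadOdd (x i 0)) b₂ *
          (L₁.pol (x i 0) * L₃.pol (x i 1) * L₄.pol (x i 2) * L₂.pol (x i 3))))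
      + k L₁.flavour L₄.flavour L₂.flavour L₃.flavour *
        (∑ i, z i * (koszul (quadOdd (x i 0)) b₄ * koszul (quadOdd (x i 0)) b₃ *
          koszul (quadOdd (x i 2)) b₃ * koszul (quadOdd (x i 0)) b₂ *
          (L₁.pol (x i 0) * L₄.pol (x i 1) * L₂.pol (x i 2) * L₃.pol (x i 3))))
      + k L₁.flavour L₄.flavour L₃.flavour L₂.flavour *
        (∑ i, z i * (koszul (quadOdd (x i 0)) b₄ * koszul (quadOdd (x i 0)) b₃ *
          koszul (quadOdd (x i 0)) b₂ *
          (L₁.pol (x i 0) * L₄.pol (x i 1) * L₃.pol (x i 2) * L₂.pol (x i 3))))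
      + k L₂.flavour L₁.flavour L₃.flavour L₄.flavour *
        (∑ i, z i * (koszul (quadOdd (x i 0)) b₄ * koszul (quadOdd (x i 1)) b₄ *
          koszul (quadOdd (x i 2)) b₄ * koszul (quadOdd (x i 0)) b₃ * koszul (quadOdd (x i 1)) b₃ *
          (L₂.pol (x i 0) * L₁.pol (x i 1) * L₃.pol (x i 2) * L₄.pol (x i 3))))
      + k L₂.flavour L₁.flavour L₄.flavour L₃.flavour *
        (∑ i, z i * (koszul (quadOdd (x i 0)) b₄ * koszul (quadOdd (x i 1)) b₄ *
          koszul (quadOdd (x i 0)) b₃ * koszul (quadOdd (x i 1)) b₃ *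
          (L₂.pol (x i 0) * L₁.pol (x i 1) * L₄.pol (x i 2) * L₃.pol (x i 3))))
      + k L₂.flavour L₃.flavour L₁.flavour L₄.flavour *
        (∑ i, z i * (koszul (quadOdd (x i 0)) b₄ * koszul (quadOdd (x i 1)) b₄ *
          koszul (quadOdd (x i 2)) b₄ * koszul (quadOdd (x i 0)) b₃ *
          (L₂.pol (x i 0) * L₃.pol (x i 1) * L₁.pol (x i 2) * L₄.pol (x i 3))))
      + k L₂.flavour L₃.flavour L₄.flavour L₁.flavour *
        (∑ i, z i * (koszul (quadOdd (x i 0)) b₄ * koszul (quadOdd (x i 1)) b₄ *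
          koszul (quadOdd (x i 0)) b₃ *
          (L₂.pol (x i 0) * L₃.pol (x i 1) * L₄.pol (x i 2) * L₁.pol (x i 3))))
      + k L₂.flavour L₄.flavour L₁.flavour L₃.flavour *
        (∑ i, z i * (koszul (quadOdd (x i 0)) b₄ * koszul (quadOdd (x i 0)) b₃ *
          koszul (quadOdd (x i 2)) b₃ *
          (L₂.pol (x i 0) * L₄.pol (x i 1) * L₁.pol (x i 2) * L₃.pol (x i 3))))
      + k L₂.flavour L₄.flavour L₃.flavour L₁.flavour *
        (∑ i, z i * (koszul (quadOdd (x i 0)) b₄ * koszul (quadOdd (x i 0)) b₃ *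
          (L₂.pol (x i 0) * L₄.pol (x i 1) * L₃.pol (x i 2) * L₁.pol (x i 3))))
      + k L₃.flavour L₁.flavour L₂.flavour L₄.flavour *
        (∑ i, z i * (koszul (quadOdd (x i 0)) b₄ * koszul (quadOdd (x i 1)) b₄ *
          koszul (quadOdd (x i 2)) b₄ * koszul (quadOdd (x i 1)) b₂ *
          (L₃.pol (x i 0) * L₁.pol (x i 1) * L₂.pol (x i 2) * L₄.pol (x i 3))))
      + k L₃.flavour L₁.flavour L₄.flavour L₂.flavour *
        (∑ i, z i * (koszul (quadOdd (x i 0)) b₄ * koszul (quadOdd (x i 1)) b₄ *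
          koszul (quadOdd (x i 1)) b₂ *
          (L₃.pol (x i 0) * L₁.pol (x i 1) * L₄.pol (x i 2) * L₂.pol (x i 3))))
      + k L₃.flavour L₂.flavour L₁.flavour L₄.flavour *
        (∑ i, z i * (koszul (quadOdd (x i 0)) b₄ * koszul (quadOdd (x i 1)) b₄ *
          koszul (quadOdd (x i 2)) b₄ *
          (L₃.pol (x i 0) * L₂.pol (x i 1) * L₁.pol (x i 2) * L₄.pol (x i 3))))
      + k L₃.flavour L₂.flavour L₄.flavour L₁.flavour *
        (∑ i, z i * (koszul (quadOdd (x i 0)) b₄ * koszul (quadOdd (x i 1)) b₄ *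
          (L₃.pol (x i 0) * L₂.pol (x i 1) * L₄.pol (x i 2) * L₁.pol (x i 3))))
      + k L₃.flavour L₄.flavour L₁.flavour L₂.flavour *
        (∑ i, z i * (koszul (quadOdd (x i 0)) b₄ * koszul (quadOdd (x i 2)) b₂ *
          (L₃.pol (x i 0) * L₄.pol (x i 1) * L₁.pol (x i 2) * L₂.pol (x i 3))))
      + k L₃.flavour L₄.flavour L₂.flavour L₁.flavour *
        (∑ i, z i * (koszul (quadOdd (x i 0)) b₄ *
          (L₃.pol (x i 0) * L₄.pol (x i 1) * L₂.pol (x i 2) * L₁.pol (x i 3))))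
      + k L₄.flavour L₁.flavour L₂.flavour L₃.flavour *
        (∑ i, z i * (koszul (quadOdd (x i 1)) b₃ * koszul (quadOdd (x i 2)) b₃ *
          koszul (quadOdd (x i 1)) b₂ *
          (L₄.pol (x i 0) * L₁.pol (x i 1) * L₂.pol (x i 2) * L₃.pol (x i 3))))
      + k L₄.flavour L₁.flavour L₃.flavour L₂.flavour *
        (∑ i, z i * (koszul (quadOdd (x i 1)) b₃ * koszul (quadOdd (x i 1)) b₂ *
          (L₄.pol (x i 0) * L₁.pol (x i 1) * L₃.pol (x i 2) * L₂.pol (x i 3))))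
      + k L₄.flavour L₂.flavour L₁.flavour L₃.flavour *
        (∑ i, z i * (koszul (quadOdd (x i 1)) b₃ * koszul (quadOdd (x i 2)) b₃ *
          (L₄.pol (x i 0) * L₂.pol (x i 1) * L₁.pol (x i 2) * L₃.pol (x i 3))))
      + k L₄.flavour L₂.flavour L₃.flavour L₁.flavour *
        (∑ i, z i * (koszul (quadOdd (x i 1)) b₃ *
          (L₄.pol (x i 0) * L₂.pol (x i 1) * L₃.pol (x i 2) * L₁.pol (x i 3))))
      + k L₄.flavour L₃.flavour L₁.flavour L₂.flavour *
        (∑ i, z i * (koszul (quadOdd (x i 2)) b₂ *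
          (L₄.pol (x i 0) * L₃.pol (x i 1) * L₁.pol (x i 2) * L₂.pol (x i 3))))
      + k L₄.flavour L₃.flavour L₂.flavour L₁.flavour *
        (∑ i, z i * ((L₄.pol (x i 0) * L₃.pol (x i 1) * L₂.pol (x i 2) * L₁.pol (x i 3)))) := by
  classical
  have d : ∀ {b : Bool} (L : F.Leg b) (a : Ind) (q : QuadComp),
      L.wave.val (.quad a q, 0) = (if a = L.flavour then 1 else 0) * L.pol q := by
    intro b L a q
    rw [L.val_quad a (q, 0)]
    simp [Leg.amp]
  rw [← sum_delta₄ k L₁.flavour L₂.flavour L₃.flavour L₄.flavour,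
    ← sum_delta₄ k L₁.flavour L₂.flavour L₄.flavour L₃.flavour,
    ← sum_delta₄ k L₁.flavour L₃.flavour L₂.flavour L₄.flavour,
    ← sum_delta₄ k L₁.flavour L₃.flavour L₄.flavour L₂.flavour,
    ← sum_delta₄ k L₁.flavour L₄.flavour L₂.flavour L₃.flavour,
    ← sum_delta₄ k L₁.flavour L₄.flavour L₃.flavour L₂.flavour,
    ← sum_delta₄ k L₂.flavour L₁.flavour L₃.flavour L₄.flavour,
    ← sum_delta₄ k L₂.flavour L₁.flavour L₄.flavour L₃.flavour,
    ← sum_delta₄ k L₂.flavour L₃.flavour L₁.flavour L₄.flavour,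
    ← sum_delta₄ k L₂.flavour L₃.flavour L₄.flavour L₁.flavour,
    ← sum_delta₄ k L₂.flavour L₄.flavour L₁.flavour L₃.flavour,
    ← sum_delta₄ k L₂.flavour L₄.flavour L₃.flavour L₁.flavour,
    ← sum_delta₄ k L₃.flavour L₁.flavour L₂.flavour L₄.flavour,
    ← sum_delta₄ k L₃.flavour L₁.flavour L₄.flavour L₂.flavour,
    ← sum_delta₄ k L₃.flavour L₂.flavour L₁.flavour L₄.flavour,
    ← sum_delta₄ k L₃.flavour L₂.flavour L₄.flavour L₁.flavour,
    ← sum_delta₄ k L₃.flavour L₄.flavour L₁.flavour L₂.flavour,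
    ← sum_delta₄ k L₃.flavour L₄.flavour L₂.flavour L₁.flavour,
    ← sum_delta₄ k L₄.flavour L₁.flavour L₂.flavour L₃.flavour,
    ← sum_delta₄ k L₄.flavour L₁.flavour L₃.flavour L₂.flavour,
    ← sum_delta₄ k L₄.flavour L₂.flavour L₁.flavour L₃.flavour,
    ← sum_delta₄ k L₄.flavour L₂.flavour L₃.flavour L₁.flavour,
    ← sum_delta₄ k L₄.flavour L₃.flavour L₁.flavour L₂.flavour,
    ← sum_delta₄ k L₄.flavour L₃.flavour L₂.flavour L₁.flavour]
  simp only [← Finset.sum_add_distrib]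
  simp only [quadrilinear, map_sum, map_smul, smul_eq_mul]
  refine Finset.sum_congr rfl fun a _ => Finset.sum_congr rfl fun b _ =>
    Finset.sum_congr rfl fun c _ => Finset.sum_congr rfl fun e _ => ?_
  simp only [← mul_add, Finset.mul_sum, ← Finset.sum_add_distrib]
  refine Finset.sum_congr rfl fun i _ => ?_
  simp only [amp₄_jets, amp₃_jets, amp₂_jets, d, odd_quad]
  ring

end FieldContent

/-! ### Amplitudes of trilinear expressions -/

/-- The Minkowski product of covectors. -/
def dot (x y : Fin 4 → ℂ) : ℂ := ∑ μ, eta μ * (x μ * y μ)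

/-- The determinant of four covectors. -/
def lev (x y z w : Fin 4 → ℂ) : ℂ :=
  ∑ κ, ∑ l, ∑ μ, ∑ ν, levi κ l μ ν * (x κ * y l * z μ * w ν)

theorem dot_comm (x y : Fin 4 → ℂ) : dot x y = dot y x := by
  simp only [dot, mul_comm]

theorem sum_eta_eta (x y z w : Fin 4 → ℂ) : ∑ i : Fin 4 × Fin 4,
    eta i.1 * eta i.2 * (y i.2 * x i.1 * z i.1 * w i.2) = dot x z * dot y w := by
  simp only [dot, Fintype.sum_prod_type, Finset.sum_mul_sum]
  exact Finset.sum_congr rfl fun μ _ => Finset.sum_congr rfl fun ν _ => by ring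

theorem sum_eta_mul (x y : Fin 4 → ℂ) (c d : ℂ) :
    ∑ μ, eta μ * (c * x μ * y μ * d) = c * d * dot x y := by
  rw [dot, Finset.mul_sum]
  exact Finset.sum_congr rfl fun μ _ => by ring

namespace FieldContent
variable {Ind Dir : Type*} (F : FieldContent Ind Dir)

namespace Leg
variable {F}

/-- The polarization of the vector field. -/
def vec {b : Bool} (L : F.Leg b) (μ : Fin 4) : ℂ := L.pol (.v μ)

theorem bose_u (L : F.Leg false) : L.pol .u = 0 := L.parity _ (by simp [Comp.odd])
theorem bose_ut (L : F.Leg false) : L.pol .ut = 0 := L.parity _ (by simp [Comp.odd])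
theorem fermi_v (L : F.Leg true) (μ : Fin 4) : L.pol (.v μ) = 0 := L.parity _ (by simp [Comp.odd])
theorem fermi_phi (L : F.Leg true) : L.pol .phi = 0 := L.parity _ (by simp [Comp.odd])

theorem amp_zero {b : Bool} (L : F.Leg b) (q : QuadComp) : L.amp (q, 0) = L.pol q := by
  simp [amp]

theorem amp_single {b : Bool} (L : F.Leg b) (q : QuadComp) (μ : Fin 4) :
    L.amp (q, {μ}) = L.pol q * L.mom μ := by
  simp [amp]

end Leg

section

variable [Fintype Ind]

/-- `∑ k_{abc} ∂_μ v_{aν} v_b^μ v_c^ν` -/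
def exprVVV (k : Ind → Ind → Ind → ℂ) : F.Wick :=
  F.trilinear (I := Fin 4 × Fin 4) (fun i => eta i.1 * eta i.2)
    (fun i => ![(.v i.2, {i.1}), (.v i.1, 0), (.v i.2, 0)]) k

/-- The parity violating trilinear expressions. -/
def exprLevi (k : Ind → Ind → Ind → ℂ) : F.Wick :=
  F.trilinear (I := Fin 4 × Fin 4 × Fin 4 × Fin 4) (fun i => levi i.1 i.2.1 i.2.2.1 i.2.2.2)
    (fun i => ![(.v i.2.1, {i.1}), (.v i.2.2.1, 0), (.v i.2.2.2, 0)]) k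

/-- `∑ k_{abc} ∂_μ Φ_a v_b^μ Φ_c` -/
def exprPVP (k : Ind → Ind → Ind → ℂ) : F.Wick :=
  F.trilinear (I := Fin 4) eta (fun μ => ![(.phi, {μ}), (.v μ, 0), (.phi, 0)]) k

/-- `∑ k_{abc} ∂_μ v_a^μ u_b ũ_c` -/
def exprVUA (k : Ind → Ind → Ind → ℂ) : F.Wick :=
  F.trilinear (I := Fin 4) eta (fun μ => ![(.v μ, {μ}), (.u, 0), (.ut, 0)]) k

/-- `∑ k_{abc} ∂_μ ũ_a u_b v_c^μ` -/
def exprAUV (k : Ind → Ind → Ind → ℂ) : F.Wick :=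
  F.trilinear (I := Fin 4) eta (fun μ => ![(.ut, {μ}), (.u, 0), (.v μ, 0)]) k

/-- `∑ k_{abc} Φ_a v_b^μ v_{cμ}` -/
def exprPVV (k : Ind → Ind → Ind → ℂ) : F.Wick :=
  F.trilinear (I := Fin 4) eta (fun μ => ![(.phi, 0), (.v μ, 0), (.v μ, 0)]) k

/-- `∑ k_{abc} Φ_a Φ_b Φ_c` -/
def exprPPP (k : Ind → Ind → Ind → ℂ) : F.Wick :=
  F.trilinear (I := Unit) 1 (fun _ => ![(.phi, 0), (.phi, 0), (.phi, 0)]) k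

/-- `∑ k_{abc} u_a ũ_b Φ_c` -/
def exprUAP (k : Ind → Ind → Ind → ℂ) : F.Wick :=
  F.trilinear (I := Unit) 1 (fun _ => ![(.u, 0), (.ut, 0), (.phi, 0)]) k

end

variable {F} [Fintype Ind]

theorem koszul_false (p : Bool) : koszul p false = 1 := by simp [koszul]

section

variable (L₁ L₂ L₃ : F.Leg false) (k : Ind → Ind → Ind → ℂ)

theorem amp₃_exprVVV : amp₃ L₁.wave L₂.wave L₃.wave (F.exprVVV k)
    = k L₃.flavour L₂.flavour L₁.flavour * (dot L₃.mom L₂.vec * dot L₃.vec L₁.vec)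
    + k L₃.flavour L₁.flavour L₂.flavour * (dot L₃.mom L₁.vec * dot L₃.vec L₂.vec)
    + k L₂.flavour L₃.flavour L₁.flavour * (dot L₂.mom L₃.vec * dot L₂.vec L₁.vec)
    + k L₁.flavour L₃.flavour L₂.flavour * (dot L₁.mom L₃.vec * dot L₁.vec L₂.vec)
    + k L₂.flavour L₁.flavour L₃.flavour * (dot L₂.mom L₁.vec * dot L₂.vec L₃.vec)
    + k L₁.flavour L₂.flavour L₃.flavour * (dot L₁.mom L₂.vec * dot L₁.vec L₃.vec) := by
  simp only [exprVVV, amp₃_trilinear, koszul_false, one_mul, ← sum_eta_eta]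
  simp [Leg.amp_single, Leg.amp_zero, Leg.vec]

theorem amp₃_exprPVP : amp₃ L₁.wave L₂.wave L₃.wave (F.exprPVP k)
    = k L₃.flavour L₂.flavour L₁.flavour * (L₃.pol .phi * L₁.pol .phi * dot L₃.mom L₂.vec)
    + k L₃.flavour L₁.flavour L₂.flavour * (L₃.pol .phi * L₂.pol .phi * dot L₃.mom L₁.vec)
    + k L₂.flavour L₃.flavour L₁.flavour * (L₂.pol .phi * L₁.pol .phi * dot L₂.mom L₃.vec)
    + k L₁.flavour L₃.flavour L₂.flavour * (L₁.pol .phi * L₂.pol .phi * dot L₁.mom L₃.vec)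
    + k L₂.flavour L₁.flavour L₃.flavour * (L₂.pol .phi * L₃.pol .phi * dot L₂.mom L₁.vec)
    + k L₁.flavour L₂.flavour L₃.flavour * (L₁.pol .phi * L₃.pol .phi * dot L₁.mom L₂.vec) := by
  simp only [exprPVP, amp₃_trilinear, koszul_false, one_mul, ← sum_eta_mul]
  simp [Leg.amp_single, Leg.amp_zero, Leg.vec]

theorem amp₃_exprPVV : amp₃ L₁.wave L₂.wave L₃.wave (F.exprPVV k)
    = k L₃.flavour L₂.flavour L₁.flavour * (L₃.pol .phi * 1 * dot L₂.vec L₁.vec)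
    + k L₃.flavour L₁.flavour L₂.flavour * (L₃.pol .phi * 1 * dot L₁.vec L₂.vec)
    + k L₂.flavour L₃.flavour L₁.flavour * (L₂.pol .phi * 1 * dot L₃.vec L₁.vec)
    + k L₁.flavour L₃.flavour L₂.flavour * (L₁.pol .phi * 1 * dot L₃.vec L₂.vec)
    + k L₂.flavour L₁.flavour L₃.flavour * (L₂.pol .phi * 1 * dot L₁.vec L₃.vec)
    + k L₁.flavour L₂.flavour L₃.flavour * (L₁.pol .phi * 1 * dot L₂.vec L₃.vec) := by
  simp only [exprPVV, amp₃_trilinear, koszul_false, one_mul, ← sum_eta_mul]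
  simp [Leg.amp_zero, Leg.vec]

theorem amp₃_exprPPP : amp₃ L₁.wave L₂.wave L₃.wave (F.exprPPP k)
    = (k L₃.flavour L₂.flavour L₁.flavour + k L₃.flavour L₁.flavour L₂.flavour
    + k L₂.flavour L₃.flavour L₁.flavour + k L₁.flavour L₃.flavour L₂.flavour
    + k L₂.flavour L₁.flavour L₃.flavour + k L₁.flavour L₂.flavour L₃.flavour) *
      (L₁.pol .phi * L₂.pol .phi * L₃.pol .phi) := by
  simp only [exprPPP, amp₃_trilinear, koszul_false, one_mul]
  simp [Leg.amp_zero]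
  ring

theorem amp₃_exprLevi : amp₃ L₁.wave L₂.wave L₃.wave (F.exprLevi k)
    = k L₃.flavour L₂.flavour L₁.flavour * lev L₃.mom L₃.vec L₂.vec L₁.vec
    + k L₃.flavour L₁.flavour L₂.flavour * lev L₃.mom L₃.vec L₁.vec L₂.vec
    + k L₂.flavour L₃.flavour L₁.flavour * lev L₂.mom L₂.vec L₃.vec L₁.vec
    + k L₁.flavour L₃.flavour L₂.flavour * lev L₁.mom L₁.vec L₃.vec L₂.vec
    + k L₂.flavour L₁.flavour L₃.flavour * lev L₂.mom L₂.vec L₁.vec L₃.vec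
    + k L₁.flavour L₂.flavour L₃.flavour * lev L₁.mom L₁.vec L₂.vec L₃.vec := by
  have h (L L' L'' : F.Leg false) : ∑ i : Fin 4 × Fin 4 × Fin 4 × Fin 4,
      levi i.1 i.2.1 i.2.2.1 i.2.2.2 * (L.amp (.v i.2.1, {i.1}) * L'.amp (.v i.2.2.1, 0)
        * L''.amp (.v i.2.2.2, 0)) = lev L.mom L.vec L'.vec L''.vec := by
    simp only [Leg.amp_single, Leg.amp_zero, lev, Leg.vec, Fintype.sum_prod_type,
      mul_comm (L.pol _) (L.mom _)]
  simp only [exprLevi, amp₃_trilinear, koszul_false, one_mul]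
  simp only [← h]
  rfl

theorem amp₃_expr_ghosts : amp₃ L₁.wave L₂.wave L₃.wave (F.exprVUA k) = 0 ∧
    amp₃ L₁.wave L₂.wave L₃.wave (F.exprAUV k) = 0 ∧
    amp₃ L₁.wave L₂.wave L₃.wave (F.exprUAP k) = 0 := by
  simp [exprVUA, exprAUV, exprUAP, amp₃_trilinear, Leg.amp_zero, Leg.bose_u, Leg.bose_ut]

end

/-- Expressions without ghosts have no amplitudes with ghosts. -/
theorem amp₃_expr_bose {b₁ b₂ b₃ : Bool} (L₁ : F.Leg b₁) (L₂ : F.Leg b₂) (L₃ : F.Leg b₃)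
    (k : Ind → Ind → Ind → ℂ) (hv : ∀ μ, L₁.pol (.v μ) = 0) (hp : L₁.pol .phi = 0) :
    amp₃ L₁.wave L₂.wave L₃.wave (F.exprVVV k) = 0 ∧
    amp₃ L₁.wave L₂.wave L₃.wave (F.exprLevi k) = 0 ∧
    amp₃ L₁.wave L₂.wave L₃.wave (F.exprPVP k) = 0 ∧
    amp₃ L₁.wave L₂.wave L₃.wave (F.exprPVV k) = 0 ∧
    amp₃ L₁.wave L₂.wave L₃.wave (F.exprPPP k) = 0 := by
  simp [exprVVV, exprLevi, exprPVP, exprPVV, exprPPP, amp₃_trilinear, Leg.amp_zero, Leg.amp_single,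
    hv, hp]

section

variable (L₁ : F.Leg true) (k : Ind → Ind → Ind → ℂ)

/-- The amplitudes of a ghost `L₁`, an antighost `L₂`, and a Bose field `L₃`. -/
theorem amp₃_ghost₂ (L₂ : F.Leg true) (L₃ : F.Leg false) (h : L₁.pol .ut = 0) (h' : L₂.pol .u = 0) :
    amp₃ L₁.wave L₂.wave L₃.wave (F.exprVUA k)
      = -(k L₃.flavour L₁.flavour L₂.flavour * (L₁.pol .u * L₂.pol .ut * dot L₃.mom L₃.vec)) ∧
    amp₃ L₁.wave L₂.wave L₃.wave (F.exprAUV k)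
      = k L₂.flavour L₁.flavour L₃.flavour * (L₁.pol .u * L₂.pol .ut * dot L₂.mom L₃.vec) ∧
    amp₃ L₁.wave L₂.wave L₃.wave (F.exprUAP k)
      = -(k L₁.flavour L₂.flavour L₃.flavour * (L₁.pol .u * L₂.pol .ut * L₃.pol .phi)) := by
  refine ⟨?_, ?_, ?_⟩ <;>
  simp [exprVUA, exprAUV, exprUAP, amp₃_trilinear, Leg.amp_zero, Leg.amp_single, Leg.bose_u,
    Leg.bose_ut, Leg.fermi_v, Leg.fermi_phi, h, h', koszul, quadOdd, Comp.odd, dot, Leg.vec,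
    Finset.mul_sum, -mul_eq_mul_left_iff]
  all_goals first | ring1 | exact Finset.sum_congr rfl fun _ _ => by ring1

/-- The amplitudes of a ghost `L₁`, a Bose field `L₂`, and an antighost `L₃`. -/
theorem amp₃_ghost₃ (L₂ : F.Leg false) (L₃ : F.Leg true) (h : L₁.pol .ut = 0) (h' : L₃.pol .u = 0) :
    amp₃ L₁.wave L₂.wave L₃.wave (F.exprVUA k)
      = -(k L₂.flavour L₁.flavour L₃.flavour * (L₁.pol .u * L₃.pol .ut * dot L₂.mom L₂.vec)) ∧
    amp₃ L₁.wave L₂.wave L₃.wave (F.exprAUV k)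
      = k L₃.flavour L₁.flavour L₂.flavour * (L₁.pol .u * L₃.pol .ut * dot L₃.mom L₂.vec) ∧
    amp₃ L₁.wave L₂.wave L₃.wave (F.exprUAP k)
      = -(k L₁.flavour L₃.flavour L₂.flavour * (L₁.pol .u * L₃.pol .ut * L₂.pol .phi)) := by
  refine ⟨?_, ?_, ?_⟩ <;>
  simp [exprVUA, exprAUV, exprUAP, amp₃_trilinear, Leg.amp_zero, Leg.amp_single, Leg.bose_u,
    Leg.bose_ut, Leg.fermi_v, Leg.fermi_phi, h, h', koszul, quadOdd, Comp.odd, dot, Leg.vec,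
    Finset.mul_sum, -mul_eq_mul_left_iff]
  all_goals first | ring1 | exact Finset.sum_congr rfl fun _ _ => by ring1

end

end FieldContent

theorem dot_mul_right (x y : Fin 4 → ℂ) (c : ℂ) : dot x (fun μ => c * y μ) = c * dot x y := by
  simp only [dot, Finset.mul_sum]
  exact Finset.sum_congr rfl fun μ _ => by ring

theorem dot_mul_left (x y : Fin 4 → ℂ) (c : ℂ) : dot (fun μ => c * x μ) y = c * dot x y := by
  rw [dot_comm, dot_mul_right, dot_comm]

theorem lev_mul₂ (x y z w : Fin 4 → ℂ) (c : ℂ) : lev x (fun μ => c * y μ) z w = c * lev x y z w := by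
  simp only [lev, Finset.mul_sum]
  exact Finset.sum_congr rfl fun _ _ => Finset.sum_congr rfl fun _ _ =>
    Finset.sum_congr rfl fun _ _ => Finset.sum_congr rfl fun _ _ => by ring

theorem lev_mul₃ (x y z w : Fin 4 → ℂ) (c : ℂ) : lev x y (fun μ => c * z μ) w = c * lev x y z w := by
  simp only [lev, Finset.mul_sum]
  exact Finset.sum_congr rfl fun _ _ => Finset.sum_congr rfl fun _ _ =>
    Finset.sum_congr rfl fun _ _ => Finset.sum_congr rfl fun _ _ => by ring

theorem lev_mul₄ (x y z w : Fin 4 → ℂ) (c : ℂ) : lev x y z (fun μ => c * w μ) = c * lev x y z w := by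
  simp only [lev, Finset.mul_sum]
  exact Finset.sum_congr rfl fun _ _ => Finset.sum_congr rfl fun _ _ =>
    Finset.sum_congr rfl fun _ _ => Finset.sum_congr rfl fun _ _ => by ring

/-- The reflection of the first spatial coordinate. -/
def reflect (x : Fin 4 → ℂ) (μ : Fin 4) : ℂ := (if μ = 1 then -1 else 1) * x μ

theorem dot_reflect (x y : Fin 4 → ℂ) : dot (reflect x) (reflect y) = dot x y := by
  simp only [dot, reflect]
  refine Finset.sum_congr rfl fun μ _ => ?_
  split_ifs <;> ring

theorem levi_reflect (κ l μ ν : Fin 4) : levi κ l μ ν * ((if κ = 1 then -1 else 1) *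
    (if l = 1 then -1 else 1) * (if μ = 1 then -1 else 1) * (if ν = 1 then -1 else 1))
    = -levi κ l μ ν := by
  have h : ∀ κ l μ ν : Fin 4, ((κ : ℤ) - l) * (κ - μ) * (κ - ν) * (l - μ) * (l - ν) * (μ - ν) *
      ((if κ = 1 then -1 else 1) * (if l = 1 then -1 else 1) * (if μ = 1 then -1 else 1) *
        (if ν = 1 then -1 else 1))
      = -(((κ : ℤ) - l) * (κ - μ) * (κ - ν) * (l - μ) * (l - ν) * (μ - ν)) := by decide
  have := congrArg (Int.cast : ℤ → ℂ) (h κ l μ ν)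
  push_cast at this
  simp only [levi]
  linear_combination 1 / 12 * this

theorem lev_reflect (x y z w : Fin 4 → ℂ) :
    lev (reflect x) (reflect y) (reflect z) (reflect w) = -lev x y z w := by
  simp only [lev, reflect, ← Finset.sum_neg_distrib]
  refine Finset.sum_congr rfl fun κ _ => Finset.sum_congr rfl fun l _ =>
    Finset.sum_congr rfl fun μ _ => Finset.sum_congr rfl fun ν _ => ?_
  linear_combination x κ * y l * z μ * w ν * levi_reflect κ l μ ν

namespace FieldContent
variable {Ind Dir : Type*} (F : FieldContent Ind Dir)

theorem sum_cubicShape {M : Type*} [AddCommMonoid M] (f : CubicShape → M) : ∑ τ, f τ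
    = f .vvv + f .levi + f .pvp + f .uadv + f .dauv + f .pvv + f .ppp + f .uap := by
  change Multiset.sum (Multiset.map f {.vvv, .levi, .pvp, .uadv, .dauv, .pvv, .ppp, .uap}) = _
  simp [add_assoc]

theorem sum_quarticShape {M : Type*} [AddCommMonoid M] (f : QuarticShape → M) : ∑ τ, f τ
    = f .pppp + f .vvpp + f .vvvv + f .levi + f .uapp + f .uavv + f .uuaa := by
  change Multiset.sum (Multiset.map f {.pppp, .vvpp, .vvvv, .levi, .uapp, .uavv, .uuaa}) = _
  simp [add_assoc]

section
variable [Fintype Ind]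

theorem sum_smul_sub_swap {M : Type*} [AddCommGroup M] [Module ℂ M] (X : Ind → Ind → Ind → M)
    {k : Ind → Ind → Ind → ℂ} (hk : ∀ a b c, k a b c = -k c b a) :
    ∑ a, ∑ b, ∑ c, k a b c • (X a b c - X c b a) = ∑ a, ∑ b, ∑ c, (2 * k a b c) • X a b c := by
  have h : ∑ a, ∑ b, ∑ c, k a b c • X c b a = -∑ a, ∑ b, ∑ c, k a b c • X a b c := by
    rw [Finset.sum_comm]
    conv_rhs => rw [Finset.sum_comm]
    rw [← Finset.sum_neg_distrib]
    refine Finset.sum_congr rfl fun b _ => ?_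
    rw [Finset.sum_comm, ← Finset.sum_neg_distrib]
    refine Finset.sum_congr rfl fun a _ => ?_
    rw [← Finset.sum_neg_distrib]
    refine Finset.sum_congr rfl fun c _ => ?_
    rw [hk, neg_smul]
  simp only [smul_sub, Finset.sum_sub_distrib, h, two_mul, add_smul, Finset.sum_add_distrib]
  abel

theorem sum_smul_add_swap {M : Type*} [AddCommGroup M] [Module ℂ M] (X : Ind → Ind → Ind → M)
    {k : Ind → Ind → Ind → ℂ} (hk : ∀ a b c, k a b c = k a c b) :
    ∑ a, ∑ b, ∑ c, k a b c • (X c a b + X b a c) = ∑ c, ∑ a, ∑ b, (2 * k a b c) • X c a b := by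
  have h : ∑ a, ∑ b, ∑ c, k a b c • X b a c = ∑ a, ∑ b, ∑ c, k a b c • X c a b := by
    refine Finset.sum_congr rfl fun a _ => ?_
    rw [Finset.sum_comm]
    exact Finset.sum_congr rfl fun b _ => Finset.sum_congr rfl fun c _ => by rw [hk]
  have h' : ∑ c, ∑ a, ∑ b, (2 * k a b c) • X c a b = ∑ a, ∑ b, ∑ c, (2 * k a b c) • X c a b := by
    rw [Finset.sum_comm]
    exact Finset.sum_congr rfl fun a _ => Finset.sum_comm
  rw [h']
  simp only [smul_add, Finset.sum_add_distrib, h, two_mul, add_smul]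

variable {F}
variable {k : VertexCoeffs Ind Dir}

/-- The trilinear part of an interaction without Dirac fields. -/
theorem sum_cubicVertex (hk : VertexCoeffs.IsNormal F k) :
    ∑ τ, ∑ a, ∑ b, ∑ c, k.cubic τ a b c • F.cubicVertex τ a b c
    = F.exprVVV (fun a b c => 2 * k.cubic .vvv a b c) + F.exprLevi (k.cubic .levi)
      + F.exprPVP (fun a b c => 2 * k.cubic .pvp a b c)
      + F.exprVUA (fun a b c => 2 * k.cubic .uadv b c a) + F.exprAUV (k.cubic .dauv)
      + F.exprPVV (k.cubic .pvv) + F.exprPPP (k.cubic .ppp) + F.exprUAP (k.cubic .uap) := by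
  rw [sum_cubicShape]
  iterate 7 refine congrArg₂ (· + ·) ?_ ?_
  · have h := sum_smul_sub_swap (fun a b c => ∑ μ, ∑ ν, (eta μ * eta ν) •
      (F.pd μ (F.v a ν) * (F.v b μ * F.v c ν)))
      (k := k.cubic .vvv) (fun a b c => hk.cubic_neg .vvv _ _ _ _ _ _ (F.cubicVertex_vvv_neg a b c))
    simp only [cubicVertex]
    rw [h]
    simp only [exprVVV, trilinear, Fintype.sum_prod_type, pd_field, v]
    rfl
  · simp only [exprLevi, trilinear, Fintype.sum_prod_type, cubicVertex, pd_field, v]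
    rfl
  · have h := sum_smul_sub_swap (fun a b c => ∑ μ, eta μ •
      (F.pd μ (F.phi a) * (F.v b μ * F.phi c)))
      (k := k.cubic .pvp) (fun a b c => hk.cubic_neg .pvp _ _ _ _ _ _ (F.cubicVertex_pvp_neg a b c))
    simp only [cubicVertex]
    rw [h]
    simp only [exprPVP, trilinear, v, phi, pd_field]
    rfl
  · have h := sum_smul_add_swap (fun a b c => ∑ μ, eta μ •
      (F.pd μ (F.v a μ) * (F.u b * F.ut c)))
      (k := k.cubic .uadv) (fun a b c => hk.cubic_eq .uadv _ _ _ _ _ _ (F.cubicVertex_uadv_swap a b c))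
    simp only [cubicVertex]
    rw [h]
    simp only [exprVUA, trilinear, v, u, ut, pd_field]
    rfl
  · simp only [exprAUV, trilinear, cubicVertex, v, u, ut, pd_field]
    rfl
  · simp only [exprPVV, trilinear, cubicVertex, v, phi]
    rfl
  · simp [exprPPP, trilinear, cubicVertex, phi]
  · simp [exprUAP, trilinear, cubicVertex, phi, u, ut]

end
end FieldContent
namespace FieldContent
variable {Ind Dir : Type*} (F : FieldContent Ind Dir)

/-! ### The co-cycle condition for trilinear couplings -/

namespace Leg
variable {F}

/-- A plane wave of the Bose fields `v_a` and `Φ_a`. -/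
def bose (a : Ind) (p e : Fin 4 → ℂ) (φ : ℂ) (hp : dot p p = -(F.mass a : ℂ) ^ 2)
    (he : F.sector a = .higgs → e = 0) (hφ : F.sector a = .massless → φ = 0) : F.Leg false where
  flavour := a
  pol
    | .v μ => e μ
    | .phi => φ
    | _ => 0
  mom := p
  parity q h := by cases q <;> simp_all [Comp.odd]
  shell := hp
  absent q h := by
    cases q with
    | v μ => simp [he h]
    | u => rfl
    | ut => rfl
    | phi => exact hφ h

/-- A plane wave of the ghost field `u_a` (with coefficient `x`) and the antighost field `ũ_a` (with
coefficient `y`). -/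
def ghost (a : Ind) (p : Fin 4 → ℂ) (x y : ℂ) (hp : dot p p = -(F.mass a : ℂ) ^ 2)
    (ha : F.sector a ≠ .higgs) : F.Leg true where
  flavour := a
  pol
    | .u => x
    | .ut => y
    | _ => 0
  mom := p
  parity q h := by cases q <;> simp_all [Comp.odd]
  shell := hp
  absent q h := by
    cases q with
    | v μ => rfl
    | u => exact absurd h ha
    | ut => exact absurd h ha
    | phi => rfl

end Leg

variable [Fintype Ind] {F} {k : VertexCoeffs Ind Dir}

/-- The quadrilinear part of an interaction without Dirac fields. -/
theorem sum_quarticVertex :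
    ∑ τ, ∑ a, ∑ b, ∑ c, ∑ d, k.quartic τ a b c d • F.quarticVertex τ a b c d
    = F.quadrilinear (I := Unit) 1 (fun _ => ![.phi, .phi, .phi, .phi]) (k.quartic .pppp)
      + F.quadrilinear (I := Fin 4) eta (fun μ => ![.v μ, .v μ, .phi, .phi]) (k.quartic .vvpp)
      + F.quadrilinear (I := Fin 4 × Fin 4) (fun i => eta i.1 * eta i.2)
        (fun i => ![.v i.1, .v i.1, .v i.2, .v i.2]) (k.quartic .vvvv)
      + F.quadrilinear (I := Fin 4 × Fin 4 × Fin 4 × Fin 4)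
        (fun i => levi i.1 i.2.1 i.2.2.1 i.2.2.2)
        (fun i => ![.v i.1, .v i.2.1, .v i.2.2.1, .v i.2.2.2]) (k.quartic .levi)
      + F.quadrilinear (I := Unit) 1 (fun _ => ![.u, .ut, .phi, .phi]) (k.quartic .uapp)
      + F.quadrilinear (I := Fin 4) eta (fun μ => ![.u, .ut, .v μ, .v μ]) (k.quartic .uavv)
      + F.quadrilinear (I := Unit) 1 (fun _ => ![.u, .u, .ut, .ut]) (k.quartic .uuaa) := by
  rw [sum_quarticShape]
  iterate 6 refine congrArg₂ (· + ·) ?_ ?_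
  · simp [quadrilinear, quarticVertex, phi]
  · simp only [quadrilinear, quarticVertex, phi, v]
    rfl
  · simp only [quadrilinear, quarticVertex, Fintype.sum_prod_type, v]
    rfl
  · simp only [quadrilinear, quarticVertex, Fintype.sum_prod_type, v]
    rfl
  · simp [quadrilinear, quarticVertex, phi, u, ut]
  · simp only [quadrilinear, quarticVertex, v, u, ut]
    rfl
  · simp [quadrilinear, quarticVertex, u, ut]

variable [Fintype Dir] {b₁ b₂ b₃ b₄ : Bool} (L₁ : F.Leg b₁) (L₂ : F.Leg b₂) (L₃ : F.Leg b₃)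
  (L₄ : F.Leg b₄)

theorem amp₃_interaction (hk : VertexCoeffs.IsNormal F k) :
    amp₃ L₁.wave L₂.wave L₃.wave (F.interaction k)
    = amp₃ L₁.wave L₂.wave L₃.wave (F.exprVVV (fun a b c => 2 * k.cubic .vvv a b c))
      + amp₃ L₁.wave L₂.wave L₃.wave (F.exprLevi (k.cubic .levi))
      + amp₃ L₁.wave L₂.wave L₃.wave (F.exprPVP (fun a b c => 2 * k.cubic .pvp a b c))
      + amp₃ L₁.wave L₂.wave L₃.wave (F.exprVUA (fun a b c => 2 * k.cubic .uadv b c a))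
      + amp₃ L₁.wave L₂.wave L₃.wave (F.exprAUV (k.cubic .dauv))
      + amp₃ L₁.wave L₂.wave L₃.wave (F.exprPVV (k.cubic .pvv))
      + amp₃ L₁.wave L₂.wave L₃.wave (F.exprPPP (k.cubic .ppp))
      + amp₃ L₁.wave L₂.wave L₃.wave (F.exprUAP (k.cubic .uap)) := by
  have h1 (ε A B c) : amp₃ L₁.wave L₂.wave L₃.wave (F.scalarVertex ε A B c) = 0 := by
    simp [scalarVertex, psibar, psi, phi, amp₃_jets, amp₂_jets, Leg.val_dirac]
  have h2 (ε A B c) : amp₃ L₁.wave L₂.wave L₃.wave (F.vectorVertex ε A B c) = 0 := by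
    simp [vectorVertex, psibar, psi, v, amp₃_jets, amp₂_jets, Leg.val_dirac]
  simp [interaction, sum_cubicVertex hk, sum_quarticVertex, amp₃_quadrilinear, h1, h2]

theorem amp₄_interaction (hk : VertexCoeffs.IsNormal F k) :
    amp₄ L₁.wave L₂.wave L₃.wave L₄.wave (F.interaction k)
    = amp₄ L₁.wave L₂.wave L₃.wave L₄.wave (F.quadrilinear (I := Unit) 1
        (fun _ => ![.phi, .phi, .phi, .phi]) (k.quartic .pppp))
      + amp₄ L₁.wave L₂.wave L₃.wave L₄.wave (F.quadrilinear (I := Fin 4) eta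
        (fun μ => ![.v μ, .v μ, .phi, .phi]) (k.quartic .vvpp))
      + amp₄ L₁.wave L₂.wave L₃.wave L₄.wave (F.quadrilinear (I := Fin 4 × Fin 4)
        (fun i => eta i.1 * eta i.2) (fun i => ![.v i.1, .v i.1, .v i.2, .v i.2]) (k.quartic .vvvv))
      + amp₄ L₁.wave L₂.wave L₃.wave L₄.wave (F.quadrilinear (I := Fin 4 × Fin 4 × Fin 4 × Fin 4)
        (fun i => levi i.1 i.2.1 i.2.2.1 i.2.2.2)
        (fun i => ![.v i.1, .v i.2.1, .v i.2.2.1, .v i.2.2.2]) (k.quartic .levi))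
      + amp₄ L₁.wave L₂.wave L₃.wave L₄.wave (F.quadrilinear (I := Unit) 1
        (fun _ => ![.u, .ut, .phi, .phi]) (k.quartic .uapp))
      + amp₄ L₁.wave L₂.wave L₃.wave L₄.wave (F.quadrilinear (I := Fin 4) eta
        (fun μ => ![.u, .ut, .v μ, .v μ]) (k.quartic .uavv))
      + amp₄ L₁.wave L₂.wave L₃.wave L₄.wave (F.quadrilinear (I := Unit) 1
        (fun _ => ![.u, .u, .ut, .ut]) (k.quartic .uuaa)) := by
  have h1 (ε A B c) : amp₄ L₁.wave L₂.wave L₃.wave L₄.wave (F.scalarVertex ε A B c) = 0 := by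
    simp [scalarVertex, psibar, psi, phi, amp₄_three_jets]
  have h2 (ε A B c) : amp₄ L₁.wave L₂.wave L₃.wave L₄.wave (F.vectorVertex ε A B c) = 0 := by
    simp [vectorVertex, psibar, psi, v, amp₄_three_jets]
  simp [interaction, sum_cubicVertex hk, sum_quarticVertex, exprVVV, exprLevi, exprPVP, exprVUA,
    exprAUV, exprPVV, exprPPP, exprUAP, amp₄_trilinear, h1, h2]

set_option maxHeartbeats 2000000 in
/-- The co-cycle condition for a wave of a ghost and two waves of Bose fields. -/
theorem cubic_cocycle (hk : VertexCoeffs.IsNormal F k) (hQ : F.IsCocycle (F.interaction k))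
    (a b c : Ind) (p₁ p₂ p₃ e₂ e₃ : Fin 4 → ℂ) (φ₂ φ₃ : ℂ)
    (h₁ : dot p₁ p₁ = -(F.mass a : ℂ) ^ 2) (h₂ : dot p₂ p₂ = -(F.mass b : ℂ) ^ 2)
    (h₃ : dot p₃ p₃ = -(F.mass c : ℂ) ^ 2) (hp : ∀ μ, p₁ μ + p₂ μ + p₃ μ = 0)
    (ha : F.sector a ≠ .higgs) (he₂ : F.sector b = .higgs → e₂ = 0)
    (he₃ : F.sector c = .higgs → e₃ = 0) (hφ₂ : F.sector b = .massless → φ₂ = 0)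
    (hφ₃ : F.sector c = .massless → φ₃ = 0) :
    2 * (k.cubic .vvv c b a * (dot p₃ e₂ * dot e₃ p₁)
      + k.cubic .vvv c a b * (dot p₃ p₁ * dot e₃ e₂)
      + k.cubic .vvv b c a * (dot p₂ e₃ * dot e₂ p₁)
      + k.cubic .vvv a c b * (dot p₁ e₃ * dot p₁ e₂)
      + k.cubic .vvv b a c * (dot p₂ p₁ * dot e₂ e₃)
      + k.cubic .vvv a b c * (dot p₁ e₂ * dot p₁ e₃))
    + (k.cubic .levi c b a * lev p₃ e₃ e₂ p₁ + k.cubic .levi c a b * lev p₃ e₃ p₁ e₂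
      + k.cubic .levi b c a * lev p₂ e₂ e₃ p₁ + k.cubic .levi a c b * lev p₁ p₁ e₃ e₂
      + k.cubic .levi b a c * lev p₂ e₂ p₁ e₃ + k.cubic .levi a b c * lev p₁ p₁ e₂ e₃)
    + 2 * F.gaugeMass a * (k.cubic .pvp c b a * φ₃ * dot p₃ e₂ + k.cubic .pvp b c a * φ₂ * dot p₂ e₃
      + k.cubic .pvp a c b * φ₂ * dot p₁ e₃ + k.cubic .pvp a b c * φ₃ * dot p₁ e₂)
    + 2 * φ₂ * φ₃ * (k.cubic .pvp c a b * dot p₃ p₁ + k.cubic .pvp b a c * dot p₂ p₁)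
    + ((k.cubic .pvv c b a + k.cubic .pvv c a b) * φ₃ * dot p₁ e₂
      + (k.cubic .pvv b c a + k.cubic .pvv b a c) * φ₂ * dot p₁ e₃
      + (k.cubic .pvv a b c + k.cubic .pvv a c b) * F.gaugeMass a * dot e₂ e₃)
    + (k.cubic .ppp c b a + k.cubic .ppp c a b + k.cubic .ppp b c a + k.cubic .ppp a c b
      + k.cubic .ppp b a c + k.cubic .ppp a b c) * F.gaugeMass a * φ₂ * φ₃
    + (dot p₃ e₃ + F.gaugeMass c * φ₃) * (2 * k.cubic .uadv a c b * dot p₂ e₂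
      - k.cubic .dauv c a b * dot p₃ e₂ + k.cubic .uap a c b * φ₂)
    + (dot p₂ e₂ + F.gaugeMass b * φ₂) * (2 * k.cubic .uadv a b c * dot p₃ e₃
      - k.cubic .dauv b a c * dot p₂ e₃ + k.cubic .uap a b c * φ₃) = 0 := by
  set G := Leg.ghost a p₁ 1 0 h₁ ha
  set B₂ := Leg.bose b p₂ e₂ φ₂ h₂ he₂ hφ₂
  set B₃ := Leg.bose c p₃ e₃ φ₃ h₃ he₃ hφ₃
  have h := amp₃_cocycle G.wave B₂.wave B₃.wave hQ hp
  have z (x : ℂ) : -Complex.I * x * 0 = 0 := by ring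
  rw [Leg.wave_gauge, Leg.wave_gauge, Leg.wave_gauge, amp₃_interaction _ _ _ hk,
    amp₃_interaction _ _ _ hk, amp₃_interaction _ _ _ hk] at h
  have v1 (k) := amp₃_expr_bose G B₂ B₃.gauge k (fun _ => rfl) rfl
  have v2 (k) := amp₃_expr_bose G B₂.gauge B₃ k (fun _ => rfl) rfl
  have v3 (k) := amp₃_expr_ghosts G.gauge B₂ B₃ k
  have w1 (k) := amp₃_ghost₃ G k B₂ B₃.gauge rfl rfl
  have w2 (k) := amp₃_ghost₂ G k B₂.gauge B₃ rfl rfl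
  simp only [fun k => (v1 k).1, fun k => (v1 k).2.1, fun k => (v1 k).2.2.1,
    fun k => (v1 k).2.2.2.1, fun k => (v1 k).2.2.2.2, fun k => (v2 k).1, fun k => (v2 k).2.1,
    fun k => (v2 k).2.2.1, fun k => (v2 k).2.2.2.1, fun k => (v2 k).2.2.2.2, fun k => (v3 k).1,
    fun k => (v3 k).2.1, fun k => (v3 k).2.2, fun k => (w1 k).1, fun k => (w1 k).2.1,
    fun k => (w1 k).2.2, fun k => (w2 k).1, fun k => (w2 k).2.1, fun k => (w2 k).2.2] at h
  have e1 : G.gauge.vec = fun μ => Complex.I * p₁ μ :=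
    funext fun μ => by simp [G, Leg.vec, Leg.gauge, Leg.ghost]
  have e2 : B₂.vec = e₂ := rfl
  have e3 : B₃.vec = e₃ := rfl
  have f1 : G.gauge.pol .phi = Complex.I * F.gaugeMass a := by simp [G, Leg.gauge, Leg.ghost]
  have g1 : B₂.gauge.pol .ut = -Complex.I * (dot p₂ e₂ + F.gaugeMass b * φ₂) := rfl
  have g2 : B₃.gauge.pol .ut = -Complex.I * (dot p₃ e₃ + F.gaugeMass c * φ₃) := rfl
  have i1 : G.pol .u = 1 := rfl
  have j2 : B₂.pol .phi = φ₂ := rfl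
  have j3 : B₃.pol .phi = φ₃ := rfl
  have m1 : G.gauge.mom = p₁ := rfl
  have m2 : B₂.mom = p₂ := rfl
  have m3 : B₃.mom = p₃ := rfl
  have m2' : B₂.gauge.mom = p₂ := rfl
  have m3' : B₃.gauge.mom = p₃ := rfl
  have n1 : G.gauge.flavour = a := rfl
  have n1' : G.flavour = a := rfl
  have n2 : B₂.flavour = b := rfl
  have n3 : B₃.flavour = c := rfl
  have n2' : B₂.gauge.flavour = b := rfl
  have n3' : B₃.gauge.flavour = c := rfl
  simp only [amp₃_exprVVV, amp₃_exprLevi, amp₃_exprPVP, amp₃_exprPVV, amp₃_exprPPP, e1, e2, e3, f1,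
    g1, g2, i1, j2, j3, m1, m2, m3, m2', m3', n1, n1', n2, n3, n2', n3', koszul_false,
    dot_mul_left, dot_mul_right, lev_mul₂, lev_mul₃, lev_mul₄, dot_comm e₃ e₂] at h
  have d1 : dot e₂ p₁ = dot p₁ e₂ := dot_comm _ _
  have d2 : dot e₃ p₁ = dot p₁ e₃ := dot_comm _ _
  simp only [d1, d2, dot_comm e₃ e₂] at h ⊢
  have r : koszul false true = 1 := by simp [koszul]
  rw [r] at h
  refine (mul_eq_zero_iff_left Complex.I_ne_zero).1 ?_
  linear_combination h

end FieldContent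

/-- The determinant of four covectors, expanded. -/
theorem lev_expand (x y z w : Fin 4 → ℂ) : lev x y z w =
    x 0 * (y 1 * (z 2 * w 3 - z 3 * w 2) - y 2 * (z 1 * w 3 - z 3 * w 1)
      + y 3 * (z 1 * w 2 - z 2 * w 1))
    - x 1 * (y 0 * (z 2 * w 3 - z 3 * w 2) - y 2 * (z 0 * w 3 - z 3 * w 0)
      + y 3 * (z 0 * w 2 - z 2 * w 0))
    + x 2 * (y 0 * (z 1 * w 3 - z 3 * w 1) - y 1 * (z 0 * w 3 - z 3 * w 0)
      + y 3 * (z 0 * w 1 - z 1 * w 0))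
    - x 3 * (y 0 * (z 1 * w 2 - z 2 * w 1) - y 1 * (z 0 * w 2 - z 2 * w 0)
      + y 2 * (z 0 * w 1 - z 1 * w 0)) := by
  simp only [lev, Fin.sum_univ_four, levi, Fin.val_zero, Fin.val_one, Fin.val_two,
    show ((3 : Fin 4) : ℕ) = 3 from rfl]
  norm_num
  ring

/-- The covector with coefficients `x, y, z, w` in a basis of complex null covectors, in which the
first two and the last two have products `1` with each other, and all the other products are
zero. -/
def nullFrame (x y z w : ℂ) : Fin 4 → ℂ :=
  ![x + y / 2, z - w / 2, Complex.I * (z + w / 2), x - y / 2]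

theorem dot_nullFrame (x y z w x' y' z' w' : ℂ) :
    dot (nullFrame x y z w) (nullFrame x' y' z' w') = x * y' + y * x' + z * w' + w * z' := by
  simp [dot, nullFrame, Fin.sum_univ_four, eta]
  linear_combination -(z + w / 2) * (z' + w' / 2) * Complex.I_mul_I

theorem nullFrame_add (x y z w x' y' z' w' : ℂ) (μ : Fin 4) :
    nullFrame x y z w μ + nullFrame x' y' z' w' μ
      = nullFrame (x + x') (y + y') (z + z') (w + w') μ := by
  fin_cases μ <;> simp [nullFrame] <;> ring

theorem nullFrame_zero : nullFrame 0 0 0 0 = 0 := by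
  funext μ
  fin_cases μ <;> simp [nullFrame]

namespace FieldContent
variable {Ind Dir : Type*} [Fintype Ind] {F : FieldContent Ind Dir} {k : VertexCoeffs Ind Dir}
  [Fintype Dir]

/-- The co-cycle condition for a wave of a ghost and two waves of Bose fields, written out for momenta
and polarizations in a null frame. The momenta `nullFrame 1 * 0 0`, `nullFrame 0 r 1 *` and minus their
sum have the squares that the three masses prescribe; `nullFrame s P 0 Q` and `nullFrame 0 x 0 y` are
the polarizations of the vector fields, `φ₂` and `φ₃` the amplitudes of the scalar fields. As the
condition holds for all values of these parameters, it amounts to one relation for each monomial in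
them. -/
theorem cubic_cocycle_nullFrame (hk : VertexCoeffs.IsNormal F k)
    (hQ : F.IsCocycle (F.interaction k))
    (a b c : Ind) (P Q s x y φ₂ φ₃ r : ℂ)
    (hr : r = ((F.mass a : ℂ) ^ 2 + (F.mass b : ℂ) ^ 2 - (F.mass c : ℂ) ^ 2) / 2)
    (ha : F.sector a ≠ .higgs) (he₂ : F.sector b = .higgs → P = 0 ∧ Q = 0 ∧ s = 0)
    (he₃ : F.sector c = .higgs → x = 0 ∧ y = 0) (hφ₂ : F.sector b = .massless → φ₂ = 0)
    (hφ₃ : F.sector c = .massless → φ₃ = 0) :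
    2 * (k.cubic .vvv c b a * ((- P - Q + s * ((F.mass a : ℂ) ^ 2 / 2 - r)) * x)
      + k.cubic .vvv c a b * (((F.mass a : ℂ) ^ 2 - r) * (s * x))
      + k.cubic .vvv b c a * (y * (P - s * (F.mass a : ℂ) ^ 2 / 2))
      + k.cubic .vvv a c b * (x * (P - s * (F.mass a : ℂ) ^ 2 / 2))
      + k.cubic .vvv b a c * (r * (s * x))
      + k.cubic .vvv a b c * ((P - s * (F.mass a : ℂ) ^ 2 / 2) * x))
    + 2 * F.gaugeMass a * (k.cubic .pvp c b a * φ₃ * (- P - Q + s * ((F.mass a : ℂ) ^ 2 / 2 - r))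
      + k.cubic .pvp b c a * φ₂ * y
      + k.cubic .pvp a c b * φ₂ * x + k.cubic .pvp a b c * φ₃ * (P - s * (F.mass a : ℂ) ^ 2 / 2))
    + 2 * φ₂ * φ₃ * (k.cubic .pvp c a b * ((F.mass a : ℂ) ^ 2 - r) + k.cubic .pvp b a c * r)
    + ((k.cubic .pvv c b a + k.cubic .pvv c a b) * φ₃ * (P - s * (F.mass a : ℂ) ^ 2 / 2)
      + (k.cubic .pvv b c a + k.cubic .pvv b a c) * φ₂ * x
      + (k.cubic .pvv a b c + k.cubic .pvv a c b) * F.gaugeMass a * (s * x))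
    + (k.cubic .ppp c b a + k.cubic .ppp c a b + k.cubic .ppp b c a + k.cubic .ppp a c b
      + k.cubic .ppp b a c + k.cubic .ppp a b c) * F.gaugeMass a * φ₂ * φ₃
    + (- x - y + F.gaugeMass c * φ₃) * (2 * k.cubic .uadv a c b * (Q + s * r)
      - k.cubic .dauv c a b * (- P - Q + s * ((F.mass a : ℂ) ^ 2 / 2 - r))
      + k.cubic .uap a c b * φ₂)
    + (Q + s * r + F.gaugeMass b * φ₂) * (2 * k.cubic .uadv a b c * (- x - y)
      - k.cubic .dauv b a c * y + k.cubic .uap a b c * φ₃) = 0 := by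
  set p₁ := nullFrame 1 (-(F.mass a : ℂ) ^ 2 / 2) 0 0 with hp₁
  set p₂ := nullFrame 0 r 1 (-(F.mass b : ℂ) ^ 2 / 2) with hp₂
  set p₃ := nullFrame (-1) ((F.mass a : ℂ) ^ 2 / 2 - r) (-1) ((F.mass b : ℂ) ^ 2 / 2) with hp₃
  set e₂ := nullFrame s P 0 Q with he₂'
  set e₃ := nullFrame 0 x 0 y with he₃'
  have s₁ : dot p₁ p₁ = -(F.mass a : ℂ) ^ 2 := by rw [hp₁, dot_nullFrame]; ring
  have s₂ : dot p₂ p₂ = -(F.mass b : ℂ) ^ 2 := by rw [hp₂, dot_nullFrame]; ring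
  have s₃ : dot p₃ p₃ = -(F.mass c : ℂ) ^ 2 := by rw [hp₃, dot_nullFrame, hr]; ring
  have hp (μ) : p₁ μ + p₂ μ + p₃ μ = 0 := by
    rw [hp₁, hp₂, hp₃, nullFrame_add, nullFrame_add]
    ring_nf
    simp [nullFrame_zero]
  have z₂ (h : F.sector b = .higgs) : e₂ = 0 := by
    obtain ⟨h1, h2, h3⟩ := he₂ h
    rw [he₂', h1, h2, h3, nullFrame_zero]
  have z₃ (h : F.sector c = .higgs) : e₃ = 0 := by
    obtain ⟨h1, h2⟩ := he₃ h
    rw [he₃', h1, h2, nullFrame_zero]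
  have z' (x : Fin 4 → ℂ) (h : x = 0) : reflect x = 0 := by
    rw [h]; funext μ; simp [reflect]
  have h := cubic_cocycle hk hQ a b c p₁ p₂ p₃ e₂ e₃ φ₂ φ₃ s₁ s₂ s₃ hp ha z₂ z₃ hφ₂ hφ₃
  -- The reflected waves show that the terms of even and odd parity vanish separately.
  have h' := cubic_cocycle hk hQ a b c (reflect p₁) (reflect p₂) (reflect p₃) (reflect e₂)
    (reflect e₃) φ₂ φ₃ (by rwa [dot_reflect]) (by rwa [dot_reflect]) (by rwa [dot_reflect])
    (fun μ => by simp only [reflect, ← mul_add, hp, mul_zero]) ha (fun h => z' _ (z₂ h))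
    (fun h => z' _ (z₃ h)) hφ₂ hφ₃
  simp only [dot_reflect, lev_reflect] at h'
  simp only [hp₁, hp₂, hp₃, he₂', he₃', dot_nullFrame] at h h'
  linear_combination (h + h') / 2

/-- The parity violating terms in the co-cycle condition, isolated by subtracting the condition for
the reflected waves. -/
theorem levi_cocycle (hk : VertexCoeffs.IsNormal F k) (hQ : F.IsCocycle (F.interaction k))
    (a b c : Ind) (ha : F.sector a ≠ .higgs) (hb : F.sector b ≠ .higgs)
    (hc : F.sector c ≠ .higgs) :
    k.cubic .levi c a b - k.cubic .levi c b a + k.cubic .levi b a c - k.cubic .levi b c a = 0 := by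
  obtain ⟨r, hr⟩ : ∃ r, r = ((F.mass a : ℂ) ^ 2 + (F.mass b : ℂ) ^ 2 - (F.mass c : ℂ) ^ 2) / 2 :=
    ⟨_, rfl⟩
  set p₁ := nullFrame 1 (-(F.mass a : ℂ) ^ 2 / 2) 0 0 with hp₁
  set p₂ := nullFrame 0 r 1 (-(F.mass b : ℂ) ^ 2 / 2) with hp₂
  set p₃ := nullFrame (-1) ((F.mass a : ℂ) ^ 2 / 2 - r) (-1) ((F.mass b : ℂ) ^ 2 / 2) with hp₃
  set e₂ := nullFrame 0 1 0 0 with he₂'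
  set e₃ := nullFrame 0 0 0 1 with he₃'
  have s₁ : dot p₁ p₁ = -(F.mass a : ℂ) ^ 2 := by rw [hp₁, dot_nullFrame]; ring
  have s₂ : dot p₂ p₂ = -(F.mass b : ℂ) ^ 2 := by rw [hp₂, dot_nullFrame]; ring
  have s₃ : dot p₃ p₃ = -(F.mass c : ℂ) ^ 2 := by rw [hp₃, dot_nullFrame, hr]; ring
  have hp (μ) : p₁ μ + p₂ μ + p₃ μ = 0 := by
    rw [hp₁, hp₂, hp₃, nullFrame_add, nullFrame_add]
    ring_nf
    simp [nullFrame_zero]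
  have h := cubic_cocycle hk hQ a b c p₁ p₂ p₃ e₂ e₃ 0 0 s₁ s₂ s₃ hp ha (fun h => absurd h hb)
    (fun h => absurd h hc) (fun _ => rfl) (fun _ => rfl)
  have h' := cubic_cocycle hk hQ a b c (reflect p₁) (reflect p₂) (reflect p₃) (reflect e₂)
    (reflect e₃) 0 0 (by rwa [dot_reflect]) (by rwa [dot_reflect]) (by rwa [dot_reflect])
    (fun μ => by simp only [reflect, ← mul_add, hp, mul_zero]) ha (fun h => absurd h hb)
    (fun h => absurd h hc) (fun _ => rfl) (fun _ => rfl)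
  simp only [dot_reflect, lev_reflect] at h'
  have l₁ : lev p₃ e₃ e₂ p₁ = lev p₁ p₂ e₂ e₃ * (-1) := by
    rw [hp₁, hp₂, hp₃, he₂', he₃', lev_expand, lev_expand]
    simp [nullFrame]
    ring
  have l₂ : lev p₃ e₃ p₁ e₂ = lev p₁ p₂ e₂ e₃ := by
    rw [hp₁, hp₂, hp₃, he₂', he₃', lev_expand, lev_expand]
    simp [nullFrame]
    ring
  have l₃ : lev p₂ e₂ e₃ p₁ = lev p₁ p₂ e₂ e₃ * (-1) := by
    rw [hp₁, hp₂, he₂', he₃', lev_expand, lev_expand]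
    simp [nullFrame]
    ring
  have l₄ : lev p₂ e₂ p₁ e₃ = lev p₁ p₂ e₂ e₃ := by
    rw [hp₁, hp₂, he₂', he₃', lev_expand, lev_expand]
    simp [nullFrame]
    ring
  have l₅ (x y) : lev p₁ p₁ x y = 0 := by rw [lev_expand]; ring
  have l₀ : lev p₁ p₂ e₂ e₃ = Complex.I := by
    rw [hp₁, hp₂, he₂', he₃', lev_expand]
    simp [nullFrame]
    ring
  rw [l₁, l₂, l₃, l₄, l₅, l₅, l₀] at h h'
  refine (mul_eq_zero_iff_left Complex.I_ne_zero).1 ?_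
  linear_combination (h - h') / 2

end FieldContent
namespace FieldContent
variable {Ind Dir : Type*} {F : FieldContent Ind Dir}

/-! ### Trilinear couplings -/

theorem sector_eq_massive {a : Ind} (h : F.sector a ≠ .higgs) (h' : F.sector a ≠ .massless) :
    F.sector a = .massive := by
  cases h'' : F.sector a <;> simp_all

variable {k : VertexCoeffs Ind Dir}

namespace VertexCoeffs.IsNormal

variable (hk : VertexCoeffs.IsNormal F k)
include hk

/-! Symmetries of the trilinear couplings. -/

theorem vvv_neg (a b c : Ind) : k.cubic .vvv a b c = -k.cubic .vvv c b a :=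
  hk.cubic_neg _ _ _ _ _ _ _ (F.cubicVertex_vvv_neg a b c)

theorem pvp_neg (a b c : Ind) : k.cubic .pvp a b c = -k.cubic .pvp c b a :=
  hk.cubic_neg _ _ _ _ _ _ _ (F.cubicVertex_pvp_neg a b c)

theorem uadv_swap (a b c : Ind) : k.cubic .uadv a b c = k.cubic .uadv a c b :=
  hk.cubic_eq _ _ _ _ _ _ _ (F.cubicVertex_uadv_swap a b c)

theorem pvv_swap (a b c : Ind) : k.cubic .pvv a b c = k.cubic .pvv a c b :=
  hk.cubic_eq _ _ _ _ _ _ _ (F.cubicVertex_pvv_swap a b c)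

theorem ppp_swap (a b c : Ind) : k.cubic .ppp a b c = k.cubic .ppp b a c :=
  hk.cubic_eq _ _ _ _ _ _ _ (F.cubicVertex_ppp_swap a b c)

theorem ppp_swap' (a b c : Ind) : k.cubic .ppp a b c = k.cubic .ppp a c b :=
  hk.cubic_eq _ _ _ _ _ _ _ (F.cubicVertex_ppp_swap' a b c)

theorem levi_neg (a b c : Ind) : k.cubic .levi a b c = -k.cubic .levi a c b :=
  hk.cubic_neg _ _ _ _ _ _ _ (F.cubicVertex_levi_neg a b c)

/-! Couplings of absent fields. -/

theorem vvv_higgs {a b c : Ind}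
    (h : F.sector a = .higgs ∨ F.sector b = .higgs ∨ F.sector c = .higgs) :
    k.cubic .vvv a b c = 0 := by
  refine hk.cubic_zero _ _ _ _ ?_
  rcases h with h | h | h <;> simp [cubicVertex, v, pd_field, F.jet_v_higgs h]

theorem levi_higgs {a b c : Ind}
    (h : F.sector a = .higgs ∨ F.sector b = .higgs ∨ F.sector c = .higgs) :
    k.cubic .levi a b c = 0 := by
  refine hk.cubic_zero _ _ _ _ ?_
  rcases h with h | h | h <;> simp [cubicVertex, v, pd_field, F.jet_v_higgs h]

theorem uadv_higgs {a b c : Ind} (h : F.sector a = .higgs ∨ F.sector b = .higgs) :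
    k.cubic .uadv a b c = 0 := by
  refine hk.cubic_zero _ _ _ _ ?_
  rcases h with h | h <;>
    simp [cubicVertex, v, u, ut, pd_field, F.jet_v_higgs h, F.jet_u_higgs h, F.jet_ut_higgs h]

theorem dauv_higgs {a b c : Ind}
    (h : F.sector a = .higgs ∨ F.sector b = .higgs ∨ F.sector c = .higgs) :
    k.cubic .dauv a b c = 0 := by
  refine hk.cubic_zero _ _ _ _ ?_
  rcases h with h | h | h <;>
    simp [cubicVertex, v, u, ut, pd_field, F.jet_v_higgs h, F.jet_u_higgs h, F.jet_ut_higgs h]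

theorem pvp_higgs {a b c : Ind} (h : F.sector b = .higgs) : k.cubic .pvp a b c = 0 :=
  hk.cubic_zero _ _ _ _ (by simp [cubicVertex, v, F.jet_v_higgs h])

theorem pvp_massless {a b c : Ind} (h : F.sector a = .massless) : k.cubic .pvp a b c = 0 :=
  hk.cubic_zero _ _ _ _ (by simp [cubicVertex, phi, pd_field, F.jet_phi_massless h])

theorem ppp_massless {a b c : Ind} (h : F.sector a = .massless) : k.cubic .ppp a b c = 0 :=
  hk.cubic_zero _ _ _ _ (by simp [cubicVertex, phi, F.jet_phi_massless h])

variable [Fintype Ind] [Fintype Dir] (hQ : F.IsCocycle (F.interaction k))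
include hQ

/-! Relations between the trilinear couplings. In most cases the relation is the coefficient of one
product of amplitudes in `cubic_cocycle_nullFrame`; the two amplitudes are set to `1` and the others
to `0`. -/

/-- The co-cycle condition makes the coefficients totally antisymmetric, hence each a third of its
cyclic sum, which vanishes by `levi_cyclic`. -/
theorem levi_eq_zero (a b c : Ind) : k.cubic .levi a b c = 0 := by
  by_cases ha : F.sector a = .higgs
  · exact hk.levi_higgs (.inl ha)
  by_cases hb : F.sector b = .higgs
  · exact hk.levi_higgs (.inr (.inl hb))
  by_cases hc : F.sector c = .higgs
  · exact hk.levi_higgs (.inr (.inr hc))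
  have h1 := levi_cocycle hk hQ a b c ha hb hc
  have h2 := levi_cocycle hk hQ b a c hb ha hc
  have h3 := hk.levi_cyclic a b c
  have e1 := hk.levi_neg a b c
  have e2 := hk.levi_neg b a c
  have e3 := hk.levi_neg c a b
  grind

/-- The ghost coupling is determined by the coupling of three vector fields. -/
theorem dauv_eq (a b c : Ind) : k.cubic .dauv c a b = 2 * k.cubic .vvv b c a := by
  by_cases ha : F.sector a = .higgs
  · rw [hk.dauv_higgs (.inr (.inl ha)), hk.vvv_higgs (.inr (.inr ha)), mul_zero]
  by_cases hb : F.sector b = .higgs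
  · rw [hk.dauv_higgs (.inr (.inr hb)), hk.vvv_higgs (.inl hb), mul_zero]
  by_cases hc : F.sector c = .higgs
  · rw [hk.dauv_higgs (.inl hc), hk.vvv_higgs (.inr (.inl hc)), mul_zero]
  have h := cubic_cocycle_nullFrame hk hQ a b c 1 0 0 0 1 0 0 _ rfl ha (by simp [hb]) (by simp [hc])
    (by simp) (by simp)
  linear_combination -h

/-- With `vvv_neg`, this makes the coupling of three vector fields totally antisymmetric. -/
theorem vvv_neg' (a b c : Ind) : k.cubic .vvv a b c = -k.cubic .vvv a c b := by
  by_cases ha : F.sector a = .higgs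
  · rw [hk.vvv_higgs (.inl ha), hk.vvv_higgs (.inl ha), neg_zero]
  by_cases hb : F.sector b = .higgs
  · rw [hk.vvv_higgs (.inr (.inl hb)), hk.vvv_higgs (.inr (.inr hb)), neg_zero]
  by_cases hc : F.sector c = .higgs
  · rw [hk.vvv_higgs (.inr (.inr hc)), hk.vvv_higgs (.inr (.inl hc)), neg_zero]
  have h := cubic_cocycle_nullFrame hk hQ a b c 1 0 0 1 0 0 0 _ rfl ha (by simp [hb]) (by simp [hc])
    (by simp) (by simp)
  rw [hk.dauv_eq hQ] at h
  linear_combination h / 4 + hk.vvv_neg c b a / 2 + hk.vvv_neg b c a / 2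

theorem uadv_eq_zero (a b c : Ind) : k.cubic .uadv a b c = 0 := by
  by_cases ha : F.sector a = .higgs
  · exact hk.uadv_higgs (.inl ha)
  by_cases hb : F.sector b = .higgs
  · exact hk.uadv_higgs (.inr hb)
  by_cases hc : F.sector c = .higgs
  · rw [hk.uadv_swap, hk.uadv_higgs (.inr hc)]
  have h := cubic_cocycle_nullFrame hk hQ a b c 0 1 0 1 0 0 0 _ rfl ha (by simp [hb]) (by simp [hc])
    (by simp) (by simp)
  rw [hk.dauv_eq hQ] at h
  linear_combination -h / 4 - hk.vvv_neg c b a / 2 + hk.uadv_swap a b c / 2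
    + hk.vvv_neg' hQ a b c / 2 - hk.vvv_neg b c a / 2

/-- The coupling of `Φ_c v_a v_b` is determined by the couplings of three vector fields and of `Φ ∂Φ
v`. -/
theorem pvv_eq (a b c : Ind) (ha : F.sector a ≠ .higgs) (hb : F.sector b ≠ .higgs)
    (hc : F.sector c ≠ .massless) : 2 * k.cubic .pvv c b a
      = -4 * F.gaugeMass a * k.cubic .pvp a b c - 2 * F.gaugeMass c * k.cubic .vvv a b c := by
  have h := cubic_cocycle_nullFrame hk hQ a b c 1 0 0 0 0 0 1 _ rfl ha (by simp [hb]) (by simp)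
    (by simp) (by simp [hc])
  rw [hk.dauv_eq hQ] at h
  linear_combination h + 2 * F.gaugeMass a * hk.pvp_neg c b a + hk.pvv_swap c b a
    - F.gaugeMass c * (2 * hk.vvv_neg b c a - 2 * hk.vvv_neg' hQ a c b)

/-- The coupling of `u_a ũ_b Φ_c` is determined by the couplings of three vector fields and of `Φ ∂Φ
v`. -/
theorem uap_eq (a b c : Ind) (ha : F.sector a ≠ .higgs) (hb : F.sector b ≠ .higgs)
    (hc : F.sector c ≠ .massless) : k.cubic .uap a b c
      = -2 * F.gaugeMass a * k.cubic .pvp a b c - 2 * F.gaugeMass c * k.cubic .vvv a b c := by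
  have h := cubic_cocycle_nullFrame hk hQ a b c 0 1 0 0 0 0 1 _ rfl ha (by simp [hb]) (by simp)
    (by simp) (by simp [hc])
  rw [hk.dauv_eq hQ, hk.uadv_eq_zero hQ, hk.uadv_eq_zero hQ] at h
  linear_combination h + 2 * F.gaugeMass a * hk.pvp_neg c b a
    - F.gaugeMass c * (2 * hk.vvv_neg b c a - 2 * hk.vvv_neg' hQ a c b)

/-- The mass relation between the coupling of `Φ ∂Φ v` and that of three vector fields, from the
symmetry of the coupling of `Φ_c v_a v_b` in `a` and `b`. -/
theorem pvp_mass (a b c : Ind) (ha : F.sector a ≠ .higgs) (hb : F.sector b ≠ .higgs)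
    (hc : F.sector c ≠ .massless) :
    F.gaugeMass a * k.cubic .pvp a b c - F.gaugeMass b * k.cubic .pvp b a c
      = -F.gaugeMass c * k.cubic .vvv a b c := by
  linear_combination hk.pvv_eq hQ a b c ha hb hc / 4 - hk.pvv_eq hQ b a c hb ha hc / 4
    - hk.pvv_swap c b a / 2 + F.gaugeMass c * (hk.vvv_neg b a c - hk.vvv_neg' hQ c a b +
    hk.vvv_neg c b a) / 2

/-- The relation between the cubic coupling of the scalar fields and the masses. In `mass² -
gaugeMass²` only the masses of Higgs fields remain. -/
theorem ppp_eq (a b c : Ind) (ha : F.sector a ≠ .higgs) (hb : F.sector b ≠ .massless)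
    (hc : F.sector c ≠ .massless) : 6 * F.gaugeMass a * k.cubic .ppp a b c
      = 2 * k.cubic .pvp c a b * (((F.mass b : ℂ) ^ 2 - (F.gaugeMass b : ℂ) ^ 2)
        - ((F.mass c : ℂ) ^ 2 - (F.gaugeMass c : ℂ) ^ 2)) := by
  have h := cubic_cocycle_nullFrame hk hQ a b c 0 0 0 0 0 1 1 _ rfl ha (by simp) (by simp)
    (by simp [hb]) (by simp [hc])
  have s1 := hk.ppp_swap' a b c
  have s2 := hk.ppp_swap a b c
  have s3 := hk.ppp_swap' b a c
  have s4 := hk.ppp_swap a c b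
  have s5 := hk.ppp_swap' c a b
  have s6 := hk.pvp_neg b a c
  have y1 : F.gaugeMass b * k.cubic .uap a b c = F.gaugeMass b *
      (-2 * F.gaugeMass a * k.cubic .pvp a b c - 2 * F.gaugeMass c * k.cubic .vvv a b c) := by
    by_cases hb' : F.sector b = .higgs
    · simp [gaugeMass_higgs _ hb']
    · rw [hk.uap_eq hQ a b c ha hb' hc]
  have y2 : F.gaugeMass c * k.cubic .uap a c b = F.gaugeMass c *
      (-2 * F.gaugeMass a * k.cubic .pvp a c b - 2 * F.gaugeMass b * k.cubic .vvv a c b) := by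
    by_cases hc' : F.sector c = .higgs
    · simp [gaugeMass_higgs _ hc']
    · rw [hk.uap_eq hQ a c b ha hc' hb]
  have z1 : F.gaugeMass b * (F.gaugeMass a * k.cubic .pvp a b c - F.gaugeMass b * k.cubic .pvp b a c)
      = F.gaugeMass b * (-F.gaugeMass c * k.cubic .vvv a b c) := by
    by_cases hb' : F.sector b = .higgs
    · simp [gaugeMass_higgs _ hb']
    · rw [hk.pvp_mass hQ a b c ha hb' hc]
  have z2 : F.gaugeMass c * (F.gaugeMass a * k.cubic .pvp a c b - F.gaugeMass c * k.cubic .pvp c a b)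
      = F.gaugeMass c * (-F.gaugeMass b * k.cubic .vvv a c b) := by
    by_cases hc' : F.sector c = .higgs
    · simp [gaugeMass_higgs _ hc']
    · rw [hk.pvp_mass hQ a c b ha hc' hb]
  rw [s6] at h z1
  rw [hk.uadv_eq_zero hQ, hk.uadv_eq_zero hQ, ← s5, ← s4, ← s3, ← s2, ← s1] at h
  linear_combination h - y1 - y2 + 2 * z1 + 2 * z2

end VertexCoeffs.IsNormal
end FieldContent

/-! ### Amplitudes of quadrilinear expressions -/

theorem lev_swap₁ (x y z w : Fin 4 → ℂ) : lev y x z w = -lev x y z w := by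
  rw [lev_expand, lev_expand]; ring

theorem lev_swap₂ (x y z w : Fin 4 → ℂ) : lev x z y w = -lev x y z w := by
  rw [lev_expand, lev_expand]; ring

theorem lev_swap₃ (x y z w : Fin 4 → ℂ) : lev x y w z = -lev x y z w := by
  rw [lev_expand, lev_expand]; ring

theorem sum_eta_sq_mul_sq (x y z w : Fin 4 → ℂ) : ∑ i : Fin 4 × Fin 4,
    eta i.1 * eta i.2 * (x i.1 * y i.1 * z i.2 * w i.2) = dot x y * dot z w := by
  simp only [dot, Fintype.sum_prod_type, Finset.sum_mul_sum]
  exact Finset.sum_congr rfl fun μ _ => Finset.sum_congr rfl fun ν _ => by ring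

theorem sum_eta_mul_left (x y : Fin 4 → ℂ) (c d : ℂ) :
    ∑ μ, eta μ * (x μ * y μ * c * d) = c * d * dot x y := by
  rw [dot, Finset.mul_sum]
  exact Finset.sum_congr rfl fun μ _ => by ring

theorem sum_eta_mul_right (x y : Fin 4 → ℂ) (c d : ℂ) :
    ∑ μ, eta μ * (c * d * x μ * y μ) = c * d * dot x y := by
  rw [dot, Finset.mul_sum]
  exact Finset.sum_congr rfl fun μ _ => by ring

theorem sum_levi (x y z w : Fin 4 → ℂ) : ∑ i : Fin 4 × Fin 4 × Fin 4 × Fin 4,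
    levi i.1 i.2.1 i.2.2.1 i.2.2.2 * (x i.1 * y i.2.1 * z i.2.2.1 * w i.2.2.2) = lev x y z w := by
  simp only [lev, Fintype.sum_prod_type]

namespace FieldContent
variable {Ind Dir : Type*} {F : FieldContent Ind Dir} [Fintype Ind]

section

variable (L₁ L₂ L₃ L₄ : F.Leg false) (k : Ind → Ind → Ind → Ind → ℂ)

theorem amp₄_pppp (h₁ : ∀ a b c d, k b a c d = k a b c d) (h₂ : ∀ a b c d, k a c b d = k a b c d)
    (h₃ : ∀ a b c d, k a b d c = k a b c d) :
    amp₄ L₁.wave L₂.wave L₃.wave L₄.wave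
      (F.quadrilinear (I := Unit) 1 (fun _ => ![.phi, .phi, .phi, .phi]) k)
    = 24 * k L₁.flavour L₂.flavour L₃.flavour L₄.flavour *
      (L₁.pol .phi * L₂.pol .phi * L₃.pol .phi * L₄.pol .phi) := by
  rw [amp₄_quadrilinear]
  simp [koszul_false]
  generalize L₁.flavour = a; generalize L₂.flavour = b; generalize L₃.flavour = c
  generalize L₄.flavour = d
  simp only [h₁ a b, h₁ a c, h₁ a d, h₁ b c, h₁ b d, h₁ c d, h₂ _ a b, h₂ _ a c, h₂ _ a d, h₂ _ b c,
    h₂ _ b d, h₂ _ c d, h₃ _ _ a b, h₃ _ _ a c, h₃ _ _ a d, h₃ _ _ b c, h₃ _ _ b d, h₃ _ _ c d]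
  ring

theorem amp₄_levi (h₁ : ∀ a b c d, k b a c d = -k a b c d) (h₂ : ∀ a b c d, k a c b d = -k a b c d)
    (h₃ : ∀ a b c d, k a b d c = -k a b c d) :
    amp₄ L₁.wave L₂.wave L₃.wave L₄.wave
      (F.quadrilinear (I := Fin 4 × Fin 4 × Fin 4 × Fin 4)
        (fun i => levi i.1 i.2.1 i.2.2.1 i.2.2.2)
        (fun i => ![.v i.1, .v i.2.1, .v i.2.2.1, .v i.2.2.2]) k)
    = 24 * k L₁.flavour L₂.flavour L₃.flavour L₄.flavour * lev L₁.vec L₂.vec L₃.vec L₄.vec := by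
  have s (L L' L'' L''' : F.Leg false) := sum_levi L.vec L'.vec L''.vec L'''.vec
  simp only [Leg.vec] at s
  rw [amp₄_quadrilinear]
  simp only [koszul_false, one_mul, Matrix.cons_val]
  simp only [s]
  generalize L₁.flavour = a; generalize L₂.flavour = b; generalize L₃.flavour = c
  generalize L₄.flavour = d
  generalize L₁.vec = x; generalize L₂.vec = y; generalize L₃.vec = z
  generalize L₄.vec = w
  simp only [h₁ a b, h₁ a c, h₁ a d, h₁ b c, h₁ b d, h₁ c d, h₂ _ a b, h₂ _ a c, h₂ _ a d, h₂ _ b c,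
    h₂ _ b d, h₂ _ c d, h₃ _ _ a b, h₃ _ _ a c, h₃ _ _ a d, h₃ _ _ b c, h₃ _ _ b d, h₃ _ _ c d,
    lev_swap₁ x y, lev_swap₁ x z, lev_swap₁ x w, lev_swap₁ y z, lev_swap₁ y w, lev_swap₁ z w,
    lev_swap₂ _ x y, lev_swap₂ _ x z, lev_swap₂ _ x w, lev_swap₂ _ y z, lev_swap₂ _ y w,
    lev_swap₂ _ z w, lev_swap₃ _ _ x y, lev_swap₃ _ _ x z, lev_swap₃ _ _ x w, lev_swap₃ _ _ y z,
    lev_swap₃ _ _ y w, lev_swap₃ _ _ z w]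
  ring

theorem amp₄_vvvv (h₁ : ∀ a b c d, k b a c d = k a b c d) (h₂ : ∀ a b c d, k a b d c = k a b c d)
    (h₃ : ∀ a b c d, k c d a b = k a b c d) :
    amp₄ L₁.wave L₂.wave L₃.wave L₄.wave (F.quadrilinear (I := Fin 4 × Fin 4)
        (fun i => eta i.1 * eta i.2) (fun i => ![.v i.1, .v i.1, .v i.2, .v i.2]) k)
    = 8 * (k L₁.flavour L₂.flavour L₃.flavour L₄.flavour * dot L₁.vec L₂.vec * dot L₃.vec L₄.vec
      + k L₁.flavour L₃.flavour L₂.flavour L₄.flavour * dot L₁.vec L₃.vec * dot L₂.vec L₄.vec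
      + k L₁.flavour L₄.flavour L₂.flavour L₃.flavour * dot L₁.vec L₄.vec * dot L₂.vec L₃.vec) := by
  have s (L L' L'' L''' : F.Leg false) := sum_eta_sq_mul_sq L.vec L'.vec L''.vec L'''.vec
  simp only [Leg.vec] at s
  rw [amp₄_quadrilinear]
  simp only [koszul_false, one_mul, Matrix.cons_val]
  simp only [s]
  generalize L₁.flavour = a; generalize L₂.flavour = b; generalize L₃.flavour = c
  generalize L₄.flavour = d
  generalize L₁.vec = x; generalize L₂.vec = y; generalize L₃.vec = z
  generalize L₄.vec = w
  simp only [h₃ a _ b, h₃ a _ c, h₃ a _ d, h₁ a b, h₁ a c, h₁ a d, h₁ b c, h₁ b d, h₁ c d,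
    h₂ _ _ a b, h₂ _ _ a c, h₂ _ _ a d, h₂ _ _ b c, h₂ _ _ b d, h₂ _ _ c d, dot_comm y x,
    dot_comm z x, dot_comm w x, dot_comm z y, dot_comm w y, dot_comm w z]
  ring

theorem amp₄_vvpp (h₁ : ∀ a b c d, k b a c d = k a b c d) (h₂ : ∀ a b c d, k a b d c = k a b c d) :
    amp₄ L₁.wave L₂.wave L₃.wave L₄.wave (F.quadrilinear (I := Fin 4) eta
        (fun μ => ![.v μ, .v μ, .phi, .phi]) k)
    = 4 * (k L₁.flavour L₂.flavour L₃.flavour L₄.flavour * dot L₁.vec L₂.vec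
        * L₃.pol .phi * L₄.pol .phi
      + k L₁.flavour L₃.flavour L₂.flavour L₄.flavour * dot L₁.vec L₃.vec
        * L₂.pol .phi * L₄.pol .phi
      + k L₁.flavour L₄.flavour L₂.flavour L₃.flavour * dot L₁.vec L₄.vec
        * L₂.pol .phi * L₃.pol .phi
      + k L₂.flavour L₃.flavour L₁.flavour L₄.flavour * dot L₂.vec L₃.vec
        * L₁.pol .phi * L₄.pol .phi
      + k L₂.flavour L₄.flavour L₁.flavour L₃.flavour * dot L₂.vec L₄.vec
        * L₁.pol .phi * L₃.pol .phi
      + k L₃.flavour L₄.flavour L₁.flavour L₂.flavour * dot L₃.vec L₄.vec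
        * L₁.pol .phi * L₂.pol .phi) := by
  have s (L L' : F.Leg false) := sum_eta_mul_left L.vec L'.vec
  simp only [Leg.vec] at s
  rw [amp₄_quadrilinear]
  simp only [koszul_false, one_mul, Matrix.cons_val]
  simp only [s]
  generalize L₁.flavour = a; generalize L₂.flavour = b; generalize L₃.flavour = c
  generalize L₄.flavour = d
  generalize L₁.vec = x; generalize L₂.vec = y; generalize L₃.vec = z
  generalize L₄.vec = w
  simp only [h₁ a b, h₁ a c, h₁ a d, h₁ b c, h₁ b d, h₁ c d,
    h₂ _ _ a b, h₂ _ _ a c, h₂ _ _ a d, h₂ _ _ b c, h₂ _ _ b d, h₂ _ _ c d, dot_comm y x,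
    dot_comm z x, dot_comm w x, dot_comm z y, dot_comm w y, dot_comm w z]
  ring

/-- Without waves of ghosts, vertices with ghosts have no amplitudes. -/
theorem amp₄_ghost_bose {I : Type*} [Fintype I] (z : I → ℂ) (x : I → Fin 4 → QuadComp)
    (hx : ∀ i, x i 0 = .u) : amp₄ L₁.wave L₂.wave L₃.wave L₄.wave (F.quadrilinear z x k) = 0 := by
  rw [amp₄_quadrilinear]
  simp [hx, Leg.bose_u]

end
end FieldContent
namespace FieldContent
variable {Ind Dir : Type*} {F : FieldContent Ind Dir}

section
variable [Fintype Ind] (k : Ind → Ind → Ind → Ind → ℂ)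

/-- Vertices without ghosts have no amplitudes with ghosts. -/
theorem amp₄_bose_ghost {I : Type*} [Fintype I] {b₁ b₂ b₃ b₄ : Bool} (L₁ : F.Leg b₁) (L₂ : F.Leg b₂)
    (L₃ : F.Leg b₃) (L₄ : F.Leg b₄) (z : I → ℂ) (x : I → Fin 4 → QuadComp)
    (hx : ∀ i j, L₁.pol (x i j) = 0) :
    amp₄ L₁.wave L₂.wave L₃.wave L₄.wave (F.quadrilinear z x k) = 0 := by
  rw [amp₄_quadrilinear]
  simp [hx]

variable (L₁ : F.Leg true)

/-! The amplitudes of a ghost `L₁`, an antighost, and two Bose fields. -/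

section
variable (hk : ∀ a b c d, k a b d c = k a b c d) (h₁ : L₁.pol .ut = 0)
include hk h₁

theorem amp₄_uapp₂ (L₂ : F.Leg true) (L₃ L₄ : F.Leg false) (h₂ : L₂.pol .u = 0) :
    amp₄ L₁.wave L₂.wave L₃.wave L₄.wave
      (F.quadrilinear (I := Unit) 1 (fun _ => ![.u, .ut, .phi, .phi]) k)
    = -2 * k L₁.flavour L₂.flavour L₃.flavour L₄.flavour *
      (L₁.pol .u * L₂.pol .ut * L₃.pol .phi * L₄.pol .phi) := by
  rw [amp₄_quadrilinear]
  simp [koszul, quadOdd, Comp.odd, h₁, h₂, Leg.bose_u, Leg.bose_ut, Leg.fermi_phi,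
    hk _ _ L₃.flavour L₄.flavour]
  ring

theorem amp₄_uapp₃ (L₂ L₄ : F.Leg false) (L₃ : F.Leg true) (h₂ : L₃.pol .u = 0) :
    amp₄ L₁.wave L₂.wave L₃.wave L₄.wave
      (F.quadrilinear (I := Unit) 1 (fun _ => ![.u, .ut, .phi, .phi]) k)
    = -2 * k L₁.flavour L₃.flavour L₂.flavour L₄.flavour *
      (L₁.pol .u * L₃.pol .ut * L₂.pol .phi * L₄.pol .phi) := by
  rw [amp₄_quadrilinear]
  simp [koszul, quadOdd, Comp.odd, h₁, h₂, Leg.bose_u, Leg.bose_ut, Leg.fermi_phi,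
    hk _ _ L₂.flavour L₄.flavour]
  ring

theorem amp₄_uapp₄ (L₂ L₃ : F.Leg false) (L₄ : F.Leg true) (h₂ : L₄.pol .u = 0) :
    amp₄ L₁.wave L₂.wave L₃.wave L₄.wave
      (F.quadrilinear (I := Unit) 1 (fun _ => ![.u, .ut, .phi, .phi]) k)
    = -2 * k L₁.flavour L₄.flavour L₂.flavour L₃.flavour *
      (L₁.pol .u * L₄.pol .ut * L₂.pol .phi * L₃.pol .phi) := by
  rw [amp₄_quadrilinear]
  simp [koszul, quadOdd, Comp.odd, h₁, h₂, Leg.bose_u, Leg.bose_ut, Leg.fermi_phi,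
    hk _ _ L₂.flavour L₃.flavour]
  ring

theorem amp₄_uavv₂ (L₂ : F.Leg true) (L₃ L₄ : F.Leg false) (h₂ : L₂.pol .u = 0) :
    amp₄ L₁.wave L₂.wave L₃.wave L₄.wave
      (F.quadrilinear (I := Fin 4) eta (fun μ => ![.u, .ut, .v μ, .v μ]) k)
    = -2 * k L₁.flavour L₂.flavour L₃.flavour L₄.flavour *
      (L₁.pol .u * L₂.pol .ut * dot L₃.vec L₄.vec) := by
  have s (L L' : F.Leg false) := sum_eta_mul_right L.vec L'.vec
  simp only [Leg.vec] at s
  rw [amp₄_quadrilinear]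
  simp [koszul, quadOdd, Comp.odd, h₁, h₂, Leg.bose_u, Leg.bose_ut, Leg.fermi_v,
    hk _ _ L₃.flavour L₄.flavour, s, dot_comm L₄.vec L₃.vec]
  ring

theorem amp₄_uavv₃ (L₂ L₄ : F.Leg false) (L₃ : F.Leg true) (h₂ : L₃.pol .u = 0) :
    amp₄ L₁.wave L₂.wave L₃.wave L₄.wave
      (F.quadrilinear (I := Fin 4) eta (fun μ => ![.u, .ut, .v μ, .v μ]) k)
    = -2 * k L₁.flavour L₃.flavour L₂.flavour L₄.flavour *
      (L₁.pol .u * L₃.pol .ut * dot L₂.vec L₄.vec) := by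
  have s (L L' : F.Leg false) := sum_eta_mul_right L.vec L'.vec
  simp only [Leg.vec] at s
  rw [amp₄_quadrilinear]
  simp [koszul, quadOdd, Comp.odd, h₁, h₂, Leg.bose_u, Leg.bose_ut, Leg.fermi_v,
    hk _ _ L₂.flavour L₄.flavour, s, dot_comm L₄.vec L₂.vec]
  ring

theorem amp₄_uavv₄ (L₂ L₃ : F.Leg false) (L₄ : F.Leg true) (h₂ : L₄.pol .u = 0) :
    amp₄ L₁.wave L₂.wave L₃.wave L₄.wave
      (F.quadrilinear (I := Fin 4) eta (fun μ => ![.u, .ut, .v μ, .v μ]) k)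
    = -2 * k L₁.flavour L₄.flavour L₂.flavour L₃.flavour *
      (L₁.pol .u * L₄.pol .ut * dot L₂.vec L₃.vec) := by
  have s (L L' : F.Leg false) := sum_eta_mul_right L.vec L'.vec
  simp only [Leg.vec] at s
  rw [amp₄_quadrilinear]
  simp [koszul, quadOdd, Comp.odd, h₁, h₂, Leg.bose_u, Leg.bose_ut, Leg.fermi_v,
    hk _ _ L₂.flavour L₃.flavour, s, dot_comm L₃.vec L₂.vec]
  ring

end

/-- A single antighost is not enough for vertices with two ghosts. -/
theorem amp₄_uuaa_eq_zero {b₂ b₃ b₄ : Bool} (L₂ : F.Leg b₂) (L₃ : F.Leg b₃) (L₄ : F.Leg b₄)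
    (h : L₁.pol .ut = 0) (h' : L₂.pol .u = 0 ∧ L₂.pol .ut = 0 ∨ L₃.pol .u = 0 ∧ L₃.pol .ut = 0) :
    amp₄ L₁.wave L₂.wave L₃.wave L₄.wave
      (F.quadrilinear (I := Unit) 1 (fun _ => ![.u, .u, .ut, .ut]) k) = 0 := by
  rw [amp₄_quadrilinear]
  rcases h' with ⟨h1, h2⟩ | ⟨h1, h2⟩ <;> simp [h, h1, h2]

theorem amp₄_uuaa (hk : ∀ a b c d, k b a c d = -k a b c d) (hk' : ∀ a b c d, k a b d c = -k a b c d)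
    (L₂ L₃ L₄ : F.Leg true)
    (h₁ : L₁.pol .ut = 0) (h₂ : L₂.pol .ut = 0) (h₃ : L₃.pol .u = 0) (h₄ : L₄.pol .u = 0) :
    amp₄ L₁.wave L₂.wave L₃.wave L₄.wave
      (F.quadrilinear (I := Unit) 1 (fun _ => ![.u, .u, .ut, .ut]) k)
    = 4 * k L₁.flavour L₂.flavour L₃.flavour L₄.flavour *
      (L₁.pol .u * L₂.pol .u * L₃.pol .ut * L₄.pol .ut) := by
  rw [amp₄_quadrilinear]
  simp [koszul, quadOdd, Comp.odd, h₁, h₂, h₃, h₄, hk L₁.flavour L₂.flavour,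
    hk' _ _ L₃.flavour L₄.flavour]
  ring

end

/-! Symmetries of the quadrilinear vertices. -/

theorem phi_left_comm (a b : Ind) (w : F.Wick) :
    F.phi a * (F.phi b * w) = F.phi b * (F.phi a * w) := by
  rw [F.phi_comm, mul_assoc, ← F.phi_comm]

theorem v_left_comm (a b : Ind) (μ ν : Fin 4) (w : F.Wick) :
    F.v a μ * (F.v b ν * w) = F.v b ν * (F.v a μ * w) := by
  rw [F.v_comm, mul_assoc, ← F.v_comm]

namespace VertexCoeffs.IsNormal

variable {k : VertexCoeffs Ind Dir} (hk : VertexCoeffs.IsNormal F k)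
include hk

theorem pppp_swap₁ (a b c d : Ind) : k.quartic .pppp b a c d = k.quartic .pppp a b c d :=
  hk.quartic_eq _ _ _ _ _ _ _ _ _ (by simp only [quarticVertex]; rw [phi_left_comm])

theorem pppp_swap₂ (a b c d : Ind) : k.quartic .pppp a c b d = k.quartic .pppp a b c d :=
  hk.quartic_eq _ _ _ _ _ _ _ _ _ (by simp only [quarticVertex]; rw [phi_left_comm c])

theorem pppp_swap₃ (a b c d : Ind) : k.quartic .pppp a b d c = k.quartic .pppp a b c d :=
  hk.quartic_eq _ _ _ _ _ _ _ _ _ (by simp only [quarticVertex]; rw [F.phi_comm d])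

theorem vvpp_swap₁ (a b c d : Ind) : k.quartic .vvpp b a c d = k.quartic .vvpp a b c d :=
  hk.quartic_eq _ _ _ _ _ _ _ _ _ (by simp only [quarticVertex, v_left_comm b a])

theorem vvpp_swap₂ (a b c d : Ind) : k.quartic .vvpp a b d c = k.quartic .vvpp a b c d :=
  hk.quartic_eq _ _ _ _ _ _ _ _ _ (by simp only [quarticVertex, F.phi_comm d])

theorem uapp_swap (a b c d : Ind) : k.quartic .uapp a b d c = k.quartic .uapp a b c d :=
  hk.quartic_eq _ _ _ _ _ _ _ _ _ (by simp only [quarticVertex, F.phi_comm d])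

theorem uavv_swap (a b c d : Ind) : k.quartic .uavv a b d c = k.quartic .uavv a b c d :=
  hk.quartic_eq _ _ _ _ _ _ _ _ _ (by simp only [quarticVertex, F.v_comm d])

theorem vvvv_swap₁ (a b c d : Ind) : k.quartic .vvvv b a c d = k.quartic .vvvv a b c d :=
  hk.quartic_eq _ _ _ _ _ _ _ _ _ (by simp only [quarticVertex, v_left_comm b a])

theorem vvvv_swap₂ (a b c d : Ind) : k.quartic .vvvv a b d c = k.quartic .vvvv a b c d :=
  hk.quartic_eq _ _ _ _ _ _ _ _ _ (by simp only [quarticVertex, F.v_comm d])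

theorem vvvv_swap₃ (a b c d : Ind) : k.quartic .vvvv c d a b = k.quartic .vvvv a b c d := by
  refine hk.quartic_eq _ _ _ _ _ _ _ _ _ ?_
  simp only [quarticVertex]
  rw [Finset.sum_comm]
  refine Finset.sum_congr rfl fun μ _ => Finset.sum_congr rfl fun ν _ => ?_
  rw [mul_comm (eta ν), v_left_comm d, v_left_comm c, F.v_comm d, v_left_comm c]

theorem quartic_levi_swap₁ (a b c d : Ind) :
    k.quartic .levi b a c d = -k.quartic .levi a b c d := by
  refine hk.quartic_neg _ _ _ _ _ _ _ _ _ ?_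
  simp only [quarticVertex, ← Finset.sum_neg_distrib]
  rw [Finset.sum_comm]
  refine Finset.sum_congr rfl fun κ _ => Finset.sum_congr rfl fun l _ =>
    Finset.sum_congr rfl fun μ _ => Finset.sum_congr rfl fun ν _ => ?_
  rw [v_left_comm, ← wick_neg_smul]
  congr 1
  simp only [YangMills.levi]; ring

theorem quartic_levi_swap₂ (a b c d : Ind) :
    k.quartic .levi a c b d = -k.quartic .levi a b c d := by
  refine hk.quartic_neg _ _ _ _ _ _ _ _ _ ?_
  simp only [quarticVertex, ← Finset.sum_neg_distrib]
  refine Finset.sum_congr rfl fun κ _ => ?_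
  rw [Finset.sum_comm]
  refine Finset.sum_congr rfl fun l _ =>
    Finset.sum_congr rfl fun μ _ => Finset.sum_congr rfl fun ν _ => ?_
  rw [v_left_comm c, ← wick_neg_smul]
  congr 1
  simp only [YangMills.levi]; ring

theorem quartic_levi_swap₃ (a b c d : Ind) :
    k.quartic .levi a b d c = -k.quartic .levi a b c d := by
  refine hk.quartic_neg _ _ _ _ _ _ _ _ _ ?_
  simp only [quarticVertex, ← Finset.sum_neg_distrib]
  refine Finset.sum_congr rfl fun κ _ => Finset.sum_congr rfl fun l _ => ?_
  rw [Finset.sum_comm]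
  refine Finset.sum_congr rfl fun μ _ => Finset.sum_congr rfl fun ν _ => ?_
  rw [F.v_comm d, ← wick_neg_smul]
  congr 1
  simp only [YangMills.levi]; ring

theorem uuaa_swap₁ (a b c d : Ind) : k.quartic .uuaa b a c d = -k.quartic .uuaa a b c d :=
  hk.quartic_neg _ _ _ _ _ _ _ _ _ (by
    simp only [quarticVertex]
    rw [← mul_assoc, u, u, F.fermi_comm rfl rfl, wick_neg_mul, mul_assoc])

theorem uuaa_swap₂ (a b c d : Ind) : k.quartic .uuaa a b d c = -k.quartic .uuaa a b c d :=
  hk.quartic_neg _ _ _ _ _ _ _ _ _ (by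
    simp only [quarticVertex]
    rw [ut, ut, F.fermi_comm rfl rfl, wick_mul_neg, wick_mul_neg])

end VertexCoeffs.IsNormal
end FieldContent
namespace FieldContent
variable {Ind Dir : Type*} {F : FieldContent Ind Dir} [Fintype Ind] [Fintype Dir]
  {k : VertexCoeffs Ind Dir}

/-! ### Quadrilinear couplings -/

set_option maxHeartbeats 2000000 in
/-- The co-cycle condition for a wave of a ghost and three waves of Bose fields. -/
theorem quartic_cocycle_aux (hk : VertexCoeffs.IsNormal F k) (hQ : F.IsCocycle (F.interaction k))
    (a b c d : Ind) (p₁ p₂ p₃ p₄ e₂ e₃ e₄ : Fin 4 → ℂ) (φ₂ φ₃ φ₄ : ℂ)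
    (h₁ : dot p₁ p₁ = -(F.mass a : ℂ) ^ 2) (h₂ : dot p₂ p₂ = -(F.mass b : ℂ) ^ 2)
    (h₃ : dot p₃ p₃ = -(F.mass c : ℂ) ^ 2) (h₄ : dot p₄ p₄ = -(F.mass d : ℂ) ^ 2)
    (hp : ∀ μ, p₁ μ + p₂ μ + p₃ μ + p₄ μ = 0)
    (ha : F.sector a ≠ .higgs) (he₂ : F.sector b = .higgs → e₂ = 0)
    (he₃ : F.sector c = .higgs → e₃ = 0) (he₄ : F.sector d = .higgs → e₄ = 0)
    (hφ₂ : F.sector b = .massless → φ₂ = 0) (hφ₃ : F.sector c = .massless → φ₃ = 0)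
    (hφ₄ : F.sector d = .massless → φ₄ = 0) :
    24 * k.quartic .pppp a b c d * (F.gaugeMass a * φ₂ * φ₃ * φ₄)
    + 4 * (k.quartic .vvpp a b c d * dot p₁ e₂ * φ₃ * φ₄
      + k.quartic .vvpp a c b d * dot p₁ e₃ * φ₂ * φ₄
      + k.quartic .vvpp a d b c * dot p₁ e₄ * φ₂ * φ₃
      + k.quartic .vvpp b c a d * dot e₂ e₃ * F.gaugeMass a * φ₄
      + k.quartic .vvpp b d a c * dot e₂ e₄ * F.gaugeMass a * φ₃
      + k.quartic .vvpp c d a b * dot e₃ e₄ * F.gaugeMass a * φ₂)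
    + 8 * (k.quartic .vvvv a b c d * dot p₁ e₂ * dot e₃ e₄
      + k.quartic .vvvv a c b d * dot p₁ e₃ * dot e₂ e₄
      + k.quartic .vvvv a d b c * dot p₁ e₄ * dot e₂ e₃)
    + 24 * k.quartic .levi a b c d * lev p₁ e₂ e₃ e₄
    + 2 * (dot p₂ e₂ + F.gaugeMass b * φ₂) * (k.quartic .uapp a b c d * φ₃ * φ₄
      + k.quartic .uavv a b c d * dot e₃ e₄)
    + 2 * (dot p₃ e₃ + F.gaugeMass c * φ₃) * (k.quartic .uapp a c b d * φ₂ * φ₄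
      + k.quartic .uavv a c b d * dot e₂ e₄)
    + 2 * (dot p₄ e₄ + F.gaugeMass d * φ₄) * (k.quartic .uapp a d b c * φ₂ * φ₃
      + k.quartic .uavv a d b c * dot e₂ e₃) = 0 := by
  set G := Leg.ghost a p₁ 1 0 h₁ ha
  set B₂ := Leg.bose b p₂ e₂ φ₂ h₂ he₂ hφ₂
  set B₃ := Leg.bose c p₃ e₃ φ₃ h₃ he₃ hφ₃
  set B₄ := Leg.bose d p₄ e₄ φ₄ h₄ he₄ hφ₄
  have h := amp₄_cocycle G.wave B₂.wave B₃.wave B₄.wave hQ hp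
  rw [Leg.wave_gauge, Leg.wave_gauge, Leg.wave_gauge, Leg.wave_gauge, amp₄_interaction _ _ _ _ hk,
    amp₄_interaction _ _ _ _ hk, amp₄_interaction _ _ _ _ hk, amp₄_interaction _ _ _ _ hk] at h
  have gp : ∀ (x : Unit) (j : Fin 4),
      G.pol ((![.phi, .phi, .phi, .phi] : Fin 4 → QuadComp) j) = 0 := by
    intro _ j; fin_cases j <;> rfl
  have gvp : ∀ (μ : Fin 4) (j : Fin 4),
      G.pol ((![.v μ, .v μ, .phi, .phi] : Fin 4 → QuadComp) j) = 0 := by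
    intro μ j; fin_cases j <;> rfl
  have gv : ∀ (i : Fin 4 × Fin 4) (j : Fin 4),
      G.pol ((![.v i.1, .v i.1, .v i.2, .v i.2] : Fin 4 → QuadComp) j) = 0 := by
    intro μ j; fin_cases j <;> rfl
  have gl : ∀ (i : Fin 4 × Fin 4 × Fin 4 × Fin 4) (j : Fin 4),
      G.pol ((![.v i.1, .v i.2.1, .v i.2.2.1, .v i.2.2.2] : Fin 4 → QuadComp) j) = 0 := by
    intro μ j; fin_cases j <;> rfl
  have b2 : B₂.pol .u = 0 ∧ B₂.pol .ut = 0 := ⟨rfl, rfl⟩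
  have b3 : B₃.pol .u = 0 ∧ B₃.pol .ut = 0 := ⟨rfl, rfl⟩
  rw [amp₄_bose_ghost _ G B₂ B₃ B₄.gauge _ _ gp, amp₄_bose_ghost _ G B₂ B₃.gauge B₄ _ _ gp,
    amp₄_bose_ghost _ G B₂.gauge B₃ B₄ _ _ gp, amp₄_bose_ghost _ G B₂ B₃ B₄.gauge _ _ gvp,
    amp₄_bose_ghost _ G B₂ B₃.gauge B₄ _ _ gvp, amp₄_bose_ghost _ G B₂.gauge B₃ B₄ _ _ gvp,
    amp₄_bose_ghost _ G B₂ B₃ B₄.gauge _ _ gv, amp₄_bose_ghost _ G B₂ B₃.gauge B₄ _ _ gv,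
    amp₄_bose_ghost _ G B₂.gauge B₃ B₄ _ _ gv, amp₄_bose_ghost _ G B₂ B₃ B₄.gauge _ _ gl,
    amp₄_bose_ghost _ G B₂ B₃.gauge B₄ _ _ gl, amp₄_bose_ghost _ G B₂.gauge B₃ B₄ _ _ gl,
    amp₄_uuaa_eq_zero _ G B₂ B₃ B₄.gauge rfl (.inl b2),
    amp₄_uuaa_eq_zero _ G B₂ B₃.gauge B₄ rfl (.inl b2),
    amp₄_uuaa_eq_zero _ G B₂.gauge B₃ B₄ rfl (.inr b3),
    amp₄_ghost_bose G.gauge B₂ B₃ B₄ (k.quartic .uapp) _ _ (fun _ => rfl),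
    amp₄_ghost_bose G.gauge B₂ B₃ B₄ (k.quartic .uavv) _ _ (fun _ => rfl),
    amp₄_ghost_bose G.gauge B₂ B₃ B₄ (k.quartic .uuaa) _ _ (fun _ => rfl),
    amp₄_pppp G.gauge B₂ B₃ B₄ _ hk.pppp_swap₁ hk.pppp_swap₂ hk.pppp_swap₃,
    amp₄_vvpp G.gauge B₂ B₃ B₄ _ hk.vvpp_swap₁ hk.vvpp_swap₂,
    amp₄_vvvv G.gauge B₂ B₃ B₄ _ hk.vvvv_swap₁ hk.vvvv_swap₂ hk.vvvv_swap₃,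
    amp₄_levi G.gauge B₂ B₃ B₄ _ hk.quartic_levi_swap₁ hk.quartic_levi_swap₂ hk.quartic_levi_swap₃,
    amp₄_uapp₂ _ G hk.uapp_swap rfl B₂.gauge B₃ B₄ rfl,
    amp₄_uapp₃ _ G hk.uapp_swap rfl B₂ B₄ B₃.gauge rfl,
    amp₄_uapp₄ _ G hk.uapp_swap rfl B₂ B₃ B₄.gauge rfl,
    amp₄_uavv₂ _ G hk.uavv_swap rfl B₂.gauge B₃ B₄ rfl,
    amp₄_uavv₃ _ G hk.uavv_swap rfl B₂ B₄ B₃.gauge rfl,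
    amp₄_uavv₄ _ G hk.uavv_swap rfl B₂ B₃ B₄.gauge rfl] at h
  have e1 : G.gauge.vec = fun μ => Complex.I * p₁ μ :=
    funext fun μ => by simp [G, Leg.vec, Leg.gauge, Leg.ghost]
  have e2 : B₂.vec = e₂ := rfl
  have e3 : B₃.vec = e₃ := rfl
  have e4 : B₄.vec = e₄ := rfl
  have f1 : G.gauge.pol .phi = Complex.I * F.gaugeMass a := by simp [G, Leg.gauge, Leg.ghost]
  have g2 : B₂.gauge.pol .ut = -Complex.I * (dot p₂ e₂ + F.gaugeMass b * φ₂) := rfl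
  have g3 : B₃.gauge.pol .ut = -Complex.I * (dot p₃ e₃ + F.gaugeMass c * φ₃) := rfl
  have g4 : B₄.gauge.pol .ut = -Complex.I * (dot p₄ e₄ + F.gaugeMass d * φ₄) := rfl
  have i1 : G.pol .u = 1 := rfl
  have j2 : B₂.pol .phi = φ₂ := rfl
  have j3 : B₃.pol .phi = φ₃ := rfl
  have j4 : B₄.pol .phi = φ₄ := rfl
  have n1 : G.gauge.flavour = a := rfl
  have n1' : G.flavour = a := rfl
  have n2 : B₂.flavour = b := rfl
  have n3 : B₃.flavour = c := rfl
  have n4 : B₄.flavour = d := rfl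
  have n2' : B₂.gauge.flavour = b := rfl
  have n3' : B₃.gauge.flavour = c := rfl
  have n4' : B₄.gauge.flavour = d := rfl
  have l (y z w : Fin 4 → ℂ) : lev (fun μ => Complex.I * p₁ μ) y z w = Complex.I * lev p₁ y z w := by
    rw [lev_expand, lev_expand]; ring
  have r : koszul false true = 1 := by simp [koszul]
  simp only [e1, e2, e3, e4, f1, g2, g3, g4, i1, j2, j3, j4, n1, n1', n2, n3, n4, n2', n3', n4', r,
    dot_mul_left, l] at h
  refine (mul_eq_zero_iff_left Complex.I_ne_zero).1 ?_
  linear_combination h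

/-- The co-cycle condition for a wave of a ghost and three waves of Bose fields whose momenta are in
general position. Trilinear vertices have no amplitudes for four waves, so that the condition
restricts the quadrilinear couplings alone; the terms of odd and even parity vanish separately. -/
theorem quartic_cocycle (hk : VertexCoeffs.IsNormal F k) (hQ : F.IsCocycle (F.interaction k))
    (a b c d : Ind) (e₂ e₃ e₄ : Fin 4 → ℂ) (φ₂ φ₃ φ₄ : ℂ) {p₁ p₂ p₃ p₄ : Fin 4 → ℂ}
    (hp₁ : p₁ = nullFrame 1 (-(F.mass a : ℂ) ^ 2 / 2) 0 0)
    (hp₂ : p₂ = nullFrame 0 0 1 (-(F.mass b : ℂ) ^ 2 / 2))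
    (hp₃ : p₃ = nullFrame (-1) ((F.mass c : ℂ) ^ 2 / 2) 0
      ((F.mass b : ℂ) ^ 2 / 2 - (F.mass d : ℂ) ^ 2 / 2))
    (hp₄ : p₄ = nullFrame 0 ((F.mass a : ℂ) ^ 2 / 2 - (F.mass c : ℂ) ^ 2 / 2) (-1)
      ((F.mass d : ℂ) ^ 2 / 2))
    (ha : F.sector a ≠ .higgs) (he₂ : F.sector b = .higgs → e₂ = 0)
    (he₃ : F.sector c = .higgs → e₃ = 0) (he₄ : F.sector d = .higgs → e₄ = 0)
    (hφ₂ : F.sector b = .massless → φ₂ = 0) (hφ₃ : F.sector c = .massless → φ₃ = 0)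
    (hφ₄ : F.sector d = .massless → φ₄ = 0) :
    k.quartic .levi a b c d * lev p₁ e₂ e₃ e₄ = 0 ∧
    24 * k.quartic .pppp a b c d * (F.gaugeMass a * φ₂ * φ₃ * φ₄)
    + 4 * (k.quartic .vvpp a b c d * dot p₁ e₂ * φ₃ * φ₄
      + k.quartic .vvpp a c b d * dot p₁ e₃ * φ₂ * φ₄
      + k.quartic .vvpp a d b c * dot p₁ e₄ * φ₂ * φ₃
      + k.quartic .vvpp b c a d * dot e₂ e₃ * F.gaugeMass a * φ₄
      + k.quartic .vvpp b d a c * dot e₂ e₄ * F.gaugeMass a * φ₃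
      + k.quartic .vvpp c d a b * dot e₃ e₄ * F.gaugeMass a * φ₂)
    + 8 * (k.quartic .vvvv a b c d * dot p₁ e₂ * dot e₃ e₄
      + k.quartic .vvvv a c b d * dot p₁ e₃ * dot e₂ e₄
      + k.quartic .vvvv a d b c * dot p₁ e₄ * dot e₂ e₃)
    + 2 * (dot p₂ e₂ + F.gaugeMass b * φ₂) * (k.quartic .uapp a b c d * φ₃ * φ₄
      + k.quartic .uavv a b c d * dot e₃ e₄)
    + 2 * (dot p₃ e₃ + F.gaugeMass c * φ₃) * (k.quartic .uapp a c b d * φ₂ * φ₄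
      + k.quartic .uavv a c b d * dot e₂ e₄)
    + 2 * (dot p₄ e₄ + F.gaugeMass d * φ₄) * (k.quartic .uapp a d b c * φ₂ * φ₃
      + k.quartic .uavv a d b c * dot e₂ e₃) = 0 := by
  have s₁ : dot p₁ p₁ = -(F.mass a : ℂ) ^ 2 := by rw [hp₁, dot_nullFrame]; ring
  have s₂ : dot p₂ p₂ = -(F.mass b : ℂ) ^ 2 := by rw [hp₂, dot_nullFrame]; ring
  have s₃ : dot p₃ p₃ = -(F.mass c : ℂ) ^ 2 := by rw [hp₃, dot_nullFrame]; ring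
  have s₄ : dot p₄ p₄ = -(F.mass d : ℂ) ^ 2 := by rw [hp₄, dot_nullFrame]; ring
  have hp (μ) : p₁ μ + p₂ μ + p₃ μ + p₄ μ = 0 := by
    rw [hp₁, hp₂, hp₃, hp₄, nullFrame_add, nullFrame_add, nullFrame_add]
    ring_nf
    simp [nullFrame_zero]
  have z (x : Fin 4 → ℂ) (h : x = 0) : reflect x = 0 := by
    rw [h]; funext μ; simp [reflect]
  have h := quartic_cocycle_aux hk hQ a b c d p₁ p₂ p₃ p₄ e₂ e₃ e₄ φ₂ φ₃ φ₄ s₁ s₂ s₃ s₄ hp ha he₂ he₃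
    he₄ hφ₂ hφ₃ hφ₄
  have h' := quartic_cocycle_aux hk hQ a b c d (reflect p₁) (reflect p₂) (reflect p₃) (reflect p₄)
    (reflect e₂) (reflect e₃) (reflect e₄) φ₂ φ₃ φ₄ (by rwa [dot_reflect]) (by rwa [dot_reflect])
    (by rwa [dot_reflect]) (by rwa [dot_reflect])
    (fun μ => by simp only [reflect, ← mul_add, hp, mul_zero]) ha (fun h => z _ (he₂ h))
    (fun h => z _ (he₃ h)) (fun h => z _ (he₄ h)) hφ₂ hφ₃ hφ₄
  simp only [dot_reflect, lev_reflect] at h'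
  constructor
  · linear_combination (h - h') / 48
  · linear_combination (h + h') / 2

namespace VertexCoeffs.IsNormal
variable (hk : VertexCoeffs.IsNormal F k) (hQ : F.IsCocycle (F.interaction k))
include hk

theorem vvvv_higgs {a b c d : Ind} (h : F.sector a = .higgs ∨ F.sector b = .higgs ∨
    F.sector c = .higgs ∨ F.sector d = .higgs) : k.quartic .vvvv a b c d = 0 := by
  refine hk.quartic_zero _ _ _ _ _ ?_
  rcases h with h | h | h | h <;> simp [quarticVertex, v, F.jet_v_higgs h]

theorem quartic_levi_higgs {a b c d : Ind} (h : F.sector a = .higgs ∨ F.sector b = .higgs ∨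
    F.sector c = .higgs ∨ F.sector d = .higgs) : k.quartic .levi a b c d = 0 := by
  refine hk.quartic_zero _ _ _ _ _ ?_
  rcases h with h | h | h | h <;> simp [quarticVertex, v, F.jet_v_higgs h]

theorem vvpp_zero {a b c d : Ind} (h : F.sector a = .higgs ∨ F.sector b = .higgs ∨
    F.sector c = .massless ∨ F.sector d = .massless) : k.quartic .vvpp a b c d = 0 := by
  refine hk.quartic_zero _ _ _ _ _ ?_
  rcases h with h | h | h | h
  · simp [quarticVertex, v, F.jet_v_higgs h]
  · simp [quarticVertex, v, F.jet_v_higgs h]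
  · simp [quarticVertex, phi, F.jet_phi_massless h]
  · simp [quarticVertex, phi, F.jet_phi_massless h]

theorem uapp_zero {a b c d : Ind} (h : F.sector a = .higgs ∨ F.sector b = .higgs ∨
    F.sector c = .massless ∨ F.sector d = .massless) : k.quartic .uapp a b c d = 0 := by
  refine hk.quartic_zero _ _ _ _ _ ?_
  rcases h with h | h | h | h
  · simp [quarticVertex, u, F.jet_u_higgs h]
  · simp [quarticVertex, ut, F.jet_ut_higgs h]
  · simp [quarticVertex, phi, F.jet_phi_massless h]
  · simp [quarticVertex, phi, F.jet_phi_massless h]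

theorem uavv_higgs {a b c d : Ind} (h : F.sector a = .higgs ∨ F.sector b = .higgs ∨
    F.sector c = .higgs ∨ F.sector d = .higgs) : k.quartic .uavv a b c d = 0 := by
  refine hk.quartic_zero _ _ _ _ _ ?_
  rcases h with h | h | h | h
  · simp [quarticVertex, u, F.jet_u_higgs h]
  · simp [quarticVertex, ut, F.jet_ut_higgs h]
  · simp [quarticVertex, v, F.jet_v_higgs h]
  · simp [quarticVertex, v, F.jet_v_higgs h]

theorem uuaa_higgs {a b c d : Ind} (h : F.sector a = .higgs ∨ F.sector b = .higgs ∨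
    F.sector c = .higgs ∨ F.sector d = .higgs) : k.quartic .uuaa a b c d = 0 := by
  refine hk.quartic_zero _ _ _ _ _ ?_
  rcases h with h | h | h | h
  · simp [quarticVertex, u, F.jet_u_higgs h]
  · simp [quarticVertex, u, F.jet_u_higgs h]
  · simp [quarticVertex, ut, F.jet_ut_higgs h]
  · simp [quarticVertex, ut, F.jet_ut_higgs h]

theorem pppp_massless {a b c d : Ind} (h : F.sector a = .massless) :
    k.quartic .pppp a b c d = 0 :=
  hk.quartic_zero _ _ _ _ _ (by simp [quarticVertex, phi, F.jet_phi_massless h])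

include hQ

/-- The vector fields have no quadrilinear couplings: the polarizations `e₂`, `e₃`, `e₄` are chosen
such that, of the products of some `p₁·e_i` or `p_i·e_i` with `e_j·e_k`, only that of `p₁·e₂` with
`e₃·e₄` does not vanish. -/
theorem vvvv_and_levi_eq_zero (a b c d : Ind) :
    k.quartic .vvvv a b c d = 0 ∧ k.quartic .levi a b c d = 0 := by
  by_cases h : F.sector a = .higgs ∨ F.sector b = .higgs ∨ F.sector c = .higgs ∨
    F.sector d = .higgs
  · exact ⟨hk.vvvv_higgs h, hk.quartic_levi_higgs h⟩
  push Not at h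
  obtain ⟨ha, hb, hc, hd⟩ := h
  obtain ⟨h1, h2⟩ := quartic_cocycle hk hQ a b c d (nullFrame 0 1 0 0) (nullFrame 0 0 1 0)
    (nullFrame 0 0 0 1) 0 0 0 rfl rfl rfl rfl ha (by simp [hb]) (by simp [hc]) (by simp [hd])
    (by simp) (by simp) (by simp)
  simp only [dot_nullFrame] at h2
  refine ⟨by linear_combination h2 / 8, ?_⟩
  have l : lev (nullFrame 1 (-(F.mass a : ℂ) ^ 2 / 2) 0 0) (nullFrame 0 1 0 0) (nullFrame 0 0 1 0)
      (nullFrame 0 0 0 1) = -Complex.I := by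
    rw [lev_expand]
    simp [nullFrame]
    ring
  rw [l] at h1
  simpa using h1

theorem uavv_eq_zero (a b c d : Ind) : k.quartic .uavv a b c d = 0 := by
  by_cases h : F.sector a = .higgs ∨ F.sector b = .higgs ∨ F.sector c = .higgs ∨
    F.sector d = .higgs
  · exact hk.uavv_higgs h
  push Not at h
  obtain ⟨ha, hb, hc, hd⟩ := h
  obtain ⟨h1, h2⟩ := quartic_cocycle hk hQ a b c d (nullFrame 0 0 0 1) (nullFrame 1 0 0 0)
    (nullFrame 0 1 0 0) 0 0 0 rfl rfl rfl rfl ha (by simp [hb]) (by simp [hc]) (by simp [hd])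
    (by simp) (by simp) (by simp)
  simp only [dot_nullFrame, (hk.vvvv_and_levi_eq_zero hQ _ _ _ _).1] at h2
  linear_combination h2 / 2

theorem vvpp_eq_zero (a b c d : Ind) : k.quartic .vvpp a b c d = 0 := by
  by_cases h : F.sector a = .higgs ∨ F.sector b = .higgs ∨ F.sector c = .massless ∨
    F.sector d = .massless
  · exact hk.vvpp_zero h
  push Not at h
  obtain ⟨ha, hb, hc, hd⟩ := h
  obtain ⟨-, h2⟩ := quartic_cocycle hk hQ a b c d (nullFrame 0 1 0 0) 0 0 0 1 1 rfl rfl rfl rfl ha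
    (by simp [hb]) (by simp) (by simp) (by simp) (by simp [hc]) (by simp [hd])
  simp only [← nullFrame_zero, dot_nullFrame] at h2
  linear_combination h2 / 4

theorem uapp_eq_zero (a b c d : Ind) : k.quartic .uapp a b c d = 0 := by
  by_cases h : F.sector a = .higgs ∨ F.sector b = .higgs ∨ F.sector c = .massless ∨
    F.sector d = .massless
  · exact hk.uapp_zero h
  push Not at h
  obtain ⟨ha, hb, hc, hd⟩ := h
  obtain ⟨-, h2⟩ := quartic_cocycle hk hQ a b c d (nullFrame 0 0 0 1) 0 0 0 1 1 rfl rfl rfl rfl ha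
    (by simp [hb]) (by simp) (by simp) (by simp) (by simp [hc]) (by simp [hd])
  simp only [← nullFrame_zero, dot_nullFrame] at h2
  linear_combination h2 / 2

/-- Only the Higgs fields have a quadrilinear coupling. -/
theorem pppp_eq_zero {a b c d : Ind} (h : F.sector a ≠ .higgs) : k.quartic .pppp a b c d = 0 := by
  by_cases ha : F.sector a = .massless
  · exact hk.pppp_massless ha
  by_cases hb : F.sector b = .massless
  · rw [← hk.pppp_swap₁, hk.pppp_massless hb]
  by_cases hc : F.sector c = .massless
  · rw [← hk.pppp_swap₂, ← hk.pppp_swap₁, hk.pppp_massless hc]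
  by_cases hd : F.sector d = .massless
  · rw [← hk.pppp_swap₃, ← hk.pppp_swap₂, ← hk.pppp_swap₁, hk.pppp_massless hd]
  obtain ⟨-, h2⟩ := quartic_cocycle hk hQ a b c d 0 0 0 1 1 1 rfl rfl rfl rfl h
    (by simp) (by simp) (by simp) (by simp [hb]) (by simp [hc]) (by simp [hd])
  simp only [← nullFrame_zero, dot_nullFrame, hk.uapp_eq_zero hQ] at h2
  -- `a` has a scalar field and is no Higgs index, so its gauge mass does not vanish.
  have hm : (F.gaugeMass a : ℂ) ≠ 0 := by
    rw [F.gaugeMass_of_ne h]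
    exact_mod_cast (F.mass_massive a (sector_eq_massive h ha)).ne'
  refine (mul_eq_zero_iff_left hm).1 ?_
  linear_combination h2 / 24

set_option maxHeartbeats 1000000 in
/-- Two ghosts, an antighost and a vector field test the coupling of two ghosts and two antighosts:
only the gauge transformation of the vector field contributes, once the other couplings with ghosts
are known to vanish. -/
theorem uuaa_eq_zero (a b c d : Ind) : k.quartic .uuaa a b c d = 0 := by
  by_cases h : F.sector a = .higgs ∨ F.sector b = .higgs ∨ F.sector c = .higgs ∨
    F.sector d = .higgs
  · exact hk.uuaa_higgs h
  push Not at h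
  obtain ⟨ha, hb, hc, hd⟩ := h
  set p₁ := nullFrame 1 (-(F.mass a : ℂ) ^ 2 / 2) 0 0 with hp₁
  set p₂ := nullFrame 0 0 1 (-(F.mass b : ℂ) ^ 2 / 2) with hp₂
  set p₃ := nullFrame (-1) ((F.mass c : ℂ) ^ 2 / 2) 0
      ((F.mass b : ℂ) ^ 2 / 2 - (F.mass d : ℂ) ^ 2 / 2) with hp₃
  set p₄ := nullFrame 0 ((F.mass a : ℂ) ^ 2 / 2 - (F.mass c : ℂ) ^ 2 / 2) (-1)
      ((F.mass d : ℂ) ^ 2 / 2) with hp₄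
  have s₁ : dot p₁ p₁ = -(F.mass a : ℂ) ^ 2 := by rw [hp₁, dot_nullFrame]; ring
  have s₂ : dot p₂ p₂ = -(F.mass b : ℂ) ^ 2 := by rw [hp₂, dot_nullFrame]; ring
  have s₃ : dot p₃ p₃ = -(F.mass c : ℂ) ^ 2 := by rw [hp₃, dot_nullFrame]; ring
  have s₄ : dot p₄ p₄ = -(F.mass d : ℂ) ^ 2 := by rw [hp₄, dot_nullFrame]; ring
  have hp (μ) : p₁ μ + p₂ μ + p₃ μ + p₄ μ = 0 := by
    rw [hp₁, hp₂, hp₃, hp₄, nullFrame_add, nullFrame_add, nullFrame_add]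
    ring_nf
    simp [nullFrame_zero]
  set G₁ := Leg.ghost a p₁ 1 0 s₁ ha
  set G₂ := Leg.ghost b p₂ 1 0 s₂ hb
  set A₃ := Leg.ghost c p₃ 0 1 s₃ hc
  set B₄ := Leg.bose d p₄ (nullFrame 0 0 0 1) 0 s₄ (by simp [hd]) (by simp)
  have h := amp₄_cocycle G₁.wave G₂.wave A₃.wave B₄.wave hQ hp
  have q0 {b₁ b₂ b₃ b₄ : Bool} (L₁ : F.Leg b₁) (L₂ : F.Leg b₂) (L₃ : F.Leg b₃) (L₄ : F.Leg b₄)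
      {I : Type} [Fintype I] (z : I → ℂ) (x : I → Fin 4 → QuadComp) :
      amp₄ L₁.wave L₂.wave L₃.wave L₄.wave (F.quadrilinear z x 0) = 0 := by
    simp [quadrilinear]
  have t1 : k.quartic .uapp = 0 := by funext a b c d; exact hk.uapp_eq_zero hQ a b c d
  have t2 : k.quartic .uavv = 0 := by funext a b c d; exact hk.uavv_eq_zero hQ a b c d
  have t3 : k.quartic .vvpp = 0 := by funext a b c d; exact hk.vvpp_eq_zero hQ a b c d
  have t4 : k.quartic .vvvv = 0 := by
    funext a b c d; exact (hk.vvvv_and_levi_eq_zero hQ a b c d).1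
  have t5 : k.quartic .levi = 0 := by
    funext a b c d; exact (hk.vvvv_and_levi_eq_zero hQ a b c d).2
  have g3 (q : QuadComp) : A₃.gauge.pol q = 0 := by
    cases q <;> simp [A₃, Leg.gauge, Leg.ghost]
  have r {I : Type} [Fintype I] (z : I → ℂ) (x : I → Fin 4 → QuadComp) (k) :
      amp₄ G₁.wave G₂.wave A₃.gauge.wave B₄.wave (F.quadrilinear z x k) = 0 := by
    rw [amp₄_quadrilinear]; simp [g3]
  have gp {L : F.Leg true} : ∀ (x : Unit) (j : Fin 4),
      L.pol ((![.phi, .phi, .phi, .phi] : Fin 4 → QuadComp) j) = 0 := by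
    intro _ j; fin_cases j <;> exact L.fermi_phi
  have y2 : G₂.gauge.pol .ut = 0 := by simp [G₂, Leg.gauge, Leg.ghost]
  have y1 : G₁.gauge.pol .u = 0 := rfl
  have y1' : G₁.gauge.pol .ut = 0 := by simp [G₁, Leg.gauge, Leg.ghost]
  have w2 : amp₄ G₁.wave G₂.gauge.wave A₃.wave B₄.wave (F.interaction k) = 0 := by
    rw [amp₄_interaction _ _ _ _ hk, t1, t2, t3, t4, t5,
      amp₄_bose_ghost _ G₁ G₂.gauge A₃ B₄ _ _ gp,
      amp₄_uuaa_eq_zero _ G₁ G₂.gauge A₃ B₄ rfl (.inl ⟨rfl, y2⟩)]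
    simp only [q0, add_zero]
  have w1 : amp₄ G₁.gauge.wave G₂.wave A₃.wave B₄.wave (F.interaction k) = 0 := by
    rw [amp₄_interaction _ _ _ _ hk, t1, t2, t3, t4, t5]
    simp only [q0, add_zero, zero_add]
    rw [amp₄_quadrilinear, amp₄_quadrilinear]
    simp [y1, y1', G₂.fermi_phi]
  have w3 : amp₄ G₁.wave G₂.wave A₃.gauge.wave B₄.wave (F.interaction k) = 0 := by
    rw [amp₄_interaction _ _ _ _ hk]
    simp only [r, add_zero]
  rw [Leg.wave_gauge, Leg.wave_gauge, Leg.wave_gauge, Leg.wave_gauge, w1, w2, w3,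
    amp₄_interaction _ _ _ _ hk, t1, t2, t3, t4, t5, amp₄_bose_ghost _ G₁ G₂ A₃ B₄.gauge _ _ gp,
    amp₄_uuaa _ G₁ hk.uuaa_swap₁ hk.uuaa_swap₂ G₂ A₃ B₄.gauge rfl rfl rfl rfl] at h
  simp only [q0] at h
  have e : B₄.gauge.pol .ut = Complex.I := by
    have : B₄.gauge.pol .ut = -Complex.I * (dot p₄ (nullFrame 0 0 0 1) + F.gaugeMass d * 0) := rfl
    rw [this, hp₄, dot_nullFrame]
    ring
  rw [e] at h
  have h' : 4 * k.quartic .uuaa a b c d * (1 * 1 * 1 * Complex.I) = 0 := by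
    refine Eq.trans ?_ h
    simp only [mul_zero, add_zero, zero_add]
    rfl
  simpa using h'

end VertexCoeffs.IsNormal
end FieldContent
namespace FieldContent
variable {Ind Dir : Type*} {F : FieldContent Ind Dir}

/-! ### Couplings of the Dirac fields -/

namespace PlaneWave

theorem op_eq_zero {b : Bool} {χ : F.PlaneWave b} (h : ∀ c, χ.pol c = 0) : χ.op = 0 := by
  refine LinearMap.ext fun w => ?_
  induction w using F.wick_induction with
  | one => exact χ.op_isLeibniz.one
  | jet_mul x w hw =>
    rw [χ.op_isLeibniz.jet_mul, hw, op_jet]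
    simp [val, h]
  | add w z hw hz => rw [map_add, hw, hz]; simp
  | smul c w hw => rw [map_smul, hw]; simp

open Classical in
/-- A plane wave of the Dirac field `Ψ_B`. -/
def spinor (B : Dir) (p w : Fin 4 → ℂ) (h : ∀ s, ∑ μ, ∑ r, Complex.I * gamma μ s r * (p μ * w r)
    = F.diracMass B * w s) : F.PlaneWave true where
  pol
    | .psi A s => if A = B then w s else 0
    | _ => 0
  mom := p
  parity c hc := by rcases c with ⟨a, q⟩ | ⟨A, s⟩ | ⟨A, s⟩ <;> simp_all [Comp.odd]
  kleinGordon a q := by simp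
  absent a q _ := rfl
  dirac A s := by
    by_cases hA : A = B
    · subst hA
      simpa using h s
    · simp [hA]
  diracBar A s := by simp

open Classical in
/-- A plane wave of the conjugate Dirac field `Ψ̄_A`. -/
def cospinor (A : Dir) (p w : Fin 4 → ℂ)
    (h : ∀ s, ∑ μ, ∑ r, Complex.I * gamma μ r s * (p μ * w r) = -F.diracMass A * w s) :
    F.PlaneWave true where
  pol
    | .psibar B s => if B = A then w s else 0
    | _ => 0
  mom := p
  parity c hc := by rcases c with ⟨a, q⟩ | ⟨A, s⟩ | ⟨A, s⟩ <;> simp_all [Comp.odd]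
  kleinGordon a q := by simp
  absent a q _ := rfl
  dirac A s := by simp
  diracBar B s := by
    by_cases hB : B = A
    · subst hB
      simpa using h s
    · simp [hB]

end PlaneWave

variable [Fintype Ind] [Fintype Dir] {k : VertexCoeffs Ind Dir}

/-- The co-cycle condition for waves of two Dirac fields and of a ghost. -/
theorem dirac_cocycle (hk : VertexCoeffs.IsNormal F k) (hQ : F.IsCocycle (F.interaction k))
    (A B : Dir) (c : Ind) {p₁ p₂ p₃ x y : Fin 4 → ℂ}
    (h₁ : ∀ s, ∑ μ, ∑ r, Complex.I * gamma μ r s * (p₁ μ * x r) = -F.diracMass A * x s)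
    (h₂ : ∀ s, ∑ μ, ∑ r, Complex.I * gamma μ s r * (p₂ μ * y r) = F.diracMass B * y s)
    (h₃ : dot p₃ p₃ = -(F.mass c : ℂ) ^ 2) (hp : ∀ μ, p₁ μ + p₂ μ + p₃ μ = 0)
    (hc : F.sector c ≠ .higgs) :
    ∑ ε, (k.scalar ε A B c * (F.gaugeMass c * ∑ s, ∑ r, chiral ε s r * (x s * y r))
      + k.vector ε A B c * ∑ μ, p₃ μ * ∑ s, ∑ r, (gamma μ * chiral ε) s r * (x s * y r)) = 0 := by
  classical
  set X := PlaneWave.cospinor A p₁ x h₁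
  set Y := PlaneWave.spinor B p₂ y h₂
  set G := Leg.ghost c p₃ 1 0 h₃ hc
  have h := amp₃_cocycle X Y G.wave hQ hp
  -- The Dirac fields are gauge invariant, so that only the wave of the ghost is transformed.
  have oX : X.gauge.op = 0 := PlaneWave.op_eq_zero fun c => by
    rcases c with ⟨a, (μ | _ | _ | _)⟩ | ⟨A, s⟩ | ⟨A, s⟩ <;>
      simp [PlaneWave.gauge, PlaneWave.gaugePol, X, PlaneWave.cospinor]
  have oY : Y.gauge.op = 0 := PlaneWave.op_eq_zero fun c => by
    rcases c with ⟨a, (μ | _ | _ | _)⟩ | ⟨A, s⟩ | ⟨A, s⟩ <;>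
      simp [PlaneWave.gauge, PlaneWave.gaugePol, Y, PlaneWave.spinor]
  have hX (w : F.Wick) : amp₃ X.gauge Y G.wave w = 0 := by simp [amp₃, amp₂, oX]
  have hY (w : F.Wick) : amp₃ X Y.gauge G.wave w = 0 := by simp [amp₃, amp₂, oY]
  rw [hX, hY, Leg.wave_gauge, interaction, sum_cubicVertex hk, sum_quarticVertex] at h
  have x0 (a q α) : X.val (.quad a q, α) = 0 := by simp [X, PlaneWave.val, PlaneWave.cospinor]
  have y0 (a q α) : Y.val (.quad a q, α) = 0 := by simp [Y, PlaneWave.val, PlaneWave.spinor]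
  have t0 {I : Type} [Fintype I] (z : I → ℂ) (f : I → Fin 3 → QuadComp × Multiset (Fin 4)) (k) :
      amp₃ X Y G.gauge.wave (F.trilinear z f k) = 0 := by
    simp [trilinear, amp₃_jets, amp₂_jets, x0, y0]
  have g (q a) : G.gauge.wave.val (.quad a q, 0) = (if a = c then 1 else 0) * G.gauge.pol q := by
    rw [G.gauge.val_quad a (q, 0), Leg.amp_zero]
    simp [G, Leg.gauge, Leg.ghost]
  have j0 (A' B' c' : _) (q) (s r : Fin 4) : amp₃ X Y G.gauge.wave
      (F.jet (.psibar A' s, 0) * (F.jet (.psi B' r, 0) * F.jet (.quad c' q, 0)))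
      = -((if A' = A then 1 else 0) * (if B' = B then 1 else 0) * (if c' = c then 1 else 0) *
        (G.gauge.pol q * (x s * y r))) := by
    rw [amp₃_jets, amp₂_jets, amp₂_jets, amp₂_jets, g, (G.gauge.val_dirac _ _ _).1,
      (G.gauge.val_dirac _ _ _).2]
    simp [X, Y, PlaneWave.val, PlaneWave.spinor, PlaneWave.cospinor, koszul, Comp.odd]
    split_ifs <;> simp
    exact .inl (mul_comm _ _)
  have gφ : G.gauge.pol .phi = Complex.I * F.gaugeMass c := by simp [G, Leg.gauge, Leg.ghost]
  have gv (μ) : G.gauge.pol (.v μ) = Complex.I * p₃ μ := by simp [G, Leg.gauge, Leg.ghost]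
  have s0 (ε A' B' c') : amp₃ X Y G.gauge.wave (F.scalarVertex ε A' B' c')
      = -Complex.I * ((if A' = A then 1 else 0) * (if B' = B then 1 else 0) *
        (if c' = c then 1 else 0) *
        (F.gaugeMass c * ∑ s, ∑ r, chiral ε s r * (x s * y r))) := by
    simp only [scalarVertex, psibar, psi, phi, map_sum, map_smul, j0, gφ, smul_eq_mul,
      Finset.mul_sum]
    exact Finset.sum_congr rfl fun s _ => Finset.sum_congr rfl fun r _ => by ring
  have v0 (ε A' B' c') : amp₃ X Y G.gauge.wave (F.vectorVertex ε A' B' c')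
      = -Complex.I * ((if A' = A then 1 else 0) * (if B' = B then 1 else 0) *
        (if c' = c then 1 else 0) *
        ∑ μ, p₃ μ * ∑ s, ∑ r, (gamma μ * chiral ε) s r * (x s * y r)) := by
    simp only [vectorVertex, psibar, psi, v, map_sum, map_smul, j0, gv, smul_eq_mul,
      Finset.mul_sum]
    exact Finset.sum_congr rfl fun μ _ => Finset.sum_congr rfl fun s _ =>
      Finset.sum_congr rfl fun r _ => by ring
  simp only [map_add, map_sum, map_smul, s0, v0, exprVVV, exprLevi, exprPVP, exprVUA, exprAUV,
    exprPVV, exprPPP, exprUAP, t0, amp₃_quadrilinear, smul_eq_mul, mul_zero, add_zero, zero_add] at h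
  refine (mul_eq_zero_iff_left (neg_ne_zero.2 Complex.I_ne_zero)).1 ?_
  refine Eq.trans ?_ h
  have d (f : Dir → Dir → Ind → ℂ) (z : ℂ) : ∑ A', ∑ B', ∑ c', f A' B' c' * (-Complex.I *
      ((if A' = A then 1 else 0) * (if B' = B then 1 else 0) * (if c' = c then 1 else 0) * z))
      = -Complex.I * (f A B c * z) := by
    simp [mul_ite, ite_mul, Finset.sum_ite_eq']
    ring
  simp only [d, ← Finset.mul_sum, ← mul_add, Finset.sum_add_distrib]

theorem sum_units {M : Type*} [AddCommMonoid M] (f : ℤˣ → M) : ∑ ε, f ε = f 1 + f (-1) := by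
  rw [UnitsInt.univ, Finset.sum_pair (by decide)]

set_option maxHeartbeats 2000000 in
/-- The co-cycle condition for explicit solutions `x` and `y` of the Dirac equations, whose momenta
have products prescribed by the three masses. -/
theorem VertexCoeffs.IsNormal.dirac_pos (hk : VertexCoeffs.IsNormal F k)
    (hQ : F.IsCocycle (F.interaction k)) (A B : Dir) (c : Ind) (hc : F.sector c ≠ .higgs) :
    F.gaugeMass c * k.scalar 1 A B c = Complex.I * (F.diracMass A * k.vector 1 A B c
      - k.vector (-1) A B c * F.diracMass B) := by
  obtain ⟨r, hr⟩ : ∃ r, r = ((F.diracMass A : ℂ) ^ 2 + (F.diracMass B : ℂ) ^ 2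
    - (F.mass c : ℂ) ^ 2) / 2 := ⟨_, rfl⟩
  have hI := Complex.I_mul_I
  have h := dirac_cocycle hk hQ A B c (p₁ := nullFrame 1 (-(F.diracMass A : ℂ) ^ 2 / 2) 0 0)
    (p₂ := nullFrame 0 r 1 (-(F.diracMass B : ℂ) ^ 2 / 2))
    (p₃ := nullFrame (-1) ((F.diracMass A : ℂ) ^ 2 / 2 - r) (-1) ((F.diracMass B : ℂ) ^ 2 / 2))
    (x := ![F.diracMass A, 0, -2 * Complex.I, 0]) (y := ![0, F.diracMass B, -2 * Complex.I, 0])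
    (by
      intro s
      fin_cases s <;> simp [Fin.sum_univ_four, gamma, nullFrame]
      · linear_combination (F.diracMass A : ℂ) ^ 2 * hI
      · ring)
    (by
      intro s
      fin_cases s <;> simp [Fin.sum_univ_four, gamma, nullFrame]
      · linear_combination -(F.diracMass B : ℂ) ^ 2 * hI
      · ring)
    (by rw [dot_nullFrame, hr]; ring)
    (fun μ => by
      rw [nullFrame_add, nullFrame_add]
      ring_nf
      simp [nullFrame_zero]) hc
  rw [sum_units, chiral_pos, chiral_neg] at h
  simp [Fin.sum_univ_four, gamma, nullFrame, Matrix.mul_apply] at h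
  linear_combination -h / 4 + (F.gaugeMass c * k.scalar 1 A B c - (-1 + (F.diracMass B : ℂ) ^ 2 / 4)
    * Complex.I * F.diracMass B * k.vector (-1) A B c / 2) * hI

set_option maxHeartbeats 2000000 in
/-- The mirror image of `dirac_pos`: reflection of a spatial coordinate exchanges the chiralities.
-/
theorem VertexCoeffs.IsNormal.dirac_neg (hk : VertexCoeffs.IsNormal F k)
    (hQ : F.IsCocycle (F.interaction k)) (A B : Dir) (c : Ind) (hc : F.sector c ≠ .higgs) :
    F.gaugeMass c * k.scalar (-1) A B c = Complex.I * (F.diracMass A * k.vector (-1) A B c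
      - k.vector 1 A B c * F.diracMass B) := by
  obtain ⟨r, hr⟩ : ∃ r, r = ((F.diracMass A : ℂ) ^ 2 + (F.diracMass B : ℂ) ^ 2
    - (F.mass c : ℂ) ^ 2) / 2 := ⟨_, rfl⟩
  have hI := Complex.I_mul_I
  have h := dirac_cocycle hk hQ A B c
    (p₁ := reflect (nullFrame 1 (-(F.diracMass A : ℂ) ^ 2 / 2) 0 0))
    (p₂ := reflect (nullFrame 0 r 1 (-(F.diracMass B : ℂ) ^ 2 / 2)))
    (p₃ := reflect (nullFrame (-1) ((F.diracMass A : ℂ) ^ 2 / 2 - r) (-1)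
      ((F.diracMass B : ℂ) ^ 2 / 2)))
    (x := ![0, -2 * Complex.I, 0, F.diracMass A]) (y := ![0, -2 * Complex.I, F.diracMass B, 0])
    (by
      intro s
      fin_cases s <;> simp [Fin.sum_univ_four, gamma, nullFrame, reflect]
      · ring
      · linear_combination (F.diracMass A : ℂ) ^ 2 * hI)
    (by
      intro s
      fin_cases s <;> simp [Fin.sum_univ_four, gamma, nullFrame, reflect]
      · ring
      · linear_combination -(F.diracMass B : ℂ) ^ 2 * hI)
    (by rw [dot_reflect, dot_nullFrame, hr]; ring)
    (fun μ => by
      simp only [reflect, ← mul_add]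
      rw [nullFrame_add, nullFrame_add]
      ring_nf
      simp [nullFrame_zero]) hc
  rw [sum_units, chiral_pos, chiral_neg] at h
  simp [Fin.sum_univ_four, gamma, nullFrame, reflect, Matrix.mul_apply] at h
  linear_combination -h / 4 + (F.gaugeMass c * k.scalar (-1) A B c
    - (-1 + (F.diracMass B : ℂ) ^ 2 / 4) * Complex.I * F.diracMass B * k.vector 1 A B c / 2) * hI

end FieldContent
namespace FieldContent
variable {Ind Dir : Type*} (F : FieldContent Ind Dir)

/-! ### Gauge variations of the pure Yang-Mills part -/

section
variable [Fintype Ind]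

/-- A linear combination of trilinear expressions. -/
def weighted (k : Ind → Ind → Ind → ℂ) (X : Ind → Ind → Ind → F.Wick) : F.Wick :=
  ∑ a, ∑ b, ∑ c, k a b c • X a b c

variable (k l : Ind → Ind → Ind → ℂ) (X Y : Ind → Ind → Ind → F.Wick)

theorem weighted_congr {k l : Ind → Ind → Ind → ℂ} {X Y : Ind → Ind → Ind → F.Wick}
    (h : ∀ a b c, k a b c • X a b c = l a b c • Y a b c) : F.weighted k X = F.weighted l Y :=
  Finset.sum_congr rfl fun a _ => Finset.sum_congr rfl fun b _ =>
    Finset.sum_congr rfl fun c _ => h a b c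

theorem weighted_add : F.weighted k (fun a b c => X a b c + Y a b c)
    = F.weighted k X + F.weighted k Y := by
  simp only [weighted, smul_add, Finset.sum_add_distrib]

theorem weighted_add_left : F.weighted (fun a b c => k a b c + l a b c) X
    = F.weighted k X + F.weighted l X := by
  simp only [weighted, add_smul, Finset.sum_add_distrib]

theorem weighted_smul (m : Ind → Ind → Ind → ℂ) : F.weighted k (fun a b c => m a b c • X a b c)
    = F.weighted (fun a b c => k a b c * m a b c) X := by
  simp only [weighted, smul_smul]

theorem weighted_const_smul (z : ℂ) : F.weighted (fun a b c => z * k a b c) X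
    = z • F.weighted k X := by
  simp only [weighted, mul_smul, Finset.smul_sum]

theorem weighted_const_smul' (z : ℂ) : F.weighted k (fun a b c => z • X a b c)
    = z • F.weighted k X := by
  simp only [weighted, smul_comm _ z, Finset.smul_sum]

theorem weighted_swap₁₂ :
    F.weighted k X = F.weighted (fun a b c => k b a c) (fun a b c => X b a c) :=
  Finset.sum_comm

theorem weighted_swap₂₃ :
    F.weighted k X = F.weighted (fun a b c => k a c b) (fun a b c => X a c b) :=
  Finset.sum_congr rfl fun _ _ => Finset.sum_comm

theorem weighted_rot : F.weighted k X = F.weighted (fun a b c => k b c a) (fun a b c => X b c a) := by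
  rw [weighted_swap₂₃, weighted_swap₁₂]

theorem weighted_eq_zero_of_zero {k : Ind → Ind → Ind → ℂ} {X : Ind → Ind → Ind → F.Wick}
    (h : ∀ a b c, k a b c • X a b c = 0) : F.weighted k X = 0 := by
  simp only [weighted, h, Finset.sum_const_zero]

theorem weighted_eq_zero₁₂ {k : Ind → Ind → Ind → ℂ} {X : Ind → Ind → Ind → F.Wick}
    (h : ∀ a b c, k a b c • X a b c = -(k b a c • X b a c)) : F.weighted k X = 0 := by
  refine F.wick_eq_zero_of_eq_neg ?_
  conv_rhs => rw [weighted_swap₁₂]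
  simp only [weighted, ← Finset.sum_neg_distrib]
  exact Finset.sum_congr rfl fun a _ => Finset.sum_congr rfl fun b _ =>
    Finset.sum_congr rfl fun c _ => h a b c

theorem weighted_eq_zero₂₃ {k : Ind → Ind → Ind → ℂ} {X : Ind → Ind → Ind → F.Wick}
    (h : ∀ a b c, k a b c • X a b c = -(k a c b • X a c b)) : F.weighted k X = 0 := by
  refine F.wick_eq_zero_of_eq_neg ?_
  conv_rhs => rw [weighted_swap₂₃]
  simp only [weighted, ← Finset.sum_neg_distrib]
  exact Finset.sum_congr rfl fun a _ => Finset.sum_congr rfl fun b _ =>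
    Finset.sum_congr rfl fun c _ => h a b c

end

/-! The field strength and the covariant derivative of `Φ` are gauge invariant. -/

theorem fieldStrengthUp_swap (a : Ind) (μ ν : Fin 4) :
    F.fieldStrengthUp a μ ν = -F.fieldStrengthUp a ν μ := by
  simp only [fieldStrengthUp, mul_comm (eta μ)]
  module

theorem dQ_fieldStrengthUp (a : Ind) (μ ν : Fin 4) : F.dQ (F.fieldStrengthUp a μ ν) = 0 := by
  have h : F.pd μ (F.pd ν (F.u a)) = F.pd ν (F.pd μ (F.u a)) := by
    simp only [u, pd_jet, Multiset.cons_swap]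
  rw [fieldStrengthUp, map_smul, map_sub, dQ_pd, dQ_pd, dQ_v_field, dQ_v_field, map_smul, map_smul, h,
    sub_self, smul_zero]

theorem dQ_phiUp (a : Ind) (μ : Fin 4) : F.dQ (F.phiUp a μ) = 0 := by
  rw [phiUp, map_smul, map_sub, dQ_pd, map_smul, dQ_v_field, dQ_phi_field, map_smul]
  match_scalars
  ring

theorem pd_pd (μ ν : Fin 4) (c : Comp Ind Dir) :
    F.pd μ (F.pd ν (F.jet (c, 0))) = F.pd ν (F.pd μ (F.jet (c, 0))) := by
  simp only [pd_jet, Multiset.cons_swap]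

theorem box_quad (a : Ind) (q : QuadComp) : ∑ μ, eta μ • F.pd μ (F.pd μ (F.jet (.quad a q, 0)))
    = -((F.mass a : ℂ) ^ 2) • F.jet (.quad a q, 0) := by
  simp only [pd_jet]
  exact F.jet_kleinGordon a q 0

/-- `∂·v_a` -/
def divV (a : Ind) : F.Wick := ∑ μ, eta μ • F.pd μ (F.v a μ)

/-- `∂_ν F^{μν} = ∂^μ (∂·v) + m² v^μ` -/
theorem pd_fieldStrengthUp (a : Ind) (μ : Fin 4) : ∑ ν, F.pd ν (F.fieldStrengthUp a μ ν)
    = eta μ • (F.pd μ (F.divV a) + ((F.mass a : ℂ) ^ 2) • F.v a μ) := by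
  have h1 := F.box_quad a (.v μ)
  have h2 (ν) : F.pd ν (F.fieldStrengthUp a μ ν) = eta μ • (eta ν • F.pd μ (F.pd ν (F.v a ν)))
      - eta μ • (eta ν • F.pd ν (F.pd ν (F.v a μ))) := by
    rw [fieldStrengthUp, map_smul, map_sub, v, v, F.pd_pd ν μ]
    module
  simp only [h2, Finset.sum_sub_distrib, ← Finset.smul_sum]
  rw [v, h1, divV, map_sum]
  simp only [map_smul]
  module

theorem pd_phiUp (a : Ind) : ∑ μ, F.pd μ (F.phiUp a μ)
    = -((F.mass a : ℂ) ^ 2) • F.phi a - (F.gaugeMass a : ℂ) • F.divV a := by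
  rw [phi, ← F.box_quad a .phi, divV, Finset.smul_sum, ← Finset.sum_sub_distrib]
  refine Finset.sum_congr rfl fun μ _ => ?_
  rw [phiUp, map_smul, map_sub, map_smul, phi]
  module

theorem phiUp_comm (a : Ind) (μ : Fin 4) (w : F.Wick) : F.phiUp a μ * w = w * F.phiUp a μ := by
  rw [phiUp, smul_mul_assoc, mul_smul_comm, sub_mul, mul_sub, smul_mul_assoc, mul_smul_comm,
    pd_phi_comm, v_comm]

theorem dQ_phiUp_mul (a : Ind) (μ : Fin 4) (w : F.Wick) :
    F.dQ (F.phiUp a μ * w) = F.phiUp a μ * F.dQ w := by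
  have h : F.phiUp a μ ∈ F.linSpan false := by
    rw [phiUp, phi, v, pd_jet]
    exact Submodule.smul_mem _ _ (Submodule.sub_mem _ (F.jet_mem_linSpan' rfl)
      (Submodule.smul_mem _ _ (F.jet_mem_linSpan' rfl)))
  rw [F.hasParity_linSpan h true F.dQ F.dQ_isLeibniz, dQ_phiUp]
  simp [koszul]

theorem v_left (a : Ind) (μ : Fin 4) (x y : F.Wick) : F.v a μ * (x * y) = x * (F.v a μ * y) := by
  rw [← mul_assoc, v_comm, mul_assoc]

theorem phi_left (a : Ind) (x y : F.Wick) : F.phi a * (x * y) = x * (F.phi a * y) := by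
  rw [← mul_assoc, phi_comm, mul_assoc]

/-! Monomials in the gauge variation of the interaction. -/

/-- `∂_μ u_a v_{bν} F_c^{νμ}` -/
def duVF (a b c : Ind) : F.Wick :=
  ∑ μ, ∑ ν, F.pd μ (F.u a) * (F.v b ν * F.fieldStrengthUp c ν μ)

/-- `u_a ∂_μ v_{bν} F_c^{νμ}` -/
def uDvF (a b c : Ind) : F.Wick :=
  ∑ μ, ∑ ν, F.u a * (F.pd μ (F.v b ν) * F.fieldStrengthUp c ν μ)

/-- `u_a ∂_μ u_b ∂^μ ũ_c` -/
def uDuDut (a b c : Ind) : F.Wick :=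
  ∑ μ, eta μ • (F.u a * (F.pd μ (F.u b) * F.pd μ (F.ut c)))

/-- `u_a v_b^μ ∂_μ Φ_c` -/
def uVDphi (a b c : Ind) : F.Wick := ∑ μ, eta μ • (F.u a * (F.v b μ * F.pd μ (F.phi c)))

/-- `u_a v_b^μ v_{cμ}` -/
def uVV (a b c : Ind) : F.Wick := ∑ μ, eta μ • (F.u a * (F.v b μ * F.v c μ))

/-- `u_a u_b ũ_c` -/
def uUut (a b c : Ind) : F.Wick := F.u a * (F.u b * F.ut c)

/-- `u_a Φ_b Φ_c` -/
def uPhiPhi (a b c : Ind) : F.Wick := F.u a * (F.phi b * F.phi c)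

theorem uDvF_swap (a b c : Ind) : F.uDvF a c b = F.uDvF a b c := by
  have h (a b c : Ind) : F.uDvF a b c = (∑ μ, ∑ ν, (eta μ * eta ν) •
      (F.u a * (F.pd μ (F.v b ν) * F.pd ν (F.v c μ)))) - ∑ μ, ∑ ν, (eta μ * eta ν) •
      (F.u a * (F.pd μ (F.v b ν) * F.pd μ (F.v c ν))) := by
    simp only [uDvF, ← Finset.sum_sub_distrib]
    refine Finset.sum_congr rfl fun μ _ => Finset.sum_congr rfl fun ν _ => ?_
    rw [fieldStrengthUp, mul_smul_comm, mul_smul_comm, wick_mul_sub, wick_mul_sub]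
    module
  rw [h, h]
  congr 1
  · rw [Finset.sum_comm]
    refine Finset.sum_congr rfl fun μ _ => Finset.sum_congr rfl fun ν _ => ?_
    rw [mul_comm (eta ν), F.pd_v_comm ν]
  · refine Finset.sum_congr rfl fun μ _ => Finset.sum_congr rfl fun ν _ => ?_
    rw [F.pd_v_comm μ ν c]

theorem uVV_swap (a b c : Ind) : F.uVV a c b = F.uVV a b c := by
  simp only [uVV, F.v_comm c]

theorem uUut_swap (a b c : Ind) : F.uUut b a c = -F.uUut a b c := by
  rw [uUut, uUut, ← mul_assoc, u, u, F.fermi_comm rfl rfl, wick_neg_mul, mul_assoc]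

theorem uPhiPhi_swap (a b c : Ind) : F.uPhiPhi a c b = F.uPhiPhi a b c := by
  rw [uPhiPhi, uPhiPhi, F.phi_comm c]

theorem pd_u_mul_u (μ : Fin 4) (a b : Ind) (w : F.Wick) :
    F.pd μ (F.u a) * (F.u b * w) = -(F.u b * (F.pd μ (F.u a) * w)) := by
  rw [← mul_assoc, u, u, pd_jet, F.fermi_comm rfl rfl, wick_neg_mul, mul_assoc]

/-- The gauge variation of the pure Yang-Mills part. -/
theorem dQ_pureYM (a b c : Ind) :
    F.dQ ((1 / 2 : ℂ) • (∑ μ, ∑ ν, F.v a μ * F.v b ν * F.fieldStrengthUp c ν μ)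
        + ∑ μ, F.u a * F.vUp b μ * F.pd μ (F.ut c))
    = Complex.I • ((1 / 2 : ℂ) • (F.duVF a b c - F.duVF b a c) - F.uDuDut a b c
      + (∑ μ, eta μ • (F.u a * (F.v b μ * F.pd μ (F.divV c))))
      + (F.gaugeMass c : ℂ) • F.uVDphi a b c) := by
  have h1 : F.dQ (∑ μ, ∑ ν, F.v a μ * F.v b ν * F.fieldStrengthUp c ν μ)
      = Complex.I • (F.duVF a b c - F.duVF b a c) := by
    have e : F.duVF b a c = -∑ μ, ∑ ν, F.pd ν (F.u b) * (F.v a μ * F.fieldStrengthUp c ν μ) := by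
      rw [duVF, Finset.sum_comm, ← Finset.sum_neg_distrib]
      refine Finset.sum_congr rfl fun μ _ => ?_
      rw [← Finset.sum_neg_distrib]
      refine Finset.sum_congr rfl fun ν _ => ?_
      rw [F.fieldStrengthUp_swap, wick_mul_neg, wick_mul_neg]
    rw [e, duVF, sub_neg_eq_add, ← Finset.sum_add_distrib, map_sum, Finset.smul_sum]
    refine Finset.sum_congr rfl fun μ _ => ?_
    rw [← Finset.sum_add_distrib, map_sum, Finset.smul_sum]
    refine Finset.sum_congr rfl fun ν _ => ?_
    rw [mul_assoc, dQ_v_mul, dQ_v_mul, dQ_fieldStrengthUp, mul_zero, add_zero, mul_smul_comm,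
      F.v_left a μ (F.pd ν (F.u b)), smul_add]
  have h2 : F.dQ (∑ μ, F.u a * F.vUp b μ * F.pd μ (F.ut c))
      = Complex.I • (- F.uDuDut a b c
      + (∑ μ, eta μ • (F.u a * (F.v b μ * F.pd μ (F.divV c))))
      + (F.gaugeMass c : ℂ) • F.uVDphi a b c) := by
    rw [uDuDut, uVDphi, ← Finset.sum_neg_distrib, Finset.smul_sum, ← Finset.sum_add_distrib,
      ← Finset.sum_add_distrib, map_sum, Finset.smul_sum]
    refine Finset.sum_congr rfl fun μ _ => ?_
    have hu : F.dQ (F.pd μ (F.ut c)) = -Complex.I • (F.pd μ (F.divV c)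
        + (F.gaugeMass c : ℂ) • F.pd μ (F.phi c)) := by
      rw [dQ_pd, dQ_ut_field, divV, map_smul, map_add, map_smul]
    rw [mul_assoc, vUp, smul_mul_assoc, mul_smul_comm, map_smul, dQ_u_mul, dQ_v_mul, hu]
    simp only [mul_add, mul_smul_comm]
    module
  rw [map_add, map_smul, h1, h2]
  module

/-- The divergence of the pure Yang-Mills part of `T^μ`. -/
theorem divergence_pureYM (a b c : Ind) :
    F.divergence (fun μ => (∑ ν, F.u a * F.v b ν * F.fieldStrengthUp c ν μ)
        - (1 / 2 : ℂ) • (F.u a * F.u b * (eta μ • F.pd μ (F.ut c))))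
    = F.duVF a b c + F.uDvF a b c + (∑ μ, eta μ • (F.u a * (F.v b μ * F.pd μ (F.divV c))))
      + ((F.mass c : ℂ) ^ 2) • F.uVV a b c
      - (1 / 2 : ℂ) • (F.uDuDut a b c - F.uDuDut b a c - ((F.mass c : ℂ) ^ 2) • F.uUut a b c) := by
  have h1 : ∑ μ, ∑ ν, F.pd μ (F.u a * F.v b ν * F.fieldStrengthUp c ν μ)
      = F.duVF a b c + F.uDvF a b c + (∑ μ, eta μ • (F.u a * (F.v b μ * F.pd μ (F.divV c))))
      + ((F.mass c : ℂ) ^ 2) • F.uVV a b c := by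
    have e : ∑ μ, ∑ ν, F.u a * (F.v b ν * F.pd μ (F.fieldStrengthUp c ν μ))
        = (∑ μ, eta μ • (F.u a * (F.v b μ * F.pd μ (F.divV c))))
          + ((F.mass c : ℂ) ^ 2) • F.uVV a b c := by
      rw [Finset.sum_comm, uVV, Finset.smul_sum, ← Finset.sum_add_distrib]
      refine Finset.sum_congr rfl fun ν _ => ?_
      rw [← Finset.mul_sum, ← Finset.mul_sum, pd_fieldStrengthUp]
      simp only [mul_smul_comm, mul_add]
      module
    rw [add_assoc, ← e, duVF, uDvF, ← Finset.sum_add_distrib, ← Finset.sum_add_distrib]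
    refine Finset.sum_congr rfl fun μ _ => ?_
    rw [← Finset.sum_add_distrib, ← Finset.sum_add_distrib]
    refine Finset.sum_congr rfl fun ν _ => ?_
    rw [mul_assoc, pd_mul, pd_mul, mul_add, add_assoc]
  have h2 : ∑ μ, F.pd μ (F.u a * F.u b * (eta μ • F.pd μ (F.ut c)))
      = F.uDuDut a b c - F.uDuDut b a c - ((F.mass c : ℂ) ^ 2) • F.uUut a b c := by
    have e : F.u a * (F.u b * ∑ μ, eta μ • F.pd μ (F.pd μ (F.ut c)))
        = -(((F.mass c : ℂ) ^ 2) • F.uUut a b c) := by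
      rw [ut, box_quad, uUut, mul_smul_comm, mul_smul_comm, ut, wick_neg_smul]
    rw [sub_eq_add_neg (_ - _), ← e, uDuDut, uDuDut, ← Finset.sum_sub_distrib, Finset.mul_sum,
      Finset.mul_sum, ← Finset.sum_add_distrib]
    refine Finset.sum_congr rfl fun μ _ => ?_
    rw [mul_assoc, pd_mul, pd_mul, map_smul, mul_add, pd_u_mul_u]
    simp only [mul_smul_comm]
    abel
  simp only [divergence, map_sub, map_sum, map_smul, Finset.sum_sub_distrib, ← Finset.smul_sum, h1,
    h2]

end FieldContent
namespace FieldContent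
variable {Ind Dir : Type*} (F : FieldContent Ind Dir)

/-! ### Gauge variations of the scalar terms -/

/-- `u_a ∂_μ Φ_b ∂^μ Φ_c` -/
def uDphiDphi (a b c : Ind) : F.Wick :=
  ∑ μ, eta μ • (F.u a * (F.pd μ (F.phi b) * F.pd μ (F.phi c)))

theorem uDphiDphi_swap (a b c : Ind) : F.uDphiDphi a c b = F.uDphiDphi a b c := by
  simp only [uDphiDphi, F.pd_phi_comm _ c]

/-- The gauge variation of the Higgs part, up to a divergence. -/
theorem dQ_higgsPart (a b c : Ind) :
    F.dQ ((∑ μ, F.phi a * F.phiUp b μ * F.v c μ)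
        + (F.gaugeMass b : ℂ) • (F.phi a * F.ut b * F.u c))
    = Complex.I • (F.divergence (fun μ => F.phi a * F.phiUp b μ * F.u c)
      + (F.gaugeMass a : ℂ) • F.uVDphi a c b
      - (F.gaugeMass a * F.gaugeMass b : ℂ) • F.uVV a b c
      - (F.gaugeMass a * F.gaugeMass b : ℂ) • F.uUut a c b
      + ((F.mass b : ℂ) ^ 2 - (F.gaugeMass b : ℂ) ^ 2) • F.uPhiPhi c a b
      + (F.gaugeMass b : ℂ) • F.uVDphi c b a
      - F.uDphiDphi c a b) := by
  have h1 : F.dQ (∑ μ, F.phi a * F.phiUp b μ * F.v c μ)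
      = Complex.I • ((∑ μ, F.phi a * (F.phiUp b μ * F.pd μ (F.u c)))
        + (F.gaugeMass a : ℂ) • F.uVDphi a c b
        - (F.gaugeMass a * F.gaugeMass b : ℂ) • F.uVV a b c) := by
    rw [uVDphi, uVV, Finset.smul_sum, Finset.smul_sum, ← Finset.sum_add_distrib,
      ← Finset.sum_sub_distrib, map_sum, Finset.smul_sum]
    refine Finset.sum_congr rfl fun μ _ => ?_
    rw [mul_assoc, dQ_phi_mul, dQ_phiUp_mul, dQ_v_field, F.phiUp_comm b μ (F.v c μ), phiUp,
      F.v_comm b μ (F.v c μ)]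
    simp only [mul_smul_comm, smul_mul_assoc, wick_mul_sub, wick_sub_mul]
    module
  have h2 : F.dQ (F.phi a * F.ut b * F.u c) = Complex.I • (-((F.gaugeMass a : ℂ) • F.uUut a c b)
      - F.phi a * (F.divV b * F.u c) - (F.gaugeMass b : ℂ) • F.uPhiPhi c a b) := by
    have e : F.uPhiPhi c a b = F.phi a * (F.phi b * F.u c) := by
      rw [uPhiPhi, ← mul_assoc, ← F.phi_comm a, mul_assoc, F.phi_comm b]
    rw [e, mul_assoc, dQ_phi_mul, dQ_ut_mul, dQ_u_field, F.ut_mul_u, uUut, divV]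
    simp only [mul_add, wick_mul_neg, mul_smul_comm, smul_mul_assoc, wick_neg_mul, add_mul, wick_neg_smul,
      mul_zero, sub_zero, Finset.sum_mul]
    module
  have h3 : F.divergence (fun μ => F.phi a * F.phiUp b μ * F.u c)
      = (∑ μ, F.phi a * (F.phiUp b μ * F.pd μ (F.u c))) + F.uDphiDphi c a b
        - (F.gaugeMass b : ℂ) • F.uVDphi c b a
        - ((F.mass b : ℂ) ^ 2) • F.uPhiPhi c a b - (F.gaugeMass b : ℂ) • (F.phi a * (F.divV b * F.u c)) := by
    have e : F.uPhiPhi c a b = F.phi a * (F.phi b * F.u c) := by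
      rw [uPhiPhi, ← mul_assoc, ← F.phi_comm a, mul_assoc, F.phi_comm b]
    have e2 : ∑ μ, F.pd μ (F.phi a) * (F.phiUp b μ * F.u c)
        = F.uDphiDphi c a b - (F.gaugeMass b : ℂ) • F.uVDphi c b a := by
      rw [uDphiDphi, uVDphi, Finset.smul_sum, ← Finset.sum_sub_distrib]
      refine Finset.sum_congr rfl fun μ _ => ?_
      have e3 : F.pd μ (F.phi a) * (F.phiUp b μ * F.u c)
          = F.u c * (F.pd μ (F.phi a) * F.phiUp b μ) := by
        rw [F.phiUp_comm, ← mul_assoc, F.pd_phi_comm, mul_assoc]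
      rw [e3, phiUp, mul_smul_comm, mul_smul_comm, wick_mul_sub, wick_mul_sub, mul_smul_comm, mul_smul_comm,
        F.pd_phi_comm μ a (F.v b μ)]
      module
    have e4 : ∑ μ, F.phi a * (F.pd μ (F.phiUp b μ) * F.u c)
        = - ((F.mass b : ℂ) ^ 2) • F.uPhiPhi c a b
          - (F.gaugeMass b : ℂ) • (F.phi a * (F.divV b * F.u c)) := by
      rw [← Finset.mul_sum, ← Finset.sum_mul, pd_phiUp, e]
      simp only [wick_mul_sub, wick_sub_mul, wick_neg_smul, smul_mul_assoc, mul_smul_comm, wick_neg_mul, wick_mul_neg]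
    have e5 (μ) : F.pd μ (F.phi a * F.phiUp b μ * F.u c) = F.pd μ (F.phi a) * (F.phiUp b μ * F.u c)
        + F.phi a * (F.pd μ (F.phiUp b μ) * F.u c) + F.phi a * (F.phiUp b μ * F.pd μ (F.u c)) := by
      rw [mul_assoc, pd_mul, pd_mul, mul_add, add_assoc]
    rw [divergence]
    simp only [e5, Finset.sum_add_distrib]
    rw [e2, e4]
    module
  rw [map_add, map_smul, h1, h2, h3]
  module

theorem phi_phi_mul_u (a b c : Ind) : F.phi a * (F.phi b * F.u c) = F.uPhiPhi c a b := by
  rw [F.phi_comm b, ← mul_assoc, F.phi_comm a, mul_assoc, uPhiPhi]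

theorem dQ_phi_cube (a b c : Ind) : F.dQ (F.phi a * F.phi b * F.phi c)
    = Complex.I • ((F.gaugeMass a : ℂ) • F.uPhiPhi a b c + (F.gaugeMass b : ℂ) • F.uPhiPhi b a c
      + (F.gaugeMass c : ℂ) • F.uPhiPhi c a b) := by
  have e : F.phi a * (F.u b * F.phi c) = F.uPhiPhi b a c := by
    rw [F.phi_left, uPhiPhi]
  have e' : F.u a * (F.phi b * F.phi c) = F.uPhiPhi a b c := rfl
  rw [mul_assoc, dQ_phi_mul, dQ_phi_mul, dQ_phi_field, mul_add, mul_smul_comm, mul_smul_comm,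
    mul_smul_comm, e, phi_phi_mul_u, e']
  module

theorem dQ_phi_quartic {a b c d : Ind} (ha : F.gaugeMass a = 0) (hb : F.gaugeMass b = 0)
    (hc : F.gaugeMass c = 0) (hd : F.gaugeMass d = 0) :
    F.dQ (F.phi a * F.phi b * F.phi c * F.phi d) = 0 := by
  rw [mul_assoc, mul_assoc, dQ_phi_mul, dQ_phi_mul, dQ_phi_mul, dQ_phi_field, ha, hb, hc, hd]
  simp

section
variable [Fintype Ind]

theorem weighted_sub (k : Ind → Ind → Ind → ℂ) (X Y : Ind → Ind → Ind → F.Wick) :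
    F.weighted k (fun a b c => X a b c - Y a b c) = F.weighted k X - F.weighted k Y := by
  simp only [weighted, smul_sub, Finset.sum_sub_distrib]

theorem weighted_swap₁₃ (k : Ind → Ind → Ind → ℂ) (X : Ind → Ind → Ind → F.Wick) :
    F.weighted k X = F.weighted (fun a b c => k c b a) (fun a b c => X c b a) :=
  (F.weighted_swap₁₂ k X).trans ((F.weighted_swap₂₃ _ _).trans (F.weighted_swap₁₂ _ _))

theorem dQ_weighted (k : Ind → Ind → Ind → ℂ) (X : Ind → Ind → Ind → F.Wick) :
    F.dQ (F.weighted k X) = F.weighted k fun a b c => F.dQ (X a b c) := by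
  simp only [weighted, map_sum, map_smul]

/-- The gauge variation of the pure Yang-Mills part: for massless fields it is a divergence. -/
theorem dQ_weighted_pureYM {f : Ind → Ind → Ind → ℂ} (h₁ : ∀ a b c, f a b c = -f b a c)
    (h₂ : ∀ a b c, f a b c = -f a c b) (hm : ∀ a b c, f a b c * F.mass c = f a b c * F.gaugeMass c) :
    F.dQ (F.weighted f fun a b c =>
      (1 / 2 : ℂ) • (∑ μ, ∑ ν, F.v a μ * F.v b ν * F.fieldStrengthUp c ν μ)
        + ∑ μ, F.u a * F.vUp b μ * F.pd μ (F.ut c))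
    = Complex.I • (F.weighted f (fun a b c => F.divergence (fun μ =>
          (∑ ν, F.u a * F.v b ν * F.fieldStrengthUp c ν μ)
          - (1 / 2 : ℂ) • (F.u a * F.u b * (eta μ • F.pd μ (F.ut c)))))
      + F.weighted (fun a b c => f a b c * F.gaugeMass c) F.uVDphi
      - F.weighted (fun a b c => f a b c * (F.gaugeMass c : ℂ) ^ 2) F.uVV
      - (1 / 2 : ℂ) • F.weighted (fun a b c => f a b c * (F.gaugeMass c : ℂ) ^ 2) F.uUut) := by
  have z1 : F.weighted f (fun a b c => F.duVF a b c + F.duVF b a c) = 0 :=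
    F.weighted_eq_zero₁₂ fun a b c => by rw [h₁ a b c]; module
  have z2 : F.weighted f F.uDvF = 0 :=
    F.weighted_eq_zero₂₃ fun a b c => by rw [h₂ a b c, F.uDvF_swap a b c]; module
  have z3 : F.weighted f (fun a b c => F.uDuDut a b c + F.uDuDut b a c) = 0 :=
    F.weighted_eq_zero₁₂ fun a b c => by rw [h₁ a b c]; module
  have hm2 (a b c) : f a b c * (F.gaugeMass c : ℂ) ^ 2 = f a b c * (F.mass c : ℂ) ^ 2 := by
    linear_combination (-(F.mass c : ℂ) - F.gaugeMass c) * hm a b c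
  have key : F.weighted f (fun a b c => (F.divergence (fun μ =>
          (∑ ν, F.u a * F.v b ν * F.fieldStrengthUp c ν μ)
          - (1 / 2 : ℂ) • (F.u a * F.u b * (eta μ • F.pd μ (F.ut c)))))
      + (F.gaugeMass c : ℂ) • F.uVDphi a b c - (F.mass c : ℂ) ^ 2 • F.uVV a b c
      - (1 / 2 : ℂ) • ((F.mass c : ℂ) ^ 2 • F.uUut a b c)
      - (1 / 2 : ℂ) • (F.duVF a b c + F.duVF b a c) - F.uDvF a b c
      - (1 / 2 : ℂ) • (F.uDuDut a b c + F.uDuDut b a c))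
    = F.weighted f (fun a b c => F.divergence (fun μ =>
          (∑ ν, F.u a * F.v b ν * F.fieldStrengthUp c ν μ)
          - (1 / 2 : ℂ) • (F.u a * F.u b * (eta μ • F.pd μ (F.ut c)))))
      + F.weighted (fun a b c => f a b c * F.gaugeMass c) F.uVDphi
      - F.weighted (fun a b c => f a b c * (F.gaugeMass c : ℂ) ^ 2) F.uVV
      - (1 / 2 : ℂ) • F.weighted (fun a b c => f a b c * (F.gaugeMass c : ℂ) ^ 2) F.uUut := by
    simp only [hm2]
    rw [weighted_sub, weighted_sub, weighted_sub, weighted_sub, weighted_sub, weighted_add,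
      weighted_const_smul', weighted_const_smul', weighted_const_smul', z1, z2, z3, weighted_smul,
      weighted_smul, weighted_smul]
    simp only [smul_zero, sub_zero]
  rw [dQ_weighted, ← key, ← weighted_const_smul']
  refine F.weighted_congr fun a b c => ?_
  rw [dQ_pureYM, divergence_pureYM]
  module

theorem dQ_weighted_higgsPart {k : Ind → Ind → Ind → ℂ} (h : ∀ a b c, k a b c = -k b a c) :
    F.dQ (F.weighted k fun a b c => (∑ μ, F.phi a * F.phiUp b μ * F.v c μ)
        + (F.gaugeMass b : ℂ) • (F.phi a * F.ut b * F.u c))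
    = Complex.I • (F.weighted k (fun a b c => F.divergence (fun μ => F.phi a * F.phiUp b μ * F.u c))
      + F.weighted (fun a b c => k a c b * F.gaugeMass a + k c b a * F.gaugeMass b) F.uVDphi
      - F.weighted (fun a b c => k a b c * (F.gaugeMass a * F.gaugeMass b)) F.uVV
      - F.weighted (fun a b c => k a c b * (F.gaugeMass a * F.gaugeMass c)) F.uUut
      + F.weighted (fun a b c => k b c a * ((F.mass c : ℂ) ^ 2 - (F.gaugeMass c : ℂ) ^ 2))
        F.uPhiPhi) := by
  have z1 : F.weighted k (fun a b c => F.uDphiDphi c a b) = 0 :=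
    F.weighted_eq_zero₁₂ fun a b c => by rw [h a b c, F.uDphiDphi_swap c a b]; module
  rw [dQ_weighted]
  simp only [dQ_higgsPart]
  rw [weighted_const_smul', weighted_sub, weighted_add, weighted_add, weighted_sub, weighted_sub,
    weighted_add, z1, weighted_smul, weighted_smul, weighted_smul, weighted_smul, weighted_smul,
    weighted_add_left,
    F.weighted_swap₂₃ (fun a b c => k a b c * _) (fun a b c => F.uVDphi a c b),
    F.weighted_swap₂₃ (fun a b c => k a b c * _) (fun a b c => F.uUut a c b),
    F.weighted_rot (fun a b c => k a b c * _) (fun a b c => F.uPhiPhi c a b)]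
  have e : F.weighted (fun a b c => k a b c * (F.gaugeMass b : ℂ)) (fun a b c => F.uVDphi c b a)
      = F.weighted (fun a b c => k c b a * F.gaugeMass b) F.uVDphi := by
    rw [weighted_swap₁₃]
  rw [e]
  module

theorem dQ_weighted_cube {k : Ind → Ind → Ind → ℂ} (h₁ : ∀ a b c, k a b c = k b a c)
    (h₂ : ∀ a b c, k a b c = k a c b) :
    F.dQ (F.weighted k fun a b c => F.phi a * F.phi b * F.phi c)
    = Complex.I • ((3 : ℂ) • F.weighted (fun a b c => k a b c * F.gaugeMass a) F.uPhiPhi) := by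
  rw [dQ_weighted]
  simp only [dQ_phi_cube]
  rw [weighted_const_smul', weighted_add, weighted_add, weighted_smul, weighted_smul, weighted_smul,
    F.weighted_swap₁₂ (fun a b c => k a b c * F.gaugeMass b),
    F.weighted_rot (fun a b c => k a b c * F.gaugeMass c)]
  have e1 (a b c) : k b a c = k a b c := (h₁ a b c).symm
  have e2 (a b c) : k b c a = k a b c := by rw [h₂, e1]
  simp only [e1, e2]
  module

end

end FieldContent

/-! ### The currents of the Dirac fields -/

theorem gamma_mul_chiral (μ : Fin 4) (ε : ℤˣ) : gamma μ * chiral ε = chiral (-ε) * gamma μ := by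
  rcases Int.units_eq_one_or ε with rfl | rfl
  · rw [chiral_pos, chiral_neg]
    fin_cases μ <;> ext i j <;> fin_cases i <;> fin_cases j <;> simp [gamma]
  · rw [neg_neg, chiral_pos, chiral_neg]
    fin_cases μ <;> ext i j <;> fin_cases i <;> fin_cases j <;> simp [gamma]

namespace FieldContent
variable {Ind Dir : Type*} (F : FieldContent Ind Dir)

/-- `Ψ̄_A G Ψ_B` -/
def spinorPair (A B : Dir) (G : Matrix (Fin 4) (Fin 4) ℂ) : F.Wick :=
  ∑ s, ∑ r, G s r • (F.psibar A s * F.psi B r)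

theorem dQ_spinorPair_mul (A B : Dir) (G : Matrix (Fin 4) (Fin 4) ℂ) (w : F.Wick) :
    F.dQ (F.spinorPair A B G * w) = F.spinorPair A B G * F.dQ w := by
  simp only [spinorPair, Finset.sum_mul, map_sum, smul_mul_assoc, map_smul]
  refine Finset.sum_congr rfl fun s _ => Finset.sum_congr rfl fun r _ => ?_
  rw [mul_assoc, psibar, F.dQ_fermi_mul rfl, dQ_psibar, psi, F.dQ_fermi_mul rfl, dQ_psi, zero_mul,
    zero_mul, zero_sub, zero_sub, wick_mul_neg, neg_neg, mul_assoc]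

/-- `∂_μ (Ψ̄_A γ^μ γ_ε Ψ_B) = i (M_A Ψ̄_A γ_ε Ψ_B - M_B Ψ̄_A γ_{-ε} Ψ_B)` -/
theorem divergence_spinorPair (A B : Dir) (ε : ℤˣ) :
    ∑ μ, F.pd μ (F.spinorPair A B (gamma μ * chiral ε))
      = Complex.I • ((F.diracMass A : ℂ) • F.spinorPair A B (chiral ε)
        - (F.diracMass B : ℂ) • F.spinorPair A B (chiral (-ε))) := by
  have hb (q) : ∑ μ, ∑ s, gamma μ s q • F.pd μ (F.psibar A s)
      = (Complex.I * F.diracMass A) • F.psibar A q := by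
    have h := congrArg (fun w => -Complex.I • w) (F.jet_diracBar A q 0)
    simp only [Finset.smul_sum, smul_smul] at h
    simp only [psibar, pd_jet]
    rw [show Complex.I * (F.diracMass A : ℂ) = -Complex.I * -(F.diracMass A : ℂ) by ring, ← h]
    refine Finset.sum_congr rfl fun μ _ => Finset.sum_congr rfl fun s _ => ?_
    congr 1
    linear_combination gamma μ s q * Complex.I_mul_I
  have hp (q) : ∑ μ, ∑ r, gamma μ q r • F.pd μ (F.psi B r)
      = (-Complex.I * F.diracMass B) • F.psi B q := by
    have h := congrArg (fun w => -Complex.I • w) (F.jet_dirac B q 0)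
    simp only [Finset.smul_sum, smul_smul] at h
    simp only [psi, pd_jet]
    rw [← h]
    refine Finset.sum_congr rfl fun μ _ => Finset.sum_congr rfl fun s _ => ?_
    congr 1
    linear_combination gamma μ q s * Complex.I_mul_I
  have e1 : ∑ μ, ∑ s, ∑ r, (gamma μ * chiral ε) s r • (F.pd μ (F.psibar A s) * F.psi B r)
      = (Complex.I * F.diracMass A) • F.spinorPair A B (chiral ε) := by
    have e (q r) : (Complex.I * F.diracMass A) • chiral ε q r • (F.psibar A q * F.psi B r)
        = ∑ μ, ∑ s, (gamma μ s q * chiral ε q r) • (F.pd μ (F.psibar A s) * F.psi B r) := by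
      rw [smul_comm, ← smul_mul_assoc, ← hb, Finset.sum_mul, Finset.smul_sum]
      refine Finset.sum_congr rfl fun μ _ => ?_
      rw [Finset.sum_mul, Finset.smul_sum]
      refine Finset.sum_congr rfl fun s _ => ?_
      rw [smul_mul_assoc, smul_smul, mul_comm]
    simp only [spinorPair, Finset.smul_sum, e, Matrix.mul_apply, Finset.sum_smul]
    symm
    calc _ = ∑ q, ∑ μ, ∑ r, ∑ s, (gamma μ s q * chiral ε q r) •
            (F.pd μ (F.psibar A s) * F.psi B r) :=
          Finset.sum_congr rfl fun q _ => Finset.sum_comm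
      _ = ∑ μ, ∑ q, ∑ r, ∑ s, (gamma μ s q * chiral ε q r) •
            (F.pd μ (F.psibar A s) * F.psi B r) := Finset.sum_comm
      _ = _ := by
        refine Finset.sum_congr rfl fun μ _ => ?_
        rw [Finset.sum_comm]
        refine Eq.trans ?_ Finset.sum_comm
        exact Finset.sum_congr rfl fun r _ => Finset.sum_comm
  have e2 : ∑ μ, ∑ s, ∑ r, (gamma μ * chiral ε) s r • (F.psibar A s * F.pd μ (F.psi B r))
      = (-Complex.I * F.diracMass B) • F.spinorPair A B (chiral (-ε)) := by
    have e (s q) : (-Complex.I * F.diracMass B) • chiral (-ε) s q • (F.psibar A s * F.psi B q)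
        = ∑ μ, ∑ r, (chiral (-ε) s q * gamma μ q r) • (F.psibar A s * F.pd μ (F.psi B r)) := by
      rw [smul_comm, ← mul_smul_comm, ← hp, Finset.mul_sum, Finset.smul_sum]
      refine Finset.sum_congr rfl fun μ _ => ?_
      rw [Finset.mul_sum, Finset.smul_sum]
      refine Finset.sum_congr rfl fun r _ => ?_
      rw [mul_smul_comm, smul_smul]
    simp only [gamma_mul_chiral]
    simp only [spinorPair, Finset.smul_sum, e, Matrix.mul_apply, Finset.sum_smul]
    symm
    calc _ = ∑ s, ∑ μ, ∑ q, ∑ r, (chiral (-ε) s q * gamma μ q r) •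
            (F.psibar A s * F.pd μ (F.psi B r)) :=
          Finset.sum_congr rfl fun q _ => Finset.sum_comm
      _ = _ := by
        rw [Finset.sum_comm]
        exact Finset.sum_congr rfl fun μ _ => Finset.sum_congr rfl fun s _ => Finset.sum_comm
  have e3 (μ) : F.pd μ (F.spinorPair A B (gamma μ * chiral ε))
      = (∑ s, ∑ r, (gamma μ * chiral ε) s r • (F.pd μ (F.psibar A s) * F.psi B r))
        + ∑ s, ∑ r, (gamma μ * chiral ε) s r • (F.psibar A s * F.pd μ (F.psi B r)) := by
    simp only [spinorPair, map_sum, map_smul, pd_mul, smul_add, Finset.sum_add_distrib]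
  simp only [e3, Finset.sum_add_distrib]
  rw [e1, e2]
  module

variable [Fintype Dir] (C : Couplings Ind Dir)

theorem vectorCurrent_eq (a : Ind) (μ : Fin 4) : F.vectorCurrent C a μ
    = ∑ ε : ℤˣ, ∑ A, ∑ B, C.t ε a A B • F.spinorPair A B (gamma μ * chiral ε) := by
  simp only [vectorCurrent, spinorPair, Finset.smul_sum, smul_smul]

theorem scalarCurrent_eq (a : Ind) : F.scalarCurrent C a
    = ∑ ε : ℤˣ, ∑ A, ∑ B, C.s ε a A B • F.spinorPair A B (chiral ε) := by
  simp only [scalarCurrent, spinorPair, Finset.smul_sum, smul_smul]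

theorem dQ_vectorCurrent_mul (a : Ind) (μ : Fin 4) (w : F.Wick) :
    F.dQ (F.vectorCurrent C a μ * w) = F.vectorCurrent C a μ * F.dQ w := by
  simp only [vectorCurrent_eq, Finset.sum_mul, smul_mul_assoc, map_sum, map_smul, dQ_spinorPair_mul]

theorem dQ_scalarCurrent_mul (a : Ind) (w : F.Wick) :
    F.dQ (F.scalarCurrent C a * w) = F.scalarCurrent C a * F.dQ w := by
  simp only [scalarCurrent_eq, Finset.sum_mul, smul_mul_assoc, map_sum, map_smul, dQ_spinorPair_mul]

variable {F C}

/-- The vector currents are conserved up to the mass terms. -/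
theorem _root_.YangMills.Couplings.Restrictions.divergence_vectorCurrent [DecidableEq Dir]
    (hC : C.Restrictions F) (a : Ind) :
    F.divergence (F.vectorCurrent C a) = (F.gaugeMass a : ℂ) • F.scalarCurrent C a := by
  have h (ε A B) : (F.gaugeMass a : ℂ) * C.s ε a A B = Complex.I *
      (F.diracMass A * C.t ε a A B - C.t (-ε) a A B * F.diracMass B) := by
    simpa [diracMassMatrix] using congrFun (congrFun (hC.dirac_mass ε a) A) B
  simp only [divergence, scalarCurrent_eq, vectorCurrent_eq, Finset.smul_sum, smul_smul, h, map_sum]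
  have e (ε A B) : ∑ μ, F.pd μ (C.t ε a A B • F.spinorPair A B (gamma μ * chiral ε))
      = C.t ε a A B • Complex.I • ((F.diracMass A : ℂ) • F.spinorPair A B (chiral ε)
        - (F.diracMass B : ℂ) • F.spinorPair A B (chiral (-ε))) := by
    rw [← divergence_spinorPair, Finset.smul_sum]
    simp only [map_smul]
  have e' (ε) : ∑ μ, ∑ A, ∑ B, F.pd μ (C.t ε a A B • F.spinorPair A B (gamma μ * chiral ε))
      = ∑ A, ∑ B, C.t ε a A B • Complex.I • ((F.diracMass A : ℂ) • F.spinorPair A B (chiral ε)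
        - (F.diracMass B : ℂ) • F.spinorPair A B (chiral (-ε))) := by
    simp only [← e]
    rw [Finset.sum_comm]
    exact Finset.sum_congr rfl fun A _ => Finset.sum_comm
  simp only [sum_units, Finset.sum_add_distrib, e', neg_neg]
  simp only [← Finset.sum_add_distrib]
  refine Finset.sum_congr rfl fun A _ => Finset.sum_congr rfl fun B _ => ?_
  module

end FieldContent
namespace FieldContent
variable {Ind Dir : Type*} {F : FieldContent Ind Dir} {C : Couplings Ind Dir}

theorem u_higgs {a : Ind} (h : F.sector a = .higgs) : F.u a = 0 := F.jet_absent a .u 0 h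

theorem ut_higgs {a : Ind} (h : F.sector a = .higgs) : F.ut a = 0 := F.jet_absent a .ut 0 h

theorem v_higgs {a : Ind} (h : F.sector a = .higgs) (μ : Fin 4) : F.v a μ = 0 :=
  F.jet_absent a (.v μ) 0 h

theorem phi_massless {a : Ind} (h : F.sector a = .massless) : F.phi a = 0 :=
  F.jet_absent a .phi 0 h

theorem divergence_weighted [Fintype Ind] (k : Ind → Ind → Ind → ℂ)
    (X : Fin 4 → Ind → Ind → Ind → F.Wick) : F.divergence (fun μ => F.weighted k (X μ))
      = F.weighted k fun a b c => F.divergence fun μ => X μ a b c := by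
  simp only [divergence, weighted, map_sum, map_smul, Finset.smul_sum]
  rw [Finset.sum_comm]
  refine Finset.sum_congr rfl fun a _ => ?_
  rw [Finset.sum_comm]
  exact Finset.sum_congr rfl fun b _ => Finset.sum_comm

end FieldContent

/-! ### The descent equations -/

/-- The relation between `f''` and `f'` that gauge invariance imposes.  It has the formulas for `f''`
as consequences, and for massless `a` the condition that `f'_{bca}` links Higgs fields of the same
mass only. -/
def Couplings.ScalarRelation {Ind Dir : Type*} (C : Couplings Ind Dir) (F : FieldContent Ind Dir) :
    Prop :=
  ∀ a b c, F.sector a ≠ .higgs → F.sector b ≠ .massless → F.sector c ≠ .massless →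
    C.f'' a b c * F.gaugeMass a = C.f' b c a * (((F.mass b : ℂ) ^ 2 - (F.gaugeMass b : ℂ) ^ 2)
      - ((F.mass c : ℂ) ^ 2 - (F.gaugeMass c : ℂ) ^ 2))

namespace Couplings.Restrictions
open FieldContent
variable {Ind Dir : Type*} {F : FieldContent Ind Dir} {C : Couplings Ind Dir}
variable [Fintype Dir] [DecidableEq Dir]

/-- The couplings `f` only involve fields for which the gauge mass is the mass. -/
theorem f_mul_mass (hC : C.Restrictions F) (a b c : Ind) :
    C.f a b c * F.mass c = C.f a b c * F.gaugeMass c := by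
  by_cases h : F.sector c = .higgs
  · rw [hC.f_higgs a b c h, zero_mul, zero_mul]
  · rw [F.gaugeMass_of_ne h]

/-- The mass relation in a form that also covers massless `c`, where both sides vanish. -/
theorem f_mass' (hC : C.Restrictions F) {a b : Ind} (c : Ind) (ha : F.sector a ≠ .higgs)
    (hb : F.sector b ≠ .higgs) : C.f a b c * F.gaugeMass c
      = C.f' a c b * -F.gaugeMass a - C.f' c b a * F.gaugeMass b := by
  by_cases hc : F.sector c = .massless
  · rw [F.gaugeMass_massless hc, hC.f'_antisymm a c b, hC.f'_massless c a b hc,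
      hC.f'_massless c b a hc]
    simp
  · rw [← hC.f_mass a b c ha hb hc, hC.f'_antisymm a c b]
    ring

variable [Fintype Ind]

/-! The relations between the couplings remove the remaining terms, one monomial at a time. -/

theorem uVDphi_cancel (hC : C.Restrictions F) :
    F.weighted (fun a b c => C.f a b c * F.gaugeMass c) F.uVDphi
      + F.weighted (fun a b c => C.f' a c b * F.gaugeMass a + C.f' c b a * F.gaugeMass b) F.uVDphi
      = 0 := by
  rw [← weighted_add_left]
  refine F.weighted_eq_zero_of_zero fun a b c => ?_
  by_cases ha : F.sector a = .higgs
  · simp [uVDphi, u_higgs ha]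
  by_cases hb : F.sector b = .higgs
  · simp [uVDphi, v_higgs hb]
  rw [hC.f_mass' c ha hb]
  match_scalars
  ring

theorem uVV_cancel (hC : C.Restrictions F) :
    F.weighted (fun a b c => C.f a b c * (F.gaugeMass c : ℂ) ^ 2) F.uVV
      + F.weighted (fun a b c => C.f' a b c * (F.gaugeMass a * F.gaugeMass b)) F.uVV = 0 := by
  rw [← weighted_add_left]
  refine F.weighted_eq_zero₂₃ fun a b c => ?_
  by_cases ha : F.sector a = .higgs
  · simp [uVV, u_higgs ha]
  by_cases hb : F.sector b = .higgs
  · simp [uVV, v_higgs hb]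
  by_cases hc : F.sector c = .higgs
  · simp [uVV, v_higgs hc]
  rw [F.uVV_swap a b c]
  match_scalars
  have h1 := hC.f_mass' c ha hb
  have h2 := hC.f_mass' b ha hc
  have h3 := hC.f'_antisymm c b a
  have h4 := (hC.f_antisymm a b c).2
  linear_combination F.gaugeMass c * h1 + F.gaugeMass b * h2
    - (F.gaugeMass b * F.gaugeMass c : ℂ) * h3

theorem uUut_cancel (hC : C.Restrictions F) :
    (1 / 2 : ℂ) • F.weighted (fun a b c => C.f a b c * (F.gaugeMass c : ℂ) ^ 2) F.uUut
      + F.weighted (fun a b c => C.f' a c b * (F.gaugeMass a * F.gaugeMass c)) F.uUut = 0 := by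
  rw [← weighted_const_smul, ← weighted_add_left]
  refine F.weighted_eq_zero₁₂ fun a b c => ?_
  by_cases ha : F.sector a = .higgs
  · simp [uUut, u_higgs ha]
  by_cases hb : F.sector b = .higgs
  · simp [uUut, u_higgs hb]
  rw [F.uUut_swap a b c]
  match_scalars
  have h1 := hC.f_mass' c ha hb
  have h3 := hC.f'_antisymm b c a
  have h4 := (hC.f_antisymm a b c).1
  linear_combination F.gaugeMass c * h1 - (F.gaugeMass b * F.gaugeMass c : ℂ) * h3
    - (F.gaugeMass c : ℂ) ^ 2 / 2 * h4

theorem uPhiPhi_cancel (hC : C.Restrictions F) (h'' : C.ScalarRelation F) :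
    F.weighted (fun a b c => C.f' b c a * ((F.mass c : ℂ) ^ 2 - (F.gaugeMass c : ℂ) ^ 2)) F.uPhiPhi
      + (1 / 2 : ℂ) • F.weighted (fun a b c => C.f'' a b c * F.gaugeMass a) F.uPhiPhi = 0 := by
  rw [← weighted_const_smul, ← weighted_add_left]
  refine F.weighted_eq_zero₂₃ fun a b c => ?_
  by_cases ha : F.sector a = .higgs
  · simp [uPhiPhi, u_higgs ha]
  by_cases hb : F.sector b = .massless
  · simp [uPhiPhi, phi_massless hb]
  by_cases hc : F.sector c = .massless
  · simp [uPhiPhi, phi_massless hc]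
  rw [F.uPhiPhi_swap a b c]
  match_scalars
  have h1 := h'' a b c ha hb hc
  have h2 := (hC.f''_symm a b c).2
  have h3 := hC.f'_antisymm b c a
  linear_combination h1 - F.gaugeMass a / 2 * h2
    + ((F.mass b : ℂ) ^ 2 - (F.gaugeMass b : ℂ) ^ 2) * h3

/-- The gauge variation of the interaction is a divergence: the vector currents are conserved up to
the gauge variation of the scalar fields, the other terms that are no divergences are combinations
of four kinds of monomials, and the relations between the couplings make each combination vanish. -/
theorem dQ_ymT (hC : C.Restrictions F) (h'' : C.ScalarRelation F) :
    F.dQ (F.ymT C) = Complex.I • F.divergence (F.ymTVec C) := by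
  have e1 := F.dQ_weighted_pureYM (fun a b c => (hC.f_antisymm a b c).1)
    (fun a b c => (hC.f_antisymm a b c).2) hC.f_mul_mass
  have e2 := F.dQ_weighted_higgsPart hC.f'_antisymm
  have e3 := F.dQ_weighted_cube (fun a b c => (hC.f''_symm a b c).1)
    (fun a b c => (hC.f''_symm a b c).2)
  have e4 : F.dQ (∑ a ∈ F.higgs, ∑ b ∈ F.higgs, ∑ c ∈ F.higgs, ∑ d ∈ F.higgs,
      C.g a b c d • (F.phi a * F.phi b * F.phi c * F.phi d)) = 0 := by
    simp only [map_sum, map_smul]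
    refine Finset.sum_eq_zero fun a ha => Finset.sum_eq_zero fun b hb =>
      Finset.sum_eq_zero fun c hc => Finset.sum_eq_zero fun d hd => ?_
    simp only [FieldContent.higgs, Finset.mem_filter, Finset.mem_univ, true_and] at ha hb hc hd
    rw [F.dQ_phi_quartic (F.gaugeMass_higgs ha) (F.gaugeMass_higgs hb) (F.gaugeMass_higgs hc)
      (F.gaugeMass_higgs hd), smul_zero]
  have e5 : F.dQ (∑ a, ∑ μ, F.vectorCurrent C a μ * F.v a μ)
      + F.dQ (∑ a, F.scalarCurrent C a * F.phi a)
      = Complex.I • ∑ a, F.divergence (fun μ => F.vectorCurrent C a μ * F.u a) := by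
    rw [Finset.smul_sum, map_sum, map_sum, ← Finset.sum_add_distrib]
    refine Finset.sum_congr rfl fun a _ => ?_
    have h := hC.divergence_vectorCurrent a
    rw [divergence] at h ⊢
    simp only [pd_mul, Finset.sum_add_distrib]
    rw [← Finset.sum_mul, h, dQ_scalarCurrent_mul, dQ_phi_field, map_sum]
    simp only [dQ_vectorCurrent_mul, dQ_v_field, mul_smul_comm, smul_mul_assoc, ← Finset.smul_sum]
    module
  have e6 : F.divergence (F.ymTVec C) =
      F.weighted C.f (fun a b c => F.divergence (fun μ =>
          (∑ ν, F.u a * F.v b ν * F.fieldStrengthUp c ν μ)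
          - (1 / 2 : ℂ) • (F.u a * F.u b * (eta μ • F.pd μ (F.ut c)))))
      + F.weighted C.f' (fun a b c => F.divergence (fun μ => F.phi a * F.phiUp b μ * F.u c))
      + ∑ a, F.divergence (fun μ => F.vectorCurrent C a μ * F.u a) := by
    rw [← divergence_weighted, ← divergence_weighted]
    have h : ∑ a, F.divergence (fun μ => F.vectorCurrent C a μ * F.u a)
        = ∑ μ, F.pd μ (∑ a, F.vectorCurrent C a μ * F.u a) := by
      simp only [divergence, map_sum]
      exact Finset.sum_comm
    rw [h, divergence, divergence, divergence, ← Finset.sum_add_distrib, ← Finset.sum_add_distrib]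
    exact Finset.sum_congr rfl fun μ _ => by rw [← map_add, ← map_add]; rfl
  have e7 : F.ymT C = F.weighted C.f (fun a b c =>
      (1 / 2 : ℂ) • (∑ μ, ∑ ν, F.v a μ * F.v b ν * F.fieldStrengthUp c ν μ)
        + ∑ μ, F.u a * F.vUp b μ * F.pd μ (F.ut c))
    + F.weighted C.f' (fun a b c => (∑ μ, F.phi a * F.phiUp b μ * F.v c μ)
        + (F.gaugeMass b : ℂ) • (F.phi a * F.ut b * F.u c))
    + (1 / 6 : ℂ) • F.weighted C.f'' (fun a b c => F.phi a * F.phi b * F.phi c)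
    + (1 / 24 : ℂ) • (∑ a ∈ F.higgs, ∑ b ∈ F.higgs, ∑ c ∈ F.higgs, ∑ d ∈ F.higgs,
        C.g a b c d • (F.phi a * F.phi b * F.phi c * F.phi d))
    + (∑ a, ∑ μ, F.vectorCurrent C a μ * F.v a μ)
    + ∑ a, F.scalarCurrent C a * F.phi a := rfl
  rw [e7, map_add, map_add, map_add, map_add, map_add, map_smul, map_smul, e1, e2, e3, e4,
    smul_zero, add_zero, add_assoc _ (F.dQ _) (F.dQ _), e5, e6]
  rw [eq_neg_of_add_eq_zero_left hC.uVDphi_cancel, eq_neg_of_add_eq_zero_left hC.uVV_cancel,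
    eq_neg_of_add_eq_zero_left hC.uUut_cancel, eq_neg_of_add_eq_zero_left (hC.uPhiPhi_cancel h'')]
  module

/-- Besides the terms of the divergence there are terms `u_a u_b φ_c^μ`, which cancel by the mass
relation. -/
theorem dQ_ymTVec (hC : C.Restrictions F) (μ : Fin 4) :
    F.dQ (F.ymTVec C μ) = Complex.I • F.divergence (F.ymTTensor C μ) := by
  have e1 (a b c) : F.dQ ((∑ ν, F.u a * F.v b ν * F.fieldStrengthUp c ν μ)
        - (1 / 2 : ℂ) • (F.u a * F.u b * (eta μ • F.pd μ (F.ut c))))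
      = Complex.I • ((∑ ν, F.u a * (F.pd ν (F.u b) * F.fieldStrengthUp c μ ν))
        + (1 / 2 : ℂ) • (eta μ • (F.u a * (F.u b * F.pd μ (F.divV c))))
        + (1 / 2 : ℂ) • ((F.gaugeMass c * eta μ) • (F.u a * (F.u b * F.pd μ (F.phi c))))) := by
    have h1 (ν) : F.dQ (F.u a * F.v b ν * F.fieldStrengthUp c ν μ)
        = Complex.I • (F.u a * (F.pd ν (F.u b) * F.fieldStrengthUp c μ ν)) := by
      rw [mul_assoc, dQ_u_mul, dQ_v_mul, dQ_fieldStrengthUp, mul_zero, add_zero,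
        F.fieldStrengthUp_swap, wick_mul_neg, mul_smul_comm, wick_mul_neg, smul_neg, neg_neg]
    have h2 : F.dQ (F.pd μ (F.ut c)) = -Complex.I • (F.pd μ (F.divV c)
        + (F.gaugeMass c : ℂ) • F.pd μ (F.phi c)) := by
      rw [dQ_pd, dQ_ut_field, divV, map_smul, map_add, map_smul]
    rw [map_sub, map_sum, map_smul, mul_assoc, mul_smul_comm, mul_smul_comm, map_smul, dQ_u_mul,
      dQ_u_mul, h2]
    simp only [h1, wick_mul_neg, mul_smul_comm, mul_add, ← Finset.smul_sum]
    module
  have e2 (a b c) : F.dQ (F.phi a * F.phiUp b μ * F.u c)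
      = Complex.I • ((F.gaugeMass a : ℂ) • (F.u a * (F.u c * F.phiUp b μ))) := by
    rw [mul_assoc, dQ_phi_mul, dQ_phiUp_mul, dQ_u_field, mul_zero, mul_zero, add_zero,
      F.phiUp_comm, mul_smul]
  have e3 (a) : F.dQ (F.vectorCurrent C a μ * F.u a) = 0 := by
    rw [dQ_vectorCurrent_mul, dQ_u_field, mul_zero]
  have e4 (a b c) : ∑ ν, F.pd ν (F.u a * F.u b * F.fieldStrengthUp c μ ν)
      = (∑ ν, F.u a * (F.pd ν (F.u b) * F.fieldStrengthUp c μ ν))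
        - (∑ ν, F.u b * (F.pd ν (F.u a) * F.fieldStrengthUp c μ ν))
        + eta μ • (F.u a * (F.u b * F.pd μ (F.divV c)))
        + ((F.mass c : ℂ) ^ 2 * eta μ) • (F.u a * (F.u b * F.v c μ)) := by
    have h1 := F.pd_fieldStrengthUp c μ
    have h2 (ν) : F.pd ν (F.u a * F.u b * F.fieldStrengthUp c μ ν)
        = F.u a * (F.pd ν (F.u b) * F.fieldStrengthUp c μ ν)
          - F.u b * (F.pd ν (F.u a) * F.fieldStrengthUp c μ ν)
          + F.u a * (F.u b * F.pd ν (F.fieldStrengthUp c μ ν)) := by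
      rw [mul_assoc, pd_mul, pd_mul, pd_u_mul_u, mul_add]
      abel
    simp only [h2, Finset.sum_add_distrib, Finset.sum_sub_distrib, ← Finset.mul_sum, h1,
      mul_smul_comm, mul_add]
    module
  have w1 : F.weighted C.f (fun a b c => ∑ ν, F.u b * (F.pd ν (F.u a) * F.fieldStrengthUp c μ ν))
      = -F.weighted C.f (fun a b c => ∑ ν, F.u a * (F.pd ν (F.u b) * F.fieldStrengthUp c μ ν)) := by
    rw [weighted_swap₁₂, weighted, weighted]
    simp only [← Finset.sum_neg_distrib]
    refine Finset.sum_congr rfl fun a _ => Finset.sum_congr rfl fun b _ =>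
      Finset.sum_congr rfl fun c _ => ?_
    rw [(hC.f_antisymm a b c).1]
    module
  have w2 : (1 / 2 : ℂ) • F.weighted (fun a b c => C.f a b c * F.gaugeMass c)
        (fun a b c => F.u a * (F.u b * F.phiUp c μ))
      + F.weighted (fun a b c => C.f' a c b * F.gaugeMass a)
        (fun a b c => F.u a * (F.u b * F.phiUp c μ)) = 0 := by
    rw [← weighted_const_smul, ← weighted_add_left]
    refine F.weighted_eq_zero₁₂ fun a b c => ?_
    by_cases ha : F.sector a = .higgs
    · simp [u_higgs ha]
    by_cases hb : F.sector b = .higgs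
    · simp [u_higgs hb]
    have hu : F.u b * (F.u a * F.phiUp c μ) = -(F.u a * (F.u b * F.phiUp c μ)) := by
      rw [← mul_assoc, u, u, F.fermi_comm rfl rfl, wick_neg_mul, mul_assoc]
    rw [hu]
    match_scalars
    have h1 := hC.f_mass' c ha hb
    have h3 := hC.f'_antisymm b c a
    have h4 := (hC.f_antisymm a b c).1
    linear_combination h1 - (F.gaugeMass b : ℂ) * h3 - (F.gaugeMass c : ℂ) / 2 * h4
  have w3 : F.weighted (fun a b c => C.f a b c * F.gaugeMass c)
        (fun a b c => F.u a * (F.u b * F.phiUp c μ))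
      = F.weighted C.f (fun a b c => (F.gaugeMass c * eta μ) • (F.u a * (F.u b * F.pd μ (F.phi c))))
        - F.weighted C.f (fun a b c => ((F.mass c : ℂ) ^ 2 * eta μ) • (F.u a * (F.u b * F.v c μ))) := by
    rw [← weighted_sub, ← weighted_smul]
    refine F.weighted_congr fun a b c => ?_
    rw [phiUp, mul_smul_comm, mul_smul_comm, wick_mul_sub, wick_mul_sub, mul_smul_comm, mul_smul_comm]
    match_scalars
    · ring
    · linear_combination (F.mass c + F.gaugeMass c : ℂ) * eta μ * hC.f_mul_mass a b c
  have l : F.dQ (F.ymTVec C μ) = F.dQ (F.weighted C.f (fun a b c =>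
        (∑ ν, F.u a * F.v b ν * F.fieldStrengthUp c ν μ)
        - (1 / 2 : ℂ) • (F.u a * F.u b * (eta μ • F.pd μ (F.ut c)))))
      + F.dQ (F.weighted C.f' (fun a b c => F.phi a * F.phiUp b μ * F.u c)) := by
    have h : F.dQ (∑ a, F.vectorCurrent C a μ * F.u a) = 0 := by simp only [map_sum, e3, Finset.sum_const_zero]
    rw [ymTVec, map_add, h, add_zero, map_add]
    rfl
  have r : F.divergence (F.ymTTensor C μ) = (1 / 2 : ℂ) • F.weighted C.f (fun a b c =>
      ∑ ν, F.pd ν (F.u a * F.u b * F.fieldStrengthUp c μ ν)) := by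
    refine Eq.trans ?_ (congrArg _ (F.divergence_weighted C.f fun ν a b c =>
      F.u a * F.u b * F.fieldStrengthUp c μ ν))
    simp only [divergence, ymTTensor, map_smul, ← Finset.smul_sum]
    rfl
  have k1 (X Y Z : Ind → Ind → Ind → F.Wick) : F.weighted C.f (fun a b c => Complex.I •
      (X a b c + (1 / 2 : ℂ) • Y a b c + (1 / 2 : ℂ) • Z a b c)) = Complex.I • (F.weighted C.f X
        + (1 / 2 : ℂ) • F.weighted C.f Y + (1 / 2 : ℂ) • F.weighted C.f Z) := by
    rw [weighted_const_smul', weighted_add, weighted_add, weighted_const_smul', weighted_const_smul']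
  rw [l, r, dQ_weighted, dQ_weighted]
  simp only [e1, e2, e4]
  rw [k1, weighted_add, weighted_add, weighted_sub, w1, F.weighted_const_smul' C.f',
    F.weighted_smul C.f' _ fun a b c => (F.gaugeMass a : ℂ),
    F.weighted_swap₂₃ _ fun a b c => F.u a * (F.u c * F.phiUp b μ),
    eq_neg_of_add_eq_zero_right w2, w3]
  module

theorem dQ_ymTTensor (C : Couplings Ind Dir) (μ ν : Fin 4) : F.dQ (F.ymTTensor C μ ν) = 0 := by
  simp only [ymTTensor, map_smul, map_sum, mul_assoc, dQ_u_mul, dQ_fieldStrengthUp, mul_zero, neg_zero,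
    smul_zero, Finset.sum_const_zero]

end Couplings.Restrictions
namespace FieldContent
variable {Ind Dir : Type*} {F : FieldContent Ind Dir}

/-! ### The couplings of the Yang-Mills interaction -/

/-- The couplings of the Yang-Mills interaction in terms of the coefficients of the vertices. -/
def _root_.YangMills.VertexCoeffs.couplings (k : VertexCoeffs Ind Dir) : Couplings Ind Dir where
  f a b c := -2 * k.cubic .vvv a b c
  f' a b c := 2 * k.cubic .pvp b c a
  f'' a b c := 6 * k.cubic .ppp a b c
  g a b c d := 24 * k.quartic .pppp a b c d
  t ε a := Matrix.of fun A B => k.vector ε A B a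
  s ε a := Matrix.of fun A B => k.scalar ε A B a

theorem _root_.Finset.sum_rotate {α β γ δ M : Type*} [Fintype α] [Fintype β] [Fintype γ] [Fintype δ]
    [AddCommMonoid M] (f : α → β → γ → δ → M) :
    ∑ x, ∑ a, ∑ b, ∑ c, f x a b c = ∑ a, ∑ b, ∑ c, ∑ x, f x a b c := by
  rw [Finset.sum_comm]
  refine Finset.sum_congr rfl fun a _ => ?_
  rw [Finset.sum_comm]
  exact Finset.sum_congr rfl fun b _ => Finset.sum_comm

namespace VertexCoeffs.IsNormal

variable [Fintype Ind] [Fintype Dir] {k : VertexCoeffs Ind Dir} (hk : VertexCoeffs.IsNormal F k)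
  (hQ : F.IsCocycle (F.interaction k))
include hk

theorem vector_higgs {a : Ind} (h : F.sector a = .higgs) (ε : ℤˣ) (A B : Dir) :
    k.vector ε A B a = 0 :=
  hk.vector_zero _ _ _ _ (by simp [vectorVertex, v_higgs h])

theorem scalar_massless {a : Ind} (h : F.sector a = .massless) (ε : ℤˣ) (A B : Dir) :
    k.scalar ε A B a = 0 :=
  hk.scalar_zero _ _ _ _ (by simp [scalarVertex, phi_massless h])

include hQ

theorem scalarRelation : k.couplings.ScalarRelation F := by
  intro a b c ha hb hc
  simp only [VertexCoeffs.couplings]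
  linear_combination hk.ppp_eq hQ a b c ha hb hc

theorem dirac_mass [DecidableEq Dir] (ε : ℤˣ) (a : Ind) :
    (F.gaugeMass a : ℂ) • k.couplings.s ε a
      = Complex.I • (F.diracMassMatrix * k.couplings.t ε a
        - k.couplings.t (-ε) a * F.diracMassMatrix) := by
  ext A B
  simp only [VertexCoeffs.couplings, diracMassMatrix, Matrix.smul_apply, Matrix.sub_apply, Matrix.diagonal_mul,
    Matrix.mul_diagonal, Matrix.of_apply, smul_eq_mul]
  by_cases h : F.sector a = .higgs
  · rw [hk.vector_higgs h, hk.vector_higgs h, F.gaugeMass_higgs h]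
    simp
  · rcases Int.units_eq_one_or ε with rfl | rfl
    · exact hk.dirac_pos hQ A B a h
    · rw [neg_neg]
      exact hk.dirac_neg hQ A B a h

/-- The co-cycle condition gives the couplings all the properties of Yang-Mills couplings. -/
theorem restrictions [DecidableEq Dir] : k.couplings.Restrictions F where
  f_antisymm a b c := by
    have h := hk.vvv_neg' hQ
    constructor <;> simp only [VertexCoeffs.couplings]
    · rw [hk.vvv_neg a b c, h c b a, hk.vvv_neg b a c]
      ring
    · rw [h a b c]
      ring
  f_higgs a b c h := by simp only [VertexCoeffs.couplings, hk.vvv_higgs (.inr (.inr h)), mul_zero]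
  f'_antisymm a b c := by
    simp only [VertexCoeffs.couplings]
    rw [hk.pvp_neg b c a]
    ring
  f'_higgs a b c h := by simp only [VertexCoeffs.couplings, hk.pvp_higgs h, mul_zero]
  f'_massless a b c h := by
    simp only [VertexCoeffs.couplings]
    rw [hk.pvp_neg b c a, hk.pvp_massless h, neg_zero, mul_zero]
  f''_symm a b c := by
    simp only [VertexCoeffs.couplings]
    exact ⟨by rw [hk.ppp_swap], by rw [hk.ppp_swap']⟩
  f''_massless a b c h := by simp only [VertexCoeffs.couplings, hk.ppp_massless h, mul_zero]
  g_symm a b c d := by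
    simp only [VertexCoeffs.couplings]
    exact ⟨by rw [hk.pppp_swap₁], by rw [hk.pppp_swap₂], by rw [hk.pppp_swap₃]⟩
  t_higgs ε a h := by
    ext A B
    exact hk.vector_higgs h ε A B
  s_massless ε a h := by
    ext A B
    exact hk.scalar_massless h ε A B
  f_mass a b c ha hb hc := by
    simp only [VertexCoeffs.couplings]
    linear_combination 2 * hk.pvp_mass hQ a b c ha hb hc
  dirac_mass := hk.dirac_mass hQ
  dirac_comm a h := by
    have h1 := hk.dirac_mass hQ 1 a
    have h2 := hk.dirac_mass hQ (-1) a
    rw [h, Complex.ofReal_zero, zero_smul, eq_comm, smul_eq_zero_iff_right Complex.I_ne_zero] at h1 h2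
    rw [neg_neg] at h2
    rw [mul_smul_comm, smul_mul_assoc, mul_add, add_mul, ← smul_sub, smul_eq_zero]
    right
    rw [← add_zero (0 : Matrix Dir Dir ℂ)]
    nth_rewrite 1 [← h1]
    rw [← h2]
    abel
  dirac_anticomm a h := by
    have h1 := hk.dirac_mass hQ 1 a
    have h2 := hk.dirac_mass hQ (-1) a
    rw [h, Complex.ofReal_zero, zero_smul, eq_comm, smul_eq_zero_iff_right Complex.I_ne_zero] at h1 h2
    rw [neg_neg] at h2
    rw [mul_smul_comm, smul_mul_assoc, mul_sub, sub_mul, ← smul_add, smul_eq_zero]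
    right
    rw [← sub_zero (0 : Matrix Dir Dir ℂ)]
    nth_rewrite 1 [← h1]
    rw [← h2]
    abel
  f''_two_higgs a b c ha hb hc := by
    have h0 : (F.mass c : ℂ) ≠ 0 := by exact_mod_cast (F.mass_massive c hc).ne'
    have h := hk.scalarRelation hQ c a b (by simp [hc]) (by simp [ha]) (by simp [hb])
    rw [F.gaugeMass_of_ne (by simp [hc]), F.gaugeMass_higgs ha, F.gaugeMass_higgs hb] at h
    have hr : k.couplings.f'' a b c = k.couplings.f'' c a b := by
      simp only [VertexCoeffs.couplings]
      rw [hk.ppp_swap', hk.ppp_swap]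
    rw [hr]
    field_simp
    rw [h]
    push_cast
    ring
  f''_one_higgs a b c ha hb hc := by
    have h0 : (F.mass c : ℂ) ≠ 0 := by exact_mod_cast (F.mass_massive c hc).ne'
    have h := hk.scalarRelation hQ c a b (by simp [hc]) (by simp [ha]) (by simp [hb])
    rw [F.gaugeMass_of_ne (by simp [hc]), F.gaugeMass_of_ne (a := a) (by simp [ha]),
      F.gaugeMass_higgs hb] at h
    have hr : k.couplings.f'' a b c = k.couplings.f'' c a b := by
      simp only [VertexCoeffs.couplings]
      rw [hk.ppp_swap', hk.ppp_swap]
    rw [hr]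
    field_simp
    rw [h]
    push_cast
    ring
  f''_no_higgs a b c ha hb hc := by
    have h0 : (F.mass a : ℂ) ≠ 0 := by exact_mod_cast (F.mass_massive a ha).ne'
    have h := hk.scalarRelation hQ a b c (by simp [ha]) (by simp [hb]) (by simp [hc])
    rw [F.gaugeMass_of_ne (a := a) (by simp [ha]), F.gaugeMass_of_ne (a := b) (by simp [hb]),
      F.gaugeMass_of_ne (a := c) (by simp [hc]), sub_self, sub_self, sub_self, mul_zero] at h
    exact (mul_eq_zero.1 h).resolve_right h0

/-- The trilinear terms without Dirac fields: the Yang-Mills vertex. -/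
theorem pureYM_eq : F.weighted k.couplings.f (fun a b c =>
      (1 / 2 : ℂ) • (∑ μ, ∑ ν, F.v a μ * F.v b ν * F.fieldStrengthUp c ν μ)
        + ∑ μ, F.u a * F.vUp b μ * F.pd μ (F.ut c))
    = F.exprVVV (fun a b c => 2 * k.cubic .vvv a b c) + F.exprAUV (k.cubic .dauv) := by
  set X : Ind → Ind → Ind → F.Wick := fun a b c => ∑ μ, ∑ ν, (eta μ * eta ν) •
    (F.pd μ (F.v a ν) * (F.v b μ * F.v c ν)) with hX
  set Y : Ind → Ind → Ind → F.Wick := fun a b c => ∑ μ, eta μ •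
    (F.pd μ (F.ut a) * (F.u b * F.v c μ)) with hY
  have e1 : F.exprVVV (fun a b c => 2 * k.cubic .vvv a b c)
      = F.weighted (fun a b c => 2 * k.cubic .vvv a b c) X := by
    simp [exprVVV, trilinear, weighted, hX, Fintype.sum_prod_type, v, pd_field]
  have e2 : F.exprAUV (k.cubic .dauv) = F.weighted (k.cubic .dauv) Y := by
    simp [exprAUV, trilinear, weighted, hY, v, u, ut, pd_field]
  have h1 (a b c) : ∑ μ, ∑ ν, F.v a μ * F.v b ν * F.fieldStrengthUp c ν μ = X c b a - X c a b := by
    have e (μ ν) : F.v a μ * F.v b ν * F.fieldStrengthUp c ν μ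
        = (eta ν * eta μ) • (F.pd ν (F.v c μ) * (F.v b ν * F.v a μ))
          - (eta μ * eta ν) • (F.pd μ (F.v c ν) * (F.v a μ * F.v b ν)) := by
      rw [fieldStrengthUp, mul_smul_comm, wick_mul_sub, F.pd_v_comm ν μ c, F.pd_v_comm μ ν c,
        F.v_comm b ν (F.v a μ), mul_comm (eta μ), smul_sub]
    simp only [hX, e, Finset.sum_sub_distrib]
    rw [Finset.sum_comm]
  have h2 (a b c) : ∑ μ, F.u a * F.vUp b μ * F.pd μ (F.ut c) = -Y c a b := by
    rw [hY, ← Finset.sum_neg_distrib]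
    refine Finset.sum_congr rfl fun μ _ => ?_
    rw [vUp, mul_smul_comm, smul_mul_assoc, mul_assoc, F.v_comm, ← mul_assoc, pd_ut_mul_u,
      wick_neg_mul, mul_assoc, smul_neg]
  have s1 := hk.vvv_neg' hQ
  have s2 := hk.vvv_neg
  have s3 (a b c) : k.cubic .vvv b c a = k.cubic .vvv a b c := by
    rw [s1 a b c, s2 a c b, neg_neg]
  rw [e1, e2]
  simp only [h1, h2]
  rw [weighted_add, weighted_const_smul', weighted_sub]
  have w1 : F.weighted k.couplings.f (fun a b c => X c b a)
      = F.weighted (fun a b c => 2 * k.cubic .vvv a b c) X := by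
    rw [weighted_swap₁₃]
    refine F.weighted_congr fun a b c => ?_
    simp only [VertexCoeffs.couplings]
    rw [s2 c b a]
    module
  have w2 : F.weighted k.couplings.f (fun a b c => X c a b)
      = -F.weighted (fun a b c => 2 * k.cubic .vvv a b c) X := by
    rw [weighted_rot, ← neg_one_smul ℂ, ← weighted_const_smul]
    refine F.weighted_congr fun a b c => ?_
    simp only [VertexCoeffs.couplings, s3 a b c]
    module
  have w3 : F.weighted k.couplings.f (fun a b c => -Y c a b) = F.weighted (k.cubic .dauv) Y := by
    rw [weighted_rot]
    refine F.weighted_congr fun a b c => ?_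
    rw [hk.dauv_eq hQ b c a]
    simp only [VertexCoeffs.couplings, s3 a b c, ← s3 c a b]
    module
  rw [w1, w2, w3]
  module

/-- The trilinear terms with the fields `Φ` and one vector field or two ghosts. The coefficients of
`Φ v v` and `u ũ Φ` are those that `pvv_eq` and `uap_eq` give. -/
theorem higgsPart_eq : F.weighted k.couplings.f' (fun a b c => (∑ μ, F.phi a * F.phiUp b μ * F.v c μ)
        + (F.gaugeMass b : ℂ) • (F.phi a * F.ut b * F.u c))
    = F.exprPVP (fun a b c => 2 * k.cubic .pvp a b c) + F.exprPVV (k.cubic .pvv)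
      + F.exprUAP (k.cubic .uap) := by
  classical
  set X : Ind → Ind → Ind → F.Wick := fun a b c => ∑ μ, eta μ •
    (F.pd μ (F.phi a) * (F.v b μ * F.phi c)) with hX
  set Y : Ind → Ind → Ind → F.Wick := fun a b c => ∑ μ, eta μ •
    (F.phi a * (F.v b μ * F.v c μ)) with hY
  set Z : Ind → Ind → Ind → F.Wick := fun a b c => F.u a * (F.ut b * F.phi c) with hZ
  have e1 : F.exprPVP (fun a b c => 2 * k.cubic .pvp a b c)
      = F.weighted (fun a b c => 2 * k.cubic .pvp a b c) X := by
    simp [exprPVP, trilinear, weighted, hX, v, phi, pd_field]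
  have e2 : F.exprPVV (k.cubic .pvv) = F.weighted (k.cubic .pvv) Y := by
    simp [exprPVV, trilinear, weighted, hY, v, phi]
  have e3 : F.exprUAP (k.cubic .uap) = F.weighted (k.cubic .uap) Z := by
    simp [exprUAP, trilinear, weighted, hZ, u, ut, phi]
  have h1 (a b c) : (∑ μ, F.phi a * F.phiUp b μ * F.v c μ)
        + (F.gaugeMass b : ℂ) • (F.phi a * F.ut b * F.u c)
      = X b c a - (F.gaugeMass b : ℂ) • Y a b c - (F.gaugeMass b : ℂ) • Z c b a := by
    have e (μ) : F.phi a * F.phiUp b μ * F.v c μ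
        = eta μ • (F.pd μ (F.phi b) * (F.v c μ * F.phi a))
          - (F.gaugeMass b : ℂ) • (eta μ • (F.phi a * (F.v b μ * F.v c μ))) := by
      rw [phiUp, mul_assoc, smul_mul_assoc, mul_smul_comm, wick_sub_mul, wick_mul_sub, F.phi_comm,
        smul_mul_assoc, mul_smul_comm, mul_assoc]
      module
    have e' : F.phi a * F.ut b * F.u c = -(F.u c * (F.ut b * F.phi a)) := by
      rw [mul_assoc, ut_mul_u, F.phi_comm, wick_neg_mul, mul_assoc]
    simp only [e, e', Finset.sum_sub_distrib, ← Finset.smul_sum]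
    simp only [hX, hY, hZ]
    module
  have s := fun a b c => (hk.restrictions hQ).f'_antisymm a b c
  have m (a b c) (ha : F.sector a ≠ .higgs) (hb : F.sector b ≠ .higgs)
      (hc : F.sector c ≠ .massless) := (hk.restrictions hQ).f_mass a b c ha hb hc
  rw [e1, e2, e3]
  simp only [h1]
  have w1 : F.weighted k.couplings.f' (fun a b c => X b c a)
      = F.weighted (fun a b c => 2 * k.cubic .pvp a b c) X := by
    rw [weighted_rot, weighted_rot]
    rfl
  have w2 : F.weighted k.couplings.f' (fun a b c => (F.gaugeMass b : ℂ) • Y a b c)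
      + F.weighted (k.cubic .pvv) Y = 0 := by
    rw [weighted_smul, ← weighted_add_left]
    refine F.weighted_eq_zero₂₃ fun a b c => ?_
    by_cases ha : F.sector a = .massless
    · simp [hY, phi_massless ha]
    by_cases hb : F.sector b = .higgs
    · simp [hY, v_higgs hb]
    by_cases hc : F.sector c = .higgs
    · simp [hY, v_higgs hc]
    have hs : Y a c b = Y a b c := by
      simp only [hY, F.v_comm c]
    rw [hs]
    match_scalars
    have h2 := hk.pvv_eq hQ c b a hc hb ha
    have h3 := m c b a hc hb ha
    have h4 := s a c b
    have h5 := hk.pvv_swap a b c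
    simp only [VertexCoeffs.couplings] at h3 h4 ⊢
    linear_combination h2 - h5 - h3
  have w3 : F.weighted k.couplings.f' (fun a b c => (F.gaugeMass b : ℂ) • Z c b a)
      = -F.weighted (k.cubic .uap) Z := by
    rw [F.weighted_smul _ (fun a b c => Z c b a) fun a b c => (F.gaugeMass b : ℂ), weighted_swap₁₃,
      ← neg_one_smul ℂ, ← weighted_const_smul]
    refine F.weighted_congr fun a b c => ?_
    by_cases ha : F.sector a = .higgs
    · simp [hZ, u_higgs ha]
    by_cases hb : F.sector b = .higgs
    · simp [hZ, ut_higgs hb]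
    by_cases hc : F.sector c = .massless
    · simp [hZ, phi_massless hc]
    match_scalars
    have h2 := hk.uap_eq hQ a b c ha hb hc
    have h3 := m a b c ha hb hc
    simp only [VertexCoeffs.couplings] at h3 ⊢
    linear_combination h2 - h3
  rw [weighted_sub, weighted_sub, w1, eq_neg_of_add_eq_zero_left w2, w3]
  module

/-- The interaction is the Yang-Mills interaction: all other couplings vanish, and the remaining
ones are determined by `f`, `f'`, `f''`, `g`, `t` and `s`. -/
theorem interaction_eq [DecidableEq Dir] : F.interaction k = F.ymT k.couplings := by
  have e1 := hk.pureYM_eq hQ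
  have e2 := hk.higgsPart_eq hQ
  have e3 : (1 / 6 : ℂ) • F.weighted k.couplings.f'' (fun a b c => F.phi a * F.phi b * F.phi c)
      = F.exprPPP (k.cubic .ppp) := by
    rw [← weighted_const_smul]
    simp [exprPPP, trilinear, weighted, VertexCoeffs.couplings, phi, mul_assoc]
  have e4 : (1 / 24 : ℂ) • (∑ a ∈ F.higgs, ∑ b ∈ F.higgs, ∑ c ∈ F.higgs, ∑ d ∈ F.higgs,
        k.couplings.g a b c d • (F.phi a * F.phi b * F.phi c * F.phi d))
      = F.quadrilinear (I := Unit) 1 (fun _ => ![.phi, .phi, .phi, .phi]) (k.quartic .pppp) := by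
    have z {a b c d} (h : F.sector a ≠ .higgs ∨ F.sector b ≠ .higgs ∨ F.sector c ≠ .higgs ∨
        F.sector d ≠ .higgs) : k.quartic .pppp a b c d = 0 := by
      rcases h with h | h | h | h
      · exact hk.pppp_eq_zero hQ h
      · rw [← hk.pppp_swap₁, hk.pppp_eq_zero hQ h]
      · rw [← hk.pppp_swap₂, ← hk.pppp_swap₁, hk.pppp_eq_zero hQ h]
      · rw [← hk.pppp_swap₃, ← hk.pppp_swap₂, ← hk.pppp_swap₁, hk.pppp_eq_zero hQ h]
    simp only [Finset.smul_sum, FieldContent.higgs, Finset.sum_filter, quadrilinear, smul_ite, smul_zero]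
    refine Finset.sum_congr rfl fun a _ => ?_
    split_ifs with ha
    · refine Finset.sum_congr rfl fun b _ => ?_
      split_ifs with hb
      · refine Finset.sum_congr rfl fun c _ => ?_
        split_ifs with hc
        · refine Finset.sum_congr rfl fun d _ => ?_
          split_ifs with hd
          · simp [VertexCoeffs.couplings, phi, mul_assoc, smul_smul]
          · simp [z (.inr (.inr (.inr hd)))]
        · simp [z (.inr (.inr (.inl hc)))]
      · simp [z (.inr (.inl hb))]
    · simp [z (.inl ha)]
  have e5 : ∑ a, ∑ μ, F.vectorCurrent k.couplings a μ * F.v a μ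
      = ∑ ε, ∑ A, ∑ B, ∑ c, k.vector ε A B c • F.vectorVertex ε A B c := by
    have h (ε A B c) : F.vectorVertex ε A B c
        = ∑ μ, F.spinorPair A B (gamma μ * chiral ε) * F.v c μ := by
      simp only [vectorVertex, spinorPair, Finset.sum_mul, smul_mul_assoc, mul_assoc]
    simp only [vectorCurrent_eq, h, Finset.sum_mul, Finset.smul_sum, smul_mul_assoc]
    refine Eq.trans (Finset.sum_congr rfl fun a _ => Finset.sum_rotate _) ?_
    rw [Finset.sum_rotate]
    rfl
  have e6 : ∑ a, F.scalarCurrent k.couplings a * F.phi a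
      = ∑ ε, ∑ A, ∑ B, ∑ c, k.scalar ε A B c • F.scalarVertex ε A B c := by
    have h (ε A B c) : F.scalarVertex ε A B c = F.spinorPair A B (chiral ε) * F.phi c := by
      simp only [scalarVertex, spinorPair, Finset.sum_mul, smul_mul_assoc, mul_assoc]
    simp only [scalarCurrent_eq, h, Finset.sum_mul, smul_mul_assoc]
    rw [Finset.sum_rotate]
    rfl
  have e7 : F.ymT k.couplings = F.weighted k.couplings.f (fun a b c =>
      (1 / 2 : ℂ) • (∑ μ, ∑ ν, F.v a μ * F.v b ν * F.fieldStrengthUp c ν μ)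
        + ∑ μ, F.u a * F.vUp b μ * F.pd μ (F.ut c))
    + F.weighted k.couplings.f' (fun a b c => (∑ μ, F.phi a * F.phiUp b μ * F.v c μ)
        + (F.gaugeMass b : ℂ) • (F.phi a * F.ut b * F.u c))
    + (1 / 6 : ℂ) • F.weighted k.couplings.f'' (fun a b c => F.phi a * F.phi b * F.phi c)
    + (1 / 24 : ℂ) • (∑ a ∈ F.higgs, ∑ b ∈ F.higgs, ∑ c ∈ F.higgs, ∑ d ∈ F.higgs,
        k.couplings.g a b c d • (F.phi a * F.phi b * F.phi c * F.phi d))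
    + (∑ a, ∑ μ, F.vectorCurrent k.couplings a μ * F.v a μ)
    + ∑ a, F.scalarCurrent k.couplings a * F.phi a := rfl
  have z1 : F.exprLevi (k.cubic .levi) = 0 := by
    simp [exprLevi, trilinear, hk.levi_eq_zero hQ]
  have z2 : F.exprVUA (fun a b c => 2 * k.cubic .uadv b c a) = 0 := by
    simp [exprVUA, trilinear, hk.uadv_eq_zero hQ]
  have z3 {I : Type} [Fintype I] (z : I → ℂ) (x : I → Fin 4 → QuadComp) (τ) (h : ∀ a b c d, k.quartic τ a b c d = 0) :
      F.quadrilinear z x (k.quartic τ) = 0 := by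
    simp [quadrilinear, h]
  rw [e7, e1, e2, e3, e4, e5, e6, interaction, sum_cubicVertex hk, sum_quarticVertex, z1, z2,
    z3 _ _ .vvpp (hk.vvpp_eq_zero hQ), z3 _ _ .uavv (hk.uavv_eq_zero hQ),
    z3 _ _ .uapp (hk.uapp_eq_zero hQ), z3 _ _ .uuaa (hk.uuaa_eq_zero hQ),
    z3 _ _ .vvvv fun a b c d => (hk.vvvv_and_levi_eq_zero hQ a b c d).1,
    z3 _ _ .levi fun a b c d => (hk.vvvv_and_levi_eq_zero hQ a b c d).2]
  abel

end VertexCoeffs.IsNormal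
end FieldContent
end YangMills

end

theorem mainTheorem3 {Ind Dir : Type*} [Fintype Ind] [Fintype Dir] [DecidableEq Dir]
    (F : YangMills.FieldContent Ind Dir) (T : F.Wick)
    (hT : T ∈ F.interactionSpace) (hLorentz : F.LorentzInvariant T) (hQ : F.IsCocycle T) :
    ∃ C : YangMills.Couplings Ind Dir,
      C.Restrictions F ∧
      F.Cohomologous T (F.ymT C) ∧
      (¬ F.IsCoboundary T → ¬ F.IsCoboundary (F.ymT C)) ∧
      F.dQ (F.ymT C) = Complex.I • F.divergence (F.ymTVec C) ∧
      (∀ μ, F.dQ (F.ymTVec C μ) = Complex.I • F.divergence (F.ymTTensor C μ)) ∧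
      (∀ μ ν, F.dQ (F.ymTTensor C μ ν) = 0) := by
  obtain ⟨k, hk, hr⟩ := F.exists_interaction hT hLorentz
  have hQ' : F.IsCocycle (F.interaction k) := by
    simpa using YangMills.FieldContent.IsCocycle.sub F hQ (YangMills.FieldContent.IsCoboundary.isCocycle F hr)
  have hC := hk.restrictions hQ'
  rw [hk.interaction_eq hQ'] at hr
  refine ⟨k.couplings, hC, hr, fun h h' => h ?_, hC.dQ_ymT (hk.scalarRelation hQ'), hC.dQ_ymTVec,
    YangMills.Couplings.Restrictions.dQ_ymTTensor k.couplings⟩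
  rw [← F.mem_coboundaries] at h' ⊢
  simpa using Submodule.add_mem _ (F.mem_coboundaries.2 hr) h'
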